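/- **Setting.** Let $X$ be a totally ordered set. A formal product $z=\prod_{x\in X}x^{v_x(z)}$, $v_x(z)\in\mathbb Z_{\ge 0}$, may be infinite; it is finite if $v_x(z)=0$ for almost all $x$, and then $\deg z=\sum_x v_x(z)$. Write $\bar z$ for the support (radical) of $z$, $z(x)=x^{v_x(z)}$, and $z'\mid_s z$ ("$z'$ is a stalk of $z$") if $z'\mid z$ and $\gcd(z',z/z')=1$. Let $G$ be a profinite group with open subgroups $H_z$ ($z$ finite) such that $[G,G]\le H_z$; $H_z\le H_{z'}$ if $z'\mid z$; and $H_{zz'}=H_z\cap H_{z'}$, $G=H_zH_{z'}$ if $z,z'$ are relatively prime. Put $G_z=G/H_z$ for finite $z$ and $G_z=\varprojlim G_{z'}$ over the finite stalks $z'$ of $z$ in general. For each $x$ let $\mathrm{Fr}_x\in G$ have trivial image in every $G_{x^n}$. Let $\mathcal O$ be an integral domain, $\mathcal T$ a commutative $\mathcal O$-algebra, torsion free and finitely generated as an $\mathcal O$-module, and $p(x;t)\in\mathcal T[t]$ for each $x\in X$. Let $\mathcal A_z$ be the free $\mathcal T$-module on the symbols $[gz']$ with $z'$ a finite stalk of $z$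 and $g\in G_{z'}$, with its natural $G_z$-action. For $x\mid z$ let $N_{z(x)}=\sum_{h\in G_{z(x)}}h$, where $G_{z(x)z'}=G_{z(x)}\times G_{z'}$, and let $\lambda_{z(x)}$ be the $\mathcal T[G_z]$-endomorphism of $\mathcal A_z$ with $[z']\mapsto p(x;\mathrm{Fr}_x^{-1})[z']-N_{z(x)}[z(x)z']$ if $x\nmid z'$ and $[z']\mapsto 0$ if $x\mid z'$. The universal norm distribution is $\mathcal U_z=\mathcal A_z/\mathcal D_z$ with $\mathcal D_z=\sum_{x\mid z}\lambda_{z(x)}(\mathcal A_{z/z(x)})$. For a finite $w$ with $\bar w\mid z$ let $H_{\mathcal T,w}=\bigoplus_q H^q_{\mathcal T,w}$ be the cohomology of the complex $I_{\mathcal T}[w^2]=\bigoplus_{w'\mid\bar w}\mathcal T[w^2/w']$, where $[v]$ has degree $\deg v$ and $$\delta[v]=\sum_{x\mid v}(-1)^{\sum_{x'<x}v_{x'}(v)}a_x\,[vx],\qquad a_x=\begin{cases}0,& v_x(v)\text{ even},\\ |G_{z(x)}|,& v_x(v)\text{ odd.}\end{cases}$$ Let $m_w=\gcd\{|G_{z(x)}|: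 x\mid w\}$. **Theorem.** Let $z$ be a (finite or infinite) formal product such that for every $x\mid z$ the group $G_{z(x)}$ is cyclic and $p(x;1)=0$. Then $H^*(G_z,\mathcal U_z)$ (cohomology of the profinite group $G_z$ with coefficients in the discrete module $\mathcal U_z$; the usual group cohomology if $z$ is finite) is, as a graded $\mathcal T$-module, the direct sum of the modules $H_{\mathcal T,w}[y]$ over all pairs $(y,w)$ with $w$ finite, $y$ squarefree and $y\mid\bar w\mid z$, where $c[y]$ with $c\in H^q_{\mathcal T,w}$ has degree $q-\deg y$. That is, for every $n\ge 0$, $$H^n(G_z,\mathcal U_z)\cong\bigoplus_{y\mid\bar w\mid z}H^{\,n+\deg y}_{\mathcal T,w},$$ and $H^q_{\mathcal T,w}=0$ if $y\mid\bar w$ and $q<\deg y$. Moreover $H_{\mathcal T,1}=\mathcal T$, in degree $0$; and if $w\ne 1$ and $m_w\ne 0$ in $\mathcal O$ (which is automatic if $\mathcal O$ has characteristic $0$), then $H_{\mathcal T,w}$ is a free graded $\mathcal T/m_w\mathcal T$-module whose component of degree $2\deg w-\deg\bar w+i$ has rank $\binom{\deg\bar w-1}{i-1}$ for $1\le i\le\deg\bar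 w$, all other components being $0$. -/

import Mathlib

noncomputable section

namespace NormDist

/-- The module `Z / B` for submodules `B ≤ Z` of `M` (in general, `Z / (B ∩ Z)`). -/
def Subquotient {R M : Type*} [Ring R] [AddCommGroup M] [Module R M]
    (Z B : Submodule R M) : Type _ :=
  ↥Z ⧸ B.submoduleOf Z

instance {R M : Type*} [Ring R] [AddCommGroup M] [Module R M] (Z B : Submodule R M) :
    AddCommGroup (Subquotient Z B) :=
  inferInstanceAs (AddCommGroup (↥Z ⧸ B.submoduleOf Z))

instance {R M : Type*} [Ring R] [AddCommGroup M] [Module R M] (Z B : Submodule R M) :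
    Module R (Subquotient Z B) :=
  inferInstanceAs (Module R (↥Z ⧸ B.submoduleOf Z))

/-! ## Cohomology of a topological group with coefficients in a discrete module -/

section Cohomology

variable {R Γ V : Type*} [CommRing R] [Group Γ] [AddCommGroup V] [Module R V]

/-- The differential of the inhomogeneous cochain complex of `Γ` with values in `(V, ρ)`. -/
def dCochain (ρ : Representation R Γ V) (n : ℕ) :
    ((Fin n → Γ) → V) →ₗ[R] ((Fin (n + 1) → Γ) → V) where
  toFun f g :=
    ρ (g 0) (f fun i => g i.succ) + ∑ j : Fin (n + 1),
      (-1 : R) ^ ((j : ℕ) + 1) • f (Fin.contractNth j (· * ·) g)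
  map_add' f g := by
    ext
    simp [Finset.sum_add_distrib, add_add_add_comm]
  map_smul' r f := by
    ext
    simp [Finset.smul_sum, ← smul_assoc, mul_comm r]

variable [TopologicalSpace Γ]

/-- Continuous `n`-cochains of `Γ` in `V`, where `V` has the discrete topology. If `Γ` is finite and
discrete, these are all the functions `Γⁿ → V`. -/
def contCochains (R Γ V : Type*) [CommRing R] [AddCommGroup V] [Module R V]
    [TopologicalSpace Γ] (n : ℕ) : Submodule R ((Fin n → Γ) → V) where
  carrier := {f | IsLocallyConstant f}
  add_mem' hf hg := IsLocallyConstant.add hf hg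
  zero_mem' := IsLocallyConstant.const 0
  smul_mem' r _ hf := IsLocallyConstant.comp hf (fun v => r • v)

/-- Continuous `n`-cocycles. -/
def contCocycles (ρ : Representation R Γ V) (n : ℕ) : Submodule R ((Fin n → Γ) → V) :=
  contCochains R Γ V n ⊓ LinearMap.ker (dCochain ρ n)

/-- Continuous `n`-coboundaries. -/
def contCoboundaries (ρ : Representation R Γ V) : (n : ℕ) → Submodule R ((Fin n → Γ) → V)
  | 0 => ⊥
  | n + 1 => (contCochains R Γ V n).map (dCochain ρ n)

/-- The cohomology `Hⁿ(Γ, V)` of the topological group `Γ` with coefficients in the discrete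
module `V`, computed with continuous inhomogeneous cochains. If `Γ` is finite and discrete, this is
the usual group cohomology. -/
abbrev GroupH (ρ : Representation R Γ V) (n : ℕ) : Type _ :=
  Subquotient (contCocycles ρ n) (contCoboundaries ρ n)

end Cohomology

/-! ## The data of a norm distribution

A finite formal product `x₁^{i₁} ⋯ x_k^{i_k}` of elements of `X` is a finitely supported function
`X →₀ ℕ` (written additively: the product is `+`, divisibility is `≤`, the valuation at `x` is the
value at `x`), a possibly infinite formal product is a function `X → ℕ`. A finite squarefree product
is a `Finset X`. -/

/-- The system of groups `H_z`, `z` a finite formal product, in the group `G`, and the Frobenius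
elements. The `G`-set `⋃ B_z` attached to it is the disjoint union of the sets `G ⧸ H_z`. -/
structure NormData (X G : Type*) [Group G] [TopologicalSpace G] where
  H : (X →₀ ℕ) → Subgroup G
  isOpen_H : ∀ z, IsOpen (H z : Set G)
  commutator_le : ∀ z, commutator G ≤ H z
  anti : ∀ z' z, z' ≤ z → H z ≤ H z'
  inf_of_coprime : ∀ z z' : X →₀ ℕ, (∀ x, z x = 0 ∨ z' x = 0) → H (z + z') = H z ⊓ H z'
  mul_of_coprime : ∀ z z' : X →₀ ℕ, (∀ x, z x = 0 ∨ z' x = 0) →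
    ∀ g : G, ∃ a ∈ H z, ∃ b ∈ H z', a * b = g
  Fr : X → G
  Fr_mem : ∀ (x : X) (n : ℕ), Fr x ∈ H (Finsupp.single x n)

/-- The finite stalks of `z`: the finite divisors `z'` of `z` with `gcd (z', z / z') = 1`. -/
abbrev FinStalk {X : Type*} (z : X → ℕ) : Type _ :=
  {s : X →₀ ℕ // ∀ x, s x = 0 ∨ s x = z x}

variable {X G : Type*} [Group G] [TopologicalSpace G]

namespace NormData

variable (D : NormData X G)

instance (z : X →₀ ℕ) : (D.H z).Normal where
  conj_mem n hn g := by
    have h : g * n * g⁻¹ * n⁻¹ ∈ D.H z :=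
      D.commutator_le z (Subgroup.commutator_mem_commutator (Subgroup.mem_top g)
        (Subgroup.mem_top n))
    simpa using (D.H z).mul_mem h hn

/-- The group `G_z = G / H_z` for finite `z`. -/
abbrev Gfin (z : X →₀ ℕ) : Type _ := G ⧸ D.H z

theorem gfin_mul_comm (z : X →₀ ℕ) (a b : D.Gfin z) : a * b = b * a :=
  (Subgroup.Normal.quotient_commutative_iff_commutator_le.mpr (D.commutator_le z)).is_comm.comm a b

instance [IsTopologicalGroup G] [CompactSpace G] (z : X →₀ ℕ) : Finite (D.Gfin z) :=
  (D.H z).quotient_finite_of_isOpen (D.isOpen_H z)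

/-- The projection `G_z → G_{z'}` for `z' ∣ z`. -/
def proj {z' z : X →₀ ℕ} (h : z' ≤ z) : D.Gfin z →* D.Gfin z' :=
  QuotientGroup.map (D.H z) (D.H z') (MonoidHom.id G) (D.anti z' z h)

/-- The group `G_z` for an arbitrary `z`: the inverse limit of the groups `G_{z'}` over the finite
stalks `z'` of `z`. For finite `z`, it is `G / H_z`. -/
def Gz (z : X → ℕ) : Subgroup (∀ s : FinStalk z, D.Gfin s.1) where
  carrier := {g | ∀ (s t : FinStalk z) (h : s.1 ≤ t.1), D.proj h (g t) = g s}
  mul_mem' ha hb s t h := by simp [ha s t h, hb s t h]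
  one_mem' s t h := by simp
  inv_mem' ha s t h := by simp [ha s t h]

/-- The canonical map `G → G_z`. -/
def toGz (z : X → ℕ) : G →* D.Gz z where
  toFun g := ⟨fun s => (g : G ⧸ D.H s.1), fun _ _ _ => rfl⟩
  map_one' := rfl
  map_mul' _ _ := rfl

/-- The set `A_z`, the disjoint union of the sets `B_{z'} = {[g z'] : g ∈ G_{z'}}` over the finite
stalks `z'` of `z`. -/
abbrev ASet (z : X → ℕ) : Type _ := Σ s : FinStalk z, D.Gfin s.1

variable (T : Type*) [CommRing T]

/-- The free `T`-module `𝒜_z` on `A_z`. -/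
abbrev AMod (z : X → ℕ) : Type _ := D.ASet z →₀ T

/-- The action of `G_z` on `A_z`, given by `g [g' z'] = [g_{z'} g' z']`. -/
def act {z : X → ℕ} (g : D.Gz z) (a : D.ASet z) : D.ASet z := ⟨a.1, g.1 a.1 * a.2⟩

/-- The `T`-linear action of `G_z` on `𝒜_z`. -/
def rhoA (z : X → ℕ) : Representation T (D.Gz z) (D.AMod T z) where
  toFun g := Finsupp.lmapDomain T T (D.act g)
  map_one' := by
    have h : D.act (1 : D.Gz z) = id := funext fun a => by simp [act]
    rw [h]
    exact Finsupp.lmapDomain_id T T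
  map_mul' g k := by
    have h : D.act (g * k) = D.act g ∘ D.act k := funext fun a =>
      congrArg (Sigma.mk a.1) (mul_assoc (g.1 a.1) (k.1 a.1) a.2)
    rw [h]
    exact Finsupp.lmapDomain_comp T T _ _

@[simp] theorem rhoA_single {z : X → ℕ} (g : D.Gz z) (a : D.ASet z) (t : T) :
    D.rhoA T z g (Finsupp.single a t) = Finsupp.single (D.act g a) t := by
  simp [rhoA]

theorem rhoA_comm (z : X → ℕ) (k l : D.Gz z) :
    Commute (D.rhoA T z k) (D.rhoA T z l) := by
  have h : k * l = l * k := Subtype.ext (funext fun s => D.gfin_mul_comm s.1 _ _)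
  rw [Commute, SemiconjBy, ← map_mul, ← map_mul, h]

/-- For a stalk `z'` of `z` with `x ∤ z'`, the stalk `z(x) z'` of `z`, where `z(x) = x ^ v_x(z)`. -/
def stalkMul {z : X → ℕ} (s : FinStalk z) (x : X) (hx : s.1 x = 0) : FinStalk z :=
  ⟨s.1 + Finsupp.single x (z x), fun x' => by
    classical
    by_cases h : x = x'
    · subst h
      right
      simp [hx]
    · simpa [Finsupp.single_apply, h] using s.2 x'⟩

theorem le_stalkMul {z : X → ℕ} (s : FinStalk z) (x : X) (hx : s.1 x = 0) :
    s.1 ≤ (stalkMul s x hx).1 :=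
  le_self_add

variable [IsTopologicalGroup G] [CompactSpace G]

open Classical in
/-- For `s ∣ t` and `g ∈ G_s`, the sum of the `[h t]` over all `h ∈ G_t` that project to `g`. -/
def fiberSum {z : X → ℕ} (s t : FinStalk z) (hst : s.1 ≤ t.1) (g : D.Gfin s.1) : D.AMod T z :=
  ∑ h ∈ (Set.toFinite {h : D.Gfin t.1 | D.proj hst h = g}).toFinset,
    Finsupp.single (⟨t, h⟩ : D.ASet z) 1

/-- The element `N_{z(x)} [g z(x) z']` of `𝒜_z`, where `g ∈ G_{z'}` and `x ∤ z'`. In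
`G_{z(x) z'} = G_{z(x)} × G_{z'}`, the factor `G_{z(x)}` is the kernel of the projection to
`G_{z'}`, so this is the sum of `[h z(x) z']` over all `h ∈ G_{z(x) z'}` that project to `g`. -/
def normElt {z : X → ℕ} (x : X) (s : FinStalk z) (hx : s.1 x = 0) (g : D.Gfin s.1) :
    D.AMod T z :=
  D.fiberSum T s (stalkMul s x hx) (le_stalkMul s x hx) g

variable {T}

open Classical in
/-- The homomorphism `λ_{z(x)}` of `𝒜_z`: it sends `[g z']` to
`p(x; Fr_x⁻¹) [g z'] - N_{z(x)} [g z(x) z']` if `x ∤ z'` and to `0` if `x ∣ z'`. -/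
def lam (p : X → Polynomial T) (z : X → ℕ) (x : X) : D.AMod T z →ₗ[T] D.AMod T z :=
  Finsupp.linearCombination T fun a : D.ASet z =>
    if hx : a.1.1 x = 0 then
      Polynomial.aeval (D.rhoA T z (D.toGz z (D.Fr x)⁻¹)) (p x) (Finsupp.single a 1)
        - D.normElt T x a.1 hx a.2
    else 0

/-- The submodule `𝒟_z` of distribution relations: it is generated by the images
`λ_{z(x)} (𝒜_{z / z(x)})` for `x ∣ z`. Here `𝒜_{z / z(x)}` is spanned by the `[g z']` with
`x ∤ z'`. -/
def DMod (p : X → Polynomial T) (z : X → ℕ) : Submodule T (D.AMod T z) :=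
  ⨆ x : X, ⨆ _ : z x ≠ 0,
    (Finsupp.supported T T {a : D.ASet z | a.1.1 x = 0}).map (D.lam p z x)

theorem rhoA_fiberSum {z : X → ℕ} (k : D.Gz z) (s t : FinStalk z) (hst : s.1 ≤ t.1)
    (g : D.Gfin s.1) :
    D.rhoA T z k (D.fiberSum T s t hst g) = D.fiberSum T s t hst (k.1 s * g) := by
  classical
  have hk : D.proj hst (k.1 t) = k.1 s := k.2 s t hst
  simp only [fiberSum, map_sum, rhoA_single]
  refine Finset.sum_bij (fun h _ => k.1 t * h) ?_ ?_ ?_ ?_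
  · intro h hh
    simp only [Set.Finite.mem_toFinset, Set.mem_ofPred_eq] at hh ⊢
    rw [map_mul, hk, hh]
  · intro a _ b _ hab
    exact mul_left_cancel hab
  · intro b hb
    simp only [Set.Finite.mem_toFinset, Set.mem_ofPred_eq] at hb
    refine ⟨(k.1 t)⁻¹ * b, ?_, by simp⟩
    simp only [Set.Finite.mem_toFinset, Set.mem_ofPred_eq]
    rw [map_mul, map_inv, hk, hb, inv_mul_cancel_left]
  · intro h _
    rfl

theorem rhoA_lam (p : X → Polynomial T) (z : X → ℕ) (x : X) (k : D.Gz z) (v : D.AMod T z) :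
    D.rhoA T z k (D.lam p z x v) = D.lam p z x (D.rhoA T z k v) := by
  classical
  suffices h : (D.rhoA T z k) ∘ₗ (D.lam p z x) = (D.lam p z x) ∘ₗ (D.rhoA T z k) from
    LinearMap.congr_fun h v
  refine Finsupp.lhom_ext' fun a => LinearMap.ext_ring ?_
  simp only [LinearMap.comp_apply, Finsupp.lsingle_apply, rhoA_single, lam,
    Finsupp.linearCombination_single, one_smul]
  by_cases hx : a.1.1 x = 0
  · have hx' : (D.act k a).1.1 x = 0 := hx
    rw [dif_pos hx, dif_pos hx', map_sub, normElt, rhoA_fiberSum]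
    have hc : Commute (D.rhoA T z k)
        (Polynomial.aeval (D.rhoA T z (D.toGz z (D.Fr x)⁻¹)) (p x)) := by
      induction p x using Polynomial.induction_on' with
      | add q r hq hr => simpa using hq.add_right hr
      | monomial n t =>
        rw [Polynomial.aeval_monomial]
        exact (Algebra.commute_algebraMap_right t _).mul_right ((D.rhoA_comm T z _ _).pow_right n)
    have h := LinearMap.congr_fun hc.eq (Finsupp.single a 1)
    simp only [Module.End.mul_apply, rhoA_single] at h
    rw [h]
    rfl
  · have hx' : ¬ (D.act k a).1.1 x = 0 := hx
    rw [dif_neg hx, dif_neg hx', map_zero]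

theorem DMod_le_comap (p : X → Polynomial T) (z : X → ℕ) (k : D.Gz z) :
    D.DMod p z ≤ (D.DMod p z).comap (D.rhoA T z k) := by
  refine iSup_le fun x => iSup_le fun hx => ?_
  rintro _ ⟨v, hv, rfl⟩
  rw [Submodule.mem_comap, rhoA_lam]
  refine Submodule.mem_iSup_of_mem x (Submodule.mem_iSup_of_mem hx
    (Submodule.mem_map_of_mem ?_))
  have h : Finsupp.supported T T {a : D.ASet z | a.1.1 x = 0} ≤
      (Finsupp.supported T T {a : D.ASet z | a.1.1 x = 0}).comap (D.rhoA T z k) := by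
    rw [Finsupp.supported_eq_span_single, Submodule.span_le]
    rintro _ ⟨a, ha, rfl⟩
    refine Submodule.mem_comap.mpr ?_
    rw [rhoA_single]
    exact Submodule.subset_span ⟨D.act k a, ha, rfl⟩
  exact h hv

/-- The universal norm distribution `𝒰_z = 𝒜_z / 𝒟_z`. -/
abbrev U (p : X → Polynomial T) (z : X → ℕ) : Type _ := D.AMod T z ⧸ D.DMod p z

/-- The action of `G_z` on `𝒰_z`. -/
def rhoU (p : X → Polynomial T) (z : X → ℕ) : Representation T (D.Gz z) (D.U p z) :=
  (D.rhoA T z).quotient (D.DMod p z) (D.DMod_le_comap p z)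

end NormData

/-! ## The modules `H_{T,w}` -/

namespace NormData

section TrivialModule

variable (D : NormData X G) {T : Type*} [CommRing T]

/-- `m_w`, the greatest common divisor of the orders `|G_{z(x)}|` for `x ∣ w` (it is `0` for
`w = 1`). -/
def m (z : X → ℕ) (w : X →₀ ℕ) : ℕ :=
  w.support.gcd fun x => Nat.card (D.Gfin (Finsupp.single x (z x)))

variable [LinearOrder X]

variable (T) in
/-- The differential of the complex `⨁_v T [v]`, `v` running over the finite formal products:
`δ [v] = ∑_x (-1) ^ (∑_{x' < x} v_{x'}(v)) a_x [v x]`, where `a_x = 0` if `v_x(v)` is even and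
`a_x = |G_{z(x)}|` if `v_x(v)` is odd. -/
def delta (z : X → ℕ) : ((X →₀ ℕ) →₀ T) →ₗ[T] ((X →₀ ℕ) →₀ T) :=
  Finsupp.linearCombination T fun v : X →₀ ℕ =>
    ∑ x ∈ v.support with Odd (v x),
      Finsupp.single (v + Finsupp.single x 1)
        ((-1 : T) ^ (∑ x' ∈ v.support with x' < x, v x') *
          (Nat.card (D.Gfin (Finsupp.single x (z x))) : T))

end TrivialModule

end NormData

/-- The products `w² / w'` for `w' ∣ w̄` that have degree `q`. -/
def blockIndex {X : Type*} (w : X →₀ ℕ) (q : ℕ) : Set (X →₀ ℕ) :=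
  {v | v.degree = q ∧ ∃ w' : Finset X, w' ⊆ w.support ∧
    v + Finsupp.indicator w' (fun _ _ => 1) = 2 • w}

/-- The degree `q` component of the complex `I_T [w²] = ⨁_{w' ∣ w̄} T [w² / w']`. -/
def block (T : Type*) [CommRing T] {X : Type*} (w : X →₀ ℕ) (q : ℕ) :
    Submodule T ((X →₀ ℕ) →₀ T) :=
  Finsupp.supported T T (blockIndex w q)

namespace NormData

variable [LinearOrder X] (D : NormData X G) (T : Type*) [CommRing T]

/-- The cocycles of degree `q` of the complex `I_T [w²]`. -/
def blockCocycles (z : X → ℕ) (w : X →₀ ℕ) (q : ℕ) : Submodule T ((X →₀ ℕ) →₀ T) :=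
  block T w q ⊓ LinearMap.ker (D.delta T z)

/-- The coboundaries of degree `q` of the complex `I_T [w²]`. -/
def blockCoboundaries (z : X → ℕ) (w : X →₀ ℕ) : (q : ℕ) → Submodule T ((X →₀ ℕ) →₀ T)
  | 0 => ⊥
  | q + 1 => (block T w q).map (D.delta T z)

/-- `H_{T,w}^q`, the cohomology of degree `q` of the complex `I_T [w²]`, which is a direct summand
of the complex `⨁_{w̄ ∣ z} I_T [w²]` that computes the `G_z`-cohomology of the trivial
module `T`. -/
abbrev HT (z : X → ℕ) (w : X →₀ ℕ) (q : ℕ) : Type _ :=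
  Subquotient (D.blockCocycles T z w q) (D.blockCoboundaries T z w q)

end NormData

/-- The pairs `(y, w)` of finite formal products with `y` squarefree and `y ∣ w̄ ∣ z`. -/
abbrev PairIndex {X : Type*} (z : X → ℕ) : Type _ :=
  {yw : Finset X × (X →₀ ℕ) // yw.1 ⊆ yw.2.support ∧ ∀ x ∈ yw.2.support, z x ≠ 0}

end NormDist

end

/-!
# The cohomology of universal norm distributions

The group `G_z` is, by the Chinese remainder theorem, the product of the finite cyclic groups
`G_{z(x)}` for `x ∣ z`, as a topological group (`NormData.torusEquiv`). The cohomology of such a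
product with coefficients in a discrete module `M` is computed by the periodic complex, whose
cochains are families `c [v]` of elements of `M` indexed by exponent vectors `v`, and whose
differential multiplies by `σ_x - 1` or by the norm `N_x` according to the parity of `v_x`. The
comparison (`nonempty_groupH_equiv`) is by dimension shifting: coinduced modules are acyclic for
both complexes, and the two cohomology groups agree in degree `0`. No map between the complexes is
needed.

For coefficients in `𝒜_z`, the periodic complex is free on the cells `[g z'] [v]`, and it is a
graded tensor product over the primes `x ∣ z`. Endomorphisms of a tensor factor act on the whole
product (`ext`), and they commute up to the Koszul sign (`ext_comm`), so that identities between
such operators have to be checked on a single factor only. On cells with `x ∤ z'` and positive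
exponent at `x`, the norm is null homotopic, by an operator `θ_x` that creates the prime `x` in the
symbol and lowers the exponent at `x` by one. Since `p (x; 1) = 0`, the element `p (x; Fr_x⁻¹)` lies
in the augmentation ideal, so it is null homotopic, too, on symbols that involve only finitely many
given primes (`exists_isFrobHomotopy`); hence so is the relation `λ_{z(x)}`. For every finite set
`y` of primes, this yields a map `fL` from the part of the complex of the trivial module `T = T [1]`
with positive exponents at `y` to the periodic complex of `𝒰_z`, of degree `-deg y` (`dTot_fL`).

The sum of these maps is a quasi-isomorphism. This is `cone_acyclic`, which is proved by induction
on the number of primes in the symbols. The leading terms of relations are norms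
(`cut_mem_normMod`), because a linear relation between norms is a consequence of `N_x N_y = N_y N_x`
and the `λ_{z(x)}` commute as well (`sum_relC_mem_relFil`). The graded piece for the set of primes
`y` is therefore a tensor product of complexes of free modules modulo norms, and the map from the
trivial module to such a complex has an explicit homotopy inverse (`piL_thetaL`, `sL_homotopy`),
except if some `G_{z(x)}` with `x ∈ y` is trivial, in which case both sides are acyclic
(`exists_leading_term`). The complex of the trivial module decomposes into the complexes `I_T [w²]`,
and this gives the direct sum decomposition (`nonempty_periodic_equiv`).

The complex `I_T [w²]` is a Koszul complex for the numbers `|G_{z(x)}|`, `x ∣ w`. Dividing them by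
their greatest common divisor `m_w` gives a Koszul complex with differential `dU`, which is
contractible by Bézout's identity (`dU_hSum`). Its cocycles are the image of an idempotent matrix
with integer coefficients, hence free, and their rank is the trace of this matrix, a binomial
coefficient (`exists_factor_of_idempotent`, `trace_projMatrix`). If `m_w` is not a zero divisor,
then the cocycles of `m_w dU` are those of `dU`, and its coboundaries are the multiples of the
cocycles by `m_w` (`NormData.nonempty_HT_equiv`).
-/

noncomputable section

namespace NormDist

/-! ### Subquotients and dimension shifting -/

section Subquotients

variable {R : Type*} [CommRing R]

/-- Two modules that are quotients of a common module by the same submodule are isomorphic. -/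
theorem nonempty_equiv_of_surjective {P Q₁ Q₂ : Type*} [AddCommGroup P] [Module R P]
    [AddCommGroup Q₁] [Module R Q₁] [AddCommGroup Q₂] [Module R Q₂]
    (f₁ : P →ₗ[R] Q₁) (f₂ : P →ₗ[R] Q₂) (h₁ : Function.Surjective f₁)
    (h₂ : Function.Surjective f₂) (hk : ∀ p, f₁ p = 0 ↔ f₂ p = 0) :
    Nonempty (Q₁ ≃ₗ[R] Q₂) := by
  have hker : LinearMap.ker f₁ = LinearMap.ker f₂ := by
    ext p
    simpa using hk p
  exact ⟨(f₁.quotKerEquivOfSurjective h₁).symm ≪≫ₗ Submodule.quotEquivOfEq _ _ hker ≪≫ₗ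
    f₂.quotKerEquivOfSurjective h₂⟩

variable {V V₁ V₂ P : Type*} [AddCommGroup V] [Module R V] [AddCommGroup V₁] [Module R V₁]
  [AddCommGroup V₂] [Module R V₂] [AddCommGroup P] [Module R P]

/-- The class in `Z / B` of an element of `Z`. -/
def Subquotient.mk (Z B : Submodule R V) : Z →ₗ[R] Subquotient Z B :=
  (B.submoduleOf Z).mkQ

theorem Subquotient.mk_surjective (Z B : Submodule R V) :
    Function.Surjective (Subquotient.mk Z B) :=
  Submodule.mkQ_surjective _

theorem Subquotient.mk_eq_zero (Z B : Submodule R V) (v : Z) :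
    Subquotient.mk Z B v = 0 ↔ (v : V) ∈ B := by
  change (B.submoduleOf Z).mkQ v = 0 ↔ _
  rw [Submodule.mkQ_apply, Submodule.Quotient.mk_eq_zero, Submodule.submoduleOf,
    Submodule.mem_comap, Submodule.subtype_apply]

theorem Subquotient.subsingleton_of_le {Z B : Submodule R V} (h : Z ≤ B) :
    Subsingleton (Subquotient Z B) := by
  refine subsingleton_of_forall_eq 0 fun q => ?_
  obtain ⟨v, rfl⟩ := Subquotient.mk_surjective Z B q
  exact (Subquotient.mk_eq_zero Z B v).mpr (h v.2)

/-- A subquotient `Z₁ / B₁` is isomorphic to a subquotient `Z₂ / B₂` if both are quotients of a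
common module. -/
theorem Subquotient.nonempty_equiv {Z₁ B₁ : Submodule R V₁} {Z₂ B₂ : Submodule R V₂}
    (f₁ : P →ₗ[R] V₁) (f₂ : P →ₗ[R] V₂) (hZ₁ : ∀ p, f₁ p ∈ Z₁) (hZ₂ : ∀ p, f₂ p ∈ Z₂)
    (h₁ : ∀ v ∈ Z₁, ∃ p, v - f₁ p ∈ B₁) (h₂ : ∀ v ∈ Z₂, ∃ p, v - f₂ p ∈ B₂)
    (hk : ∀ p, f₁ p ∈ B₁ ↔ f₂ p ∈ B₂) :
    Nonempty (Subquotient Z₁ B₁ ≃ₗ[R] Subquotient Z₂ B₂) := by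
  refine nonempty_equiv_of_surjective (Subquotient.mk Z₁ B₁ ∘ₗ f₁.codRestrict Z₁ hZ₁)
    (Subquotient.mk Z₂ B₂ ∘ₗ f₂.codRestrict Z₂ hZ₂) ?_ ?_ ?_
  · intro q
    obtain ⟨v, rfl⟩ := Subquotient.mk_surjective Z₁ B₁ q
    obtain ⟨p, hp⟩ := h₁ v v.2
    refine ⟨p, (sub_eq_zero.mp ?_).symm⟩
    rw [LinearMap.comp_apply, ← map_sub]
    exact (Subquotient.mk_eq_zero _ _ _).mpr hp
  · intro q
    obtain ⟨v, rfl⟩ := Subquotient.mk_surjective Z₂ B₂ q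
    obtain ⟨p, hp⟩ := h₂ v v.2
    refine ⟨p, (sub_eq_zero.mp ?_).symm⟩
    rw [LinearMap.comp_apply, ← map_sub]
    exact (Subquotient.mk_eq_zero _ _ _).mpr hp
  · intro p
    rw [LinearMap.comp_apply, LinearMap.comp_apply, Subquotient.mk_eq_zero,
      Subquotient.mk_eq_zero]
    exact hk p

/-- A family of maps `F j` that is, on the level of subquotients, jointly surjective and jointly
injective identifies a subquotient with a direct sum of subquotients. -/
theorem Subquotient.nonempty_equiv_directSum {J W : Type*} [AddCommGroup W] [Module R W]
    [DecidableEq J] {Z B : Submodule R V} {ZJ BJ : J → Submodule R W} (F : J → W →ₗ[R] V)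
    (hZ : ∀ j, ∀ w ∈ ZJ j, F j w ∈ Z) (hB : ∀ j, ∀ w ∈ BJ j, F j w ∈ B)
    (hsurj : ∀ v ∈ Z, ∃ e : J →₀ W, (∀ j, e j ∈ ZJ j) ∧ v - e.sum (fun j w => F j w) ∈ B)
    (hinj : ∀ e : J →₀ W, (∀ j, e j ∈ ZJ j) → e.sum (fun j w => F j w) ∈ B →
      ∀ j, e j ∈ BJ j) :
    Nonempty (Subquotient Z B ≃ₗ[R] DirectSum J fun j => Subquotient (ZJ j) (BJ j)) := by
  classical
  -- a finitely supported family of elements of the `ZJ j`, as a finitely supported function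
  let toFs : (Π₀ j, ZJ j) → (J →₀ W) := fun e =>
    ⟨e.support, fun j => e j, fun j => by simp⟩
  let s : (Π₀ j, ZJ j) →ₗ[R] V :=
    DFinsupp.lsum R (fun j => (F j) ∘ₗ (ZJ j).subtype)
  have hs : ∀ e, s e = (toFs e).sum (fun j w => F j w) := by
    intro e
    simp only [s, DFinsupp.lsum_apply_apply, DFinsupp.sumAddHom_apply, Finsupp.sum]
    rfl
  have hsZ : ∀ e, s e ∈ Z := by
    intro e
    rw [hs]
    exact Submodule.sum_mem _ fun j _ => hZ j _ (e j).2
  have htoFs : ∀ e j, toFs e j = e j := fun e j => rfl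
  refine nonempty_equiv_of_surjective (Subquotient.mk Z B ∘ₗ s.codRestrict Z hsZ)
    (DFinsupp.mapRange.linearMap (fun j => Subquotient.mk (ZJ j) (BJ j))) ?_ ?_ ?_
  · intro q
    obtain ⟨v, rfl⟩ := Subquotient.mk_surjective Z B q
    obtain ⟨e, he, hv⟩ := hsurj v v.2
    let e' : Π₀ j, ZJ j := DFinsupp.mk e.support fun j => ⟨e j, he j⟩
    have he' : toFs e' = e := by
      ext j
      rw [htoFs]
      by_cases hj : j ∈ e.support
      · simp [e', DFinsupp.mk_apply, hj]
      · have : e j = 0 := by simpa using hj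
        simp [e', DFinsupp.mk_apply, this]
    refine ⟨e', (sub_eq_zero.mp ?_).symm⟩
    rw [LinearMap.comp_apply, ← map_sub]
    refine (Subquotient.mk_eq_zero _ _ _).mpr ?_
    have : s e' = e.sum (fun j w => F j w) := by rw [hs, he']
    change (v : V) - s e' ∈ B
    rwa [this]
  · exact (DFinsupp.mapRange_surjective _ fun j => map_zero _).mpr
      fun j => Subquotient.mk_surjective _ _
  · intro e
    rw [LinearMap.comp_apply, Subquotient.mk_eq_zero]
    change s e ∈ B ↔ _
    rw [hs, DFinsupp.ext_iff]
    exact ⟨fun h j => (Subquotient.mk_eq_zero _ _ _).mpr (hinj (toFs e) (fun j => (e j).2) h j),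
      fun h => Submodule.sum_mem _ fun j _ => hB j _ ((Subquotient.mk_eq_zero _ _ _).mp (h j))⟩

end Subquotients

section Complexes

variable {R : Type*} [CommRing R]

/-- The cocycles of degree `n` of the complex with components `C n` and differential `d`. -/
def cocyc {V : ℕ → Type*} [∀ n, AddCommGroup (V n)] [∀ n, Module R (V n)]
    (C : ∀ n, Submodule R (V n)) (d : ∀ n, V n →ₗ[R] V (n + 1)) (n : ℕ) : Submodule R (V n) :=
  C n ⊓ LinearMap.ker (d n)

theorem mem_cocyc {V : ℕ → Type*} [∀ n, AddCommGroup (V n)] [∀ n, Module R (V n)]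
    {C : ∀ n, Submodule R (V n)} {d : ∀ n, V n →ₗ[R] V (n + 1)} {n : ℕ} {v : V n} :
    v ∈ cocyc C d n ↔ v ∈ C n ∧ d n v = 0 :=
  Iff.rfl

/-- The coboundaries of degree `n` of the complex with components `C n` and differential `d`. -/
def cobd {V : ℕ → Type*} [∀ n, AddCommGroup (V n)] [∀ n, Module R (V n)]
    (C : ∀ n, Submodule R (V n)) (d : ∀ n, V n →ₗ[R] V (n + 1)) : ∀ n, Submodule R (V n)
  | 0 => ⊥
  | n + 1 => (C n).map (d n)

/-- A short exact sequence `0 → A → B → C → 0` of complexes, each of them given by submodules of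
ambient modules. -/
structure ShortExactComplexes {VA VB VC : ℕ → Type*}
    [∀ n, AddCommGroup (VA n)] [∀ n, Module R (VA n)] [∀ n, AddCommGroup (VB n)]
    [∀ n, Module R (VB n)] [∀ n, AddCommGroup (VC n)] [∀ n, Module R (VC n)]
    (CA : ∀ n, Submodule R (VA n)) (dA : ∀ n, VA n →ₗ[R] VA (n + 1))
    (CB : ∀ n, Submodule R (VB n)) (dB : ∀ n, VB n →ₗ[R] VB (n + 1))
    (CC : ∀ n, Submodule R (VC n)) (dC : ∀ n, VC n →ₗ[R] VC (n + 1))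
    (i : ∀ n, VA n →ₗ[R] VB n) (j : ∀ n, VB n →ₗ[R] VC n) : Prop where
  d_mem_B : ∀ n, ∀ b ∈ CB n, dB n b ∈ CB (n + 1)
  dd_B : ∀ n, ∀ b ∈ CB n, dB (n + 1) (dB n b) = 0
  i_mem : ∀ n, ∀ a ∈ CA n, i n a ∈ CB n
  j_mem : ∀ n, ∀ b ∈ CB n, j n b ∈ CC n
  i_inj : ∀ n, Function.Injective (i n)
  j_i : ∀ n a, j n (i n a) = 0
  exact : ∀ n, ∀ b ∈ CB n, j n b = 0 → ∃ a ∈ CA n, i n a = b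
  surj : ∀ n, ∀ c ∈ CC n, ∃ b ∈ CB n, j n b = c
  i_d : ∀ n a, i (n + 1) (dA n a) = dB n (i n a)
  j_d : ∀ n b, j (n + 1) (dB n b) = dC n (j n b)

variable {VA VB VC : ℕ → Type*}
    [∀ n, AddCommGroup (VA n)] [∀ n, Module R (VA n)] [∀ n, AddCommGroup (VB n)]
    [∀ n, Module R (VB n)] [∀ n, AddCommGroup (VC n)] [∀ n, Module R (VC n)]
    {CA : ∀ n, Submodule R (VA n)} {dA : ∀ n, VA n →ₗ[R] VA (n + 1)}
    {CB : ∀ n, Submodule R (VB n)} {dB : ∀ n, VB n →ₗ[R] VB (n + 1)}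
    {CC : ∀ n, Submodule R (VC n)} {dC : ∀ n, VC n →ₗ[R] VC (n + 1)}
    {i : ∀ n, VA n →ₗ[R] VB n} {j : ∀ n, VB n →ₗ[R] VC n}

namespace ShortExactComplexes

/-- The pairs `(b, a)` with `d b = i a`: this module maps onto the cohomology of `A` (by `a`) and
onto that of `C` (by `j b`), which exhibits the connecting homomorphism as a correspondence. -/
def connecting (CA : ∀ n, Submodule R (VA n)) (CB : ∀ n, Submodule R (VB n))
    (dB : ∀ n, VB n →ₗ[R] VB (n + 1)) (i : ∀ n, VA n →ₗ[R] VB n) (n : ℕ) :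
    Submodule R (VB n × VA (n + 1)) where
  carrier := {q | q.1 ∈ CB n ∧ q.2 ∈ CA (n + 1) ∧ dB n q.1 = i (n + 1) q.2}
  add_mem' := by
    rintro q q' ⟨h₁, h₂, h₃⟩ ⟨h₁', h₂', h₃'⟩
    exact ⟨add_mem h₁ h₁', add_mem h₂ h₂', by simp [h₃, h₃']⟩
  zero_mem' := ⟨zero_mem _, zero_mem _, by simp⟩
  smul_mem' := by
    rintro r q ⟨h₁, h₂, h₃⟩
    exact ⟨Submodule.smul_mem _ _ h₁, Submodule.smul_mem _ _ h₂, by simp [h₃]⟩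

variable (S : ShortExactComplexes CA dA CB dB CC dC i j)
include S

theorem snd_mem_cocyc (n : ℕ) (q : connecting CA CB dB i n) : q.1.2 ∈ cocyc CA dA (n + 1) := by
  refine ⟨q.2.2.1, S.i_inj _ ?_⟩
  rw [S.i_d, ← q.2.2.2, S.dd_B n _ q.2.1, map_zero]

theorem j_fst_mem_cocyc (n : ℕ) (q : connecting CA CB dB i n) :
    j n q.1.1 ∈ cocyc CC dC n := by
  refine mem_cocyc.mpr ⟨S.j_mem n _ q.2.1, ?_⟩
  rw [← S.j_d, q.2.2.2, S.j_i]

theorem exists_snd (n : ℕ) (hB : cocyc CB dB (n + 1) ≤ cobd CB dB (n + 1)) :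
    ∀ a ∈ cocyc CA dA (n + 1), ∃ q : connecting CA CB dB i n, q.1.2 = a := by
  intro a ha
  obtain ⟨b, hb, hba⟩ : i (n + 1) a ∈ cobd CB dB (n + 1) := by
    refine hB (mem_cocyc.mpr ⟨S.i_mem _ _ ha.1, ?_⟩)
    rw [← S.i_d, (mem_cocyc.mp ha).2, map_zero]
  exact ⟨⟨(b, a), hb, ha.1, hba⟩, rfl⟩

theorem exists_j_fst (n : ℕ) :
    ∀ c ∈ cocyc CC dC n, ∃ q : connecting CA CB dB i n, j n q.1.1 = c := by
  intro c hc
  obtain ⟨b, hb, rfl⟩ := S.surj n c hc.1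
  obtain ⟨a, ha, hab⟩ := S.exact (n + 1) (dB n b) (S.d_mem_B n b hb) (by
    rw [S.j_d, (mem_cocyc.mp hc).2])
  exact ⟨⟨(b, a), hb, ha, hab.symm⟩, rfl⟩

theorem snd_mem_cobd_iff (n : ℕ) (q : connecting CA CB dB i n) :
    q.1.2 ∈ cobd CA dA (n + 1) ↔ ∃ a ∈ CA n, dB n (q.1.1 - i n a) = 0 := by
  have h₃ : dB n q.1.1 = i (n + 1) q.1.2 := q.2.2.2
  constructor
  · rintro ⟨a, ha, haq⟩
    refine ⟨a, ha, ?_⟩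
    rw [map_sub, ← S.i_d, haq, h₃, sub_self]
  · rintro ⟨a, ha, haq⟩
    refine ⟨a, ha, S.i_inj _ ?_⟩
    rw [map_sub, sub_eq_zero] at haq
    rw [S.i_d, ← haq, ← h₃]

/-- Dimension shifting in positive degrees. -/
theorem shift (n : ℕ) (h₁ : cocyc CB dB (n + 1) ≤ cobd CB dB (n + 1))
    (h₂ : cocyc CB dB (n + 2) ≤ cobd CB dB (n + 2)) :
    Nonempty (Subquotient (cocyc CA dA (n + 2)) (cobd CA dA (n + 2)) ≃ₗ[R]
      Subquotient (cocyc CC dC (n + 1)) (cobd CC dC (n + 1))) := by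
  refine Subquotient.nonempty_equiv (P := connecting CA CB dB i (n + 1))
    (LinearMap.snd R _ _ ∘ₗ Submodule.subtype _)
    (j (n + 1) ∘ₗ LinearMap.fst R _ _ ∘ₗ Submodule.subtype _)
    (S.snd_mem_cocyc (n + 1)) (S.j_fst_mem_cocyc (n + 1)) ?_ ?_ ?_
  · intro a ha
    obtain ⟨q, hq⟩ := S.exists_snd (n + 1) h₂ a ha
    refine ⟨q, ?_⟩
    change a - q.1.2 ∈ _
    rw [hq, sub_self]
    exact zero_mem _
  · intro c hc
    obtain ⟨q, hq⟩ := S.exists_j_fst (n + 1) c hc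
    refine ⟨q, ?_⟩
    change c - j (n + 1) q.1.1 ∈ _
    rw [hq, sub_self]
    exact zero_mem _
  · intro q
    change q.1.2 ∈ _ ↔ j (n + 1) q.1.1 ∈ _
    rw [S.snd_mem_cobd_iff]
    constructor
    · rintro ⟨a, ha, haq⟩
      obtain ⟨b, hb, hbq⟩ := h₁ ⟨sub_mem q.2.1 (S.i_mem _ _ ha), haq⟩
      refine ⟨j n b, S.j_mem n b hb, ?_⟩
      rw [← S.j_d, hbq, map_sub, S.j_i, sub_zero]
    · rintro ⟨c, hc, hcq⟩
      obtain ⟨b, hb, rfl⟩ := S.surj n c hc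
      obtain ⟨a, ha, haq⟩ := S.exact (n + 1) (q.1.1 - dB n b)
        (sub_mem q.2.1 (S.d_mem_B n b hb)) (by rw [map_sub, S.j_d, hcq, sub_self])
      refine ⟨a, ha, ?_⟩
      rw [haq, sub_sub_cancel, S.dd_B n b hb]

/-- Dimension shifting in degree `0`. -/
theorem shift_zero (h : cocyc CB dB 1 ≤ cobd CB dB 1) :
    Nonempty (Subquotient (cocyc CA dA 1) (cobd CA dA 1) ≃ₗ[R]
      Subquotient (cocyc CC dC 0) ((cocyc CB dB 0).map (j 0))) := by
  refine Subquotient.nonempty_equiv (P := connecting CA CB dB i 0)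
    (LinearMap.snd R _ _ ∘ₗ Submodule.subtype _)
    (j 0 ∘ₗ LinearMap.fst R _ _ ∘ₗ Submodule.subtype _)
    (S.snd_mem_cocyc 0) (S.j_fst_mem_cocyc 0) ?_ ?_ ?_
  · intro a ha
    obtain ⟨q, hq⟩ := S.exists_snd 0 h a ha
    refine ⟨q, ?_⟩
    change a - q.1.2 ∈ _
    rw [hq, sub_self]
    exact zero_mem _
  · intro c hc
    obtain ⟨q, hq⟩ := S.exists_j_fst 0 c hc
    refine ⟨q, ?_⟩
    change c - j 0 q.1.1 ∈ _
    rw [hq, sub_self]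
    exact zero_mem _
  · intro q
    change q.1.2 ∈ _ ↔ j 0 q.1.1 ∈ _
    rw [S.snd_mem_cobd_iff]
    constructor
    · rintro ⟨a, ha, haq⟩
      refine ⟨q.1.1 - i 0 a, ⟨sub_mem q.2.1 (S.i_mem _ _ ha), haq⟩, ?_⟩
      rw [map_sub, S.j_i, sub_zero]
    · rintro ⟨b, hb, hbq⟩
      obtain ⟨a, ha, haq⟩ := S.exact 0 (q.1.1 - b) (sub_mem q.2.1 hb.1)
        (by rw [map_sub, hbq, sub_self])
      refine ⟨a, ha, ?_⟩
      rw [haq, sub_sub_cancel]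
      exact hb.2

end ShortExactComplexes

end Complexes

/-! ### Continuous cochains with values in a coinduced module -/

section FunctionModule

variable {R Γ V W : Type*} [CommRing R] [Group Γ] [AddCommGroup V] [Module R V]
  [AddCommGroup W] [Module R W]

theorem dCochain_apply (ρ : Representation R Γ V) (n : ℕ) (f : (Fin n → Γ) → V)
    (g : Fin (n + 1) → Γ) :
    dCochain ρ n f g = ρ (g 0) (f fun i => g i.succ) + ∑ j : Fin (n + 1),
      (-1 : R) ^ ((j : ℕ) + 1) • f (Fin.contractNth j (· * ·) g) :=
  rfl

theorem dCochain_compLeft (ρ : Representation R Γ V) (ρ' : Representation R Γ W) (φ : V →ₗ[R] W)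
    (hφ : ∀ g v, φ (ρ g v) = ρ' g (φ v)) (n : ℕ) (f : (Fin n → Γ) → V) :
    dCochain ρ' n (φ.compLeft _ f) = φ.compLeft _ (dCochain ρ n f) := by
  funext g
  change dCochain ρ' n (fun x => φ (f x)) g = φ (dCochain ρ n f g)
  simp only [dCochain_apply, map_add, map_sum, map_smul, hφ]

/-- The action of `Γ` by right translations on the functions `Γ → V`. -/
def repFun (R Γ V : Type*) [CommRing R] [Group Γ] [AddCommGroup V] [Module R V] :
    Representation R Γ (Γ → V) where
  toFun g := LinearMap.funLeft R V (fun h => h * g)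
  map_one' := by
    ext φ h
    simp [LinearMap.funLeft_apply]
  map_mul' g k := by
    ext φ h
    simp [LinearMap.funLeft_apply, mul_assoc]

@[simp] theorem repFun_apply (g h : Γ) (φ : Γ → V) : repFun R Γ V g φ h = φ (h * g) := rfl

/-- The contracting homotopy of the cochain complex with values in the functions on `Γ`. -/
def contraction (n : ℕ) : ((Fin (n + 1) → Γ) → Γ → V) →ₗ[R] ((Fin n → Γ) → Γ → V) where
  toFun f g g₀ := f (Fin.cons g₀ g) 1
  map_add' _ _ := rfl
  map_smul' _ _ := rfl

theorem contraction_apply (n : ℕ) (f : (Fin (n + 1) → Γ) → Γ → V) (g : Fin n → Γ) (g₀ : Γ) :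
    contraction (R := R) n f g g₀ = f (Fin.cons g₀ g) 1 := rfl

theorem contractNth_zero_cons {n : ℕ} (g₀ : Γ) (g : Fin (n + 1) → Γ) :
    Fin.contractNth 0 (· * ·) (Fin.cons g₀ g : Fin (n + 2) → Γ) =
      Fin.cons (g₀ * g 0) (fun i => g i.succ) := by
  funext k
  refine Fin.cases ?_ (fun k => ?_) k
  · simp [Fin.contractNth]
  · simp [Fin.contractNth]

theorem contractNth_succ_cons {n : ℕ} (j : Fin (n + 1)) (g₀ : Γ) (g : Fin (n + 1) → Γ) :
    Fin.contractNth j.succ (· * ·) (Fin.cons g₀ g : Fin (n + 2) → Γ) =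
      Fin.cons g₀ (Fin.contractNth j (· * ·) g) := by
  funext k
  refine Fin.cases ?_ (fun k => ?_) k
  · simp [Fin.contractNth]
  · rw [Fin.cons_succ]
    simp only [Fin.contractNth, Fin.val_succ, add_lt_add_iff_right, add_left_inj,
      ← Fin.succ_castSucc, Fin.cons_succ]

theorem dCochain_contraction (n : ℕ) (f : (Fin (n + 1) → Γ) → Γ → V) :
    dCochain (repFun R Γ V) n (contraction (R := R) n f) =
      f - contraction (R := R) (n + 1) (dCochain (repFun R Γ V) (n + 1) f) := by
  funext g g₀
  rw [Pi.sub_apply, Pi.sub_apply, contraction_apply, dCochain_apply, dCochain_apply,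
    Fin.sum_univ_succ (n := n + 1), contractNth_zero_cons]
  simp only [contractNth_succ_cons, Pi.add_apply, Finset.sum_apply, Pi.smul_apply, repFun_apply,
    contraction_apply, Fin.cons_zero, Fin.cons_succ, Fin.val_zero, Fin.val_succ, one_mul, zero_add,
    pow_one, neg_smul, one_smul, Pi.neg_apply, pow_succ _ ((_ : ℕ) + 1), mul_neg, mul_one,
    Finset.sum_neg_distrib]
  abel

theorem contraction_dCochain_zero (f : (Fin 0 → Γ) → Γ → V) :
    contraction (R := R) 0 (dCochain (repFun R Γ V) 0 f) = f - fun g _ => f g 1 := by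
  funext g g₀
  rw [contraction_apply, dCochain_apply]
  have h : ∀ a b : Fin 0 → Γ, f a = f b := fun a b => congrArg f (Subsingleton.elim a b)
  simp [h _ g, sub_eq_add_neg]

theorem dCochain_dCochain_repFun (n : ℕ) (f : (Fin n → Γ) → Γ → V) :
    dCochain (repFun R Γ V) (n + 1) (dCochain (repFun R Γ V) n f) = 0 := by
  -- left translations commute with the action, so it is enough to evaluate at `1`
  have key : ∀ n, (∀ f : (Fin n → Γ) → Γ → V, contraction (R := R) (n + 1)
      (dCochain (repFun R Γ V) (n + 1) (dCochain (repFun R Γ V) n f)) = 0) →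
      ∀ f : (Fin n → Γ) → Γ → V,
        dCochain (repFun R Γ V) (n + 1) (dCochain (repFun R Γ V) n f) = 0 := by
    intro n h f
    funext g k
    let L : (Γ → V) →ₗ[R] (Γ → V) := LinearMap.funLeft R V (fun h => k * h)
    have hL : ∀ g φ, L (repFun R Γ V g φ) = repFun R Γ V g (L φ) := by
      intro g φ
      funext h
      simp [L, LinearMap.funLeft_apply, mul_assoc]
    have h1 := congrFun (congrFun (h (L.compLeft _ f)) (fun i => g i.succ)) (g 0)
    rw [dCochain_compLeft _ _ L hL, dCochain_compLeft _ _ L hL, contraction_apply] at h1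
    have hg : (Fin.cons (g 0) (fun i => g i.succ) : Fin (n + 2) → Γ) = g :=
      Fin.cons_self_tail g
    rw [hg] at h1
    simpa [L, LinearMap.funLeft_apply] using h1
  induction n with
  | zero =>
    refine key 0 (fun f => ?_) f
    have h := dCochain_contraction (R := R) 0 (dCochain (repFun R Γ V) 0 f)
    rw [contraction_dCochain_zero, map_sub] at h
    have h0 : dCochain (repFun R Γ V) 0 (fun g _ => f g 1) = 0 := by
      funext g k
      have h : ∀ a b : Fin 0 → Γ, f a = f b := fun a b => congrArg f (Subsingleton.elim a b)
      rw [dCochain_apply]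
      simp [h _ (fun i => g i.succ)]
    rw [h0, sub_zero] at h
    exact sub_eq_self.mp h.symm
  | succ n ih =>
    refine key (n + 1) (fun f => ?_) f
    have h := dCochain_contraction (R := R) (n + 1) (dCochain (repFun R Γ V) (n + 1) f)
    have h' := dCochain_contraction (R := R) n f
    have h'' : contraction (R := R) (n + 1) (dCochain (repFun R Γ V) (n + 1) f) =
        f - dCochain (repFun R Γ V) n (contraction (R := R) n f) := by
      rw [h', sub_sub_cancel]
    rw [h'', map_sub, ih, sub_zero] at h
    exact sub_eq_self.mp h.symm

theorem dCochain_dCochain (ρ : Representation R Γ V) (n : ℕ) (f : (Fin n → Γ) → V) :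
    dCochain ρ (n + 1) (dCochain ρ n f) = 0 := by
  let φ : V →ₗ[R] (Γ → V) := LinearMap.pi fun g => ρ g
  have hφ : ∀ g v, φ (ρ g v) = repFun R Γ V g (φ v) := by
    intro g v
    funext h
    simp [φ]
  have h := dCochain_dCochain_repFun (R := R) n (φ.compLeft _ f)
  rw [dCochain_compLeft ρ _ φ hφ, dCochain_compLeft ρ _ φ hφ] at h
  funext g
  have h1 := congrFun (congrFun h g) 1
  simpa [φ] using h1

variable [TopologicalSpace Γ]

/-- The condition that `Γ` acts continuously on the discrete module `V`. -/
def IsDiscreteRep (ρ : Representation R Γ V) : Prop :=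
  ∀ v, IsLocallyConstant fun g => ρ g v

theorem dCochain_mem_contCochains [IsTopologicalGroup Γ] {ρ : Representation R Γ V}
    (hρ : IsDiscreteRep ρ) (n : ℕ) (f : (Fin n → Γ) → V) (hf : f ∈ contCochains R Γ V n) :
    dCochain ρ n f ∈ contCochains R Γ V (n + 1) := by
  have hf' : IsLocallyConstant f := hf
  have h1 : IsLocallyConstant fun g : Fin (n + 1) → Γ => ρ (g 0) (f fun i => g i.succ) := by
    rw [IsLocallyConstant.iff_eventually_eq]
    intro g
    have hc : Continuous fun g : Fin (n + 1) → Γ => fun i : Fin n => g i.succ := by fun_prop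
    have h2 := (hf'.comp_continuous hc).eventually_eq g
    have h3 := ((hρ (f fun i => g i.succ)).comp_continuous
      (continuous_apply (0 : Fin (n + 1)))).eventually_eq g
    filter_upwards [h2, h3] with k hk hk'
    simp only [Function.comp_apply] at hk hk'
    rw [hk, hk']
  have h2 : ∀ j : Fin (n + 1), (fun g : Fin (n + 1) → Γ =>
      (-1 : R) ^ ((j : ℕ) + 1) • f (Fin.contractNth j (· * ·) g)) ∈
        contCochains R Γ V (n + 1) := by
    intro j
    have hc : Continuous fun g : Fin (n + 1) → Γ => Fin.contractNth j (· * ·) g := by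
      refine continuous_pi fun k => ?_
      unfold Fin.contractNth
      split_ifs <;> fun_prop
    exact Submodule.smul_mem _ _ (hf'.comp_continuous hc)
  have h3 : dCochain ρ n f = (fun g : Fin (n + 1) → Γ => ρ (g 0) (f fun i => g i.succ)) +
      ∑ j : Fin (n + 1), fun g : Fin (n + 1) → Γ =>
        (-1 : R) ^ ((j : ℕ) + 1) • f (Fin.contractNth j (· * ·) g) := by
    funext g
    simp [dCochain_apply]
  rw [h3]
  exact Submodule.add_mem _ h1 (Submodule.sum_mem _ fun j _ => h2 j)

end FunctionModule

section Coinduced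

variable {ι : Type*} {B : ι → Type*} [∀ x, TopologicalSpace (B x)] [∀ x, DiscreteTopology (B x)]

/-- On a product of discrete spaces, a function that depends only on finitely many coordinates is
locally constant. -/
theorem isLocallyConstant_of_agree {n : ℕ} {W : Type*} (f : (Fin n → ∀ x, B x) → W)
    (r : Finset ι) (hr : ∀ g g', (∀ i, ∀ x ∈ r, g i x = g' i x) → f g = f g') :
    IsLocallyConstant f := by
  rw [IsLocallyConstant.iff_exists_open]
  intro g
  refine ⟨⋂ i, ⋂ x ∈ r, {g' | g' i x = g i x}, ?_, by simp, fun g' hg' => hr _ _ ?_⟩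
  · refine isOpen_iInter_of_finite fun i => isOpen_biInter_finset fun x _ => ?_
    have hc : Continuous fun g' : Fin n → ∀ x, B x => g' i x := by fun_prop
    exact (isOpen_discrete {g i x}).preimage hc
  · simpa using hg'

/-- On a product of finite discrete spaces, a locally constant function depends only on finitely
many coordinates. -/
theorem IsLocallyConstant.exists_agree [∀ x, Finite (B x)] {n : ℕ} {W : Type*}
    {f : (Fin n → ∀ x, B x) → W} (hf : IsLocallyConstant f) :
    ∃ r : Finset ι, ∀ g g', (∀ i, ∀ x ∈ r, g i x = g' i x) → f g = f g' := by
  classical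
  have h1 : ∀ g : Fin n → ∀ x, B x, ∃ r : Finset ι, ∀ g',
      (∀ i, ∀ x ∈ r, g' i x = g i x) → f g' = f g := by
    intro g
    obtain ⟨U, hU, hgU, hfU⟩ := hf.exists_open g
    obtain ⟨I, u, hu, hIu⟩ := isOpen_pi_iff.mp hU g hgU
    have h2 : ∀ i : Fin n, ∃ r : Finset ι, i ∈ I → ∀ k : ∀ x, B x,
        (∀ x ∈ r, k x = g i x) → k ∈ u i := by
      intro i
      by_cases hi : i ∈ I
      · obtain ⟨J, v, hv, hJv⟩ := isOpen_pi_iff.mp (hu i hi).1 (g i) (hu i hi).2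
        refine ⟨J, fun _ k hk => hJv fun x hx => ?_⟩
        rw [hk x hx]
        exact (hv x hx).2
      · exact ⟨∅, fun h => absurd h hi⟩
    choose r hr using h2
    refine ⟨Finset.univ.biUnion r, fun g' hg' => hfU g' (hIu fun i hi => hr i hi _ ?_)⟩
    exact fun x hx => hg' i x (Finset.mem_biUnion.mpr ⟨i, Finset.mem_univ i, hx⟩)
  choose r hr using h1
  obtain ⟨t, ht⟩ := (isCompact_univ (X := Fin n → ∀ x, B x)).elim_finite_subcover
    (fun g => ⋂ i, ⋂ x ∈ r g, {g' : Fin n → ∀ x, B x | g' i x = g i x}) (fun g => by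
      refine isOpen_iInter_of_finite fun i => isOpen_biInter_finset fun x _ => ?_
      have hc : Continuous fun g' : Fin n → ∀ x, B x => g' i x := by fun_prop
      exact (isOpen_discrete {g i x}).preimage hc)
    (fun g _ => Set.mem_iUnion.mpr ⟨g, by simp⟩)
  refine ⟨t.biUnion r, fun g g' hgg' => ?_⟩
  obtain ⟨k, hkt, hk⟩ : ∃ k ∈ t, ∀ i, ∀ x ∈ r k, g i x = k i x := by
    simpa using ht (Set.mem_univ g)
  rw [hr k g hk, hr k g']
  intro i x hx
  rw [← hgg' i x (Finset.mem_biUnion.mpr ⟨k, hkt, hx⟩), hk i x hx]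

end Coinduced

section Coinduced

variable {ι : Type*} {B : ι → Type*} [∀ x, Group (B x)] {R V : Type*} [CommRing R]
  [AddCommGroup V] [Module R V]

variable (R V B) in
/-- The coinduced module: the functions on the group with values in `V` that depend only on finitely
many coordinates. -/
def coind : Submodule R ((∀ x, B x) → V) where
  carrier := {φ | ∃ r : Finset ι, ∀ g g', (∀ x ∈ r, g x = g' x) → φ g = φ g'}
  add_mem' := by
    classical
    rintro φ ψ ⟨r, hr⟩ ⟨s, hs⟩
    refine ⟨r ∪ s, fun g g' h => ?_⟩
    rw [Pi.add_apply, Pi.add_apply, hr g g' fun x hx => h x (Finset.mem_union_left _ hx),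
      hs g g' fun x hx => h x (Finset.mem_union_right _ hx)]
  zero_mem' := ⟨∅, fun _ _ _ => rfl⟩
  smul_mem' := by
    rintro c φ ⟨r, hr⟩
    exact ⟨r, fun g g' h => congrArg (c • ·) (hr g g' h)⟩

variable (R V B) in
/-- The action by right translations on the coinduced module. -/
def repCoind : Representation R (∀ x, B x) (coind B R V) where
  toFun g := (repFun R (∀ x, B x) V g).restrict fun φ hφ => by
    obtain ⟨r, hr⟩ := hφ
    exact ⟨r, fun k k' h => hr _ _ fun x hx => congrArg (· * g x) (h x hx)⟩
  map_one' := by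
    ext φ h
    simp
  map_mul' g k := by
    ext φ h
    simp

@[simp] theorem repCoind_apply (g h : ∀ x, B x) (φ : coind B R V) :
    (repCoind B R V g φ : (∀ x, B x) → V) h = (φ : (∀ x, B x) → V) (h * g) := rfl

variable [∀ x, TopologicalSpace (B x)] [∀ x, DiscreteTopology (B x)]

theorem IsDiscreteRep.exists_agree [∀ x, Finite (B x)] {ρ : Representation R (∀ x, B x) V}
    (hρ : IsDiscreteRep ρ) (v : V) :
    ∃ r : Finset ι, ∀ g g' : ∀ x, B x, (∀ x ∈ r, g x = g' x) → ρ g v = ρ g' v := by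
  have hc : Continuous fun g : Fin 1 → ∀ x, B x => g 0 := by fun_prop
  obtain ⟨r, hr⟩ := IsLocallyConstant.exists_agree ((hρ v).comp_continuous hc)
  exact ⟨r, fun g g' h => hr (fun _ => g) (fun _ => g') fun _ => h⟩

theorem isDiscreteRep_of_agree {ρ : Representation R (∀ x, B x) V}
    (h : ∀ v, ∃ r : Finset ι, ∀ g g' : ∀ x, B x, (∀ x ∈ r, g x = g' x) → ρ g v = ρ g' v) :
    IsDiscreteRep ρ := by
  intro v
  obtain ⟨r, hr⟩ := h v
  have h1 := isLocallyConstant_of_agree (n := 1) (fun g : Fin 1 → ∀ x, B x => ρ (g 0) v) r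
    fun g g' h => hr _ _ (h 0)
  have hc : Continuous fun g : ∀ x, B x => (fun _ => g : Fin 1 → ∀ x, B x) := by fun_prop
  exact h1.comp_continuous hc

theorem isDiscreteRep_repCoind : IsDiscreteRep (repCoind B R V) := by
  refine isDiscreteRep_of_agree fun φ => ?_
  obtain ⟨r, hr⟩ := φ.2
  exact ⟨r, fun g g' h => Subtype.ext (funext fun k => hr _ _ fun x hx =>
    congrArg (k x * ·) (h x hx))⟩

variable [∀ x, Finite (B x)]

/-- The embedding of a discrete module in its coinduced module. -/
def toCoind (ρ : Representation R (∀ x, B x) V) (hρ : IsDiscreteRep ρ) : V →ₗ[R] coind B R V :=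
  (LinearMap.pi fun g => ρ g).codRestrict _ fun v => hρ.exists_agree v

@[simp] theorem toCoind_apply (ρ : Representation R (∀ x, B x) V) (hρ : IsDiscreteRep ρ) (v : V)
    (g : ∀ x, B x) : (toCoind ρ hρ v : (∀ x, B x) → V) g = ρ g v := rfl

theorem toCoind_injective (ρ : Representation R (∀ x, B x) V) (hρ : IsDiscreteRep ρ) :
    Function.Injective (toCoind ρ hρ) := by
  intro v w h
  have := congrFun (congrArg Subtype.val h) 1
  simpa using this

theorem toCoind_rep (ρ : Representation R (∀ x, B x) V) (hρ : IsDiscreteRep ρ) (g : ∀ x, B x)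
    (v : V) : toCoind ρ hρ (ρ g v) = repCoind B R V g (toCoind ρ hρ v) := by
  ext h
  simp

/-- The cokernel of the embedding of a discrete module in its coinduced module. -/
abbrev CoindQuot (ρ : Representation R (∀ x, B x) V) (hρ : IsDiscreteRep ρ) : Type _ :=
  coind B R V ⧸ LinearMap.range (toCoind ρ hρ)

/-- The action on the cokernel of the embedding of a discrete module in its coinduced module. -/
def repCoindQuot (ρ : Representation R (∀ x, B x) V) (hρ : IsDiscreteRep ρ) :
    Representation R (∀ x, B x) (CoindQuot ρ hρ) :=
  (repCoind B R V).quotient (LinearMap.range (toCoind ρ hρ)) (by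
    rintro g _ ⟨v, rfl⟩
    exact ⟨ρ g v, toCoind_rep ρ hρ g v⟩)

theorem repCoindQuot_mkQ (ρ : Representation R (∀ x, B x) V) (hρ : IsDiscreteRep ρ) (g : ∀ x, B x)
    (φ : coind B R V) : Submodule.mkQ _ (repCoind B R V g φ) =
      repCoindQuot ρ hρ g (Submodule.mkQ _ φ) := rfl

theorem isDiscreteRep_repCoindQuot (ρ : Representation R (∀ x, B x) V) (hρ : IsDiscreteRep ρ) :
    IsDiscreteRep (repCoindQuot ρ hρ) := by
  intro q
  obtain ⟨φ, rfl⟩ := Submodule.mkQ_surjective _ q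
  exact (isDiscreteRep_repCoind φ).comp (Submodule.mkQ _)

theorem contCocycles_repCoind_le (n : ℕ) :
    cocyc (contCochains R (∀ x, B x) (coind B R V)) (dCochain (repCoind B R V)) (n + 1) ≤
      cobd (contCochains R (∀ x, B x) (coind B R V)) (dCochain (repCoind B R V)) (n + 1) := by
  intro f hf
  obtain ⟨hf1, hf2⟩ := mem_cocyc.mp hf
  obtain ⟨r, hr⟩ := IsLocallyConstant.exists_agree (show IsLocallyConstant f from hf1)
  let F : (Fin (n + 1) → ∀ x, B x) → (∀ x, B x) → V := (coind B R V).subtype.compLeft _ f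
  have hcons : ∀ (k k' : ∀ x, B x) (g g' : Fin n → ∀ x, B x), (∀ x ∈ r, k x = k' x) →
      (∀ i, ∀ x ∈ r, g i x = g' i x) → F (Fin.cons k g) = F (Fin.cons k' g') := by
    intro k k' g g' hk hg
    refine congrArg Subtype.val (hr _ _ fun i => ?_)
    refine Fin.cases ?_ (fun i => ?_) i
    · simpa using hk
    · simpa using hg i
  let b : (Fin n → ∀ x, B x) → coind B R V := fun g =>
    ⟨contraction (R := R) n F g, r, fun k k' h => congrFun (hcons k k' g g h fun _ _ _ => rfl) 1⟩
  have hb : (coind B R V).subtype.compLeft _ b = contraction (R := R) n F := rfl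
  refine ⟨b, isLocallyConstant_of_agree b r fun g g' h => Subtype.ext (funext fun k =>
    congrFun (hcons k k g g' (fun _ _ => rfl) h) 1), ?_⟩
  have hinj : Function.Injective ((coind B R V).subtype.compLeft (Fin (n + 1) → ∀ x, B x)) :=
    fun a b h => funext fun g => Subtype.ext (congrFun h g)
  have hsub : ∀ (g : ∀ x, B x) (φ : coind B R V), (coind B R V).subtype (repCoind B R V g φ) =
      repFun R (∀ x, B x) V g ((coind B R V).subtype φ) := fun g φ => rfl
  refine hinj ?_
  rw [← dCochain_compLeft _ _ _ hsub, hb, dCochain_contraction, dCochain_compLeft _ _ _ hsub, hf2,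
    map_zero, map_zero, sub_zero]

theorem shortExact_contCochains [∀ x, IsTopologicalGroup (B x)]
    (ρ : Representation R (∀ x, B x) V) (hρ : IsDiscreteRep ρ) :
    ShortExactComplexes (contCochains R (∀ x, B x) V) (dCochain ρ)
      (contCochains R (∀ x, B x) (coind B R V)) (dCochain (repCoind B R V))
      (contCochains R (∀ x, B x) (CoindQuot ρ hρ)) (dCochain (repCoindQuot ρ hρ))
      (fun _ => (toCoind ρ hρ).compLeft _) (fun _ => (Submodule.mkQ _).compLeft _) where
  d_mem_B n b hb := dCochain_mem_contCochains isDiscreteRep_repCoind n b hb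
  dd_B n b _ := dCochain_dCochain _ n b
  i_mem n a ha := IsLocallyConstant.comp (f := a) ha (toCoind ρ hρ)
  j_mem n b hb := IsLocallyConstant.comp (f := b) hb (Submodule.mkQ _)
  i_inj _ a b h := funext fun g => toCoind_injective ρ hρ (congrFun h g)
  j_i _ a := funext fun g => by
    simp
  exact n b hb h := by
    have h1 : ∀ g, ∃ v, toCoind ρ hρ v = b g := fun g => by
      have := congrFun h g
      simpa using this
    choose a ha using h1
    refine ⟨a, ?_, funext ha⟩
    refine IsLocallyConstant.desc a (toCoind ρ hρ) ?_ (toCoind_injective ρ hρ)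
    have : toCoind ρ hρ ∘ a = b := funext ha
    rw [this]
    exact hb
  surj n c hc := by
    obtain ⟨s, hs⟩ := (Submodule.mkQ_surjective (LinearMap.range (toCoind ρ hρ))).hasRightInverse
    exact ⟨fun g => s (c g), IsLocallyConstant.comp hc s, funext fun g => hs (c g)⟩
  i_d _ a := (dCochain_compLeft _ _ _ (toCoind_rep ρ hρ) _ a).symm
  j_d _ b := (dCochain_compLeft _ _ _ (repCoindQuot_mkQ ρ hρ) _ b).symm

end Coinduced

/-! ### The periodic complex of a product of cyclic groups -/

theorem sum_sum_eq_zero_of_antisymm {α M : Type*} [AddCommGroup M] (r : Finset α)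
    (F : α → α → M) (h0 : ∀ x, F x x = 0) (h : ∀ x y, x ≠ y → F x y = -F y x) :
    ∑ x ∈ r, ∑ y ∈ r, F x y = 0 := by
  classical
  induction r using Finset.induction_on with
  | empty => simp
  | insert a s ha ih =>
    rw [Finset.sum_insert ha, Finset.sum_insert ha, h0, zero_add]
    have h1 : ∑ x ∈ s, ∑ y ∈ insert a s, F x y = ∑ x ∈ s, F x a + ∑ x ∈ s, ∑ y ∈ s, F x y := by
      rw [← Finset.sum_add_distrib]
      exact Finset.sum_congr rfl fun x _ => Finset.sum_insert ha
    rw [h1, ih, add_zero, ← Finset.sum_add_distrib]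
    refine Finset.sum_eq_zero fun x hx => ?_
    rw [h a x (fun hax => ha (hax ▸ hx)), neg_add_cancel]

section Signs

variable {ι : Type*} [LinearOrder ι]

/-- The exponent `∑_{x' < x} v_{x'}` of the sign in the Koszul rule. -/
def signExp (x : ι) (v : ι →₀ ℕ) : ℕ :=
  ∑ x' ∈ v.support with x' < x, v x'

theorem signExp_eq (x : ι) (v : ι →₀ ℕ) (r : Finset ι) (hr : v.support ⊆ r) :
    signExp x v = ∑ x' ∈ r with x' < x, v x' := by
  refine Finset.sum_subset (Finset.filter_subset_filter _ hr) fun y hy hy' => ?_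
  simp only [Finset.mem_filter, Finsupp.mem_support_iff, not_and, ne_eq] at hy hy'
  by_contra h
  exact hy' h hy.2

theorem coe_update' (v : ι →₀ ℕ) (x y : ι) (k : ℕ) :
    v.update x k y = if y = x then k else v y := by
  simp [Finsupp.update, Function.update_apply]

theorem support_update_subset (v : ι →₀ ℕ) (y : ι) (k : ℕ) :
    (v.update y k).support ⊆ insert y v.support := by
  intro x hx
  by_cases h : x = y
  · simp [h]
  · rw [Finsupp.mem_support_iff, coe_update', if_neg h] at hx
    simp [hx]

theorem signExp_update (x y : ι) (v : ι →₀ ℕ) (k : ℕ) :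
    signExp x (v.update y k) + (if y < x then v y else 0) =
      signExp x v + (if y < x then k else 0) := by
  rw [signExp_eq x v (insert y v.support) (Finset.subset_insert _ _),
    signExp_eq x _ _ (support_update_subset v y k)]
  split_ifs with h
  · have hy : y ∈ (insert y v.support).filter (· < x) := by simp [h]
    rw [← Finset.add_sum_erase _ _ hy, ← Finset.add_sum_erase _ _ hy]
    have : ∑ z ∈ ((insert y v.support).filter (· < x)).erase y, v.update y k z =
        ∑ z ∈ ((insert y v.support).filter (· < x)).erase y, v z :=
      Finset.sum_congr rfl fun z hz => by rw [coe_update', if_neg (Finset.ne_of_mem_erase hz)]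
    rw [this, coe_update', if_pos rfl]
    omega
  · refine congrArg (· + 0) (Finset.sum_congr rfl fun z hz => ?_)
    have : z ≠ y := fun hzy => h (hzy ▸ (Finset.mem_filter.mp hz).2)
    rw [coe_update', if_neg this]

theorem signExp_update_of_not_lt (x y : ι) (h : ¬ y < x) (v : ι →₀ ℕ) (k : ℕ) :
    signExp x (v.update y k) = signExp x v := by
  simpa [h] using signExp_update x y v k

theorem neg_one_pow_signExp_update {R : Type*} [CommRing R] (x y : ι) (h : y < x) (v : ι →₀ ℕ)
    (k : ℕ) (hk : Odd (v y + k)) :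
    (-1 : R) ^ signExp x (v.update y k) = -(-1 : R) ^ signExp x v := by
  have h1 := signExp_update x y v k
  simp only [h, if_true] at h1
  rcases Nat.even_or_odd (signExp x v) with h2 | h2
  · have : Odd (signExp x (v.update y k)) := by
      rw [Nat.odd_iff] at hk ⊢
      rw [Nat.even_iff] at h2
      omega
    rw [this.neg_one_pow, h2.neg_one_pow]
  · have : Even (signExp x (v.update y k)) := by
      rw [Nat.odd_iff] at hk h2
      rw [Nat.even_iff]
      omega
    rw [this.neg_one_pow, h2.neg_one_pow, neg_neg]

theorem update_pred (v : ι →₀ ℕ) (x : ι) : v.update x (v x - 1) = v - Finsupp.single x 1 := by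
  ext y
  by_cases h : y = x
  · subst h
    simp
  · rw [coe_update', if_neg h]
    simp [Finsupp.single_eq_of_ne h]

theorem update_succ (v : ι →₀ ℕ) (x : ι) : v.update x (v x + 1) = v + Finsupp.single x 1 := by
  ext y
  by_cases h : y = x
  · subst h
    simp
  · rw [coe_update', if_neg h]
    simp [Finsupp.single_eq_of_ne h]

theorem update_update (v : ι →₀ ℕ) (x : ι) (k l : ℕ) :
    (v.update x k).update x l = v.update x l := by
  ext y
  simp only [coe_update']
  split_ifs <;> rfl

theorem update_comm' (v : ι →₀ ℕ) {x y : ι} (h : x ≠ y) (k l : ℕ) :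
    (v.update x k).update y l = (v.update y l).update x k := by
  ext z
  simp only [coe_update']
  split_ifs with h1 h2 <;> first | rfl | exact absurd (h2.symm.trans h1) h

end Signs

section ShiftOperators

variable {ι R V : Type*} [LinearOrder ι] [CommRing R] [AddCommGroup V] [Module R V]

/-- The operator on `V`-valued functions on the finite formal products that acts on the exponent
of `x` (by `s`) and on the values (by `a`), with the sign of the Koszul rule. -/
def shiftOp (x : ι) (a : ℕ → V →ₗ[R] V) (s : ℕ → ℕ) : ((ι →₀ ℕ) → V) →ₗ[R] ((ι →₀ ℕ) → V) where
  toFun c v := (-1 : R) ^ signExp x v • a (v x) (c (v.update x (s (v x))))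
  map_add' c c' := by
    funext v
    simp
  map_smul' r c := by
    funext v
    simp only [Pi.smul_apply, map_smul, RingHom.id_apply]
    exact smul_comm _ _ _

theorem shiftOp_apply (x : ι) (a : ℕ → V →ₗ[R] V) (s : ℕ → ℕ) (c : (ι →₀ ℕ) → V) (v : ι →₀ ℕ) :
    shiftOp x a s c v = (-1 : R) ^ signExp x v • a (v x) (c (v.update x (s (v x)))) := rfl

theorem shiftOp_self (x : ι) (a b : ℕ → V →ₗ[R] V) (s t : ℕ → ℕ) (c : (ι →₀ ℕ) → V)
    (v : ι →₀ ℕ) : shiftOp x a s (shiftOp x b t c) v =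
      a (v x) (b (s (v x)) (c (v.update x (t (s (v x)))))) := by
  rw [shiftOp_apply, shiftOp_apply, signExp_update_of_not_lt x x (lt_irrefl x), map_smul, smul_smul,
    ← mul_pow, neg_one_mul, neg_neg, one_pow, one_smul, update_update]
  simp

theorem shiftOp_anticomm {x y : ι} (h : x ≠ y) (a b : ℕ → V →ₗ[R] V) (s t : ℕ → ℕ)
    (hs : ∀ k, a k = 0 ∨ Odd (k + s k)) (ht : ∀ k, b k = 0 ∨ Odd (k + t k))
    (hab : ∀ k l u, a k (b l u) = b l (a k u)) (c : (ι →₀ ℕ) → V) (v : ι →₀ ℕ) :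
    shiftOp x a s (shiftOp y b t c) v = -shiftOp y b t (shiftOp x a s c) v := by
  simp only [shiftOp_apply, map_smul, smul_smul, coe_update', h, h.symm, if_false]
  rcases hs (v x) with ha | ha
  · simp [ha]
  rcases ht (v y) with hb | hb
  · simp [hb]
  rw [hab, update_comm' v h, ← neg_smul]
  congr 1
  rcases lt_or_gt_of_ne h with hlt | hlt
  · rw [neg_one_pow_signExp_update y x hlt v _ ha, signExp_update_of_not_lt x y hlt.asymm]
    ring
  · rw [neg_one_pow_signExp_update x y hlt v _ hb, signExp_update_of_not_lt y x hlt.asymm]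
    ring

end ShiftOperators

section PeriodicComplex

/-- A product of finite cyclic groups. -/
abbrev Torus {ι : Type*} (m : ι → ℕ) : Type _ := ∀ x, Multiplicative (ZMod (m x))

variable {ι R V W : Type*} [LinearOrder ι] {m : ι → ℕ} [∀ x, NeZero (m x)] [CommRing R]
  [AddCommGroup V] [Module R V] [AddCommGroup W] [Module R W]

/-- The element `i` of the factor with index `x` of a product of cyclic groups. -/
def torusSingle (m : ι → ℕ) (x : ι) (i : ZMod (m x)) : Torus m :=
  Pi.mulSingle x (Multiplicative.ofAdd i)

/-- The norm of the factor with index `x`. -/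
def normOp (ρ : Representation R (Torus m) V) (x : ι) : V →ₗ[R] V :=
  ∑ i : ZMod (m x), ρ (torusSingle m x i)

/-- The differential `σ_x - 1` in the resolution of a cyclic group. -/
def diffOp (ρ : Representation R (Torus m) V) (x : ι) : V →ₗ[R] V :=
  ρ (torusSingle m x 1) - 1

omit [LinearOrder ι] [∀ x, NeZero (m x)] in
theorem rep_comm (ρ : Representation R (Torus m) V) (g h : Torus m) (u : V) :
    ρ g (ρ h u) = ρ h (ρ g u) := by
  rw [← Module.End.mul_apply, ← Module.End.mul_apply, ← map_mul, ← map_mul, mul_comm]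

omit [∀ x, NeZero (m x)] in
theorem torusSingle_add (x : ι) (i j : ZMod (m x)) :
    torusSingle m x (i + j) = torusSingle m x i * torusSingle m x j := by
  rw [torusSingle, ofAdd_add, Pi.mulSingle_mul]
  rfl

theorem diffOp_normOp (ρ : Representation R (Torus m) V) (x : ι) (u : V) :
    diffOp ρ x (normOp ρ x u) = 0 := by
  rw [diffOp, LinearMap.sub_apply, Module.End.one_apply, normOp, LinearMap.sum_apply, map_sum,
    sub_eq_zero]
  refine Fintype.sum_equiv (Equiv.addLeft 1) _ _ fun i => ?_
  rw [Equiv.coe_addLeft, torusSingle_add, map_mul, Module.End.mul_apply]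

theorem normOp_diffOp (ρ : Representation R (Torus m) V) (x : ι) (u : V) :
    normOp ρ x (diffOp ρ x u) = 0 := by
  rw [← diffOp_normOp ρ x u]
  simp only [normOp, diffOp, LinearMap.sum_apply, LinearMap.sub_apply, map_sub, map_sum,
    Finset.sum_sub_distrib, Module.End.one_apply]
  congr 1
  exact Finset.sum_congr rfl fun i _ => rep_comm ρ _ _ u

/-- The coefficient of the component of the differential that arrives at exponent `k` of `x`. -/
def stepOp (ρ : Representation R (Torus m) V) (x : ι) (k : ℕ) : V →ₗ[R] V :=
  if k = 0 then 0 else if Odd k then diffOp ρ x else normOp ρ x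

theorem stepOp_stepOp (ρ : Representation R (Torus m) V) (x : ι) (k : ℕ) (u : V) :
    stepOp ρ x k (stepOp ρ x (k - 1) u) = 0 := by
  rcases k with _ | _ | k
  · simp [stepOp]
  · simp [stepOp]
  · rcases Nat.even_or_odd k with h | h
    · have h1 : ¬ Odd (k + 1 + 1) := by
        rw [Nat.not_odd_iff_even]
        exact h.add_one.add_one
      simp [stepOp, h1, h.add_one, normOp_diffOp]
    · have h1 : ¬ Odd (k + 1) := by
        rw [Nat.not_odd_iff_even]
        exact h.add_one
      simp [stepOp, h1, h.add_one.add_one, diffOp_normOp]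

theorem stepOp_comm (ρ : Representation R (Torus m) V) (x : ι) (k : ℕ) (A : V →ₗ[R] V)
    (hA : ∀ i u, A (ρ (torusSingle m x i) u) = ρ (torusSingle m x i) (A u)) (u : V) :
    stepOp ρ x k (A u) = A (stepOp ρ x k u) := by
  unfold stepOp
  split_ifs
  · simp
  · simp [diffOp, hA]
  · simp [normOp, hA]

theorem stepOp_parity (ρ : Representation R (Torus m) V) (x : ι) (k : ℕ) :
    stepOp ρ x k = 0 ∨ Odd (k + (k - 1)) := by
  rcases k with _ | k
  · left
    simp [stepOp]
  · right
    rw [Nat.odd_iff]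
    omega

/-- The differential of the complex `⨁_v V [v]`, the tensor product of the periodic complexes of
the cyclic factors, written for functions `v ↦ V`. -/
def dPer (ρ : Representation R (Torus m) V) : ((ι →₀ ℕ) → V) →ₗ[R] ((ι →₀ ℕ) → V) where
  toFun c v := ∑ x ∈ v.support, shiftOp x (stepOp ρ x) (· - 1) c v
  map_add' c c' := by
    funext v
    simp [Finset.sum_add_distrib]
  map_smul' r c := by
    funext v
    simp [Finset.smul_sum]

theorem dPer_apply (ρ : Representation R (Torus m) V) (c : (ι →₀ ℕ) → V) (v : ι →₀ ℕ) :
    dPer ρ c v = ∑ x ∈ v.support, shiftOp x (stepOp ρ x) (· - 1) c v := rfl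

theorem dPer_eq_sum (ρ : Representation R (Torus m) V) (c : (ι →₀ ℕ) → V) (v : ι →₀ ℕ)
    (r : Finset ι) (hr : v.support ⊆ r) :
    dPer ρ c v = ∑ x ∈ r, shiftOp x (stepOp ρ x) (· - 1) c v := by
  rw [dPer_apply]
  refine Finset.sum_subset hr fun x _ hx => ?_
  have : v x = 0 := by simpa using hx
  simp [shiftOp_apply, this, stepOp]

theorem shiftOp_dPer (ρ : Representation R (Torus m) V) (x : ι) (a : ℕ → V →ₗ[R] V) (s : ℕ → ℕ)
    (c : (ι →₀ ℕ) → V) (v : ι →₀ ℕ) (r : Finset ι) (hr : insert x v.support ⊆ r) :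
    shiftOp x a s (dPer ρ c) v =
      ∑ y ∈ r, shiftOp x a s (shiftOp y (stepOp ρ y) (· - 1) c) v := by
  rw [shiftOp_apply, dPer_eq_sum ρ c _ r ((support_update_subset v x _).trans hr), map_sum,
    Finset.smul_sum]
  rfl

theorem dPer_dPer (ρ : Representation R (Torus m) V) (c : (ι →₀ ℕ) → V) :
    dPer ρ (dPer ρ c) = 0 := by
  funext v
  rw [dPer_apply]
  have : ∀ x ∈ v.support, shiftOp x (stepOp ρ x) (· - 1) (dPer ρ c) v = ∑ y ∈ v.support,
      shiftOp x (stepOp ρ x) (· - 1) (shiftOp y (stepOp ρ y) (· - 1) c) v := fun x hx =>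
    shiftOp_dPer ρ x _ _ c v _ (by simp [Finsupp.mem_support_iff.mp hx])
  rw [Finset.sum_congr rfl this]
  refine sum_sum_eq_zero_of_antisymm _ _ (fun x => ?_) fun x y h => ?_
  · rw [shiftOp_self, stepOp_stepOp]
  · exact shiftOp_anticomm h _ _ _ _ (stepOp_parity ρ x) (stepOp_parity ρ y)
      (fun k l u => stepOp_comm ρ x k _ (fun i w => stepOp_comm ρ y l _
        (fun j w' => rep_comm ρ _ _ w') w) u) c v

theorem dPer_compLeft (ρ : Representation R (Torus m) V) (ρ' : Representation R (Torus m) W)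
    (φ : V →ₗ[R] W) (hφ : ∀ g v, φ (ρ g v) = ρ' g (φ v)) (c : (ι →₀ ℕ) → V) :
    dPer ρ' (φ.compLeft _ c) = φ.compLeft _ (dPer ρ c) := by
  have h : ∀ x k u, φ (stepOp ρ x k u) = stepOp ρ' x k (φ u) := by
    intro x k u
    unfold stepOp
    split_ifs
    · simp
    · simp [diffOp, hφ]
    · simp [normOp, hφ]
  funext v
  change dPer ρ' (fun w => φ (c w)) v = φ (dPer ρ c v)
  simp only [dPer_apply, shiftOp_apply, map_sum, map_smul, h]

variable (ι R V) in
/-- The functions `c`, standing for `∑_v c(v) [v]`, of finite support and of degree `n`. -/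
def perCochains (n : ℕ) : Submodule R ((ι →₀ ℕ) → V) where
  carrier := {c | c.support.Finite ∧ ∀ v, c v ≠ 0 → v.degree = n}
  add_mem' := by
    rintro c c' ⟨h1, h2⟩ ⟨h1', h2'⟩
    refine ⟨(h1.union h1').subset (Function.support_add c c'), fun v hv => ?_⟩
    by_cases h : c v = 0
    · refine h2' v fun h' => hv ?_
      simp [h, h']
    · exact h2 v h
  zero_mem' := ⟨by simp, fun v h => absurd rfl h⟩
  smul_mem' := by
    rintro r c ⟨h1, h2⟩
    refine ⟨h1.subset (Function.support_const_smul_subset r c), fun v hv => h2 v fun h => hv ?_⟩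
    simp [h]

omit [LinearOrder ι] in
theorem compLeft_mem_perCochains (φ : V →ₗ[R] W) (n : ℕ) (c : (ι →₀ ℕ) → V)
    (hc : c ∈ perCochains ι R V n) : φ.compLeft _ c ∈ perCochains ι R W n := by
  refine ⟨hc.1.subset fun v hv h => hv ?_, fun v hv => hc.2 v fun h => hv ?_⟩
  · change φ (c v) = 0
    rw [h, map_zero]
  · change φ (c v) = 0
    rw [h, map_zero]

theorem dPer_mem_perCochains {ρ : Representation R (Torus m) V} (hρ : IsDiscreteRep ρ) (n : ℕ)
    (c : (ι →₀ ℕ) → V) (hc : c ∈ perCochains ι R V n) : dPer ρ c ∈ perCochains ι R V (n + 1) := by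
  have key : ∀ v, dPer ρ c v ≠ 0 → ∃ x ∈ v.support, c (v - Finsupp.single x 1) ≠ 0 ∧
      stepOp ρ x (v x) (c (v - Finsupp.single x 1)) ≠ 0 := by
    intro v hv
    obtain ⟨x, hx, hne⟩ := Finset.exists_ne_zero_of_sum_ne_zero hv
    rw [shiftOp_apply, update_pred] at hne
    have h1 : stepOp ρ x (v x) (c (v - Finsupp.single x 1)) ≠ 0 := fun h =>
      hne (by rw [h, smul_zero])
    exact ⟨x, hx, fun h => h1 (by rw [h, map_zero]), h1⟩
  have hv : ∀ (v : ι →₀ ℕ) (x : ι), x ∈ v.support →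
      v - Finsupp.single x 1 + Finsupp.single x 1 = v := by
    intro v x hx
    refine tsub_add_cancel_of_le ?_
    simpa [Nat.one_le_iff_ne_zero] using hx
  constructor
  · choose r hr using fun w : ι →₀ ℕ => hρ.exists_agree (c w)
    refine Set.Finite.subset (hc.1.biUnion fun w _ => Set.Finite.image
      (fun x => w + Finsupp.single x 1) (r w ∪ w.support).finite_toSet) fun v hv' => ?_
    obtain ⟨x, hx, h1, h2⟩ := key v hv'
    refine Set.mem_biUnion (x := v - Finsupp.single x 1) h1 ⟨x, ?_, hv v x hx⟩
    by_contra hxr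
    simp only [Finset.coe_union, Set.mem_union, Finset.mem_coe, not_or,
      Finsupp.notMem_support_iff] at hxr
    have hvx : v x = 1 := by
      have h3 : v x - 1 = 0 := by simpa using hxr.2
      have h4 : v x ≠ 0 := Finsupp.mem_support_iff.mp hx
      omega
    -- `σ_x` acts trivially on this value, and the exponent of `x` is `0` before the step
    refine h2 ?_
    rw [hvx, stepOp, if_neg one_ne_zero, if_pos odd_one, diffOp, LinearMap.sub_apply,
      Module.End.one_apply, sub_eq_zero]
    have h5 := hr (v - Finsupp.single x 1) (torusSingle m x 1) 1 (fun y hy => by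
      have : y ≠ x := fun h => hxr.1 (h ▸ hy)
      simp [torusSingle, this])
    rw [h5, map_one, Module.End.one_apply]
  · intro v hv'
    obtain ⟨x, hx, h1, -⟩ := key v hv'
    have := hc.2 _ h1
    rw [← hv v x hx, map_add, this, Finsupp.degree_single]

theorem shortExact_perCochains {I Q : Type*} [AddCommGroup I] [Module R I] [AddCommGroup Q]
    [Module R Q] {ρ : Representation R (Torus m) V} {ρI : Representation R (Torus m) I}
    {ρQ : Representation R (Torus m) Q} (hρI : IsDiscreteRep ρI)
    (φ : V →ₗ[R] I) (ψ : I →ₗ[R] Q) (hφ : ∀ g v, φ (ρ g v) = ρI g (φ v))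
    (hψ : ∀ g v, ψ (ρI g v) = ρQ g (ψ v)) (hinj : Function.Injective φ)
    (hsurj : Function.Surjective ψ) (hex : Function.Exact φ ψ) :
    ShortExactComplexes (VA := fun _ => (ι →₀ ℕ) → V) (VB := fun _ => (ι →₀ ℕ) → I)
      (VC := fun _ => (ι →₀ ℕ) → Q) (perCochains ι R V) (fun _ => dPer ρ)
      (perCochains ι R I) (fun _ => dPer ρI) (perCochains ι R Q) (fun _ => dPer ρQ)
      (fun _ => φ.compLeft _) (fun _ => ψ.compLeft _) where
  d_mem_B n b hb := dPer_mem_perCochains hρI n b hb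
  dd_B _ b _ := dPer_dPer _ b
  i_mem n a ha := compLeft_mem_perCochains _ n a ha
  j_mem n b hb := compLeft_mem_perCochains _ n b hb
  i_inj _ a b h := funext fun g => hinj (congrFun h g)
  j_i _ a := funext fun g => hex.apply_apply_eq_zero (a g)
  exact n b hb h := by
    choose a ha using fun g => (hex (b g)).mp (congrFun h g)
    have h2 : ∀ v, a v ≠ 0 → b v ≠ 0 := fun v hv h => hv (hinj (by rw [ha, h, map_zero]))
    exact ⟨a, ⟨hb.1.subset h2, fun v hv => hb.2 v (h2 v hv)⟩, funext ha⟩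
  surj n c hc := by
    classical
    obtain ⟨s, hs⟩ := hsurj.hasRightInverse
    have h2 : ∀ v, (if c v = 0 then 0 else s (c v)) ≠ 0 → c v ≠ 0 := by
      intro v hv h
      rw [if_pos h] at hv
      exact hv rfl
    refine ⟨fun v => if c v = 0 then 0 else s (c v), ⟨hc.1.subset h2, fun v hv => hc.2 v (h2 v hv)⟩,
      funext fun v => ?_⟩
    change ψ (if c v = 0 then 0 else s (c v)) = c v
    split_ifs with h
    · rw [h, map_zero]
    · exact hs (c v)
  i_d _ a := (dPer_compLeft _ _ _ hφ a).symm
  j_d _ b := (dPer_compLeft _ _ _ hψ b).symm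

end PeriodicComplex

section PeriodicAcyclic

set_option linter.unusedSectionVars false

/-! ### Acyclicity of coinduced modules for the periodic complex -/

section Telescoping

variable {V : Type*} [AddCommGroup V] {k : ℕ} [NeZero k]

theorem sum_range_val_sub (ψ : ZMod k → V) (i : ZMod k) :
    ∑ j ∈ Finset.range i.val, (ψ ((j : ZMod k) + 1) - ψ j) = ψ i - ψ 0 := by
  have h := Finset.sum_range_sub (fun j : ℕ => ψ (j : ZMod k)) i.val
  simpa using h

theorem zmod_val_neg_one_add_one : (-1 : ZMod k).val + 1 = k := by
  obtain ⟨l, rfl⟩ := Nat.exists_eq_succ_of_ne_zero (NeZero.ne k)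
  rw [ZMod.val_neg_one]

theorem zmod_val_add_one (i : ZMod k) (h : i ≠ -1) : (i + 1).val = i.val + 1 := by
  have h1 : i.val + 1 ≠ k := by
    intro h2
    refine h ((ZMod.val_injective k) ?_)
    have := zmod_val_neg_one_add_one (k := k)
    omega
  have h2 : i.val + 1 < k := by
    have := ZMod.val_lt i
    omega
  have h3 : (((i.val + 1 : ℕ) : ZMod k)).val = i.val + 1 := ZMod.val_cast_of_lt h2
  rw [← h3]
  simp

theorem sum_univ_zmod (ψ : ZMod k → V) : ∑ i, ψ i = ∑ j ∈ Finset.range k, ψ (j : ZMod k) := by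
  symm
  refine Finset.sum_bij (fun j _ => (j : ZMod k)) (fun _ _ => Finset.mem_univ _) ?_ ?_ ?_
  · intro a ha b hb hab
    have h := congrArg ZMod.val hab
    rwa [ZMod.val_cast_of_lt (Finset.mem_range.mp ha),
      ZMod.val_cast_of_lt (Finset.mem_range.mp hb)] at h
  · intro i _
    exact ⟨i.val, Finset.mem_range.mpr (ZMod.val_lt i), ZMod.natCast_zmod_val i⟩
  · intro _ _
    rfl

theorem sum_range_val_add_one (ψ : ZMod k → V) (i : ZMod k) :
    ∑ j ∈ Finset.range (i + 1).val, ψ (j : ZMod k) - ∑ j ∈ Finset.range i.val, ψ (j : ZMod k) +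
      (if i = -1 then ∑ j, ψ j else 0) = ψ i := by
  by_cases h : i = -1
  · subst h
    rw [if_pos rfl, sum_univ_zmod]
    have h1 : Finset.range k = Finset.range ((-1 : ZMod k).val + 1) := by
      rw [zmod_val_neg_one_add_one]
    rw [h1, Finset.sum_range_succ]
    simp
  · rw [if_neg h, zmod_val_add_one i h, Finset.sum_range_succ]
    simp

end Telescoping

variable {ι R V : Type*} [LinearOrder ι] {m : ι → ℕ} [∀ x, NeZero (m x)] [CommRing R]
  [AddCommGroup V] [Module R V]

/-- The coinduced module of a product of cyclic groups. -/
abbrev torusCoind {ι : Type*} (m : ι → ℕ) (R V : Type*) [CommRing R] [AddCommGroup V]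
    [Module R V] : Submodule R (Torus m → V) :=
  coind (fun x => Multiplicative (ZMod (m x))) R V

/-- The action by right translations on the coinduced module of a product of cyclic groups. -/
abbrev torusRep {ι : Type*} (m : ι → ℕ) (R V : Type*) [CommRing R] [AddCommGroup V]
    [Module R V] : Representation R (Torus m) (torusCoind m R V) :=
  repCoind (fun x => Multiplicative (ZMod (m x))) R V

theorem update_mul_torusSingle (g : Torus m) (x : ι) (i j : ZMod (m x)) :
    Function.update g x (Multiplicative.ofAdd i) * torusSingle m x j =
      Function.update g x (Multiplicative.ofAdd (i + j)) := by
  funext y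
  by_cases h : y = x
  · subst h
    simp [torusSingle]
  · simp [torusSingle, h]

theorem update_mul_torusSingle_of_ne (g : Torus m) {x y : ι} (h : y ≠ x)
    (a : Multiplicative (ZMod (m y))) (j : ZMod (m x)) :
    Function.update g y a * torusSingle m x j = Function.update (g * torusSingle m x j) y a := by
  funext z
  by_cases hz : z = y
  · subst hz
    simp [torusSingle, h]
  · simp [hz]

theorem mul_torusSingle (g : Torus m) (x : ι) (j : ZMod (m x)) :
    g * torusSingle m x j =
      Function.update g x (Multiplicative.ofAdd (Multiplicative.toAdd (g x) + j)) := by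
  rw [← update_mul_torusSingle, ofAdd_toAdd, Function.update_eq_self]

theorem torusCoind_agree_update {φ : Torus m → V} {r : Finset ι}
    (hr : ∀ g g' : Torus m, (∀ x ∈ r, g x = g' x) → φ g = φ g') (x : ι) (g g' : Torus m)
    (h : ∀ y ∈ insert x r, g y = g' y) (a : Multiplicative (ZMod (m x))) :
    φ (Function.update g x a) = φ (Function.update g' x a) := by
  refine hr _ _ fun y hy => ?_
  by_cases hyx : y = x
  · subst hyx
    simp
  · simpa [hyx] using h y (Finset.mem_insert_of_mem hy)

/-- The partial sums `g ↦ ∑_{j < g_x} φ (g with g_x replaced by j)`. -/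
def partialSum (x : ι) : torusCoind m R V →ₗ[R] torusCoind m R V where
  toFun φ := ⟨fun g => ∑ j ∈ Finset.range (Multiplicative.toAdd (g x)).val,
      (φ : Torus m → V) (Function.update g x (Multiplicative.ofAdd (j : ZMod (m x)))), by
    obtain ⟨r, hr⟩ := φ.2
    refine ⟨insert x r, fun g g' h => ?_⟩
    beta_reduce
    rw [h x (Finset.mem_insert_self x r)]
    exact Finset.sum_congr rfl fun j _ => torusCoind_agree_update hr x g g' h _⟩
  map_add' φ φ' := by
    ext g
    simp [Finset.sum_add_distrib]
  map_smul' c φ := by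
    ext g
    simp [Finset.smul_sum]

/-- The function that is `φ (g with g_x replaced by 1)` at the `g` whose component `g_x` is the
inverse of the generator, and `0` elsewhere. -/
def lastTerm (x : ι) : torusCoind m R V →ₗ[R] torusCoind m R V where
  toFun φ := ⟨fun g => if Multiplicative.toAdd (g x) = -1 then
      (φ : Torus m → V) (Function.update g x (Multiplicative.ofAdd 0)) else 0, by
    obtain ⟨r, hr⟩ := φ.2
    refine ⟨insert x r, fun g g' h => ?_⟩
    beta_reduce
    rw [h x (Finset.mem_insert_self x r), torusCoind_agree_update hr x g g' h]⟩
  map_add' φ φ' := by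
    ext g
    by_cases h : Multiplicative.toAdd (g x) = -1 <;> simp [h]
  map_smul' c φ := by
    ext g
    by_cases h : Multiplicative.toAdd (g x) = -1 <;> simp [h]

/-- The value of `φ` at `g` with `g_x` replaced by `1`. -/
def evalOne (x : ι) : torusCoind m R V →ₗ[R] torusCoind m R V where
  toFun φ := ⟨fun g => (φ : Torus m → V) (Function.update g x (Multiplicative.ofAdd 0)), by
    obtain ⟨r, hr⟩ := φ.2
    exact ⟨insert x r, fun g g' h => torusCoind_agree_update hr x g g' h _⟩⟩
  map_add' φ φ' := rfl
  map_smul' c φ := rfl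

theorem partialSum_apply (x : ι) (φ : torusCoind m R V) (g : Torus m) :
    (partialSum x φ : Torus m → V) g = ∑ j ∈ Finset.range (Multiplicative.toAdd (g x)).val,
      (φ : Torus m → V) (Function.update g x (Multiplicative.ofAdd (j : ZMod (m x)))) := rfl

theorem lastTerm_apply (x : ι) (φ : torusCoind m R V) (g : Torus m) :
    (lastTerm x φ : Torus m → V) g = if Multiplicative.toAdd (g x) = -1 then
      (φ : Torus m → V) (Function.update g x (Multiplicative.ofAdd 0)) else 0 := rfl

theorem evalOne_apply (x : ι) (φ : torusCoind m R V) (g : Torus m) :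
    (evalOne x φ : Torus m → V) g =
      (φ : Torus m → V) (Function.update g x (Multiplicative.ofAdd 0)) := rfl

theorem diffOp_apply (x : ι) (φ : torusCoind m R V) (g : Torus m) :
    (diffOp (torusRep m R V) x φ : Torus m → V) g =
      (φ : Torus m → V) (Function.update g x
        (Multiplicative.ofAdd (Multiplicative.toAdd (g x) + 1))) - (φ : Torus m → V) g := by
  rw [← mul_torusSingle]
  rfl

theorem normOp_apply (x : ι) (φ : torusCoind m R V) (g : Torus m) :
    (normOp (torusRep m R V) x φ : Torus m → V) g =
      ∑ i : ZMod (m x), (φ : Torus m → V) (Function.update g x (Multiplicative.ofAdd i)) := by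
  have h : (normOp (torusRep m R V) x φ : Torus m → V) g =
      ∑ i : ZMod (m x), (φ : Torus m → V) (g * torusSingle m x i) := by
    simp [normOp]
  rw [h]
  refine Fintype.sum_equiv (Equiv.addLeft (Multiplicative.toAdd (g x))) _ _ fun i => ?_
  rw [mul_torusSingle]
  rfl

theorem partialSum_diffOp (x : ι) (φ : torusCoind m R V) :
    partialSum x (diffOp (torusRep m R V) x φ) = φ - evalOne x φ := by
  ext g
  rw [partialSum_apply]
  simp only [diffOp_apply, Function.update_self, Function.update_idem, toAdd_ofAdd]
  rw [sum_range_val_sub (fun i => (φ : Torus m → V) (Function.update g x (Multiplicative.ofAdd i)))]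
  simp [evalOne_apply]

theorem diffOp_partialSum (x : ι) (φ : torusCoind m R V) :
    diffOp (torusRep m R V) x (partialSum x φ) + lastTerm x (normOp (torusRep m R V) x φ) = φ := by
  ext g
  have h := sum_range_val_add_one
    (fun i => (φ : Torus m → V) (Function.update g x (Multiplicative.ofAdd i)))
    (Multiplicative.toAdd (g x))
  simp only [ofAdd_toAdd, Function.update_eq_self] at h
  rw [Submodule.coe_add, Pi.add_apply, diffOp_apply, lastTerm_apply, partialSum_apply,
    partialSum_apply, normOp_apply]
  simpa only [Function.update_self, Function.update_idem, toAdd_ofAdd] using h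

theorem normOp_lastTerm (x : ι) (φ : torusCoind m R V) :
    normOp (torusRep m R V) x (lastTerm x φ) = evalOne x φ := by
  ext g
  rw [normOp_apply]
  simp [lastTerm_apply, evalOne_apply]

theorem partialSum_rep {x y : ι} (h : y ≠ x) (i : ZMod (m x)) (φ : torusCoind m R V) :
    partialSum y (torusRep m R V (torusSingle m x i) φ) =
      torusRep m R V (torusSingle m x i) (partialSum y φ) := by
  ext g
  simp only [repCoind_apply, partialSum_apply, update_mul_torusSingle_of_ne g h]
  simp [torusSingle, h]

theorem lastTerm_rep {x y : ι} (h : y ≠ x) (i : ZMod (m x)) (φ : torusCoind m R V) :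
    lastTerm y (torusRep m R V (torusSingle m x i) φ) =
      torusRep m R V (torusSingle m x i) (lastTerm y φ) := by
  ext g
  simp only [repCoind_apply, lastTerm_apply, update_mul_torusSingle_of_ne g h]
  simp [torusSingle, h]

/-- The coefficient of the contracting homotopy in the direction of `x` that arrives at
exponent `k`. -/
def contrOp (x : ι) (k : ℕ) : torusCoind m R V →ₗ[R] torusCoind m R V :=
  if Even k then partialSum x else lastTerm x

theorem contrOp_stepOp (x : ι) (k : ℕ) (φ : torusCoind m R V) :
    stepOp (torusRep m R V) x k (contrOp x (k - 1) φ) +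
      contrOp x k (stepOp (torusRep m R V) x (k + 1) φ) =
        φ - if k = 0 then evalOne x φ else 0 := by
  rcases k with _ | k
  · simp [stepOp, contrOp, partialSum_diffOp]
  · rcases Nat.even_or_odd k with h | h
    · have h1 : ¬ Even (k + 1) := Nat.not_even_iff_odd.mpr h.add_one
      have h2 : ¬ Odd (k + 1 + 1) := Nat.not_odd_iff_even.mpr h.add_one.add_one
      simp [stepOp, contrOp, h, h.add_one, h1, h2, diffOp_partialSum]
    · have h1 : ¬ Even k := Nat.not_even_iff_odd.mpr h
      have h2 : ¬ Odd (k + 1) := Nat.not_odd_iff_even.mpr h.add_one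
      simp [stepOp, contrOp, h.add_one, h1, h2, h.add_one.add_one, partialSum_diffOp,
        normOp_lastTerm]

/-- The contracting homotopy in the direction of `x`. -/
def perContr (x : ι) :
    ((ι →₀ ℕ) → torusCoind m R V) →ₗ[R] ((ι →₀ ℕ) → torusCoind m R V) :=
  shiftOp x (contrOp x) (· + 1)

theorem dPer_perContr (x : ι) (c : (ι →₀ ℕ) → torusCoind m R V) (v : ι →₀ ℕ) :
    dPer (torusRep m R V) (perContr x c) v + perContr x (dPer (torusRep m R V) c) v =
      c v - if v x = 0 then evalOne x (c v) else 0 := by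
  rw [perContr, dPer_eq_sum _ _ v _ (Finset.subset_insert x v.support),
    shiftOp_dPer _ x _ _ c v _ subset_rfl, ← Finset.sum_add_distrib,
    Finset.sum_eq_single_of_mem x (Finset.mem_insert_self x _)]
  · rw [shiftOp_self, shiftOp_self]
    have h := contrOp_stepOp (R := R) x (v x) (c v)
    rcases Nat.eq_zero_or_pos (v x) with h0 | h0
    · rw [h0] at h ⊢
      simpa [stepOp, update_update, show v.update x 0 = v by rw [← h0]; simp] using h
    · rw [Nat.sub_add_cancel h0, Nat.add_sub_cancel]
      simpa using h
  · intro y _ hyx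
    rw [shiftOp_anticomm hyx _ _ _ _ (stepOp_parity _ y) (fun k => Or.inr ⟨k, by ring⟩),
      neg_add_cancel]
    intro k l u
    refine stepOp_comm _ y k _ (fun i w => ?_) u
    unfold contrOp
    split_ifs
    · exact partialSum_rep hyx.symm i w
    · exact lastTerm_rep hyx.symm i w

theorem perContr_mem (x : ι) (n : ℕ) (c : (ι →₀ ℕ) → torusCoind m R V)
    (hc : c ∈ perCochains ι R (torusCoind m R V) (n + 1)) :
    perContr x c ∈ perCochains ι R (torusCoind m R V) n := by
  have key : ∀ v, perContr x c v ≠ 0 → c (v + Finsupp.single x 1) ≠ 0 := by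
    intro v hv h
    refine hv ?_
    rw [perContr, shiftOp_apply, update_succ, h, map_zero, smul_zero]
  constructor
  · refine (hc.1.image fun v => v - Finsupp.single x 1).subset fun v hv => ?_
    exact ⟨_, key v hv, by simp⟩
  · intro v hv
    have := hc.2 _ (key v hv)
    rw [map_add, Finsupp.degree_single] at this
    omega

/-- If the periodic complex has, in the direction of every `x`, a homotopy between the identity and
a map that is `0` at the `v` divisible by `x`, then it is acyclic in positive degrees. -/
theorem perCocycles_le_of_contr {I : Type*} [AddCommGroup I] [Module R I]
    {ρ : Representation R (Torus m) I} (hρ : IsDiscreteRep ρ)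
    (s : ι → ((ι →₀ ℕ) → I) →ₗ[R] ((ι →₀ ℕ) → I)) (e : ι → I →ₗ[R] I)
    (hs : ∀ x n, ∀ c ∈ perCochains ι R I (n + 1), s x c ∈ perCochains ι R I n)
    (hse : ∀ x c v, dPer ρ (s x c) v + s x (dPer ρ c) v =
      c v - if v x = 0 then e x (c v) else 0) (n : ℕ) :
    cocyc (V := fun _ => (ι →₀ ℕ) → I) (perCochains ι R I) (fun _ => dPer ρ) (n + 1) ≤
      cobd (V := fun _ => (ι →₀ ℕ) → I) (perCochains ι R I) (fun _ => dPer ρ) (n + 1) := by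
  classical
  intro c hc
  have hc1 : c ∈ perCochains ι R I (n + 1) := (mem_cocyc.mp hc).1
  have hc2 : dPer ρ c = 0 := (mem_cocyc.mp hc).2
  let r₀ : Finset ι := hc1.1.toFinset.biUnion Finsupp.support
  have hr₀ : ∀ v, c v ≠ 0 → v.support ⊆ r₀ := fun v hv =>
    Finset.subset_biUnion_of_mem Finsupp.support (hc1.1.mem_toFinset.mpr hv)
  -- make the cocycle vanish at the `v` divisible by some element of `r`
  have key : ∀ r : Finset ι, ∃ b ∈ perCochains ι R I n,
      (∀ v, (c - dPer ρ b) v ≠ 0 → v.support ⊆ r₀ ∧ ∀ x ∈ r, v x = 0) := by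
    intro r
    induction r using Finset.induction_on with
    | empty => exact ⟨0, zero_mem _, fun v hv => ⟨hr₀ v (by simpa using hv), by simp⟩⟩
    | insert x r hx ih =>
      obtain ⟨b, hb, hbv⟩ := ih
      set c' := c - dPer ρ b with hc'
      have hc'1 : c' ∈ perCochains ι R I (n + 1) :=
        sub_mem hc1 (dPer_mem_perCochains hρ n b hb)
      have hc'2 : dPer ρ c' = 0 := by
        rw [hc', map_sub, hc2, dPer_dPer, sub_zero]
      refine ⟨b + s x c', add_mem hb (hs x n c' hc'1), fun v hv => ?_⟩
      have h1 : (c - dPer ρ (b + s x c')) v = if v x = 0 then e x (c' v) else 0 := by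
        have h2 := hse x c' v
        rw [hc'2, map_zero, Pi.zero_apply, add_zero] at h2
        rw [map_add, ← sub_sub, ← hc', Pi.sub_apply, h2, sub_sub_cancel]
      rw [h1] at hv
      by_cases h0 : v x = 0
      · rw [if_pos h0] at hv
        have h3 := hbv v fun h => hv (by rw [h, map_zero])
        refine ⟨h3.1, fun y hy => ?_⟩
        rcases Finset.mem_insert.mp hy with rfl | hy
        · exact h0
        · exact h3.2 y hy
      · rw [if_neg h0] at hv
        exact absurd rfl hv
  obtain ⟨b, hb, hbv⟩ := key r₀
  refine ⟨b, hb, (sub_eq_zero.mp (funext fun v => ?_)).symm⟩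
  by_contra h
  obtain ⟨h1, h2⟩ := hbv v h
  have h3 : v = 0 := by
    ext x
    by_contra hx
    exact hx (h2 x (h1 (Finsupp.mem_support_iff.mpr hx)))
  have h4 := (sub_mem hc1 (dPer_mem_perCochains hρ n b hb)).2 v h
  rw [h3, map_zero] at h4
  omega

theorem isDiscreteRep_torusRep : IsDiscreteRep (torusRep m R V) :=
  isDiscreteRep_repCoind

theorem perCocycles_torusCoind_le (n : ℕ) :
    cocyc (V := fun _ => (ι →₀ ℕ) → torusCoind m R V) (perCochains ι R (torusCoind m R V))
        (fun _ => dPer (torusRep m R V)) (n + 1) ≤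
      cobd (V := fun _ => (ι →₀ ℕ) → torusCoind m R V) (perCochains ι R (torusCoind m R V))
        (fun _ => dPer (torusRep m R V)) (n + 1) :=
  perCocycles_le_of_contr (I := torusCoind m R V) (ρ := torusRep m R V) isDiscreteRep_torusRep
    (perContr (m := m) (R := R) (V := V)) (evalOne (m := m))
    (fun x n c hc => perContr_mem x n c hc) (fun x c v => dPer_perContr x c v) n

/-! ### Comparison of the two complexes -/

/-- An element of a discrete module that is fixed by the generators of the cyclic factors is fixed
by the whole group. -/
theorem rep_eq_self_of_gen {ρ : Representation R (Torus m) V} (hρ : IsDiscreteRep ρ) (u : V)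
    (hu : ∀ x, ρ (torusSingle m x 1) u = u) (g : Torus m) : ρ g u = u := by
  have h1 : ∀ x (i : ℕ), ρ (torusSingle m x i) u = u := by
    intro x i
    induction i with
    | zero => simp [torusSingle]
    | succ i ih =>
      rw [Nat.cast_succ, torusSingle_add, map_mul, Module.End.mul_apply, hu, ih]
  obtain ⟨r, hr⟩ := hρ.exists_agree u
  have h2 : ∀ s : Finset ι,
      ρ (∏ x ∈ s, torusSingle m x (Multiplicative.toAdd (g x))) u = u := by
    intro s
    induction s using Finset.induction_on with
    | empty => simp
    | insert x s hx ih =>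
      rw [Finset.prod_insert hx, map_mul, Module.End.mul_apply, ih]
      have := h1 x (Multiplicative.toAdd (g x)).val
      rwa [ZMod.natCast_zmod_val] at this
  rw [← hr _ g _, h2 r]
  intro x hx
  rw [Finset.prod_apply, Finset.prod_eq_single_of_mem x hx]
  · simp [torusSingle]
  · intro y _ hyx
    simp [torusSingle, hyx.symm]

/-- The invariants, as the common source of the cocycles of degree `0` of both complexes. -/
def torusInvariants (ρ : Representation R (Torus m) V) : Submodule R V where
  carrier := {u | ∀ g, ρ g u = u}
  add_mem' hu hv g := by rw [map_add, hu g, hv g]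
  zero_mem' g := map_zero _
  smul_mem' r u hu g := by rw [map_smul, hu g]

theorem contCocycles_zero_iff (ρ : Representation R (Torus m) V) (f : (Fin 0 → Torus m) → V) :
    f ∈ cocyc (contCochains R (Torus m) V) (dCochain ρ) 0 ↔
      ∃ u ∈ torusInvariants ρ, f = fun _ => u := by
  have hf : ∀ a, f a = f default := fun a => congrArg f (Subsingleton.elim _ _)
  have hd : ∀ g, dCochain ρ 0 f g = ρ (g 0) (f default) - f default := by
    intro g
    rw [dCochain_apply]
    simp [hf (fun i => g i.succ), hf (Fin.contractNth _ _ _), sub_eq_add_neg]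
  constructor
  · intro h
    refine ⟨f default, fun g => ?_, funext hf⟩
    have h1 := congrFun (mem_cocyc.mp h).2 (fun _ => g)
    rw [hd] at h1
    exact sub_eq_zero.mp h1
  · rintro ⟨u, hu, rfl⟩
    refine mem_cocyc.mpr ⟨IsLocallyConstant.const u, funext fun g => ?_⟩
    rw [hd]
    exact sub_eq_zero.mpr (hu (g 0))

theorem perCocycles_zero_iff {ρ : Representation R (Torus m) V} (hρ : IsDiscreteRep ρ)
    (c : (ι →₀ ℕ) → V) :
    c ∈ cocyc (V := fun _ => (ι →₀ ℕ) → V) (perCochains ι R V) (fun _ => dPer ρ) 0 ↔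
      ∃ u ∈ torusInvariants ρ, c = Pi.single 0 u := by
  have hd : ∀ u : V, ∀ v, dPer ρ (Pi.single 0 u) v = ∑ x ∈ v.support,
      (-1 : R) ^ signExp x v • stepOp ρ x (v x)
        ((Pi.single 0 u : (ι →₀ ℕ) → V) (v - Finsupp.single x 1)) := by
    intro u v
    simp only [dPer_apply, shiftOp_apply, update_pred]
  constructor
  · intro h
    have h1 : c ∈ perCochains ι R V 0 := (mem_cocyc.mp h).1
    have h2 : dPer ρ c = 0 := (mem_cocyc.mp h).2
    have hc : c = Pi.single 0 (c 0) := by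
      funext v
      by_cases hv : v = 0
      · subst hv
        simp
      · rw [Pi.single_eq_of_ne hv]
        by_contra hne
        exact hv ((Finsupp.degree_eq_zero_iff v).mp (h1.2 v hne))
    refine ⟨c 0, rep_eq_self_of_gen hρ _ fun x => ?_, hc⟩
    have h3 := congrFun h2 (Finsupp.single x 1)
    rw [hc, hd, Finsupp.support_single x one_ne_zero, Finset.sum_singleton, tsub_self,
      Finsupp.single_eq_same, Pi.single_eq_same] at h3
    have h4 : signExp x (Finsupp.single x 1) = 0 := by
      rw [signExp_eq x _ {x} Finsupp.support_single_subset]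
      simp
    rw [h4, pow_zero, one_smul, stepOp, if_neg one_ne_zero, if_pos odd_one] at h3
    exact sub_eq_zero.mp h3
  · rintro ⟨u, hu, rfl⟩
    refine mem_cocyc.mpr ⟨⟨(Set.finite_singleton 0).subset ?_, ?_⟩, funext fun v => ?_⟩
    · intro v hv
      by_contra h
      exact hv (Pi.single_eq_of_ne h _)
    · intro v hv
      by_cases h : v = 0
      · rw [h, map_zero]
      · exact absurd (Pi.single_eq_of_ne h _) hv
    · change dPer ρ (Pi.single 0 u) v = 0
      rw [hd]
      refine Finset.sum_eq_zero fun x hx => ?_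
      by_cases h : v - Finsupp.single x 1 = 0
      · have h1 : v x = 1 := by
          have h2 : v x - 1 = 0 := by simpa using DFunLike.congr_fun h x
          have h3 : v x ≠ 0 := Finsupp.mem_support_iff.mp hx
          omega
        rw [h, h1, Pi.single_eq_same, stepOp, if_neg one_ne_zero, if_pos odd_one, diffOp,
          LinearMap.sub_apply, hu, Module.End.one_apply, sub_self, smul_zero]
      · rw [Pi.single_eq_of_ne h, map_zero, smul_zero]

theorem nonempty_equiv_zero {Q : Type*} [AddCommGroup Q] [Module R Q]
    {ρ : Representation R (Torus m) V} (hρ : IsDiscreteRep ρ)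
    {ρQ : Representation R (Torus m) Q} (hρQ : IsDiscreteRep ρQ) (ψ : V →ₗ[R] Q) :
    Nonempty (Subquotient (cocyc (contCochains R (Torus m) Q) (dCochain ρQ) 0)
      ((cocyc (contCochains R (Torus m) V) (dCochain ρ) 0).map (ψ.compLeft _)) ≃ₗ[R]
      Subquotient (cocyc (V := fun _ => (ι →₀ ℕ) → Q) (perCochains ι R Q) (fun _ => dPer ρQ) 0)
        ((cocyc (V := fun _ => (ι →₀ ℕ) → V) (perCochains ι R V) (fun _ => dPer ρ) 0).map
          (ψ.compLeft _))) := by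
  refine Subquotient.nonempty_equiv (P := torusInvariants ρQ)
    ((LinearMap.pi fun _ => LinearMap.id) ∘ₗ Submodule.subtype _)
    (LinearMap.single R (fun _ : ι →₀ ℕ => Q) 0 ∘ₗ Submodule.subtype _) ?_ ?_ ?_ ?_ ?_
  · exact fun p => (contCocycles_zero_iff ρQ _).mpr ⟨p, p.2, rfl⟩
  · exact fun p => (perCocycles_zero_iff hρQ _).mpr ⟨p, p.2, rfl⟩
  · intro f hf
    obtain ⟨u, hu, rfl⟩ := (contCocycles_zero_iff ρQ _).mp hf
    refine ⟨⟨u, hu⟩, ?_⟩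
    change (fun _ => u) - (fun _ => u) ∈ _
    rw [sub_self]
    exact zero_mem _
  · intro f hf
    obtain ⟨u, hu, rfl⟩ := (perCocycles_zero_iff hρQ _).mp hf
    refine ⟨⟨u, hu⟩, ?_⟩
    change (Pi.single 0 u : (ι →₀ ℕ) → Q) - Pi.single 0 u ∈ _
    rw [sub_self]
    exact zero_mem _
  · rintro ⟨u, hu⟩
    constructor
    · rintro ⟨f, hf, hfu⟩
      obtain ⟨u', hu', rfl⟩ := (contCocycles_zero_iff ρ _).mp hf
      have h1 : ψ u' = u := congrFun hfu default
      refine ⟨Pi.single 0 u', (perCocycles_zero_iff hρ _).mpr ⟨u', hu', rfl⟩, ?_⟩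
      funext v
      change ψ ((Pi.single 0 u' : (ι →₀ ℕ) → V) v) = (Pi.single 0 u : (ι →₀ ℕ) → Q) v
      by_cases hv : v = 0
      · subst hv
        simpa using h1
      · simp [Pi.single_eq_of_ne hv]
    · rintro ⟨f, hf, hfu⟩
      obtain ⟨u', hu', rfl⟩ := (perCocycles_zero_iff hρ _).mp hf
      have h1 : ψ ((Pi.single 0 u' : (ι →₀ ℕ) → V) 0) = (Pi.single 0 u : (ι →₀ ℕ) → Q) 0 :=
        congrFun hfu 0
      rw [Pi.single_eq_same, Pi.single_eq_same] at h1
      exact ⟨fun _ => u', (contCocycles_zero_iff ρ _).mpr ⟨u', hu', rfl⟩, funext fun _ => h1⟩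

theorem shortExact_perCochains_torusCoind (ρ : Representation R (Torus m) V)
    (hρ : IsDiscreteRep ρ) :
    ShortExactComplexes (VA := fun _ => (ι →₀ ℕ) → V) (VB := fun _ => (ι →₀ ℕ) → torusCoind m R V)
      (VC := fun _ => (ι →₀ ℕ) → CoindQuot ρ hρ) (perCochains ι R V) (fun _ => dPer ρ)
      (perCochains ι R (torusCoind m R V)) (fun _ => dPer (torusRep m R V))
      (perCochains ι R (CoindQuot ρ hρ)) (fun _ => dPer (repCoindQuot ρ hρ))
      (fun _ => (toCoind ρ hρ).compLeft _)
      (fun _ => (Submodule.mkQ (LinearMap.range (toCoind ρ hρ))).compLeft _) :=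
  shortExact_perCochains (V := V) (I := torusCoind m R V) (Q := CoindQuot ρ hρ) (ρ := ρ)
    (ρI := torusRep m R V) (ρQ := repCoindQuot ρ hρ) isDiscreteRep_torusRep (toCoind ρ hρ)
    (Submodule.mkQ (LinearMap.range (toCoind ρ hρ))) (toCoind_rep ρ hρ) (repCoindQuot_mkQ ρ hρ)
    (toCoind_injective ρ hρ) (Submodule.mkQ_surjective _)
    (LinearMap.exact_map_mkQ_range (toCoind ρ hρ))

/-- The cohomology of a product of finite cyclic groups with coefficients in a discrete module is
computed by the periodic complex: the two cohomologies agree in degree `0`, and dimension shifting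
with coinduced modules, which are acyclic for both, reduces degree `n + 1` to degree `n`. -/
theorem nonempty_groupH_equiv.{u, v, w} {ι : Type u} {R : Type v} [LinearOrder ι] {m : ι → ℕ}
    [∀ x, NeZero (m x)] [CommRing R] (n : ℕ) :
    ∀ {V : Type max u w} [AddCommGroup V] [Module R V] (ρ : Representation R (Torus m) V),
      IsDiscreteRep ρ → Nonempty (Subquotient (cocyc (contCochains R (Torus m) V) (dCochain ρ) n)
        (cobd (contCochains R (Torus m) V) (dCochain ρ) n) ≃ₗ[R]
      Subquotient (cocyc (V := fun _ => (ι →₀ ℕ) → V) (perCochains ι R V) (fun _ => dPer ρ) n)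
        (cobd (V := fun _ => (ι →₀ ℕ) → V) (perCochains ι R V) (fun _ => dPer ρ) n)) := by
  induction n with
  | zero =>
    intro V _ _ ρ hρ
    obtain ⟨e⟩ := nonempty_equiv_zero (V := PUnit) (ρ := 1)
      (fun v => IsLocallyConstant.of_constant _ fun _ _ => rfl) hρ 0
    have h1 : ∀ p : Submodule R ((Fin 0 → Torus m) → PUnit), p.map ((0 : PUnit →ₗ[R] V).compLeft _)
        = cobd (contCochains R (Torus m) V) (dCochain ρ) 0 := by
      intro p
      refine le_antisymm ?_ bot_le
      rintro _ ⟨f, -, rfl⟩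
      exact zero_mem _
    have h2 : ∀ p : Submodule R ((ι →₀ ℕ) → PUnit), p.map ((0 : PUnit →ₗ[R] V).compLeft _)
        = cobd (V := fun _ => (ι →₀ ℕ) → V) (perCochains ι R V) (fun _ => dPer ρ) 0 := by
      intro p
      refine le_antisymm ?_ bot_le
      rintro _ ⟨f, -, rfl⟩
      exact zero_mem _
    rw [h1, h2] at e
    exact ⟨e⟩
  | succ n ih =>
    intro V _ _ ρ hρ
    rcases n with _ | n
    · obtain ⟨e₁⟩ := (shortExact_contCochains ρ hρ).shift_zero (contCocycles_repCoind_le 0)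
      obtain ⟨e₂⟩ := (shortExact_perCochains_torusCoind ρ hρ).shift_zero
        (perCocycles_torusCoind_le 0)
      obtain ⟨e₃⟩ := nonempty_equiv_zero (isDiscreteRep_torusRep (m := m) (R := R) (V := V))
        (isDiscreteRep_repCoindQuot ρ hρ) (Submodule.mkQ _)
      exact ⟨e₁ ≪≫ₗ e₃ ≪≫ₗ e₂.symm⟩
    · obtain ⟨e₁⟩ := (shortExact_contCochains ρ hρ).shift n (contCocycles_repCoind_le n)
        (contCocycles_repCoind_le (n + 1))
      obtain ⟨e₂⟩ := (shortExact_perCochains_torusCoind ρ hρ).shift n (perCocycles_torusCoind_le n)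
        (perCocycles_torusCoind_le (n + 1))
      obtain ⟨e₃⟩ := ih (repCoindQuot ρ hρ) (isDiscreteRep_repCoindQuot ρ hρ)
      exact ⟨e₁ ≪≫ₗ e₃ ≪≫ₗ e₂.symm⟩

end PeriodicAcyclic

/-! ### Operators on a single tensor factor -/

section Strand

set_option linter.unusedSectionVars false

variable {R : Type*} [CommRing R] {k : ℕ} [NeZero k]

/-- The basis of the tensor factor belonging to one `x`, with `k = |G_{z(x)}|`: the first component
is `none` for the symbols `[z']` with `x ∤ z'` and `some i` for the symbols `[σ^i z']` with
`x ∣ z'`, and the second component is the exponent of `x` in the periodic complex. -/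
abbrev Strand (k : ℕ) : Type := Option (ZMod k) × ℕ

/-- The endomorphism of the free module on `Strand k` with prescribed values on the basis. -/
def strandOp (f : Strand k → Strand k →₀ R) : Module.End R (Strand k →₀ R) :=
  Finsupp.linearCombination R f

@[simp] theorem strandOp_single (f : Strand k → Strand k →₀ R) (t : Strand k) (r : R) :
    strandOp f (Finsupp.single t r) = r • f t := by
  simp [strandOp]

theorem strand_ext {f g : Module.End R (Strand k →₀ R)}
    (hnone : ∀ v, f (Finsupp.single (none, v) 1) = g (Finsupp.single (none, v) 1))
    (hsome : ∀ i v, f (Finsupp.single (some i, v) 1) = g (Finsupp.single (some i, v) 1)) :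
    f = g := by
  refine Finsupp.lhom_ext' fun t => LinearMap.ext_ring ?_
  obtain ⟨_ | i, v⟩ := t
  · exact hnone v
  · exact hsome i v

/-- The basis vector `(some i, v)`. -/
def sb (R : Type*) [CommRing R] {k : ℕ} (v : ℕ) (i : ZMod k) : Strand k →₀ R :=
  Finsupp.single (some i, v) 1

/-- The basis vector `(none, v)`. -/
def nb (R : Type*) [CommRing R] (k : ℕ) (v : ℕ) : Strand k →₀ R :=
  Finsupp.single (none, v) 1

@[simp] theorem strandOp_sb (f : Strand k → Strand k →₀ R) (v : ℕ) (i : ZMod k) :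
    strandOp f (sb R v i) = f (some i, v) := by
  simp [sb]

@[simp] theorem strandOp_nb (f : Strand k → Strand k →₀ R) (v : ℕ) :
    strandOp f (nb R k v) = f (none, v) := by
  simp [nb]

variable (R k) in
/-- The differential of the periodic complex: on `none` the group acts trivially. -/
def sδ : Module.End R (Strand k →₀ R) := strandOp fun t => match t with
  | (none, v) => if Odd v then (k : R) • nb R k (v + 1) else 0
  | (some i, v) => if Even v then sb R (v + 1) (i + 1) - sb R (v + 1) i
      else ∑ j, sb R (v + 1) j

variable (R k) in
/-- The homotopy that exhibits the norm `none → some` as null homotopic in positive degrees; in the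
odd case it involves the derivative `∑ j σ^j` of the norm. -/
def sθ : Module.End R (Strand k →₀ R) := strandOp fun t => match t with
  | (none, 0) => 0
  | (none, v + 1) => if Odd v then sb R v 0 else -∑ j : ZMod k, (j.val : R) • sb R v j
  | (some _, _) => 0

variable (R k) in
/-- The homotopy between the generator of the cyclic group and the identity: it lowers odd exponents
by one and is zero on even ones. -/
def sη : Module.End R (Strand k →₀ R) := strandOp fun t =>
  if Odd t.2 then Finsupp.single (t.1, t.2 - 1) 1 else 0

variable (R k) in
/-- The norm map from `none` to `some`. -/
def sN : Module.End R (Strand k →₀ R) := strandOp fun t => match t with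
  | (none, v) => ∑ j, sb R v j
  | (some _, _) => 0

variable (R k) in
/-- A retraction for `sθ` that kills the norms. Its coefficient is `1 - k · [i = -1]` in odd degrees
and `[i = -2] - [i = -1]` in even degrees, for the indicator functions `[i = -1]` and `[i = -2]`:
both have sum `0` over `ZMod k`, the first one is `1` at `i = 0` if `1 < k`, and the second one has
pairing `-1` with `i ↦ val i`, which matches the values of `sθ`. -/
def sπ : Module.End R (Strand k →₀ R) := strandOp fun t => match t with
  | (none, _) => 0
  | (some i, v) => if Even v
      then -((if i = -1 then (1 : R) else 0) - (if i + 1 = -1 then 1 else 0)) • nb R k (v + 1)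
      else (1 - (if i = -1 then (k : R) else 0)) • nb R k (v + 1)

variable (R k) in
/-- The homotopy between the identity of the part spanned by the `some i` and `sθ * sπ`, modulo
norms. -/
def sS : Module.End R (Strand k →₀ R) := strandOp fun t => match t with
  | (none, _) => 0
  | (some i, v) => if Odd v then ∑ j ∈ Finset.range i.val, sb R (v - 1) (j : ZMod k) +
      (if i = -1 then ∑ j : ZMod k, (j.val : R) • sb R (v - 1) j else 0) else 0

variable (R k) in
/-- The coefficient of the norm in the homotopy `sS`. -/
def sτ : Module.End R (Strand k →₀ R) := strandOp fun t => match t with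
  | (none, _) => 0
  | (some i, v) => if i = -1 then nb R k v else 0

variable (R k) in
/-- The contracting homotopy of the positive part of the `none` complex if `k = 1`. -/
def sh : Module.End R (Strand k →₀ R) := strandOp fun t => match t with
  | (none, v) => if Even v ∧ v ≠ 0 then nb R k (v - 1) else 0
  | (some _, _) => 0

variable (R k) in
/-- A left inverse of the norm. -/
def sν : Module.End R (Strand k →₀ R) := strandOp fun t => match t with
  | (none, _) => 0
  | (some i, v) => if i = 0 then nb R k v else 0

variable (R k) in
/-- The operator `sS` shifts the norm of an element of `none` by a multiple of this operator. -/
def sS' : Module.End R (Strand k →₀ R) := strandOp fun t => match t with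
  | (none, v) => if Odd v then ((k : R) - 1) • nb R k (v - 1) else 0
  | (some _, _) => 0

variable (R k) in
/-- The projection to the part spanned by the `none` with positive exponent. -/
def sq : Module.End R (Strand k →₀ R) := strandOp fun t => match t with
  | (none, v) => if v = 0 then 0 else nb R k v
  | (some _, _) => 0

variable (R k) in
/-- The projection to the part spanned by the `some i`. -/
def ssome : Module.End R (Strand k →₀ R) := strandOp fun t => match t with
  | (none, _) => 0
  | (some i, v) => sb R v i

variable (R k) in
/-- The projection to the part spanned by `none`. -/
def snone : Module.End R (Strand k →₀ R) := strandOp fun t => match t with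
  | (none, v) => nb R k v
  | (some _, _) => 0

variable (R) in
/-- The action of an element of the cyclic group. -/
def sact (i : ZMod k) : Module.End R (Strand k →₀ R) := strandOp fun t =>
  Finsupp.single (t.1.map (· + i), t.2) 1

/-- The derivative `∑ j σ^j` of the norm `N` satisfies `(σ - 1) ∑ j σ^j = k - N`, up to a shift of
the indices. -/
theorem sum_val_smul_sub {V : Type*} [AddCommGroup V] [Module R V] (ψ : ZMod k → V) :
    ∑ j : ZMod k, (j.val : R) • (ψ (j + 1) - ψ j) = (k : R) • ψ 0 - ∑ j, ψ j := by
  have key : ∀ n, ∑ j ∈ Finset.range n, (j : R) • (ψ ((j : ZMod k) + 1) - ψ j) =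
      (n : R) • ψ (n : ZMod k) - ∑ j ∈ Finset.range n, ψ ((j : ZMod k) + 1) := by
    intro n
    induction n with
    | zero => simp
    | succ n ih =>
      rw [Finset.sum_range_succ, Finset.sum_range_succ, ih]
      push_cast
      module
  have h1 := key k
  have h2 : ∑ j ∈ Finset.range k, (j : R) • (ψ ((j : ZMod k) + 1) - ψ j) =
      ∑ j : ZMod k, (j.val : R) • (ψ (j + 1) - ψ j) := by
    rw [sum_univ_zmod (fun j : ZMod k => (j.val : R) • (ψ (j + 1) - ψ j))]
    exact Finset.sum_congr rfl fun j hj => by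
      rw [ZMod.val_cast_of_lt (Finset.mem_range.mp hj)]
  rw [← h2, h1, ← sum_univ_zmod (fun j : ZMod k => ψ (j + 1)), ZMod.natCast_self]
  congr 1
  exact Fintype.sum_equiv (Equiv.addRight 1) _ _ fun _ => rfl

theorem sum_partial_sums {V : Type*} [AddCommGroup V] [Module R V] (ψ : ZMod k → V) :
    ∑ i : ZMod k, ∑ j ∈ Finset.range i.val, ψ (j : ZMod k) + ∑ j : ZMod k, (j.val : R) • ψ j =
      ((k : R) - 1) • ∑ j, ψ j := by
  have key : ∀ n, ∑ i ∈ Finset.range n, ∑ j ∈ Finset.range i, ψ (j : ZMod k) +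
      ∑ j ∈ Finset.range n, (j : R) • ψ (j : ZMod k) =
        ((n : R) - 1) • ∑ j ∈ Finset.range n, ψ (j : ZMod k) := by
    intro n
    induction n with
    | zero => simp
    | succ n ih =>
      rw [Finset.sum_range_succ, Finset.sum_range_succ (fun j => (j : R) • ψ (j : ZMod k)),
        Finset.sum_range_succ (fun j => ψ (j : ZMod k)) n, add_add_add_comm, ih]
      push_cast
      module
  rw [sum_univ_zmod (fun i : ZMod k => ∑ j ∈ Finset.range i.val, ψ (j : ZMod k)),
    sum_univ_zmod (fun j : ZMod k => (j.val : R) • ψ j), sum_univ_zmod ψ, ← key k]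
  congr 1
  · exact Finset.sum_congr rfl fun j hj => by
      rw [ZMod.val_cast_of_lt (Finset.mem_range.mp hj)]
  · exact Finset.sum_congr rfl fun j hj => by
      rw [ZMod.val_cast_of_lt (Finset.mem_range.mp hj)]

theorem sum_ite_add_one_eq (f : ZMod k → R) :
    ∑ i : ZMod k, f i * ((if i = -1 then (1 : R) else 0) - (if i + 1 = -1 then 1 else 0)) =
      f (-1) - f (-2) := by
  have : ∀ i : ZMod k, i + 1 = -1 ↔ i = -2 := fun i => by
    rw [← sub_eq_zero, ← sub_eq_zero (a := i)]
    ring_nf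
  simp [mul_sub, Finset.sum_sub_distrib, this]

theorem odd_succ_iff (v : ℕ) : Odd (v + 1) ↔ Even v := by
  rw [Nat.odd_add_one, Nat.not_odd_iff_even]

theorem even_succ_iff (v : ℕ) : Even (v + 1) ↔ Odd v := by
  rw [Nat.even_add_one, Nat.not_even_iff_odd]

theorem sδ_nb (v : ℕ) : sδ R k (nb R k v) = if Odd v then (k : R) • nb R k (v + 1) else 0 := by
  simp [sδ]

theorem sδ_sb (v : ℕ) (i : ZMod k) : sδ R k (sb R v i) =
    if Even v then sb R (v + 1) (i + 1) - sb R (v + 1) i else ∑ j, sb R (v + 1) j := by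
  simp [sδ]

theorem sθ_nb_zero : sθ R k (nb R k 0) = 0 := by simp [sθ]

theorem sθ_nb_succ (v : ℕ) : sθ R k (nb R k (v + 1)) =
    if Odd v then sb R v 0 else -∑ j : ZMod k, (j.val : R) • sb R v j := by
  simp [sθ]

theorem sθ_sb (v : ℕ) (i : ZMod k) : sθ R k (sb R v i) = 0 := by simp [sθ]

theorem sN_nb (v : ℕ) : sN R k (nb R k v) = ∑ j, sb R v j := by simp [sN]

theorem sN_sb (v : ℕ) (i : ZMod k) : sN R k (sb R v i) = 0 := by simp [sN]

theorem sπ_nb (v : ℕ) : sπ R k (nb R k v) = 0 := by simp [sπ]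

theorem sπ_sb (v : ℕ) (i : ZMod k) : sπ R k (sb R v i) = if Even v
      then -((if i = -1 then (1 : R) else 0) - (if i + 1 = -1 then 1 else 0)) • nb R k (v + 1)
      else (1 - (if i = -1 then (k : R) else 0)) • nb R k (v + 1) := by
  simp only [sπ, strandOp_sb]

theorem sS_nb (v : ℕ) : sS R k (nb R k v) = 0 := by simp [sS]

theorem sS_sb (v : ℕ) (i : ZMod k) : sS R k (sb R v i) =
    if Odd v then ∑ j ∈ Finset.range i.val, sb R (v - 1) (j : ZMod k) +
      (if i = -1 then ∑ j : ZMod k, (j.val : R) • sb R (v - 1) j else 0) else 0 := by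
  simp only [sS, strandOp_sb]

theorem sτ_nb (v : ℕ) : sτ R k (nb R k v) = 0 := by simp [sτ]

theorem sτ_sb (v : ℕ) (i : ZMod k) : sτ R k (sb R v i) = if i = -1 then nb R k v else 0 := by
  simp [sτ]

theorem sq_nb (v : ℕ) : sq R k (nb R k v) = if v = 0 then 0 else nb R k v := by simp [sq]

theorem sq_sb (v : ℕ) (i : ZMod k) : sq R k (sb R v i) = 0 := by simp [sq]

theorem strand_ext' {f g : Module.End R (Strand k →₀ R)}
    (hnone : ∀ v, f (nb R k v) = g (nb R k v))
    (hsome : ∀ v i, f (sb R v i) = g (sb R v i)) : f = g :=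
  strand_ext hnone fun i v => hsome v i

theorem sδ_sum_sb (v : ℕ) : sδ R k (∑ j, sb R v j) =
    if Even v then 0 else (k : R) • ∑ j, sb R (v + 1) j := by
  rw [map_sum]
  simp only [sδ_sb]
  split_ifs with h
  · rw [Finset.sum_sub_distrib, sub_eq_zero]
    exact Fintype.sum_equiv (Equiv.addRight 1) _ _ fun _ => rfl
  · rw [Finset.sum_const, Finset.card_univ, ZMod.card, Nat.cast_smul_eq_nsmul]

theorem sδ_mul_sδ : sδ R k * sδ R k = 0 := by
  refine strand_ext' (fun v => ?_) fun v i => ?_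
  · simp only [Module.End.mul_apply, LinearMap.zero_apply, sδ_nb]
    split_ifs with h
    · rw [map_smul, sδ_nb, if_neg, smul_zero]
      rwa [odd_succ_iff, Nat.not_even_iff_odd]
    · simp
  · simp only [Module.End.mul_apply, LinearMap.zero_apply, sδ_sb]
    split_ifs with h
    · have h1 : ¬ Even (v + 1) := by rwa [even_succ_iff, Nat.not_odd_iff_even]
      rw [map_sub, sδ_sb, sδ_sb, if_neg h1, if_neg h1, sub_self]
    · rw [sδ_sum_sb, if_pos]
      rwa [even_succ_iff, ← Nat.not_even_iff_odd]

theorem sδ_mul_sN : sδ R k * sN R k = sN R k * sδ R k := by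
  refine strand_ext' (fun v => ?_) fun v i => ?_
  · simp only [Module.End.mul_apply, sN_nb, sδ_sum_sb, sδ_nb]
    rcases Nat.even_or_odd v with h | h
    · simp [h, Nat.not_odd_iff_even.mpr h]
    · simp [h, Nat.not_even_iff_odd.mpr h, sN_nb]
  · simp only [Module.End.mul_apply, sN_sb, sδ_sb, map_zero]
    split_ifs <;> simp [sN_sb]

theorem sδ_sθ : sδ R k * sθ R k + sθ R k * sδ R k = sN R k * sq R k := by
  refine strand_ext' (fun v => ?_) fun v i => ?_
  · simp only [Module.End.mul_apply, LinearMap.add_apply, sq_nb]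
    rcases v with _ | v
    · simp [sθ_nb_zero, sδ_nb]
    · rw [if_neg (Nat.succ_ne_zero v), sN_nb, sθ_nb_succ, sδ_nb]
      rcases Nat.even_or_odd v with h | h
      · rw [if_neg (Nat.not_odd_iff_even.mpr h), if_pos ((odd_succ_iff v).mpr h), map_smul,
          sθ_nb_succ, if_pos ((odd_succ_iff v).mpr h), map_neg, map_sum]
        simp only [map_smul, sδ_sb, if_pos h]
        rw [sum_val_smul_sub (R := R) (sb R (v + 1))]
        abel
      · rw [if_pos h, if_neg (by rwa [odd_succ_iff, Nat.not_even_iff_odd]), map_zero, sδ_sb,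
          if_neg (Nat.not_even_iff_odd.mpr h), add_zero]
  · simp only [Module.End.mul_apply, LinearMap.add_apply, sθ_sb, sδ_sb, sq_sb, map_zero, zero_add]
    split_ifs <;> simp [sθ_sb]

theorem sη_nb (v : ℕ) : sη R k (nb R k v) = if Odd v then nb R k (v - 1) else 0 := by
  simp [sη, nb]

theorem sη_sb (v : ℕ) (i : ZMod k) : sη R k (sb R v i) =
    if Odd v then sb R (v - 1) i else 0 := by
  simp [sη, sb]

theorem sact_nb (i : ZMod k) (v : ℕ) : sact R i (nb R k v) = nb R k v := by
  simp [sact, nb]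

theorem sact_sb (i : ZMod k) (v : ℕ) (j : ZMod k) : sact R i (sb R v j) = sb R v (j + i) := by
  simp [sact, sb]

theorem sδ_sη : sδ R k * sη R k + sη R k * sδ R k = sact R (1 : ZMod k) - 1 := by
  refine strand_ext' (fun v => ?_) fun v i => ?_
  · simp only [Module.End.mul_apply, LinearMap.add_apply, LinearMap.sub_apply, Module.End.one_apply,
      sact_nb, sub_self, sη_nb, sδ_nb]
    rcases v with _ | v
    · simp
    · rcases Nat.even_or_odd v with h | h
      · have h1 : ¬ Odd (v + 1 + 1) := by
          rwa [odd_succ_iff, Nat.even_add_one, not_not]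
        simp [h.add_one, sδ_nb, Nat.not_odd_iff_even.mpr h, sη_nb, h1]
      · have h1 : ¬ Odd (v + 1) := by
          rwa [odd_succ_iff, Nat.not_even_iff_odd]
        simp [h1]
  · simp only [Module.End.mul_apply, LinearMap.add_apply, LinearMap.sub_apply, Module.End.one_apply,
      sact_sb, sη_sb, sδ_sb]
    rcases Nat.even_or_odd v with h | h
    · simp [h, Nat.not_odd_iff_even.mpr h, sη_sb, h.add_one]
    · obtain ⟨v, rfl⟩ : ∃ w, v = w + 1 := ⟨v - 1, by have := h.pos; omega⟩
      have h1 : Even v := (odd_succ_iff v).mp h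
      have h2 : ¬ Even (v + 1) := by rwa [even_succ_iff, Nat.not_odd_iff_even]
      have h3 : ¬ Odd (v + 1 + 1) := by rwa [odd_succ_iff]
      simp [h, h2, h1, h3, sη_sb, sδ_sb]

theorem sπ_sum_sb (v : ℕ) : sπ R k (∑ j, sb R v j) = 0 := by
  rw [map_sum]
  simp only [sπ_sb]
  split_ifs with h
  · rw [← Finset.sum_smul, Finset.sum_neg_distrib]
    have := sum_ite_add_one_eq (R := R) (k := k) (fun _ => 1)
    simp only [one_mul, sub_self] at this
    rw [this, neg_zero, zero_smul]
  · rw [← Finset.sum_smul, Finset.sum_sub_distrib]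
    simp [ZMod.card]

theorem sπ_mul_sN : sπ R k * sN R k = 0 := by
  refine strand_ext' (fun v => ?_) fun v i => ?_
  · rw [Module.End.mul_apply, sN_nb, sπ_sum_sb, LinearMap.zero_apply]
  · rw [Module.End.mul_apply, sN_sb, map_zero, LinearMap.zero_apply]

theorem sδ_sπ : sδ R k * sπ R k + sπ R k * sδ R k = 0 := by
  refine strand_ext' (fun v => ?_) fun v i => ?_
  · simp only [Module.End.mul_apply, LinearMap.add_apply, sπ_nb, sδ_nb]
    split_ifs <;> simp [sπ_nb]
  · simp only [Module.End.mul_apply, LinearMap.add_apply, sδ_sb, sπ_sb]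
    rcases Nat.even_or_odd v with h | h
    · have h2 : ¬ Even (v + 1) := by rwa [even_succ_iff, Nat.not_odd_iff_even]
      simp only [if_pos h, map_sub, map_smul, sδ_nb, if_pos h.add_one, sπ_sb, if_neg h2,
        LinearMap.zero_apply]
      rw [smul_smul, ← sub_smul, ← add_smul]
      convert zero_smul R _
      split_ifs <;> ring
    · have h2 : ¬ Even v := by rwa [Nat.not_even_iff_odd]
      have h3 : ¬ Odd (v + 1) := by rwa [odd_succ_iff]
      rw [if_neg h2, if_neg h2, map_smul, sδ_nb, if_neg h3, sπ_sum_sb]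
      simp

theorem sπ_mul_sθ (hk : 1 < k) : sπ R k * sθ R k = sq R k := by
  have : Fact (1 < k) := ⟨hk⟩
  refine strand_ext' (fun v => ?_) fun v i => ?_
  · rw [Module.End.mul_apply, sq_nb]
    rcases v with _ | v
    · simp [sθ_nb_zero]
    · rw [if_neg (Nat.succ_ne_zero v), sθ_nb_succ]
      rcases Nat.even_or_odd v with h | h
      · rw [if_neg (Nat.not_odd_iff_even.mpr h), map_neg, map_sum]
        simp only [map_smul, sπ_sb, if_pos h, neg_smul, smul_neg, Finset.sum_neg_distrib, neg_neg,
          smul_smul]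
        rw [← Finset.sum_smul, sum_ite_add_one_eq (fun j : ZMod k => (j.val : R))]
        have h1 : (-2 : ZMod k) ≠ -1 := by
          intro h
          have h2 : (1 : ZMod k) = 0 := by linear_combination -h
          exact one_ne_zero h2
        have h2 := zmod_val_add_one (-2 : ZMod k) h1
        have h3 : (-2 : ZMod k) + 1 = -1 := by ring
        rw [h3] at h2
        rw [h2]
        push_cast
        rw [add_sub_cancel_left, one_smul]
      · rw [if_pos h, sπ_sb, if_neg (Nat.not_even_iff_odd.mpr h), if_neg, sub_zero, one_smul]
        intro h0
        have : (1 : ZMod k) = 0 := by linear_combination h0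
        exact one_ne_zero this
  · simp [Module.End.mul_apply, sθ_sb, sq_sb]

theorem ssome_nb (v : ℕ) : ssome R k (nb R k v) = 0 := by simp [ssome]

theorem ssome_sb (v : ℕ) (i : ZMod k) : ssome R k (sb R v i) = sb R v i := by simp [ssome]

theorem sS_homotopy : sδ R k * sS R k + sS R k * sδ R k + sθ R k * sπ R k + sN R k * sτ R k =
    ssome R k := by
  refine strand_ext' (fun v => ?_) fun v i => ?_
  · simp only [Module.End.mul_apply, LinearMap.add_apply, sS_nb, sπ_nb, sτ_nb, sδ_nb, map_zero,
      ssome_nb]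
    split_ifs <;> simp [sS_nb]
  · simp only [Module.End.mul_apply, LinearMap.add_apply, ssome_sb, sτ_sb, sδ_sb, sπ_sb]
    rcases Nat.even_or_odd v with h | h
    · have h2 : ¬ Odd v := Nat.not_odd_iff_even.mpr h
      simp only [if_pos h, map_sub, map_smul, sS_sb, if_pos h.add_one, if_neg h2, sθ_nb_succ,
        Nat.add_sub_cancel, map_zero, zero_add]
      have h3 := sum_range_val_add_one (sb R v) i
      conv_rhs => rw [← h3]
      split_ifs <;> simp only [map_zero, sN_nb] <;> module
    · obtain ⟨v, rfl⟩ : ∃ w, v = w + 1 := ⟨v - 1, by have := h.pos; omega⟩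
      have h1 : Even v := (odd_succ_iff v).mp h
      have h2 : ¬ Even (v + 1) := by rwa [even_succ_iff, Nat.not_odd_iff_even]
      have h3 : ¬ Odd (v + 1 + 1) := by rwa [odd_succ_iff]
      have h4 : sS R k (∑ j : ZMod k, sb R (v + 1 + 1) j) = 0 := by
        simp [sS_sb, h3]
      rw [sS_sb, if_pos h, if_neg h2, if_neg h2, h4, map_smul, sθ_nb_succ, if_pos h,
        Nat.add_sub_cancel, map_add, map_sum, add_zero]
      simp only [sδ_sb, if_pos h1]
      rw [sum_range_val_sub (sb R (v + 1)) i]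
      by_cases h4 : i = -1
      · simp only [if_pos h4, map_sum, map_smul, sδ_sb, if_pos h1, sN_nb]
        rw [sum_val_smul_sub (R := R) (sb R (v + 1))]
        module
      · simp [h4]

theorem sS_mul_sN : sS R k * sN R k = sN R k * sS' R k := by
  refine strand_ext' (fun v => ?_) fun v i => ?_
  · have h1 : sS' R k (nb R k v) = if Odd v then ((k : R) - 1) • nb R k (v - 1) else 0 := by
      simp [sS']
    rw [Module.End.mul_apply, Module.End.mul_apply, sN_nb, map_sum, h1]
    simp only [sS_sb]
    split_ifs with h
    · rw [Finset.sum_add_distrib, map_smul, sN_nb, ← sum_partial_sums (R := R) (sb R (v - 1))]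
      simp
    · simp
  · have h1 : sS' R k (sb R v i) = 0 := by simp [sS']
    rw [Module.End.mul_apply, Module.End.mul_apply, sN_sb, h1, map_zero, map_zero]

theorem sδ_sh : sδ R k * sh R k + sh R k * sδ R k = (k : R) • sq R k := by
  have h1 : ∀ v, sh R k (nb R k v) = if Even v ∧ v ≠ 0 then nb R k (v - 1) else 0 := by
    intro v
    simp only [sh, strandOp_nb]
  have h2 : ∀ v (i : ZMod k), sh R k (sb R v i) = 0 := by
    intro v i
    simp [sh]
  refine strand_ext' (fun v => ?_) fun v i => ?_
  · simp only [Module.End.mul_apply, LinearMap.add_apply, LinearMap.smul_apply, h1, sδ_nb, sq_nb]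
    rcases v with _ | v
    · simp
    · rcases Nat.even_or_odd v with h | h
      · have h3 : ¬ Even (v + 1) := by rwa [even_succ_iff, Nat.not_odd_iff_even]
        have h4 : Even (v + 1 + 1) := by rw [even_succ_iff]; exact h.add_one
        simp [h.add_one, h3, h1, h4]
      · have h3 : ¬ Odd (v + 1) := by rwa [odd_succ_iff, Nat.not_even_iff_odd]
        simp [h3, h.add_one, sδ_nb, h]
  · simp only [Module.End.mul_apply, LinearMap.add_apply, LinearMap.smul_apply, h2, sδ_sb, sq_sb,
      map_zero, zero_add, smul_zero]
    split_ifs <;> simp [h2]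

theorem sν_nb (v : ℕ) : sν R k (nb R k v) = 0 := by simp [sν]

theorem sν_sb (v : ℕ) (i : ZMod k) : sν R k (sb R v i) = if i = 0 then nb R k v else 0 := by
  simp [sν]

theorem sν_mul_sN : sν R k * sN R k = snone R k := by
  refine strand_ext' (fun v => ?_) fun v i => ?_
  · rw [Module.End.mul_apply, sN_nb, map_sum]
    simp [sν_sb, snone]
  · simp [Module.End.mul_apply, sN_sb, snone]

theorem sN_mul_sν (hk : k = 1) : sN R k * sν R k = ssome R k := by
  subst hk
  refine strand_ext' (fun v => ?_) fun v i => ?_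
  · simp [Module.End.mul_apply, sν_nb, ssome_nb]
  · have : i = 0 := Subsingleton.elim _ _
    subst this
    simp only [Module.End.mul_apply, sν_sb, if_true, ssome_sb, sN_nb]
    exact Fintype.sum_subsingleton _ 0

end Strand

/-! ### Operators on a graded tensor product -/

section Cells

set_option linter.unusedSectionVars false

variable {ι : Type*}

/-- The symbols `[g z']`: the set of `x ∣ z'` is the set of `x` with `a x ≠ none`, and `a x = some
i` says that the component of `g` in the cyclic group `G_{z(x)}` is the `i`-th power of the
generator. -/
def Symb (m : ι → ℕ) : Type _ := {a : ∀ x, Option (ZMod (m x)) // {x | a x ≠ none}.Finite}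

/-- The basis elements `[g z'] [v]` of the periodic complex with coefficients in `𝒜_z`. -/
abbrev Cell (m : ι → ℕ) : Type _ := Symb m × (ι →₀ ℕ)

variable [LinearOrder ι] {m : ι → ℕ}

/-- The symbol `a` with its component at `x` replaced by `o`. -/
def Symb.upd (a : Symb m) (x : ι) (o : Option (ZMod (m x))) : Symb m :=
  ⟨Function.update a.1 x o, (a.2.insert x).subset fun y hy => by
    by_cases h : y = x
    · exact Or.inl h
    · right
      simpa [Function.update_of_ne h] using hy⟩

theorem Symb.upd_apply (a : Symb m) (x : ι) (o : Option (ZMod (m x))) :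
    (a.upd x o).1 = Function.update a.1 x o := rfl

/-- The component of a basis element at `x`. -/
def Cell.get (x : ι) (i : Cell m) : Strand (m x) := (i.1.1 x, i.2 x)

/-- The basis element `i` with its component at `x` replaced by `t`. -/
def Cell.upd (x : ι) (i : Cell m) (t : Strand (m x)) : Cell m := (i.1.upd x t.1, i.2.update x t.2)

theorem Cell.ext' {i j : Cell m} (h : ∀ x, i.get x = j.get x) : i = j := by
  refine Prod.ext (Subtype.ext (funext fun x => (Prod.ext_iff.mp (h x)).1)) (Finsupp.ext fun x =>
    (Prod.ext_iff.mp (h x)).2)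

theorem Cell.get_upd (x : ι) (i : Cell m) (t : Strand (m x)) : (i.upd x t).get x = t := by
  refine Prod.ext ?_ ?_
  · simp [Cell.get, Cell.upd, Symb.upd_apply]
  · simp [Cell.get, Cell.upd, coe_update']

theorem Cell.get_upd_of_ne {x y : ι} (h : y ≠ x) (i : Cell m) (t : Strand (m x)) :
    (i.upd x t).get y = i.get y := by
  refine Prod.ext ?_ ?_
  · simp [Cell.get, Cell.upd, Symb.upd_apply, h]
  · simp [Cell.get, Cell.upd, coe_update', h]

theorem Cell.upd_get (x : ι) (i : Cell m) : i.upd x (i.get x) = i := by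
  refine Cell.ext' fun y => ?_
  by_cases h : y = x
  · subst h
    rw [Cell.get_upd]
  · rw [Cell.get_upd_of_ne h]

theorem Cell.upd_upd (x : ι) (i : Cell m) (t t' : Strand (m x)) :
    (i.upd x t).upd x t' = i.upd x t' := by
  refine Cell.ext' fun y => ?_
  by_cases h : y = x
  · subst h
    rw [Cell.get_upd, Cell.get_upd]
  · rw [Cell.get_upd_of_ne h, Cell.get_upd_of_ne h, Cell.get_upd_of_ne h]

theorem Cell.upd_comm {x y : ι} (h : x ≠ y) (i : Cell m) (t : Strand (m x)) (t' : Strand (m y)) :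
    (i.upd x t).upd y t' = (i.upd y t').upd x t := by
  refine Cell.ext' fun z => ?_
  by_cases hx : z = x
  · subst hx
    rw [Cell.get_upd, Cell.get_upd_of_ne h, Cell.get_upd]
  · by_cases hy : z = y
    · subst hy
      rw [Cell.get_upd, Cell.get_upd_of_ne hx, Cell.get_upd]
    · rw [Cell.get_upd_of_ne hy, Cell.get_upd_of_ne hx, Cell.get_upd_of_ne hx,
        Cell.get_upd_of_ne hy]

variable {R : Type*} [CommRing R]

/-- The embedding of the tensor factor of `x` that fixes the other components of `i`. -/
def emb (R : Type*) [CommRing R] (x : ι) (i : Cell m) : (Strand (m x) →₀ R) →ₗ[R] (Cell m →₀ R) :=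
  Finsupp.lmapDomain R R (i.upd x)

@[simp] theorem emb_single (x : ι) (i : Cell m) (t : Strand (m x)) (r : R) :
    emb R x i (Finsupp.single t r) = Finsupp.single (i.upd x t) r := by
  simp [emb]

theorem emb_upd (x : ι) (i : Cell m) (t : Strand (m x)) : emb R x (i.upd x t) = emb R x i := by
  rw [emb, emb]
  congr 1
  funext t'
  exact Cell.upd_upd x i t t'

theorem emb_eq_sum (x : ι) (i : Cell m) (s : Strand (m x) →₀ R) :
    emb R x i s = ∑ t ∈ s.support, Finsupp.single (i.upd x t) (s t) := by
  rw [emb, Finsupp.lmapDomain_apply, Finsupp.mapDomain, Finsupp.sum]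

/-- The action of an endomorphism of the tensor factor of `x` on the whole tensor product, with the
sign of the Koszul rule if the parity `ε` is odd. -/
def ext (x : ι) (ε : ℕ) (φ : Module.End R (Strand (m x) →₀ R)) : Module.End R (Cell m →₀ R) :=
  Finsupp.linearCombination R fun i =>
    (-1 : R) ^ (ε * signExp x i.2) • emb R x i (φ (Finsupp.single (i.get x) 1))

theorem ext_single (x : ι) (ε : ℕ) (φ : Module.End R (Strand (m x) →₀ R)) (i : Cell m) :
    ext x ε φ (Finsupp.single i 1) =
      (-1 : R) ^ (ε * signExp x i.2) • emb R x i (φ (Finsupp.single (i.get x) 1)) := by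
  simp [ext]

theorem cell_ext {M : Type*} [AddCommGroup M] [Module R M] {f g : (Cell m →₀ R) →ₗ[R] M}
    (h : ∀ i, f (Finsupp.single i 1) = g (Finsupp.single i 1)) : f = g :=
  Finsupp.lhom_ext' fun i => LinearMap.ext_ring (h i)

theorem ext_emb (x : ι) (ε : ℕ) (φ : Module.End R (Strand (m x) →₀ R)) (i : Cell m)
    (s : Strand (m x) →₀ R) :
    ext x ε φ (emb R x i s) = (-1 : R) ^ (ε * signExp x i.2) • emb R x i (φ s) := by
  have h : ext x ε φ ∘ₗ emb R x i = (-1 : R) ^ (ε * signExp x i.2) • (emb R x i ∘ₗ φ) := by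
    refine Finsupp.lhom_ext' fun t => LinearMap.ext_ring ?_
    simp only [LinearMap.comp_apply, Finsupp.lsingle_apply, emb_single, ext_single, emb_upd,
      LinearMap.smul_apply, Cell.get_upd]
    rw [Cell.upd, signExp_update_of_not_lt x x (lt_irrefl x)]
  exact LinearMap.congr_fun h s

theorem ext_mul (x : ι) (ε ε' : ℕ) (φ ψ : Module.End R (Strand (m x) →₀ R)) :
    ext x ε φ * ext x ε' ψ = ext x (ε + ε') (φ * ψ) := by
  refine cell_ext fun i => ?_
  rw [Module.End.mul_apply, ext_single, map_smul, ext_emb, smul_smul, ext_single, ← pow_add]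
  congr 2
  ring

theorem ext_add_two (x : ι) (ε : ℕ) (φ : Module.End R (Strand (m x) →₀ R)) :
    ext x (ε + 2) φ = ext x ε φ := by
  refine cell_ext fun i => ?_
  rw [ext_single, ext_single, add_mul, pow_add, pow_mul (-1 : R) 2]
  simp

theorem ext_two (x : ι) (φ : Module.End R (Strand (m x) →₀ R)) : ext x 2 φ = ext x 0 φ :=
  ext_add_two x 0 φ

theorem ext_add (x : ι) (ε : ℕ) (φ ψ : Module.End R (Strand (m x) →₀ R)) :
    ext x ε (φ + ψ) = ext x ε φ + ext x ε ψ := by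
  refine cell_ext fun i => ?_
  simp only [LinearMap.add_apply, ext_single, map_add, smul_add]

theorem ext_smul (x : ι) (ε : ℕ) (r : R) (φ : Module.End R (Strand (m x) →₀ R)) :
    ext x ε (r • φ) = r • ext x ε φ := by
  refine cell_ext fun i => ?_
  simp only [LinearMap.smul_apply, ext_single, map_smul]
  rw [smul_comm]

theorem ext_sub (x : ι) (ε : ℕ) (φ ψ : Module.End R (Strand (m x) →₀ R)) :
    ext x ε (φ - ψ) = ext x ε φ - ext x ε ψ := by
  refine cell_ext fun i => ?_
  simp only [LinearMap.sub_apply, ext_single, map_sub, smul_sub]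

theorem ext_zero (x : ι) (ε : ℕ) : ext x ε (0 : Module.End R (Strand (m x) →₀ R)) = 0 := by
  refine cell_ext fun i => ?_
  simp [ext_single]

theorem ext_one (x : ι) : ext x 0 (1 : Module.End R (Strand (m x) →₀ R)) = 1 := by
  refine cell_ext fun i => ?_
  simp [ext_single, Cell.upd_get]

/-- An endomorphism of a tensor factor that changes the parity of the exponent by `ε`. -/
def Homog {k : ℕ} (ε : ℕ) (φ : Module.End R (Strand k →₀ R)) : Prop :=
  ∀ t, ∀ t' ∈ (φ (Finsupp.single t 1)).support, Even (t.2 + t'.2 + ε)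

theorem neg_one_pow_eq_of_even {a b : ℕ} (h : Even (a + b)) : (-1 : R) ^ a = (-1 : R) ^ b := by
  rcases Nat.even_or_odd a with ha | ha
  · have hb : Even b := (Nat.even_add.mp h).mp ha
    rw [ha.neg_one_pow, hb.neg_one_pow]
  · have hb : Odd b := by
      rw [← Nat.not_even_iff_odd] at ha ⊢
      exact fun hb => ha ((Nat.even_add.mp h).mpr hb)
    rw [ha.neg_one_pow, hb.neg_one_pow]

theorem ext_emb_of_ne {x y : ι} (h : x ≠ y) (ε ε' : ℕ) (φ : Module.End R (Strand (m x) →₀ R))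
    (i : Cell m) (s : Strand (m y) →₀ R) (hs : ∀ t ∈ s.support, Even (i.2 y + t.2 + ε')) :
    ext x ε φ (emb R y i s) =
      (-1 : R) ^ (ε * signExp x i.2 + if y < x then ε * ε' else 0) • ∑ t ∈ s.support,
        s t • emb R x (i.upd y t) (φ (Finsupp.single (i.get x) 1)) := by
  rw [emb_eq_sum, map_sum, Finset.smul_sum]
  refine Finset.sum_congr rfl fun t ht => ?_
  have h1 : Finsupp.single (i.upd y t) (s t) = s t • Finsupp.single (i.upd y t) (1 : R) := by simp
  rw [h1, map_smul, ext_single, Cell.get_upd_of_ne h, smul_comm]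
  congr 1
  refine neg_one_pow_eq_of_even ?_
  have h2 := signExp_update x y i.2 t.2
  have h3 := hs t ht
  change Even (ε * signExp x (i.2.update y t.2) + _)
  split_ifs with hlt
  · simp only [hlt, if_true] at h2
    have h4 : ε * signExp x (i.2.update y t.2) + (ε * signExp x i.2 + ε * ε') + 2 * (ε * i.2 y) =
        2 * (ε * signExp x i.2) + ε * (i.2 y + t.2 + ε') := by
      have : ε * (signExp x (i.2.update y t.2) + i.2 y) = ε * (signExp x i.2 + t.2) := by rw [h2]
      linear_combination this
    have h5 : Even (2 * (ε * signExp x i.2) + ε * (i.2 y + t.2 + ε')) :=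
      (even_two_mul _).add (h3.mul_left ε)
    rw [← h4, Nat.even_add] at h5
    exact h5.mpr (even_two_mul _)
  · simp only [hlt, if_false, add_zero] at h2
    rw [h2, add_zero]
    exact ⟨_, rfl⟩

theorem sum_smul_emb_comm {x y : ι} (h : x ≠ y) (i : Cell m) (s : Strand (m y) →₀ R)
    (u : Strand (m x) →₀ R) :
    ∑ t ∈ s.support, s t • emb R x (i.upd y t) u =
      ∑ t ∈ u.support, u t • emb R y (i.upd x t) s := by
  simp only [emb_eq_sum, Finset.smul_sum]
  rw [Finset.sum_comm]
  refine Finset.sum_congr rfl fun t _ => Finset.sum_congr rfl fun t' _ => ?_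
  rw [Cell.upd_comm h, Finsupp.smul_single, Finsupp.smul_single, smul_eq_mul, smul_eq_mul, mul_comm]

/-- The Koszul rule: operators on different tensor factors commute up to the sign given by their
parities. -/
theorem ext_comm {x y : ι} (h : x ≠ y) {ε ε' : ℕ} {φ : Module.End R (Strand (m x) →₀ R)}
    {ψ : Module.End R (Strand (m y) →₀ R)} (hφ : Homog ε φ) (hψ : Homog ε' ψ) :
    ext x ε φ * ext y ε' ψ = (-1 : R) ^ (ε * ε') • (ext y ε' ψ * ext x ε φ) := by
  refine cell_ext fun i => ?_
  rw [LinearMap.smul_apply, Module.End.mul_apply, Module.End.mul_apply, ext_single, ext_single,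
    map_smul, map_smul, ext_emb_of_ne h ε ε' φ i _ (hψ (i.get y)),
    ext_emb_of_ne h.symm ε' ε ψ i _ (hφ (i.get x)), sum_smul_emb_comm h, smul_smul, smul_smul,
    smul_smul, ← pow_add, ← pow_add, ← pow_add]
  congr 1
  refine neg_one_pow_eq_of_even ?_
  rcases lt_or_gt_of_ne h with hlt | hlt
  · rw [if_pos hlt, if_neg hlt.asymm]
    exact ⟨ε' * signExp y i.2 + ε * signExp x i.2 + ε * ε', by ring⟩
  · rw [if_pos hlt, if_neg hlt.asymm]
    exact ⟨ε' * signExp y i.2 + ε * signExp x i.2 + ε * ε', by ring⟩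

theorem ext_anticomm_apply {x y : ι} (h : x ≠ y) {φ : Module.End R (Strand (m x) →₀ R)}
    {ψ : Module.End R (Strand (m y) →₀ R)} (hφ : Homog 1 φ) (hψ : Homog 1 ψ) (c : Cell m →₀ R) :
    ext x 1 φ (ext y 1 ψ c) = -ext y 1 ψ (ext x 1 φ c) := by
  have := LinearMap.congr_fun (ext_comm h hφ hψ) c
  simpa using this

/-! ### The differential on the tensor product -/

/-- The indices at which a basis element differs from `(none, 0)`. -/
def Cell.supp (i : Cell m) : Finset ι := i.1.2.toFinset ∪ i.2.support

theorem Cell.get_of_notMem_supp {i : Cell m} {x : ι} (h : x ∉ i.supp) : i.get x = (none, 0) := by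
  simp only [Cell.supp, Finset.mem_union, Set.Finite.mem_toFinset, Set.mem_ofPred_eq,
    Finsupp.mem_support_iff, not_or, not_not] at h
  exact Prod.ext h.1 h.2

theorem Cell.mem_supp_iff {i : Cell m} {x : ι} : x ∈ i.supp ↔ i.get x ≠ (none, 0) := by
  refine ⟨fun h h' => ?_, fun h => ?_⟩
  · simp only [Cell.supp, Finset.mem_union, Set.Finite.mem_toFinset, Set.mem_ofPred_eq,
      Finsupp.mem_support_iff] at h
    have h1 := (Prod.ext_iff.mp h').1
    have h2 := (Prod.ext_iff.mp h').2
    rcases h with h | h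
    · exact h h1
    · exact h h2
  · by_contra h'
    exact h (Cell.get_of_notMem_supp h')

theorem Cell.supp_upd_subset (i : Cell m) (x : ι) (t : Strand (m x)) :
    (i.upd x t).supp ⊆ insert x i.supp := by
  intro y hy
  by_cases h : y = x
  · simp [h]
  · refine Finset.mem_insert_of_mem ?_
    rw [Cell.mem_supp_iff, Cell.get_upd_of_ne h] at hy
    exact Cell.mem_supp_iff.mpr hy

variable [∀ x, NeZero (m x)]

variable (m R) in
/-- The differential of the periodic complex with coefficients in `𝒜_z`. -/
def dTot : Module.End R (Cell m →₀ R) :=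
  Finsupp.linearCombination R fun i => ∑ x ∈ i.supp, ext x 1 (sδ R (m x)) (Finsupp.single i 1)

theorem dTot_single (i : Cell m) {r : Finset ι} (hr : i.supp ⊆ r) :
    dTot m R (Finsupp.single i 1) =
      ∑ x ∈ r, ext x 1 (sδ R (m x)) (Finsupp.single i 1) := by
  rw [dTot, Finsupp.linearCombination_single, one_smul]
  refine Finset.sum_subset hr fun x _ hx => ?_
  have h : sδ R (m x) (Finsupp.single (none, 0) 1) = 0 := by
    have := sδ_nb (R := R) (k := m x) 0
    simpa [nb] using this
  rw [ext_single, Cell.get_of_notMem_supp hx, h, map_zero, smul_zero]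

theorem dTot_emb (x : ι) (i : Cell m) (s : Strand (m x) →₀ R) {r : Finset ι}
    (hr : insert x i.supp ⊆ r) :
    dTot m R (emb R x i s) = ∑ y ∈ r, ext y 1 (sδ R (m y)) (emb R x i s) := by
  simp only [emb_eq_sum, map_sum]
  rw [Finset.sum_comm]
  refine Finset.sum_congr rfl fun t _ => ?_
  have h1 : Finsupp.single (i.upd x t) (s t) = s t • Finsupp.single (i.upd x t) (1 : R) := by simp
  simp only [h1, map_smul]
  rw [dTot_single _ ((Cell.supp_upd_subset i x t).trans hr), Finset.smul_sum]

/-- The span of the basis elements of a tensor factor whose exponent has the same parity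
as `e`. -/
def par (R : Type*) [CommRing R] (k e : ℕ) : Submodule R (Strand k →₀ R) :=
  Finsupp.supported R R {t | Even (e + t.2)}

theorem sb_mem_par {k e v : ℕ} (i : ZMod k) (h : Even (e + v)) : sb R v i ∈ par R k e :=
  Finsupp.single_mem_supported R 1 h

theorem nb_mem_par {k e v : ℕ} (h : Even (e + v)) : nb R k v ∈ par R k e :=
  Finsupp.single_mem_supported R 1 h

theorem homog_of_basis {k ε : ℕ} {φ : Module.End R (Strand k →₀ R)}
    (hn : ∀ v, φ (nb R k v) ∈ par R k (v + ε)) (hs : ∀ v i, φ (sb R v i) ∈ par R k (v + ε)) :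
    Homog ε φ := by
  rintro ⟨_ | i, v⟩ t' ht'
  · have := (Finsupp.mem_supported R _).mp (hn v) ht'
    simp only [Set.mem_ofPred_eq] at this
    convert this using 1
    ring
  · have := (Finsupp.mem_supported R _).mp (hs v i) ht'
    simp only [Set.mem_ofPred_eq] at this
    convert this using 1
    ring

theorem homog_sδ (k : ℕ) [NeZero k] : Homog 1 (sδ R k) := by
  refine homog_of_basis (fun v => ?_) fun v i => ?_
  · rw [sδ_nb]
    split_ifs
    · exact Submodule.smul_mem _ _ (nb_mem_par ⟨_, rfl⟩)
    · exact Submodule.zero_mem _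
  · rw [sδ_sb]
    split_ifs
    · exact Submodule.sub_mem _ (sb_mem_par _ ⟨_, rfl⟩) (sb_mem_par _ ⟨_, rfl⟩)
    · exact Submodule.sum_mem _ fun _ _ => sb_mem_par _ ⟨_, rfl⟩

theorem homog_sθ (k : ℕ) [NeZero k] : Homog 1 (sθ R k) := by
  refine homog_of_basis (fun v => ?_) fun v i => ?_
  · rcases v with _ | v
    · rw [sθ_nb_zero]
      exact Submodule.zero_mem _
    · have h : Even (v + 1 + 1 + v) := ⟨v + 1, by ring⟩
      rw [sθ_nb_succ]
      split_ifs
      · exact sb_mem_par _ h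
      · exact Submodule.neg_mem _ (Submodule.sum_mem _ fun _ _ =>
          Submodule.smul_mem _ _ (sb_mem_par _ h))
  · rw [sθ_sb]
    exact Submodule.zero_mem _

theorem even_add_one_add_pred {v : ℕ} (h : v ≠ 0) : Even (v + 1 + (v - 1)) :=
  ⟨v, by omega⟩

theorem homog_sη (k : ℕ) [NeZero k] : Homog 1 (sη R k) := by
  refine homog_of_basis (fun v => ?_) fun v i => ?_
  · rw [sη_nb]
    split_ifs with h
    · exact nb_mem_par (even_add_one_add_pred h.pos.ne')
    · exact Submodule.zero_mem _
  · rw [sη_sb]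
    split_ifs with h
    · exact sb_mem_par _ (even_add_one_add_pred h.pos.ne')
    · exact Submodule.zero_mem _

theorem homog_sπ (k : ℕ) [NeZero k] : Homog 1 (sπ R k) := by
  refine homog_of_basis (fun v => ?_) fun v i => ?_
  · rw [sπ_nb]
    exact Submodule.zero_mem _
  · rw [sπ_sb]
    split_ifs <;> exact Submodule.smul_mem _ _ (nb_mem_par ⟨_, rfl⟩)

theorem homog_sS (k : ℕ) [NeZero k] : Homog 1 (sS R k) := by
  refine homog_of_basis (fun v => ?_) fun v i => ?_
  · rw [sS_nb]
    exact Submodule.zero_mem _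
  · rw [sS_sb]
    by_cases h : Odd v
    · have h' := even_add_one_add_pred h.pos.ne'
      rw [if_pos h]
      refine Submodule.add_mem _ (Submodule.sum_mem _ fun _ _ => sb_mem_par _ h') ?_
      split_ifs
      · exact Submodule.sum_mem _ fun _ _ => Submodule.smul_mem _ _ (sb_mem_par _ h')
      · exact Submodule.zero_mem _
    · rw [if_neg h]
      exact Submodule.zero_mem _

theorem homog_sh (k : ℕ) [NeZero k] : Homog 1 (sh R k) := by
  refine homog_of_basis (fun v => ?_) fun v i => ?_
  · simp only [sh, strandOp_nb]
    split_ifs with h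
    · exact nb_mem_par (even_add_one_add_pred h.2)
    · exact Submodule.zero_mem _
  · simp only [sh, strandOp_sb]
    exact Submodule.zero_mem _

theorem homog_sN (k : ℕ) [NeZero k] : Homog 0 (sN R k) := by
  refine homog_of_basis (fun v => ?_) fun v i => ?_
  · rw [sN_nb]
    exact Submodule.sum_mem _ fun _ _ => sb_mem_par _ ⟨_, rfl⟩
  · rw [sN_sb]
    exact Submodule.zero_mem _

theorem homog_sν (k : ℕ) [NeZero k] : Homog 0 (sν R k) := by
  refine homog_of_basis (fun v => ?_) fun v i => ?_
  · rw [sν_nb]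
    exact Submodule.zero_mem _
  · rw [sν_sb]
    split_ifs
    · exact nb_mem_par ⟨_, rfl⟩
    · exact Submodule.zero_mem _

theorem snone_nb (k : ℕ) [NeZero k] (v : ℕ) : snone R k (nb R k v) = nb R k v := by simp [snone]

theorem snone_sb (k : ℕ) [NeZero k] (v : ℕ) (i : ZMod k) : snone R k (sb R v i) = 0 := by
  simp [snone]

theorem homog_snone (k : ℕ) [NeZero k] : Homog 0 (snone R k) := by
  refine homog_of_basis (fun v => ?_) fun v i => ?_
  · rw [snone_nb]
    exact nb_mem_par ⟨_, rfl⟩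
  · rw [snone_sb]
    exact Submodule.zero_mem _

/-- The graded commutator of the differential with an operator on a tensor factor is given by the
graded commutator on this factor. -/
theorem dTot_ext (x : ι) {ε : ℕ} {φ : Module.End R (Strand (m x) →₀ R)} (hφ : Homog ε φ)
    (c : Cell m →₀ R) :
    dTot m R (ext x ε φ c) = (-1 : R) ^ ε • ext x ε φ (dTot m R c) +
      ext x (1 + ε) (sδ R (m x) * φ - (-1 : R) ^ ε • (φ * sδ R (m x))) c := by
  suffices h : dTot m R * ext x ε φ = (-1 : R) ^ ε • (ext x ε φ * dTot m R) +
      ext x (1 + ε) (sδ R (m x) * φ - (-1 : R) ^ ε • (φ * sδ R (m x))) from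
    LinearMap.congr_fun h c
  refine cell_ext fun i => ?_
  have hr : i.supp ⊆ insert x i.supp := Finset.subset_insert _ _
  rw [Module.End.mul_apply, LinearMap.add_apply, LinearMap.smul_apply, Module.End.mul_apply,
    dTot_single i hr, map_sum, ext_sub, ext_smul, ← ext_mul, add_comm 1 ε, ← ext_mul]
  have h1 : dTot m R (ext x ε φ (Finsupp.single i 1)) =
      ∑ y ∈ insert x i.supp, ext y 1 (sδ R (m y)) (ext x ε φ (Finsupp.single i 1)) := by
    rw [ext_single, map_smul, dTot_emb x i _ subset_rfl, Finset.smul_sum]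
    exact Finset.sum_congr rfl fun y _ => by rw [map_smul]
  have h2 : ∀ y ∈ insert x i.supp, y ≠ x → ext y 1 (sδ R (m y)) (ext x ε φ (Finsupp.single i 1)) =
      (-1 : R) ^ ε • ext x ε φ (ext y 1 (sδ R (m y)) (Finsupp.single i 1)) := by
    intro y _ hy
    have := LinearMap.congr_fun (ext_comm hy (homog_sδ (m y)) hφ) (Finsupp.single i 1)
    rw [one_mul] at this
    exact this
  rw [h1, ← Finset.add_sum_erase _ _ (Finset.mem_insert_self x i.supp),
    ← Finset.add_sum_erase (a := x) (f := fun y => ext x ε φ (ext y 1 (sδ R (m y))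
      (Finsupp.single i 1))) _ (Finset.mem_insert_self x i.supp),
    Finset.sum_congr rfl fun y hy =>
      h2 y (Finset.mem_of_mem_erase hy) (Finset.ne_of_mem_erase hy), ← Finset.smul_sum,
    LinearMap.sub_apply, LinearMap.smul_apply, Module.End.mul_apply, Module.End.mul_apply]
  module

theorem dTot_dTot (c : Cell m →₀ R) : dTot m R (dTot m R c) = 0 := by
  suffices h : dTot m R * dTot m R = 0 from LinearMap.congr_fun h c
  refine cell_ext fun i => ?_
  rw [Module.End.mul_apply, LinearMap.zero_apply, dTot_single i subset_rfl, map_sum]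
  have h : ∀ y ∈ i.supp, dTot m R (ext y 1 (sδ R (m y)) (Finsupp.single i 1)) =
      ∑ x ∈ i.supp, ext x 1 (sδ R (m x)) (ext y 1 (sδ R (m y)) (Finsupp.single i 1)) := by
    intro y hy
    rw [ext_single, map_smul, dTot_emb y i _ (Finset.insert_eq_of_mem hy).subset, Finset.smul_sum]
    exact Finset.sum_congr rfl fun x _ => by rw [map_smul]
  rw [Finset.sum_congr rfl h]
  refine sum_sum_eq_zero_of_antisymm i.supp _ (fun x => ?_) fun x y hxy => ?_
  · rw [← Module.End.mul_apply, ext_mul, sδ_mul_sδ, ext_zero, LinearMap.zero_apply]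
  · exact ext_anticomm_apply hxy.symm (homog_sδ (m y)) (homog_sδ (m x)) _

/-! ### The group action on the tensor product -/

/-- The action of the group on the symbols. -/
def Symb.act (g : Torus m) (a : Symb m) : Symb m :=
  ⟨fun x => (a.1 x).map (· + (g x).toAdd), a.2.subset fun x hx h => hx (by simp [h])⟩

theorem Symb.act_one (a : Symb m) : a.act 1 = a := by
  refine Subtype.ext (funext fun x => ?_)
  change (a.1 x).map (· + (0 : ZMod (m x))) = a.1 x
  simp

theorem Symb.act_mul (g h : Torus m) (a : Symb m) : a.act (g * h) = (a.act h).act g := by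
  refine Subtype.ext (funext fun x => ?_)
  change (a.1 x).map (· + ((g x).toAdd + (h x).toAdd)) =
    ((a.1 x).map (· + (h x).toAdd)).map (· + (g x).toAdd)
  rcases a.1 x with _ | i
  · rfl
  · simp only [Option.map_some]
    congr 1
    ring

theorem Symb.act_apply_of_eq_one {g : Torus m} {x : ι} (h : g x = 1) (a : Symb m) :
    (a.act g).1 x = a.1 x := by
  change (a.1 x).map (· + (g x).toAdd) = a.1 x
  rw [h]
  simp

theorem Symb.act_eq_none_iff {g : Torus m} {x : ι} (a : Symb m) :
    (a.act g).1 x = none ↔ a.1 x = none :=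
  Option.map_eq_none_iff

variable (m R) in
/-- The linear action of the group on the free module on the symbols. -/
def repSymb : Representation R (Torus m) (Symb m →₀ R) where
  toFun g := Finsupp.lmapDomain R R (Symb.act g)
  map_one' := by
    rw [funext Symb.act_one]
    exact Finsupp.lmapDomain_id R R
  map_mul' g h := by
    rw [funext (Symb.act_mul g h)]
    exact Finsupp.lmapDomain_comp R R (Symb.act h) (Symb.act g)

@[simp] theorem repSymb_single (g : Torus m) (a : Symb m) (r : R) :
    repSymb m R g (Finsupp.single a r) = Finsupp.single (a.act g) r := by
  simp [repSymb]

/-- The action of the group on the basis of the tensor product. -/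
def Cell.act (g : Torus m) (i : Cell m) : Cell m := (i.1.act g, i.2)

theorem Cell.act_one (i : Cell m) : i.act 1 = i := by
  rw [Cell.act, Symb.act_one]

theorem Cell.act_mul (g h : Torus m) (i : Cell m) : i.act (g * h) = (i.act h).act g := by
  rw [Cell.act, Symb.act_mul]
  rfl

variable (m R) in
/-- The linear action of the group on the tensor product. -/
def repCell : Representation R (Torus m) (Cell m →₀ R) where
  toFun g := Finsupp.lmapDomain R R (Cell.act g)
  map_one' := by
    rw [funext Cell.act_one]
    exact Finsupp.lmapDomain_id R R
  map_mul' g h := by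
    rw [funext (Cell.act_mul g h)]
    exact Finsupp.lmapDomain_comp R R (Cell.act h) (Cell.act g)

@[simp] theorem repCell_single (g : Torus m) (i : Cell m) (r : R) :
    repCell m R g (Finsupp.single i r) = Finsupp.single (i.act g) r := by
  simp [repCell]

theorem Cell.act_upd (g : Torus m) (x : ι) (i : Cell m) (t : Strand (m x)) :
    (i.upd x t).act g = (i.act g).upd x (t.1.map (· + (g x).toAdd), t.2) := by
  refine Cell.ext' fun y => ?_
  by_cases h : y = x
  · subst h
    rw [Cell.get_upd]
    change (((i.upd y t).get y).1.map _, ((i.upd y t).get y).2) = _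
    rw [Cell.get_upd]
  · rw [Cell.get_upd_of_ne h]
    change (((i.upd x t).get y).1.map _, ((i.upd x t).get y).2) = ((i.get y).1.map _, (i.get y).2)
    rw [Cell.get_upd_of_ne h]

theorem repCell_emb (g : Torus m) (x : ι) (i : Cell m) (s : Strand (m x) →₀ R) :
    repCell m R g (emb R x i s) = emb R x (i.act g) (sact R (g x).toAdd s) := by
  suffices h : repCell m R g ∘ₗ emb R x i = emb R x (i.act g) ∘ₗ sact R (g x).toAdd from
    LinearMap.congr_fun h s
  refine Finsupp.lhom_ext' fun t => LinearMap.ext_ring ?_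
  simp [Cell.act_upd, sact]

/-- An endomorphism of a tensor factor that commutes with the cyclic group. -/
def Equivar {k : ℕ} (φ : Module.End R (Strand k →₀ R)) : Prop := ∀ j, Commute φ (sact R j)

theorem commute_ext_repCell {x : ι} (ε : ℕ) {φ : Module.End R (Strand (m x) →₀ R)}
    (hφ : Equivar φ) (g : Torus m) : Commute (ext x ε φ) (repCell m R g) := by
  refine cell_ext fun i => ?_
  rw [Module.End.mul_apply, Module.End.mul_apply, repCell_single, ext_single, ext_single, map_smul,
    repCell_emb, ← Module.End.mul_apply, ← (hφ _).eq, Module.End.mul_apply]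
  congr 3
  simp [sact, Cell.act, Cell.get, Symb.act]

theorem repCell_torusSingle (x : ι) :
    repCell m R (torusSingle m x 1) = ext x 0 (sact R (1 : ZMod (m x))) := by
  refine cell_ext fun i => ?_
  rw [repCell_single, ext_single, zero_mul, pow_zero, one_smul, sact, strandOp_single, one_smul,
    emb_single]
  congr 1
  refine Cell.ext' fun y => ?_
  by_cases h : y = x
  · subst h
    rw [Cell.get_upd]
    refine Prod.ext ?_ rfl
    simp [Cell.get, Cell.act, Symb.act, torusSingle]
  · rw [Cell.get_upd_of_ne h]
    refine Prod.ext (Symb.act_apply_of_eq_one ?_ i.1) rfl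
    simp [torusSingle, h]

theorem equivar_of_basis {k : ℕ} [NeZero k] {φ : Module.End R (Strand k →₀ R)}
    (hn : ∀ j v, φ (nb R k v) = sact R j (φ (nb R k v)))
    (hs : ∀ j v i, φ (sb R v (i + j)) = sact R j (φ (sb R v i))) : Equivar φ := fun j =>
  strand_ext' (fun v => by simpa [sact_nb] using hn j v) fun v i => by
    simpa [sact_sb] using hs j v i

theorem sact_sum_sb {k : ℕ} [NeZero k] (j : ZMod k) (v : ℕ) :
    sact R j (∑ i, sb R v i) = ∑ i, sb R v i := by
  rw [map_sum]
  simp only [sact_sb]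
  exact Fintype.sum_equiv (Equiv.addRight j) _ _ fun _ => rfl

theorem equivar_sδ (k : ℕ) [NeZero k] : Equivar (sδ R k) := by
  refine equivar_of_basis (fun j v => ?_) fun j v i => ?_
  · rw [sδ_nb]
    split_ifs <;> simp [sact_nb]
  · rw [sδ_sb, sδ_sb]
    split_ifs
    · rw [map_sub, sact_sb, sact_sb, add_right_comm]
    · rw [sact_sum_sb]

theorem equivar_sN (k : ℕ) [NeZero k] : Equivar (sN R k) := by
  refine equivar_of_basis (fun j v => ?_) fun j v i => ?_
  · rw [sN_nb, sact_sum_sb]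
  · rw [sN_sb, sN_sb, map_zero]

theorem equivar_sη (k : ℕ) [NeZero k] : Equivar (sη R k) := by
  refine equivar_of_basis (fun j v => ?_) fun j v i => ?_
  · rw [sη_nb]
    split_ifs <;> simp [sact_nb]
  · rw [sη_sb, sη_sb]
    split_ifs <;> simp [sact_sb]

theorem equivar_snone (k : ℕ) [NeZero k] : Equivar (snone R k) := by
  refine equivar_of_basis (fun j v => ?_) fun j v i => ?_
  · rw [snone_nb, sact_nb]
  · rw [snone_sb, snone_sb, map_zero]

theorem commute_dTot_repCell (g : Torus m) : Commute (dTot m R) (repCell m R g) := by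
  refine cell_ext fun i => ?_
  have h : (i.act g).supp ⊆ i.supp := fun x hx => by
    by_contra h'
    have h2 := Cell.get_of_notMem_supp h'
    refine Cell.mem_supp_iff.mp hx (Prod.ext ?_ (Prod.ext_iff.mp h2).2)
    exact (Symb.act_eq_none_iff i.1).mpr (Prod.ext_iff.mp h2).1
  rw [Module.End.mul_apply, Module.End.mul_apply, repCell_single, dTot_single _ h,
    dTot_single _ subset_rfl, map_sum]
  refine Finset.sum_congr rfl fun x _ => ?_
  have := LinearMap.congr_fun (commute_ext_repCell 1 (equivar_sδ (R := R) (m x)) g).eq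
    (Finsupp.single i 1)
  simpa using this

end Cells

/-! ### The relations and the filtration by the number of primes in a symbol -/

section Relations

set_option linter.unusedSectionVars false

variable {ι : Type*} [LinearOrder ι] {m : ι → ℕ} {R : Type*} [CommRing R]

theorem commute_ext_of_ne {x y : ι} (h : x ≠ y) {ε : ℕ} {φ : Module.End R (Strand (m x) →₀ R)}
    {ψ : Module.End R (Strand (m y) →₀ R)} (hφ : Homog ε φ) (hψ : Homog 0 ψ) :
    Commute (ext x ε φ) (ext y 0 ψ) := by
  have := ext_comm h hφ hψ
  rwa [mul_zero, pow_zero, one_smul] at this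

theorem commute_ext_same {x : ι} {ε ε' : ℕ} {φ ψ : Module.End R (Strand (m x) →₀ R)}
    (h : Commute φ ψ) : Commute (ext x ε φ) (ext x ε' ψ) := by
  rw [Commute, SemiconjBy, ext_mul, ext_mul, h.eq, add_comm]

/-- The projection to the span of the basis elements that satisfy `P`. -/
def cut (R : Type*) [CommRing R] (P : Cell m → Prop) : Module.End R (Cell m →₀ R) :=
  open Classical in Finsupp.linearCombination R fun i => if P i then Finsupp.single i 1 else 0

theorem cut_single_of_pos {P : Cell m → Prop} {i : Cell m} (h : P i) :
    cut R P (Finsupp.single i 1) = Finsupp.single i 1 := by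
  simp [cut, h]

theorem cut_single_of_neg {P : Cell m → Prop} {i : Cell m} (h : ¬ P i) :
    cut R P (Finsupp.single i 1) = 0 := by
  simp [cut, h]

theorem cut_apply_of_pos {P : Cell m → Prop} {i : Cell m} (h : P i) (c : Cell m →₀ R) :
    cut R P c i = c i := by
  classical
  suffices h : Finsupp.lapply i ∘ₗ cut R P = Finsupp.lapply i from LinearMap.congr_fun h c
  refine cell_ext fun j => ?_
  simp only [LinearMap.comp_apply, Finsupp.lapply_apply]
  by_cases hj : P j
  · rw [cut_single_of_pos hj]
  · have : j ≠ i := fun hji => hj (hji ▸ h)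
    rw [cut_single_of_neg hj, Finsupp.single_eq_of_ne this.symm, Finsupp.zero_apply]

theorem cut_apply_of_neg {P : Cell m → Prop} {i : Cell m} (h : ¬ P i) (c : Cell m →₀ R) :
    cut R P c i = 0 := by
  suffices h : Finsupp.lapply i ∘ₗ cut R P = 0 from LinearMap.congr_fun h c
  refine cell_ext fun j => ?_
  simp only [LinearMap.comp_apply, Finsupp.lapply_apply, LinearMap.zero_apply]
  by_cases hj : P j
  · have : j ≠ i := fun hji => h (hji ▸ hj)
    rw [cut_single_of_pos hj, Finsupp.single_eq_of_ne this.symm]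
  · rw [cut_single_of_neg hj, Finsupp.zero_apply]

theorem cut_eq_self_iff {P : Cell m → Prop} {c : Cell m →₀ R} :
    cut R P c = c ↔ c ∈ Finsupp.supported R R {i | P i} := by
  rw [Finsupp.mem_supported']
  refine ⟨fun h i hi => ?_, fun h => Finsupp.ext fun i => ?_⟩
  · have h1 : cut R P c i = 0 := cut_apply_of_neg hi c
    rwa [h] at h1
  · by_cases hi : P i
    · rw [cut_apply_of_pos hi]
    · rw [cut_apply_of_neg hi, h i hi]

theorem cut_mem {P : Cell m → Prop} (c : Cell m →₀ R) :
    cut R P c ∈ Finsupp.supported R R {i | P i} := by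
  rw [Finsupp.mem_supported']
  exact fun i hi => cut_apply_of_neg hi c

theorem cut_eq_zero {P Q : Cell m → Prop} {c : Cell m →₀ R}
    (hc : c ∈ Finsupp.supported R R {i | Q i}) (h : ∀ i, Q i → ¬ P i) : cut R P c = 0 := by
  rw [Finsupp.mem_supported'] at hc
  refine Finsupp.ext fun i => ?_
  by_cases hi : P i
  · rw [cut_apply_of_pos hi, hc i fun hq => h i hq hi, Finsupp.zero_apply]
  · rw [cut_apply_of_neg hi, Finsupp.zero_apply]

theorem ext_mem_supported {x : ι} {ε : ℕ} {φ : Module.End R (Strand (m x) →₀ R)}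
    {S S' : Set (Cell m)}
    (h : ∀ i ∈ S, ∀ t ∈ (φ (Finsupp.single (i.get x) 1)).support, i.upd x t ∈ S')
    {c : Cell m →₀ R} (hc : c ∈ Finsupp.supported R R S) :
    ext x ε φ c ∈ Finsupp.supported R R S' := by
  rw [Finsupp.supported_eq_span_single] at hc
  induction hc using Submodule.span_induction with
  | zero => simp
  | add _ _ _ _ h1 h2 => rw [map_add]; exact Submodule.add_mem _ h1 h2
  | smul r _ _ h1 => rw [map_smul]; exact Submodule.smul_mem _ _ h1
  | mem _ hi =>
    obtain ⟨i, hi, rfl⟩ := hi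
    rw [ext_single, emb_eq_sum]
    exact Submodule.smul_mem _ _ (Submodule.sum_mem _ fun t ht =>
      Finsupp.single_mem_supported R _ (h i hi t ht))

theorem cut_mul_ext {x : ι} {ε : ℕ} {φ : Module.End R (Strand (m x) →₀ R)} {P Q : Cell m → Prop}
    (h : ∀ i, ∀ t ∈ (φ (Finsupp.single (i.get x) 1)).support, P (i.upd x t) ↔ Q i) :
    cut R P * ext x ε φ = ext x ε φ * cut R Q := by
  refine cell_ext fun i => ?_
  rw [Module.End.mul_apply, Module.End.mul_apply]
  have hi : (Finsupp.single i (1 : R)) ∈ Finsupp.supported R R {i} :=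
    Finsupp.single_mem_supported R _ rfl
  by_cases hQ : Q i
  · rw [cut_single_of_pos hQ, cut_eq_self_iff]
    refine ext_mem_supported (fun j hj t ht => ?_) hi
    obtain rfl : j = i := hj
    exact (h j t ht).mpr hQ
  · rw [cut_single_of_neg hQ, map_zero]
    refine cut_eq_zero (Q := fun i => ¬ P i) (ext_mem_supported (fun j hj t ht => ?_) hi)
      fun _ h => h
    obtain rfl : j = i := hj
    exact fun hP => hQ ((h j t ht).mp hP)

/-- The set of `x` that divide the symbol of a basis element. -/
def Cell.somes (i : Cell m) : Finset ι := i.1.2.toFinset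

theorem Cell.mem_somes {i : Cell m} {x : ι} : x ∈ i.somes ↔ (i.get x).1 ≠ none := by
  simp [Cell.somes, Cell.get]

theorem Cell.mem_somes_upd {i : Cell m} {x y : ι} {t : Strand (m x)} :
    y ∈ (i.upd x t).somes ↔ (y = x ∧ t.1 ≠ none) ∨ (y ≠ x ∧ y ∈ i.somes) := by
  by_cases h : y = x
  · subst h
    simp [Cell.mem_somes, Cell.get_upd]
  · simp [Cell.mem_somes, Cell.get_upd_of_ne h, h]

theorem Cell.somes_upd_of_iff {i : Cell m} {x : ι} {t : Strand (m x)}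
    (h : t.1 = none ↔ (i.get x).1 = none) : (i.upd x t).somes = i.somes := by
  ext y
  rw [Cell.mem_somes_upd]
  by_cases hy : y = x
  · subst hy
    simp [Cell.mem_somes, h]
  · simp [hy]

theorem Cell.somes_upd_some {i : Cell m} {x : ι} {t : Strand (m x)} (h : t.1 ≠ none) :
    (i.upd x t).somes = insert x i.somes := by
  ext y
  rw [Cell.mem_somes_upd, Finset.mem_insert]
  by_cases hy : y = x <;> simp [hy, h]

theorem Cell.somes_upd_none {i : Cell m} {x : ι} {t : Strand (m x)} (h : t.1 = none) :
    (i.upd x t).somes = i.somes.erase x := by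
  ext y
  rw [Cell.mem_somes_upd, Finset.mem_erase]
  simp [h]

variable [∀ x, NeZero (m x)]

theorem Cell.somes_act (g : Torus m) (i : Cell m) : (i.act g).somes = i.somes := by
  ext x
  rw [Cell.mem_somes, Cell.mem_somes]
  exact not_congr (Symb.act_eq_none_iff i.1)

theorem cut_comm_rep {P : Cell m → Prop} (hP : ∀ g i, P (Cell.act g i) ↔ P i)
    (g : Torus m) : Commute (cut R P) (repCell m R g) := by
  refine cell_ext fun i => ?_
  rw [Module.End.mul_apply, Module.End.mul_apply, repCell_single]
  by_cases h : P i
  · rw [cut_single_of_pos h, cut_single_of_pos ((hP g i).mpr h), repCell_single]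
  · rw [cut_single_of_neg h, cut_single_of_neg fun h' => h ((hP g i).mp h'), map_zero]

theorem support_subset_of_mem {k : ℕ} {P : Strand k → Prop} {s : Strand k →₀ R}
    (h : s ∈ Finsupp.supported R R {t | P t}) : ∀ t ∈ s.support, P t :=
  fun _ ht => (Finsupp.mem_supported R s).mp h ht

theorem sb_mem {k : ℕ} {S : Set (Strand k)} {v : ℕ} {i : ZMod k} (h : (some i, v) ∈ S) :
    sb R v i ∈ Finsupp.supported R R S :=
  Finsupp.single_mem_supported R 1 h

theorem nb_mem {k : ℕ} {S : Set (Strand k)} {v : ℕ} (h : (none, v) ∈ S) :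
    nb R k v ∈ Finsupp.supported R R S :=
  Finsupp.single_mem_supported R 1 h

theorem sN_location {k : ℕ} [NeZero k] (t : Strand k) :
    ∀ t' ∈ (sN R k (Finsupp.single t 1)).support, t.1 = none ∧ t'.1 ≠ none := by
  refine support_subset_of_mem ?_
  obtain ⟨_ | i, v⟩ := t
  · exact (sN_nb (R := R) (k := k) v).symm ▸
      Submodule.sum_mem _ fun j _ => sb_mem ⟨rfl, Option.some_ne_none j⟩
  · exact (sN_sb (R := R) v i).symm ▸ Submodule.zero_mem _

theorem sθ_location {k : ℕ} [NeZero k] (t : Strand k) :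
    ∀ t' ∈ (sθ R k (Finsupp.single t 1)).support, t.1 = none ∧ t'.1 ≠ none := by
  refine support_subset_of_mem ?_
  obtain ⟨_ | i, _ | v⟩ := t
  · exact (sθ_nb_zero (R := R) (k := k)).symm ▸ Submodule.zero_mem _
  · refine (sθ_nb_succ (R := R) (k := k) v).symm ▸ ?_
    split_ifs
    · exact sb_mem ⟨rfl, Option.some_ne_none _⟩
    · exact Submodule.neg_mem _ (Submodule.sum_mem _ fun j _ =>
        Submodule.smul_mem _ _ (sb_mem ⟨rfl, Option.some_ne_none j⟩))
  · exact (sθ_sb (R := R) 0 i).symm ▸ Submodule.zero_mem _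
  · exact (sθ_sb (R := R) (v + 1) i).symm ▸ Submodule.zero_mem _

theorem sν_location {k : ℕ} [NeZero k] (t : Strand k) :
    ∀ t' ∈ (sν R k (Finsupp.single t 1)).support, t.1 ≠ none ∧ t'.1 = none := by
  refine support_subset_of_mem ?_
  obtain ⟨_ | i, v⟩ := t
  · exact (sν_nb (R := R) (k := k) v).symm ▸ Submodule.zero_mem _
  · refine (sν_sb (R := R) v i).symm ▸ ?_
    split_ifs
    · exact nb_mem ⟨Option.some_ne_none i, rfl⟩
    · exact Submodule.zero_mem _

theorem sη_location {k : ℕ} [NeZero k] (t : Strand k) :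
    ∀ t' ∈ (sη R k (Finsupp.single t 1)).support, t'.1 = none ↔ t.1 = none := by
  refine support_subset_of_mem ?_
  obtain ⟨_ | i, v⟩ := t
  · refine (sη_nb (R := R) (k := k) v).symm ▸ ?_
    split_ifs
    · exact nb_mem Iff.rfl
    · exact Submodule.zero_mem _
  · refine (sη_sb (R := R) v i).symm ▸ ?_
    split_ifs
    · exact sb_mem (by simp)
    · exact Submodule.zero_mem _

theorem sδ_location {k : ℕ} [NeZero k] (t : Strand k) :
    ∀ t' ∈ (sδ R k (Finsupp.single t 1)).support, t'.1 = none ↔ t.1 = none := by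
  refine support_subset_of_mem ?_
  obtain ⟨_ | i, v⟩ := t
  · refine (sδ_nb (R := R) (k := k) v).symm ▸ ?_
    split_ifs
    · exact Submodule.smul_mem _ _ (nb_mem Iff.rfl)
    · exact Submodule.zero_mem _
  · refine (sδ_sb (R := R) v i).symm ▸ ?_
    split_ifs
    · exact Submodule.sub_mem _ (sb_mem (by simp)) (sb_mem (by simp))
    · exact Submodule.sum_mem _ fun j _ => sb_mem (by simp)

theorem snone_location {k : ℕ} [NeZero k] (t : Strand k) :
    ∀ t' ∈ (snone R k (Finsupp.single t 1)).support, t.1 = none ∧ t' = t := by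
  refine support_subset_of_mem ?_
  obtain ⟨_ | i, v⟩ := t
  · exact (snone_nb (R := R) k v).symm ▸ nb_mem ⟨rfl, rfl⟩
  · exact (snone_sb (R := R) k v i).symm ▸ Submodule.zero_mem _

variable (m R) in
/-- The norm map `[z'] ↦ N_{z(x)} [z(x) z']`. -/
def normC (x : ι) : Module.End R (Cell m →₀ R) := ext x 0 (sN R (m x))

variable (m R) in
/-- The projection to the part of the symbols not divisible by `x`. -/
def noneC (x : ι) : Module.End R (Cell m →₀ R) := ext x 0 (snone R (m x))

variable (m R) in
/-- The projection to the part of the symbols divisible by `x`. -/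
def someC (x : ι) : Module.End R (Cell m →₀ R) := ext x 0 (ssome R (m x))

variable (m R) in
/-- The projection to the part of the symbols not divisible by `x`, with positive exponent of `x`
in the periodic complex. -/
def posC (x : ι) : Module.End R (Cell m →₀ R) := ext x 0 (sq R (m x))

theorem noneC_eq_cut (x : ι) : noneC m R x = cut R fun i => x ∉ i.somes := by
  refine cell_ext fun i => ?_
  have h0 : noneC m R x (Finsupp.single i 1) =
      emb R x i (snone R (m x) (Finsupp.single (i.get x) 1)) := by
    rw [noneC, ext_single, zero_mul, pow_zero, one_smul]
  rw [h0]
  rcases h : (i.get x).1 with _ | j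
  · have h1 : i.get x = (none, (i.get x).2) := Prod.ext h rfl
    have h2 := snone_nb (R := R) (m x) (i.get x).2
    rw [cut_single_of_pos (by simp [Cell.mem_somes, h]), h1]
    change emb R x i (snone R (m x) (nb R (m x) (i.get x).2)) = _
    rw [h2, nb, ← h1, emb_single, Cell.upd_get]
  · have h1 : i.get x = (some j, (i.get x).2) := Prod.ext h rfl
    have h2 := snone_sb (R := R) (m x) (i.get x).2 j
    rw [cut_single_of_neg (by simp [Cell.mem_somes, h]), h1]
    change emb R x i (snone R (m x) (sb R (i.get x).2 j)) = _
    rw [h2, map_zero]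

theorem noneC_eq_self_iff {x : ι} {c : Cell m →₀ R} :
    noneC m R x c = c ↔ c ∈ Finsupp.supported R R {i : Cell m | x ∉ i.somes} := by
  rw [noneC_eq_cut, cut_eq_self_iff]

theorem noneC_add_someC (x : ι) : noneC m R x + someC m R x = 1 := by
  rw [noneC, someC, ← ext_add, ← ext_one]
  congr 1
  refine strand_ext' (fun v => ?_) fun v i => ?_
  · simp [snone_nb, ssome_nb]
  · simp [snone_sb, ssome_sb]

theorem someC_eq_self {x : ι} {c : Cell m →₀ R}
    (hc : c ∈ Finsupp.supported R R {i : Cell m | x ∈ i.somes}) : someC m R x c = c := by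
  have h1 : noneC m R x c = 0 := by
    rw [noneC_eq_cut]
    exact cut_eq_zero hc fun i hi => not_not.mpr hi
  have h2 := LinearMap.congr_fun (noneC_add_someC (R := R) (m := m) x) c
  rwa [LinearMap.add_apply, h1, zero_add, Module.End.one_apply] at h2

theorem noneC_posC (x : ι) : noneC m R x * posC m R x = posC m R x := by
  rw [noneC, posC, ext_mul]
  congr 1
  refine strand_ext' (fun v => ?_) fun v i => ?_
  · rw [Module.End.mul_apply, sq_nb]
    split_ifs <;> simp [snone_nb]
  · rw [Module.End.mul_apply, sq_sb, map_zero]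

theorem noneC_of_posC {x : ι} {c : Cell m →₀ R} (h : posC m R x c = c) : noneC m R x c = c := by
  rw [← h, ← Module.End.mul_apply, noneC_posC]

theorem noneC_mul_noneC (x : ι) : noneC m R x * noneC m R x = noneC m R x := by
  rw [noneC, ext_mul]
  congr 1
  refine strand_ext' (fun v => ?_) fun v i => ?_
  · rw [Module.End.mul_apply, snone_nb, snone_nb]
  · rw [Module.End.mul_apply, snone_sb, map_zero]

theorem normC_mul_noneC (x : ι) : normC m R x * noneC m R x = normC m R x := by
  rw [normC, noneC, ext_mul]
  congr 1
  refine strand_ext' (fun v => ?_) fun v i => ?_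
  · rw [Module.End.mul_apply, snone_nb]
  · rw [Module.End.mul_apply, snone_sb, map_zero, sN_sb]

variable (φ : ι → Torus m) (p : ι → Polynomial R)

/-- The operator `p (x; Fr_x⁻¹)`, where `φ x` is the image of `Fr_x⁻¹`. -/
def frobC (x : ι) : Module.End R (Cell m →₀ R) :=
  Polynomial.aeval (repCell m R (φ x)) (p x)

/-- The operator `λ_{z(x)}`. -/
def relC (x : ι) : Module.End R (Cell m →₀ R) :=
  frobC φ p x * noneC m R x - normC m R x

/-- The submodule spanned by the relations. -/
def relMod : Submodule R (Cell m →₀ R) := ⨆ x, LinearMap.range (relC φ p x)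

variable {φ p}

theorem relC_mem (x : ι) (c : Cell m →₀ R) : relC φ p x c ∈ relMod φ p :=
  Submodule.mem_iSup_of_mem x (LinearMap.mem_range_self _ c)

theorem commute_aeval {A B : Module.End R (Cell m →₀ R)} (h : Commute A B) (q : Polynomial R) :
    Commute A (Polynomial.aeval B q) := by
  induction q using Polynomial.induction_on' with
  | add q r hq hr => simpa using hq.add_right hr
  | monomial n t =>
    rw [Polynomial.aeval_monomial]
    exact (Algebra.commute_algebraMap_right t _).mul_right (h.pow_right n)

/-- The operators that commute with the group action. -/
def EquivarC (A : Module.End R (Cell m →₀ R)) : Prop := ∀ g, Commute A (repCell m R g)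

theorem EquivarC.commute_frobC {A : Module.End R (Cell m →₀ R)} (h : EquivarC A) (x : ι) :
    Commute A (frobC φ p x) := commute_aeval (h (φ x)) _

theorem equivarC_rep (g : Torus m) : EquivarC (repCell m R g) := fun h =>
  LinearMap.ext fun c => rep_comm (repCell m R) g h c

theorem equivarC_frobC (x : ι) : EquivarC (frobC φ p x) := fun g =>
  ((equivarC_rep g).commute_frobC x).symm

theorem equivarC_normC (x : ι) : EquivarC (normC m R x) := commute_ext_repCell 0 (equivar_sN _)

theorem equivarC_noneC (x : ι) : EquivarC (noneC m R x) := commute_ext_repCell 0 (equivar_snone _)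

theorem equivarC_dTot : EquivarC (dTot m R) := commute_dTot_repCell

theorem commute_sub_right {A B C : Module.End R (Cell m →₀ R)} (h1 : Commute A B)
    (h2 : Commute A C) : Commute A (B - C) := by
  refine LinearMap.ext fun c => ?_
  have h3 := LinearMap.congr_fun h1.eq c
  have h4 := LinearMap.congr_fun h2.eq c
  simp only [Module.End.mul_apply, LinearMap.sub_apply, map_sub] at h3 h4 ⊢
  rw [h3, h4]

theorem commute_sub_left {A B C : Module.End R (Cell m →₀ R)} (h1 : Commute B A)
    (h2 : Commute C A) : Commute (B - C) A := (commute_sub_right h1.symm h2.symm).symm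

theorem commute_relC {A : Module.End R (Cell m →₀ R)} (h : EquivarC A) {x : ι}
    (h1 : Commute A (noneC m R x)) (h2 : Commute A (normC m R x)) : Commute A (relC φ p x) :=
  commute_sub_right ((h.commute_frobC x).mul_right h1) h2

theorem relMod_le_comap {A : Module.End R (Cell m →₀ R)} (h : ∀ x, Commute A (relC φ p x)) :
    relMod φ p ≤ (relMod φ p).comap A := by
  refine iSup_le fun x => ?_
  rintro _ ⟨c, rfl⟩
  rw [Submodule.mem_comap, ← Module.End.mul_apply, (h x).eq]
  exact relC_mem x _

theorem commute_dTot_ext {x : ι} {φ : Module.End R (Strand (m x) →₀ R)} (hφ : Homog 0 φ)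
    (h : Commute (sδ R (m x)) φ) : Commute (dTot m R) (ext x 0 φ) := by
  refine LinearMap.ext fun c => ?_
  have := dTot_ext x hφ c
  rwa [pow_zero, one_smul, one_smul, h.eq, show φ * sδ R (m x) - φ * sδ R (m x) = 0 from
    sub_self (G := Module.End R (Strand (m x) →₀ R)) _, ext_zero, LinearMap.zero_apply,
    add_zero] at this

theorem commute_sδ_snone (k : ℕ) [NeZero k] : Commute (sδ R k) (snone R k) := by
  refine strand_ext' (fun v => ?_) fun v i => ?_
  · simp only [Module.End.mul_apply, snone_nb, sδ_nb]
    split_ifs <;> simp [snone_nb]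
  · simp only [Module.End.mul_apply, snone_sb, sδ_sb]
    split_ifs <;> simp [snone_sb]

theorem commute_sη_snone (k : ℕ) [NeZero k] : Commute (sη R k) (snone R k) := by
  refine strand_ext' (fun v => ?_) fun v i => ?_
  · simp only [Module.End.mul_apply, snone_nb, sη_nb]
    split_ifs <;> simp [snone_nb]
  · simp only [Module.End.mul_apply, snone_sb, sη_sb]
    split_ifs <;> simp [snone_sb]

theorem commute_sη_sN (k : ℕ) [NeZero k] : Commute (sη R k) (sN R k) := by
  refine strand_ext' (fun v => ?_) fun v i => ?_
  · simp only [Module.End.mul_apply, sN_nb, sη_nb, map_sum, sη_sb]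
    split_ifs <;> simp [sN_nb]
  · simp only [Module.End.mul_apply, sN_sb, sη_sb]
    split_ifs <;> simp [sN_sb]

theorem commute_dTot_normC (x : ι) : Commute (dTot m R) (normC m R x) :=
  commute_dTot_ext (homog_sN _) sδ_mul_sN

theorem commute_dTot_noneC (x : ι) : Commute (dTot m R) (noneC m R x) :=
  commute_dTot_ext (homog_snone _) (commute_sδ_snone _)

theorem dTot_mem_relMod {c : Cell m →₀ R} (hc : c ∈ relMod φ p) : dTot m R c ∈ relMod φ p :=
  relMod_le_comap (fun x => commute_relC equivarC_dTot (commute_dTot_noneC x)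
    (commute_dTot_normC x)) hc

theorem commute_noneC_noneC (x y : ι) : Commute (noneC m R x) (noneC m R y) := by
  by_cases h : x = y
  · subst h
    exact Commute.refl _
  · exact commute_ext_of_ne h (homog_snone _) (homog_snone _)

theorem commute_relC_relC {x y : ι} (h : x ≠ y) : Commute (relC φ p x) (relC φ p y) := by
  have h1 : EquivarC (relC φ p x) := fun g =>
    commute_sub_left ((equivarC_frobC x g).mul_left (equivarC_noneC x g)) (equivarC_normC x g)
  have h2 : Commute (frobC φ p x * noneC m R x - normC m R x) (noneC m R y) :=
    commute_sub_left (((equivarC_noneC y).commute_frobC x).symm.mul_left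
      (commute_noneC_noneC x y)) (commute_ext_of_ne h (homog_sN _) (homog_snone _))
  have h3 : Commute (frobC φ p x * noneC m R x - normC m R x) (normC m R y) :=
    commute_sub_left (((equivarC_normC y).commute_frobC x).symm.mul_left
      (commute_ext_of_ne h (homog_snone _) (homog_sN _)))
      (commute_ext_of_ne h (homog_sN _) (homog_sN _))
  exact commute_relC h1 h2 h3

variable (m R) in
/-- The span of the basis elements whose symbol has less than `k` primes. -/
def filC (k : ℕ) : Submodule R (Cell m →₀ R) :=
  Finsupp.supported R R {i : Cell m | i.somes.card < k}

theorem filC_mono {k l : ℕ} (h : k ≤ l) : filC m R k ≤ filC m R l :=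
  Finsupp.supported_mono fun _ hi => lt_of_lt_of_le hi h

theorem filC_zero : filC m R 0 = ⊥ := by
  rw [filC, eq_bot_iff]
  intro c hc
  rw [Finsupp.mem_supported'] at hc
  exact Finsupp.ext fun i => hc i (Nat.not_lt_zero _)

theorem noneC_mem_filC {x : ι} {k : ℕ} {c : Cell m →₀ R} (hc : c ∈ filC m R k) :
    noneC m R x c ∈ filC m R k := by
  refine ext_mem_supported (fun i hi t ht => ?_) hc
  rw [(snone_location _ t ht).2, Cell.upd_get]
  exact hi

theorem rep_mem_filC {g : Torus m} {k : ℕ} {c : Cell m →₀ R} (hc : c ∈ filC m R k) :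
    repCell m R g c ∈ filC m R k := by
  rw [filC, ← cut_eq_self_iff] at hc ⊢
  rw [← Module.End.mul_apply, cut_comm_rep fun g i => by rw [Cell.somes_act],
    Module.End.mul_apply, hc]

theorem aeval_mem {A : Module.End R (Cell m →₀ R)} {S : Submodule R (Cell m →₀ R)}
    (h : ∀ c ∈ S, A c ∈ S) (q : Polynomial R) : ∀ c ∈ S, Polynomial.aeval A q c ∈ S := by
  induction q using Polynomial.induction_on' with
  | add q r hq hr =>
    intro c hc
    rw [map_add, LinearMap.add_apply]
    exact S.add_mem (hq c hc) (hr c hc)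
  | monomial n t =>
    intro c hc
    rw [Polynomial.aeval_monomial, Module.End.mul_apply, Module.algebraMap_end_apply]
    refine S.smul_mem _ ?_
    induction n with
    | zero => simpa using hc
    | succ n ih =>
      rw [pow_succ', Module.End.mul_apply]
      exact h _ ih

theorem frobC_mem_filC {x : ι} {k : ℕ} {c : Cell m →₀ R} (hc : c ∈ filC m R k) :
    frobC φ p x c ∈ filC m R k :=
  aeval_mem (fun _ h => rep_mem_filC h) _ _ hc

/-- The part of the module of relations that comes from symbols with less than `k` primes. -/
def relFil (φ : ι → Torus m) (p : ι → Polynomial R) (k : ℕ) : Submodule R (Cell m →₀ R) :=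
  ⨆ x, (filC m R k).map (relC φ p x)

theorem relC_mem_relFil {x : ι} {k : ℕ} {c : Cell m →₀ R} (hc : c ∈ filC m R k) :
    relC φ p x c ∈ relFil φ p k :=
  Submodule.mem_iSup_of_mem x ⟨c, hc, rfl⟩

variable (m R) in
/-- The operator that divides by the norm. -/
def nuC (x : ι) : Module.End R (Cell m →₀ R) := ext x 0 (sν R (m x))

theorem nuC_mul_normC (x : ι) : nuC m R x * normC m R x = noneC m R x := by
  rw [nuC, normC, ext_mul, sν_mul_sN, noneC]

theorem commute_normC_normC (x y : ι) : Commute (normC m R x) (normC m R y) := by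
  by_cases h : x = y
  · subst h
    exact Commute.refl _
  · exact commute_ext_of_ne h (homog_sN _) (homog_sN _)

theorem commute_nuC_normC {x y : ι} (h : x ≠ y) : Commute (nuC m R x) (normC m R y) :=
  commute_ext_of_ne h (homog_sν _) (homog_sN _)

theorem nuC_mem_filC {x : ι} {k : ℕ} {c : Cell m →₀ R} (hc : c ∈ filC m R (k + 1)) :
    nuC m R x c ∈ filC m R k := by
  refine ext_mem_supported (fun i hi t ht => ?_) hc
  have h := sν_location _ t ht
  have h1 := Finset.card_erase_lt_of_mem (Cell.mem_somes.mpr h.1)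
  have hi' : i.somes.card < k + 1 := hi
  rw [Set.mem_ofPred_eq, Cell.somes_upd_none h.2]
  omega

variable (m R) in
/-- The span of the basis elements whose symbol has exactly `k` primes. -/
def gradC (k : ℕ) : Submodule R (Cell m →₀ R) :=
  Finsupp.supported R R {i : Cell m | i.somes.card = k}

theorem gradC_le_filC (k : ℕ) : gradC m R k ≤ filC m R (k + 1) :=
  Finsupp.supported_mono fun i (hi : i.somes.card = k) => by
    rw [Set.mem_ofPred_eq, hi]
    exact Nat.lt_succ_self k

/-- A linear relation between norms is a consequence of the relations `N_x N_y = N_y N_x`. Hence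
the corresponding relations differ from relations that involve fewer primes only by commutators,
which vanish. -/
theorem sum_relC_mem_relFil {k : ℕ} (F : Finset ι) (b : ι → Cell m →₀ R)
    (hb : ∀ x ∈ F, b x ∈ gradC m R k) (h : ∑ x ∈ F, normC m R x (b x) = 0) :
    ∑ x ∈ F, relC φ p x (b x) ∈ relFil φ p k := by
  classical
  induction F using Finset.induction_on generalizing b with
  | empty => simp
  | insert y F hy ih =>
    have hne : ∀ x ∈ F, x ≠ y := fun x hx hxy => hy (hxy ▸ hx)
    -- Applying the left inverse `ν_y` of `N_y` to the relation expresses `b y` as `-∑ N_x u_x`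
    -- with `u_x = ν_y b_x`. The elements `b' x = b x - N_y u_x` satisfy a relation without the
    -- term at `y`.
    set b' : ι → Cell m →₀ R := fun x => b x - normC m R y (nuC m R y (b x)) with hb'
    have h0 : normC m R y (b y) + ∑ x ∈ F, normC m R x (b x) = 0 := by
      rwa [Finset.sum_insert hy] at h
    have h1 : noneC m R y (b y) = -∑ x ∈ F, normC m R x (nuC m R y (b x)) := by
      have := congrArg (nuC m R y) h0
      rw [map_add, map_sum, map_zero, ← Module.End.mul_apply, nuC_mul_normC] at this
      rw [eq_neg_iff_add_eq_zero, ← this]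
      congr 1
      refine Finset.sum_congr rfl fun x hx => ?_
      rw [← Module.End.mul_apply, ← Module.End.mul_apply, (commute_nuC_normC (hne x hx).symm).eq]
    have h2 : ∑ x ∈ F, relC φ p x (b' x) ∈ relFil φ p k := by
      refine ih b' (fun x hx => Submodule.sub_mem _ (hb x (Finset.mem_insert_of_mem hx)) ?_) ?_
      · rw [← Module.End.mul_apply, normC, nuC, ext_mul]
        refine ext_mem_supported (S := {i : Cell m | i.somes.card = k}) (fun i hi t ht => ?_)
          (hb x (Finset.mem_insert_of_mem hx))
        have h3 : ∀ t' ∈ ((sN R (m y) * sν R (m y)) (Finsupp.single (i.get y) 1)).support,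
            t'.1 ≠ none ∧ (i.get y).1 ≠ none := by
          refine support_subset_of_mem ?_
          obtain ⟨_ | j, v⟩ := i.get y
          · rw [Module.End.mul_apply]
            exact (sν_nb (R := R) (k := m y) v).symm ▸ (map_zero (sN R (m y))).symm ▸
              Submodule.zero_mem _
          · rw [Module.End.mul_apply]
            refine (sν_sb (R := R) v j).symm ▸ ?_
            split_ifs
            · exact (sN_nb (R := R) (k := m y) v).symm ▸ Submodule.sum_mem _ fun i _ =>
                sb_mem ⟨Option.some_ne_none i, Option.some_ne_none j⟩
            · exact (map_zero (sN R (m y))).symm ▸ Submodule.zero_mem _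
        rw [Set.mem_ofPred_eq, Cell.somes_upd_of_iff]
        · exact hi
        · simp [(h3 t ht).1, (h3 t ht).2]
      · have h3 : normC m R y (noneC m R y (b y)) = normC m R y (b y) := by
          rw [← Module.End.mul_apply, normC_mul_noneC]
        have h4 : ∑ x ∈ F, normC m R x (normC m R y (nuC m R y (b x))) =
            -normC m R y (b y) := by
          rw [← h3, h1, map_neg, neg_neg, map_sum]
          refine Finset.sum_congr rfl fun x _ => ?_
          rw [← Module.End.mul_apply, (commute_normC_normC x y).eq, Module.End.mul_apply]
        simp only [hb', map_sub, Finset.sum_sub_distrib]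
        rw [h4, sub_neg_eq_add, add_comm, h0]
    have h5 : relC φ p y (b y) = relC φ p y (noneC m R y (b y)) := by
      simp only [relC, LinearMap.sub_apply, Module.End.mul_apply]
      rw [← Module.End.mul_apply (noneC m R y), noneC_mul_noneC,
        ← Module.End.mul_apply (normC m R y), normC_mul_noneC]
    -- Since `N_x u = P_x u - λ_x u`, where `P_x` is the operator `p (x; Fr_x⁻¹)`, and `λ_x`
    -- commutes with `λ_y`, the terms in which `λ` is applied twice cancel, and only elements
    -- `λ_x P_y u` and `λ_y P_x u` with fewer primes are left.
    have h6 : ∀ x ∈ F, relC φ p x (b x) - relC φ p y (normC m R x (nuC m R y (b x))) -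
        relC φ p x (b' x) ∈ relFil φ p k := by
      intro x hx
      have hu : nuC m R y (b x) ∈ filC m R k :=
        nuC_mem_filC (gradC_le_filC k (hb x (Finset.mem_insert_of_mem hx)))
      set u := nuC m R y (b x)
      have h7 : ∀ x, normC m R x u = frobC φ p x (noneC m R x u) - relC φ p x u := by
        intro x
        rw [relC, LinearMap.sub_apply, Module.End.mul_apply, sub_sub_cancel]
      have h8 : relC φ p x (b x) - relC φ p y (normC m R x u) - relC φ p x (b' x) =
          relC φ p x (frobC φ p y (noneC m R y u)) - relC φ p y (frobC φ p x (noneC m R x u)) := by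
        have h9 := LinearMap.congr_fun (commute_relC_relC (φ := φ) (p := p) (hne x hx)).eq u
        rw [Module.End.mul_apply, Module.End.mul_apply] at h9
        simp only [hb']
        change _ - _ - relC φ p x (b x - normC m R y u) = _
        rw [map_sub, h7, h7, map_sub, map_sub, h9]
        abel
      rw [h8]
      exact Submodule.sub_mem _ (relC_mem_relFil (frobC_mem_filC (noneC_mem_filC hu)))
        (relC_mem_relFil (frobC_mem_filC (noneC_mem_filC hu)))
    rw [Finset.sum_insert hy, h5, h1, map_neg, map_sum, neg_add_eq_sub, ← Finset.sum_sub_distrib]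
    have h10 := Submodule.add_mem _ (Submodule.sum_mem _ h6) h2
    rw [← Finset.sum_add_distrib] at h10
    simpa using h10

theorem mem_relFil_iff {k : ℕ} {d : Cell m →₀ R} : d ∈ relFil φ p k ↔
    ∃ (F : Finset ι) (b : ι → Cell m →₀ R), (∀ x, b x ∈ filC m R k) ∧
      d = ∑ x ∈ F, relC φ p x (b x) := by
  classical
  constructor
  · intro hd
    obtain ⟨f, hf, rfl⟩ := (Submodule.mem_iSup_iff_exists_finsupp _ _).mp hd
    choose b hb hb' using hf
    exact ⟨f.support, b, hb, Finset.sum_congr rfl fun x _ => (hb' x).symm⟩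
  · rintro ⟨F, b, hb, rfl⟩
    exact Submodule.sum_mem _ fun x _ => relC_mem_relFil (hb x)

theorem mem_relFil_of_mem_relMod {d : Cell m →₀ R} (hd : d ∈ relMod φ p) :
    ∃ k, d ∈ relFil φ p k := by
  classical
  obtain ⟨f, hf, rfl⟩ := (Submodule.mem_iSup_iff_exists_finsupp _ _).mp hd
  choose b hb using hf
  let k := f.support.sup fun x => (b x).support.sup fun i => i.somes.card + 1
  refine ⟨k, Submodule.sum_mem _ fun x hx => ?_⟩
  rw [← hb]
  refine relC_mem_relFil ((Finsupp.mem_supported R _).mpr fun i hi => ?_)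
  have h1 : (b x).support.sup (fun i => i.somes.card + 1) ≤ k :=
    Finset.le_sup (f := fun x => (b x).support.sup fun i => i.somes.card + 1) hx
  exact lt_of_lt_of_le (Nat.lt_succ_self _)
    ((Finset.le_sup (f := fun i : Cell m => i.somes.card + 1) hi).trans h1)

theorem cut_card_normC (x : ι) (k : ℕ) (c : Cell m →₀ R) :
    cut R (fun i : Cell m => i.somes.card = k + 1) (normC m R x c) =
      normC m R x (cut R (fun i : Cell m => i.somes.card = k) c) := by
  suffices h : cut R (fun i : Cell m => i.somes.card = k + 1) * normC m R x =
      normC m R x * cut R (fun i : Cell m => i.somes.card = k) from LinearMap.congr_fun h c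
  refine cut_mul_ext fun i t ht => ?_
  have h := sN_location _ t ht
  rw [Cell.somes_upd_some h.2, Finset.card_insert_of_notMem, Nat.succ_inj]
  rw [Cell.mem_somes, not_not]
  exact h.1

theorem sub_cut_mem_filC {k : ℕ} {c : Cell m →₀ R} (hc : c ∈ filC m R (k + 1)) :
    c - cut R (fun i : Cell m => i.somes.card = k) c ∈ filC m R k := by
  rw [filC, Finsupp.mem_supported'] at hc ⊢
  intro i hi
  rw [Finsupp.sub_apply]
  by_cases h : i.somes.card = k
  · rw [cut_apply_of_pos h, sub_self]
  · rw [cut_apply_of_neg h, sub_zero]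
    refine hc i ?_
    simp only [Set.mem_ofPred_eq] at hi ⊢
    omega

theorem cut_eq_zero_of_mem_filC {k : ℕ} {P : Cell m → Prop} (hP : ∀ i, P i → k ≤ i.somes.card)
    {c : Cell m →₀ R} (hc : c ∈ filC m R k) : cut R P c = 0 :=
  cut_eq_zero hc fun i hi hPi => absurd (hP i hPi) (not_le.mpr hi)

/-- A relation that involves symbols with at most `k` primes is a combination of basic relations
that do so, too. -/
theorem mem_relFil_of_mem_filC {k : ℕ} {d : Cell m →₀ R} (hd : d ∈ relMod φ p)
    (hk : d ∈ filC m R (k + 1)) : d ∈ relFil φ p k := by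
  obtain ⟨l, hl⟩ := mem_relFil_of_mem_relMod hd
  induction l with
  | zero =>
    have : relFil φ p 0 ≤ relFil φ p k :=
      iSup_mono fun x => Submodule.map_mono (filC_mono (Nat.zero_le k))
    exact this hl
  | succ l ih =>
    by_cases hlk : l + 1 ≤ k
    · have : relFil φ p (l + 1) ≤ relFil φ p k :=
        iSup_mono fun x => Submodule.map_mono (filC_mono hlk)
      exact this hl
    · refine ih ?_
      obtain ⟨F, b, hb, rfl⟩ := mem_relFil_iff.mp hl
      -- The component of the combination with `l + 1` primes is `0`, and it is the negative of the
      -- sum of the norms of the components `b0` of the `b x` with `l` primes.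
      set b0 : ι → Cell m →₀ R := fun x => cut R (fun i : Cell m => i.somes.card = l) (b x)
      have h1 : ∑ x ∈ F, normC m R x (b0 x) = 0 := by
        have h2 : cut R (fun i : Cell m => i.somes.card = l + 1)
            (∑ x ∈ F, relC φ p x (b x)) = 0 :=
          cut_eq_zero_of_mem_filC (k := k + 1) (fun i hi => by omega) hk
        rw [map_sum] at h2
        have h3 : ∀ x ∈ F, cut R (fun i : Cell m => i.somes.card = l + 1) (relC φ p x (b x)) =
            -normC m R x (b0 x) := by
          intro x _
          rw [relC, LinearMap.sub_apply, map_sub, cut_card_normC, Module.End.mul_apply,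
            cut_eq_zero_of_mem_filC (k := l + 1) (fun i hi => hi.ge)
              (frobC_mem_filC (noneC_mem_filC (hb x))), zero_sub]
        rw [Finset.sum_congr rfl h3, Finset.sum_neg_distrib, neg_eq_zero] at h2
        exact h2
      have h4 := sum_relC_mem_relFil (φ := φ) (p := p) F b0 (fun x _ => cut_mem _) h1
      have h5 : ∑ x ∈ F, relC φ p x (b x - b0 x) ∈ relFil φ p l :=
        Submodule.sum_mem _ fun x _ => relC_mem_relFil (sub_cut_mem_filC (hb x))
      have := Submodule.add_mem _ h5 h4
      rw [← Finset.sum_add_distrib] at this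
      simpa using this

variable (m R) in
/-- The span of the norms for the primes in `y`. -/
def normMod (y : Set ι) : Submodule R (Cell m →₀ R) :=
  ⨆ x ∈ y, LinearMap.range (normC m R x)

theorem normC_mem_normMod {y : Set ι} {x : ι} (hx : x ∈ y) (c : Cell m →₀ R) :
    normC m R x c ∈ normMod m R y :=
  Submodule.mem_iSup_of_mem x (Submodule.mem_iSup_of_mem hx (LinearMap.mem_range_self _ c))

theorem normMod_mono {y y' : Set ι} (h : y ⊆ y') : normMod m R y ≤ normMod m R y' :=
  biSup_mono fun _ hx => h hx

theorem normMod_le_comap {y : Set ι} {A : Module.End R (Cell m →₀ R)}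
    (h : ∀ x ∈ y, ∀ c, A (normC m R x c) ∈ normMod m R y) :
    normMod m R y ≤ (normMod m R y).comap A := by
  refine iSup_le fun x => iSup_le fun hx => ?_
  rintro _ ⟨c, rfl⟩
  exact h x hx c

theorem cut_somes_normC (x : ι) (y : Finset ι) (c : Cell m →₀ R) :
    cut R (fun i : Cell m => i.somes = y) (normC m R x c) =
      if x ∈ y then normC m R x (cut R (fun i : Cell m => i.somes = y.erase x) c) else 0 := by
  split_ifs with hx
  · suffices h : cut R (fun i : Cell m => i.somes = y) * normC m R x =
        normC m R x * cut R (fun i : Cell m => i.somes = y.erase x) from LinearMap.congr_fun h c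
    refine cut_mul_ext fun i t ht => ?_
    have h := sN_location _ t ht
    have hxi : x ∉ i.somes := by
      rw [Cell.mem_somes, not_not]
      exact h.1
    rw [Cell.somes_upd_some h.2]
    constructor
    · rintro rfl
      rw [Finset.erase_insert hxi]
    · intro h
      rw [h, Finset.insert_erase hx]
  · have : cut R (fun i : Cell m => i.somes = y) * normC m R x =
        normC m R x * cut R (fun _ => False) := by
      refine cut_mul_ext fun i t ht => ?_
      have h := sN_location _ t ht
      rw [Cell.somes_upd_some h.2, iff_false]
      rintro rfl
      exact hx (Finset.mem_insert_self _ _)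
    have h2 := LinearMap.congr_fun this c
    rw [Module.End.mul_apply, Module.End.mul_apply] at h2
    rw [h2, show cut R (fun _ : Cell m => False) c = 0 from
      cut_eq_zero (Q := fun _ => True) (by simp) fun _ _ h => h, map_zero]

/-- The leading term of a relation is a sum of norms. -/
theorem cut_mem_normMod {y : Finset ι} {d : Cell m →₀ R} (hd : d ∈ relMod φ p)
    (hk : d ∈ filC m R (y.card + 1)) :
    cut R (fun i : Cell m => i.somes = y) d ∈ normMod m R (y : Set ι) := by
  obtain ⟨F, b, hb, rfl⟩ := mem_relFil_iff.mp (mem_relFil_of_mem_filC hd hk)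
  rw [map_sum]
  refine Submodule.sum_mem _ fun x _ => ?_
  rw [relC, LinearMap.sub_apply, map_sub, Module.End.mul_apply,
    cut_eq_zero_of_mem_filC (k := y.card) (fun i hi => (congrArg Finset.card hi).ge)
      (frobC_mem_filC (noneC_mem_filC (hb x))), zero_sub, cut_somes_normC]
  refine Submodule.neg_mem _ ?_
  split_ifs with hx
  · exact normC_mem_normMod (Finset.mem_coe.mpr hx) _
  · exact Submodule.zero_mem _

/-- Every norm is the leading term of a relation: `N_x b` is congruent to `p (x; Fr_x⁻¹) b`, which
involves one prime less. -/
theorem cut_mem_relMod_sup_filC {y : Finset ι} {d : Cell m →₀ R}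
    (hd : d ∈ normMod m R (y : Set ι)) :
    cut R (fun i : Cell m => i.somes = y) d ∈ relMod φ p ⊔ filC m R y.card := by
  suffices h : normMod m R (y : Set ι) ≤
      (relMod φ p ⊔ filC m R y.card).comap (cut R fun i : Cell m => i.somes = y) from h hd
  refine iSup_le fun x => iSup_le fun hx => ?_
  rintro _ ⟨c, rfl⟩
  have hx' : x ∈ y := hx
  rw [Submodule.mem_comap, cut_somes_normC, if_pos hx']
  set b := cut R (fun i : Cell m => i.somes = y.erase x) c with hbdef
  have hb : b ∈ filC m R y.card := by
    have h0 : {i : Cell m | i.somes = y.erase x} ⊆ {i : Cell m | i.somes.card < y.card} := by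
      intro i hi
      rw [Set.mem_ofPred_eq] at hi ⊢
      rw [hi]
      exact Finset.card_erase_lt_of_mem hx'
    exact Finsupp.supported_mono h0 (cut_mem c)
  have h1 : normC m R x b = -relC φ p x b + frobC φ p x (noneC m R x b) := by
    rw [relC, LinearMap.sub_apply, Module.End.mul_apply]
    abel
  rw [h1]
  exact Submodule.add_mem_sup (Submodule.neg_mem _ (relC_mem x b))
    (frobC_mem_filC (noneC_mem_filC hb))

end Relations

/-! ### Chain homotopies for several primes -/

section Homotopies

set_option linter.unusedSectionVars false

variable {ι : Type*} [LinearOrder ι] {m : ι → ℕ} {R : Type*} [CommRing R] [∀ x, NeZero (m x)]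

theorem homog_sq (k : ℕ) [NeZero k] : Homog 0 (sq R k) := by
  refine homog_of_basis (fun v => ?_) fun v i => ?_
  · rw [sq_nb]
    split_ifs
    · exact Submodule.zero_mem _
    · exact nb_mem_par ⟨_, rfl⟩
  · rw [sq_sb]
    exact Submodule.zero_mem _

theorem homog_ssome (k : ℕ) [NeZero k] : Homog 0 (ssome R k) := by
  refine homog_of_basis (fun v => ?_) fun v i => ?_
  · rw [ssome_nb]
    exact Submodule.zero_mem _
  · rw [ssome_sb]
    exact sb_mem_par _ ⟨_, rfl⟩

/-- The anticommutator of the differential with an odd operator. -/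
theorem dTot_ext_one {x : ι} {φ ψ : Module.End R (Strand (m x) →₀ R)} (hφ : Homog 1 φ)
    (h : sδ R (m x) * φ + φ * sδ R (m x) = ψ) (c : Cell m →₀ R) :
    dTot m R (ext x 1 φ c) = -ext x 1 φ (dTot m R c) + ext x 0 ψ c := by
  have h1 := dTot_ext x hφ c
  have h2 : sδ R (m x) * φ - (-1 : R) ^ 1 • (φ * sδ R (m x)) = ψ := by
    rw [← h]
    refine LinearMap.ext fun s => ?_
    simp only [LinearMap.sub_apply, LinearMap.smul_apply, LinearMap.add_apply, pow_one,
      neg_one_smul, sub_neg_eq_add]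
  rwa [h2, ext_two, pow_one, neg_one_smul] at h1

variable (m R) in
/-- The operator `sθ` on the whole tensor product. -/
def thetaC (x : ι) : Module.End R (Cell m →₀ R) := ext x 1 (sθ R (m x))

variable (m R) in
/-- The operator `sπ` on the whole tensor product. -/
def piC (x : ι) : Module.End R (Cell m →₀ R) := ext x 1 (sπ R (m x))

variable (m R) in
/-- The operator `sS` on the whole tensor product. -/
def sC (x : ι) : Module.End R (Cell m →₀ R) := ext x 1 (sS R (m x))

variable (m R) in
/-- The operator `sη` on the whole tensor product. -/
def etaC (x : ι) : Module.End R (Cell m →₀ R) := ext x 1 (sη R (m x))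

variable (m R) in
/-- The operator `sh` on the whole tensor product. -/
def hC (x : ι) : Module.End R (Cell m →₀ R) := ext x 1 (sh R (m x))

theorem dTot_thetaC (x : ι) (c : Cell m →₀ R) :
    dTot m R (thetaC m R x c) = -thetaC m R x (dTot m R c) + normC m R x (posC m R x c) := by
  rw [thetaC, dTot_ext_one (homog_sθ _) sδ_sθ, normC, posC, ← Module.End.mul_apply (ext x 0 _),
    ext_mul]

theorem dTot_piC (x : ι) (c : Cell m →₀ R) :
    dTot m R (piC m R x c) = -piC m R x (dTot m R c) := by
  rw [piC, dTot_ext_one (homog_sπ _) sδ_sπ, ext_zero, LinearMap.zero_apply, add_zero]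

theorem dTot_etaC (x : ι) (c : Cell m →₀ R) :
    dTot m R (etaC m R x c) =
      -etaC m R x (dTot m R c) + (repCell m R (torusSingle m x 1) c - c) := by
  rw [etaC, dTot_ext_one (homog_sη _) sδ_sη, ext_sub, ext_one, ← repCell_torusSingle]
  rfl

theorem dTot_hC (x : ι) (c : Cell m →₀ R) :
    dTot m R (hC m R x c) = -hC m R x (dTot m R c) + (m x : R) • posC m R x c := by
  rw [hC, dTot_ext_one (homog_sh _) sδ_sh, ext_smul, LinearMap.smul_apply, posC]

theorem dTot_sC (x : ι) (c : Cell m →₀ R) :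
    dTot m R (sC m R x c) = -sC m R x (dTot m R c) + someC m R x c - thetaC m R x (piC m R x c) -
      normC m R x (ext x 0 (sτ R (m x)) c) := by
  have h := congrArg (fun A => ext x 0 A c) (sS_homotopy (R := R) (k := m x))
  simp only [ext_add, LinearMap.add_apply] at h
  have h1 : thetaC m R x (piC m R x c) = ext x 0 (sθ R (m x) * sπ R (m x)) c := by
    rw [← Module.End.mul_apply, thetaC, piC, ext_mul, ext_two]
  have h2 : normC m R x (ext x 0 (sτ R (m x)) c) = ext x 0 (sN R (m x) * sτ R (m x)) c := by
    rw [← Module.End.mul_apply, normC, ext_mul]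
  rw [sC, dTot_ext_one (homog_sS _) rfl, ext_add, LinearMap.add_apply, someC, ← h, h1, h2]
  abel

variable (m R) in
/-- The product of the operators `thetaC` over a list. -/
def thetaL : List ι → Module.End R (Cell m →₀ R)
  | [] => 1
  | x :: l => thetaL l * thetaC m R x

variable (m R) in
/-- The product of the operators `piC` over a list, in the opposite order. -/
def piL : List ι → Module.End R (Cell m →₀ R)
  | [] => 1
  | x :: l => piC m R x * piL l

variable (m R) in
/-- The homotopy between the identity and `thetaL l * piL l` obtained from the homotopies `sC`. -/
def sL : List ι → Module.End R (Cell m →₀ R)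
  | [] => 0
  | x :: l => sL l + (-1 : R) ^ l.length • (thetaL m R l * sC m R x * piL m R l)

theorem commute_thetaL {A : Module.End R (Cell m →₀ R)} {l : List ι}
    (h : ∀ x ∈ l, Commute A (thetaC m R x)) : Commute A (thetaL m R l) := by
  induction l with
  | nil => exact Commute.one_right A
  | cons x l ih =>
    exact (ih fun y hy => h y (List.mem_cons_of_mem _ hy)).mul_right (h x List.mem_cons_self)

theorem commute_piL {A : Module.End R (Cell m →₀ R)} {l : List ι}
    (h : ∀ x ∈ l, Commute A (piC m R x)) : Commute A (piL m R l) := by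
  induction l with
  | nil => exact Commute.one_right A
  | cons x l ih =>
    exact (h x List.mem_cons_self).mul_right (ih fun y hy => h y (List.mem_cons_of_mem _ hy))

/-- An even operator on the factor of `x` commutes with `thetaL l` if `x ∉ l`. -/
theorem ext_thetaL {x : ι} {φ : Module.End R (Strand (m x) →₀ R)} (hφ : Homog 0 φ) {l : List ι}
    (hx : x ∉ l) (c : Cell m →₀ R) : ext x 0 φ (thetaL m R l c) = thetaL m R l (ext x 0 φ c) :=
  LinearMap.congr_fun (commute_thetaL fun y hy =>
    (commute_ext_of_ne (by rintro rfl; exact hx hy) (homog_sθ _) hφ).symm).eq c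

theorem ext_piL {x : ι} {φ : Module.End R (Strand (m x) →₀ R)} (hφ : Homog 0 φ) {l : List ι}
    (hx : x ∉ l) (c : Cell m →₀ R) : ext x 0 φ (piL m R l c) = piL m R l (ext x 0 φ c) :=
  LinearMap.congr_fun (commute_piL fun y hy =>
    (commute_ext_of_ne (by rintro rfl; exact hx hy) (homog_sπ _) hφ).symm).eq c

theorem ext_sL {x : ι} {φ : Module.End R (Strand (m x) →₀ R)} (hφ : Homog 0 φ) {l : List ι}
    (hx : x ∉ l) (c : Cell m →₀ R) : ext x 0 φ (sL m R l c) = sL m R l (ext x 0 φ c) := by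
  induction l generalizing c with
  | nil => simp [sL]
  | cons y l ih =>
    rw [List.mem_cons, not_or] at hx
    simp only [sL, LinearMap.add_apply, map_add, LinearMap.smul_apply, map_smul,
      Module.End.mul_apply]
    rw [ih hx.2, ext_thetaL hφ hx.2, sC, ← Module.End.mul_apply (ext x 0 φ),
      (commute_ext_of_ne (Ne.symm hx.1) (homog_sS _) hφ).symm.eq, Module.End.mul_apply,
      ext_piL hφ hx.2]

theorem normC_thetaL {x : ι} {l : List ι} (hx : x ∉ l) (c : Cell m →₀ R) :
    normC m R x (thetaL m R l c) = thetaL m R l (normC m R x c) := ext_thetaL (homog_sN _) hx c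

theorem dTot_thetaL {l : List ι} (hl : l.Nodup) (c : Cell m →₀ R) :
    dTot m R (thetaL m R l c) - (-1 : R) ^ l.length • thetaL m R l (dTot m R c) ∈
      normMod m R {x | x ∈ l} := by
  induction l generalizing c with
  | nil => simp [thetaL]
  | cons x l ih =>
    rw [List.nodup_cons] at hl
    have h1 := ih hl.2 (thetaC m R x c)
    have h2 : (-1 : R) ^ l.length • normC m R x (thetaL m R l (posC m R x c)) ∈
        normMod m R {y | y ∈ x :: l} :=
      Submodule.smul_mem _ _ (normC_mem_normMod (Set.mem_ofPred_eq ▸ List.mem_cons_self) _)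
    have h3 := Submodule.add_mem _ (normMod_mono (R := R) (m := m)
      (y' := {y | y ∈ x :: l}) (fun y hy => List.mem_cons_of_mem x hy) h1) h2
    convert h3 using 1
    rw [thetaL, Module.End.mul_apply, Module.End.mul_apply, dTot_thetaC, map_add, map_neg,
      normC_thetaL hl.1, List.length_cons, pow_succ]
    module

theorem dTot_piL (l : List ι) (c : Cell m →₀ R) :
    dTot m R (piL m R l c) = (-1 : R) ^ l.length • piL m R l (dTot m R c) := by
  induction l with
  | nil => simp [piL]
  | cons x l ih =>
    rw [piL, Module.End.mul_apply, Module.End.mul_apply, dTot_piC, ih, map_smul, List.length_cons,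
      pow_succ]
    module

theorem piC_thetaC {x : ι} (hx : 1 < m x) (c : Cell m →₀ R) :
    piC m R x (thetaC m R x c) = posC m R x c := by
  rw [← Module.End.mul_apply, piC, thetaC, ext_mul, sπ_mul_sθ hx, ext_two, posC]

theorem piL_thetaL {l : List ι} (hl : l.Nodup) (h1 : ∀ x ∈ l, 1 < m x) {c : Cell m →₀ R}
    (hc : ∀ x ∈ l, posC m R x c = c) : piL m R l (thetaL m R l c) = c := by
  induction l generalizing c with
  | nil => simp [piL, thetaL]
  | cons x l ih =>
    rw [List.nodup_cons] at hl
    rw [piL, thetaL, Module.End.mul_apply, Module.End.mul_apply,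
      ih hl.2 (fun y hy => h1 y (List.mem_cons_of_mem _ hy)), piC_thetaC (h1 x List.mem_cons_self),
      hc x List.mem_cons_self]
    intro y hy
    have hyx : x ≠ y := fun h => hl.1 (h ▸ hy)
    rw [← Module.End.mul_apply, posC, thetaC,
      ← (commute_ext_of_ne hyx (homog_sθ _) (homog_sq _)).eq, Module.End.mul_apply]
    exact congrArg _ (hc y (List.mem_cons_of_mem _ hy))

theorem piL_normC {x : ι} {l : List ι} (hx : x ∈ l) (c : Cell m →₀ R) :
    piL m R l (normC m R x c) = 0 := by
  induction l generalizing c with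
  | nil => simp at hx
  | cons y l ih =>
    rw [piL, Module.End.mul_apply]
    by_cases hxl : x ∈ l
    · rw [ih hxl, map_zero]
    · obtain rfl : x = y := (List.mem_cons.mp hx).resolve_right hxl
      rw [normC, ← ext_piL (homog_sN _) hxl, ← Module.End.mul_apply, piC, ext_mul, sπ_mul_sN,
        ext_zero, LinearMap.zero_apply]

theorem sL_normC {x : ι} {l : List ι} (hl : l.Nodup) (hx : x ∈ l) (c : Cell m →₀ R) :
    sL m R l (normC m R x c) ∈ normMod m R {y | y ∈ l} := by
  induction l generalizing c with
  | nil => simp at hx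
  | cons y l ih =>
    rw [List.nodup_cons] at hl
    simp only [sL, LinearMap.add_apply, LinearMap.smul_apply, Module.End.mul_apply]
    by_cases hxl : x ∈ l
    · rw [piL_normC hxl, map_zero, map_zero, smul_zero, add_zero]
      exact normMod_mono (fun y hy => List.mem_cons_of_mem _ hy) (ih hl.2 hxl c)
    · obtain rfl : x = y := (List.mem_cons.mp hx).resolve_right hxl
      have h1 : sC m R x (normC m R x (piL m R l c)) =
          normC m R x (ext x 1 (sS' R (m x)) (piL m R l c)) := by
        rw [sC, normC, ← Module.End.mul_apply, ext_mul, sS_mul_sN,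
          ← Module.End.mul_apply (ext x 0 _), ext_mul]
      have h2 : piL m R l (normC m R x c) = normC m R x (piL m R l c) :=
        (ext_piL (homog_sN _) hxl c).symm
      have h3 : sL m R l (normC m R x c) = normC m R x (sL m R l c) :=
        (ext_sL (homog_sN _) hxl c).symm
      rw [h2, h1, ← normC_thetaL hxl, h3]
      have h4 : x ∈ {y | y ∈ x :: l} := hx
      exact Submodule.add_mem _ (normC_mem_normMod h4 _)
        (Submodule.smul_mem _ _ (normC_mem_normMod h4 _))

/-- On the part divisible by all the primes in `l`, the operator `sL l` is a homotopy between the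
identity and `thetaL l * piL l`, modulo norms. -/
theorem sL_homotopy {l : List ι} (hl : l.Nodup) {c : Cell m →₀ R}
    (hc : ∀ x ∈ l, someC m R x c = c) :
    dTot m R (sL m R l c) + sL m R l (dTot m R c) + thetaL m R l (piL m R l c) - c ∈
      normMod m R {x | x ∈ l} := by
  induction l with
  | nil => simp [sL, thetaL, piL]
  | cons x l ih =>
    rw [List.nodup_cons] at hl
    set u := piL m R l c with hu
    have hv := dTot_sC x u
    set v := ext x 0 (sτ R (m x)) u
    have hsub : normMod m R {y | y ∈ l} ≤ normMod m R {y | y ∈ x :: l} :=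
      normMod_mono fun y hy => List.mem_cons_of_mem x hy
    have h1 := hsub (ih hl.2 fun y hy => hc y (List.mem_cons_of_mem _ hy))
    have h2 := hsub (dTot_thetaL hl.2 (sC m R x u))
    have h3 : normC m R x (thetaL m R l v) ∈ normMod m R {y | y ∈ x :: l} :=
      normC_mem_normMod (Set.mem_ofPred_eq ▸ List.mem_cons_self) _
    have h4 : someC m R x u = u := by
      rw [hu, someC, ext_piL (homog_ssome _) hl.1]
      exact congrArg _ (hc x List.mem_cons_self)
    have h5 : dTot m R u = (-1 : R) ^ l.length • piL m R l (dTot m R c) := dTot_piL l c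
    have h6 := Submodule.sub_mem _ (Submodule.add_mem _ h1
      (Submodule.smul_mem _ ((-1 : R) ^ l.length) h2)) h3
    have h7 : ((-1 : R) ^ l.length) * ((-1 : R) ^ l.length) = 1 := by
      rw [← mul_pow]
      simp
    convert h6 using 1
    simp only [sL, thetaL, piL, LinearMap.add_apply, map_add, LinearMap.smul_apply, map_smul,
      Module.End.mul_apply]
    rw [← hu, hv, h4, h5, normC_thetaL hl.1]
    simp only [map_add, map_sub, map_neg, map_smul, smul_sub, smul_add, smul_neg, smul_smul, h7,
      one_smul]
    abel

/-! ### Homotopies between the Frobenius relations and zero -/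

variable {φ : ι → Torus m} {p : ι → Polynomial R}

theorem degree_update (v : ι →₀ ℕ) (x : ι) (k : ℕ) :
    (v.update x k).degree + v x = v.degree + k := by
  have h : v.update x k = v.erase x + Finsupp.single x k := Finsupp.update_eq_erase_add_single v x k
  have h1 : v.degree = (v.erase x).degree + v x := by
    conv_lhs => rw [← Finsupp.erase_add_single x v, map_add, Finsupp.degree_single]
  rw [h, map_add, Finsupp.degree_single, h1]
  ring

theorem sη_degree {k : ℕ} [NeZero k] (t : Strand k) :
    ∀ t' ∈ (sη R k (Finsupp.single t 1)).support, t'.2 + 1 = t.2 := by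
  refine support_subset_of_mem ?_
  obtain ⟨_ | i, v⟩ := t
  · refine (sη_nb (R := R) (k := k) v).symm ▸ ?_
    split_ifs with h
    · exact nb_mem (Nat.sub_add_cancel h.pos)
    · exact Submodule.zero_mem _
  · refine (sη_sb (R := R) v i).symm ▸ ?_
    split_ifs with h
    · exact sb_mem (Nat.sub_add_cancel h.pos)
    · exact Submodule.zero_mem _

theorem sθ_degree {k : ℕ} [NeZero k] (t : Strand k) :
    ∀ t' ∈ (sθ R k (Finsupp.single t 1)).support, t'.2 + 1 = t.2 := by
  refine support_subset_of_mem ?_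
  obtain ⟨_ | i, _ | v⟩ := t
  · refine (sθ_nb_zero (R := R) (k := k)).symm ▸ ?_
    exact Submodule.zero_mem _
  · refine (sθ_nb_succ (R := R) (k := k) v).symm ▸ ?_
    split_ifs with h
    · exact sb_mem rfl
    · exact Submodule.neg_mem _ (Submodule.sum_mem _ fun j _ => Submodule.smul_mem _ _ (sb_mem rfl))
  all_goals
    refine (sθ_sb (R := R) _ i).symm ▸ ?_
    exact Submodule.zero_mem _

theorem sδ_degree {k : ℕ} [NeZero k] (t : Strand k) :
    ∀ t' ∈ (sδ R k (Finsupp.single t 1)).support, t'.2 = t.2 + 1 := by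
  refine support_subset_of_mem ?_
  obtain ⟨_ | i, v⟩ := t
  · refine (sδ_nb (R := R) (k := k) v).symm ▸ ?_
    split_ifs
    · exact Submodule.smul_mem _ _ (nb_mem rfl)
    · exact Submodule.zero_mem _
  · refine (sδ_sb (R := R) v i).symm ▸ ?_
    split_ifs
    · exact Submodule.sub_mem _ (sb_mem rfl) (sb_mem rfl)
    · exact Submodule.sum_mem _ fun j _ => sb_mem rfl

variable (m R) in
/-- The chains of degree `n`. -/
def degC (n : ℕ) : Submodule R (Cell m →₀ R) :=
  Finsupp.supported R R {i : Cell m | i.2.degree = n}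

variable (m R) in
/-- The chains of degree `n - 1`; there are none for `n = 0`. -/
def predDegC (n : ℕ) : Submodule R (Cell m →₀ R) :=
  Finsupp.supported R R {i : Cell m | i.2.degree + 1 = n}

theorem etaC_mem_predDegC (x : ι) {n : ℕ} {c : Cell m →₀ R} (hc : c ∈ degC m R n) :
    etaC m R x c ∈ predDegC m R n := by
  refine ext_mem_supported (fun i hi t ht => ?_) hc
  have h1 : t.2 + 1 = i.2 x := sη_degree _ t ht
  have h2 : (i.2.update x t.2).degree + i.2 x = i.2.degree + t.2 := degree_update i.2 x t.2
  rw [Set.mem_ofPred_eq] at hi ⊢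
  change (i.2.update x t.2).degree + 1 = n
  omega

theorem thetaC_mem_predDegC (x : ι) {n : ℕ} {c : Cell m →₀ R} (hc : c ∈ degC m R n) :
    thetaC m R x c ∈ predDegC m R n := by
  refine ext_mem_supported (fun i hi t ht => ?_) hc
  have h1 : t.2 + 1 = i.2 x := sθ_degree _ t ht
  have h2 : (i.2.update x t.2).degree + i.2 x = i.2.degree + t.2 := degree_update i.2 x t.2
  rw [Set.mem_ofPred_eq] at hi ⊢
  change (i.2.update x t.2).degree + 1 = n
  omega

theorem rep_mem_supported_exponent {P : (ι →₀ ℕ) → Prop} {g : Torus m} {c : Cell m →₀ R}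
    (hc : c ∈ Finsupp.supported R R {i : Cell m | P i.2}) :
    repCell m R g c ∈ Finsupp.supported R R {i : Cell m | P i.2} := by
  rw [← cut_eq_self_iff] at hc ⊢
  rw [← Module.End.mul_apply, cut_comm_rep (P := fun i : Cell m => P i.2) fun g i => Iff.rfl,
    Module.End.mul_apply, hc]

/-- On the part of the tensor product spanned by the symbols that are divisible only by primes
in `y`, the operators `H x` are homotopies between `p (x; Fr_x⁻¹)` and `0`. -/
structure IsFrobHomotopy (φ : ι → Torus m) (p : ι → Polynomial R) (y : Finset ι)
    (H : ι → Module.End R (Cell m →₀ R)) : Prop where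
  equivarC : ∀ x, EquivarC (H x)
  commute_noneC : ∀ x x', Commute (H x) (noneC m R x')
  commute_normC : ∀ x x', Commute (H x) (normC m R x')
  mem_filC : ∀ x k, ∀ c ∈ filC m R k, H x c ∈ filC m R k
  mem_predDegC : ∀ x n, ∀ c ∈ degC m R n, H x c ∈ predDegC m R n
  dTot_apply : ∀ x c, (∀ x' ∉ y, noneC m R x' c = c) →
    dTot m R (H x c) = -H x (dTot m R c) + frobC φ p x c

theorem commute_asAlgebraHom {A : Module.End R (Cell m →₀ R)} (hA : EquivarC A)
    (a : MonoidAlgebra R (Torus m)) : Commute A ((repCell m R).asAlgebraHom a) := by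
  induction a using MonoidAlgebra.induction_on with
  | of g => simpa using hA g
  | add a b ha hb => simpa using ha.add_right hb
  | smul r a ha => simpa using ha.smul_right r

/-- A finite product of generators of the cyclic factors is `1` modulo the ideal generated by
the elements `σ - 1`. -/
theorem exists_eq_sum_sub_one (g : Torus m) (y : Finset ι) :
    ∃ b : ι → MonoidAlgebra R (Torus m),
      MonoidAlgebra.of R (Torus m) (∏ x ∈ y, Pi.mulSingle x (g x)) - 1 =
        ∑ x ∈ y, b x * (MonoidAlgebra.of R (Torus m) (torusSingle m x 1) - 1) := by
  classical
  induction y using Finset.induction_on with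
  | empty => exact ⟨0, by simp [MonoidAlgebra.one_def]⟩
  | insert x y hx ih =>
    obtain ⟨b, hb⟩ := ih
    have h1 : Pi.mulSingle x (g x) = torusSingle m x 1 ^ (g x).toAdd.val := by
      rw [torusSingle, ← Pi.mulSingle_pow]
      congr 1
      apply Multiplicative.toAdd.injective
      simp
    obtain ⟨d, hd⟩ := sub_one_dvd_pow_sub_one
      (MonoidAlgebra.of R (Torus m) (torusSingle m x 1)) (g x).toAdd.val
    set P := MonoidAlgebra.of R (Torus m) (∏ x ∈ y, Pi.mulSingle x (g x))
    refine ⟨Function.update b x (P * d), ?_⟩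
    rw [Finset.prod_insert hx, Finset.sum_insert hx, Function.update_self, mul_comm, map_mul, h1,
      map_pow]
    have h2 : ∑ x' ∈ y, Function.update b x (P * d) x' *
        (MonoidAlgebra.of R (Torus m) (torusSingle m x' 1) - 1) = P - 1 := by
      rw [hb]
      refine Finset.sum_congr rfl fun x' hx' => ?_
      rw [Function.update_of_ne (by rintro rfl; exact hx hx')]
    rw [h2]
    linear_combination P * hd

theorem repCell_prod_mulSingle (g : Torus m) (y : Finset ι) {c : Cell m →₀ R}
    (hc : ∀ x ∉ y, noneC m R x c = c) :
    repCell m R (∏ x ∈ y, Pi.mulSingle x (g x)) c = repCell m R g c := by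
  have h1 : c ∈ Finsupp.supported R R {i : Cell m | i.somes ⊆ y} := by
    rw [Finsupp.mem_supported']
    intro i hi
    obtain ⟨x, hx, hxy⟩ := Finset.not_subset.mp hi
    exact (Finsupp.mem_supported' R c).mp (noneC_eq_self_iff.mp (hc x hxy)) i fun h => h hx
  rw [Finsupp.supported_eq_span_single] at h1
  clear hc
  induction h1 using Submodule.span_induction with
  | zero => simp
  | add _ _ _ _ h1 h2 => rw [map_add, map_add, h1, h2]
  | smul r _ _ h1 => rw [map_smul, map_smul, h1]
  | mem _ hi =>
    obtain ⟨i, hi, rfl⟩ := hi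
    rw [repCell_single, repCell_single]
    congr 1
    refine Prod.ext (Subtype.ext (funext fun x => ?_)) rfl
    by_cases hx : x ∈ y
    · have h2 : (∏ x ∈ y, Pi.mulSingle x (g x) : Torus m) x = g x := by
        rw [Finset.prod_apply, Finset.prod_eq_single_of_mem x hx fun x' _ hx' => by
          rw [Pi.mulSingle_eq_of_ne hx'.symm], Pi.mulSingle_eq_same]
      change (i.1.1 x).map _ = (i.1.1 x).map _
      rw [h2]
    · have h2 : i.1.1 x = none := by
        by_contra h3
        exact hx (hi (Cell.mem_somes.mpr h3))
      rw [show (i.act _).1.1 x = none from (Symb.act_eq_none_iff i.1).mpr h2,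
        show (i.act _).1.1 x = none from (Symb.act_eq_none_iff i.1).mpr h2]

theorem asAlgebraHom_mem {S : Submodule R (Cell m →₀ R)} (h : ∀ g, ∀ c ∈ S, repCell m R g c ∈ S)
    (a : MonoidAlgebra R (Torus m)) {c : Cell m →₀ R} (hc : c ∈ S) :
    (repCell m R).asAlgebraHom a c ∈ S := by
  induction a using MonoidAlgebra.induction_on with
  | of g => simpa using h g c hc
  | add a b ha hb => simpa using Submodule.add_mem _ ha hb
  | smul r a ha => simpa using Submodule.smul_mem _ r ha

theorem etaC_mem_filC (x : ι) {k : ℕ} {c : Cell m →₀ R} (hc : c ∈ filC m R k) :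
    etaC m R x c ∈ filC m R k := by
  refine ext_mem_supported (fun i hi t ht => ?_) hc
  rw [Set.mem_ofPred_eq, Cell.somes_upd_of_iff (sη_location _ t ht)]
  exact hi

theorem equivarC_etaC (x : ι) : EquivarC (etaC m R x) := commute_ext_repCell 1 (equivar_sη _)

theorem commute_etaC_noneC (x x' : ι) : Commute (etaC m R x) (noneC m R x') := by
  by_cases h : x = x'
  · subst h
    exact commute_ext_same (commute_sη_snone _)
  · exact commute_ext_of_ne h (homog_sη _) (homog_snone _)

theorem commute_etaC_normC (x x' : ι) : Commute (etaC m R x) (normC m R x') := by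
  by_cases h : x = x'
  · subst h
    exact commute_ext_same (commute_sη_sN _)
  · exact commute_ext_of_ne h (homog_sη _) (homog_sN _)

/-- Since `p (x; 1) = 0`, the element `p (x; Fr_x⁻¹)` is a combination of elements `σ - 1`, for
which the operators `etaC` are homotopies. -/
theorem exists_isFrobHomotopy (φ : ι → Torus m) (hp : ∀ x, (p x).eval 1 = 0) (y : Finset ι) :
    ∃ H, IsFrobHomotopy φ p y H := by
  classical
  -- `p (x; t) = (t - 1) q (x; t)`, and `φ x - 1 = ∑ b_i (σ_i - 1)`, where the sum may be restricted
  -- to `i ∈ y`, since the other generators act trivially on the symbols that occur.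
  have h1 : ∀ x, ∃ q : Polynomial R, p x = (Polynomial.X - Polynomial.C 1) * q := fun x =>
    Polynomial.dvd_iff_isRoot.mpr (hp x)
  choose q hq using h1
  choose b hb using fun x => exists_eq_sum_sub_one (R := R) (φ x) y
  set Q : ι → Module.End R (Cell m →₀ R) := fun x =>
    Polynomial.aeval (repCell m R (φ x)) (q x) with hQ
  set A : ι → ι → Module.End R (Cell m →₀ R) := fun x i => (repCell m R).asAlgebraHom (b x i)
  have comm : ∀ (B : Module.End R (Cell m →₀ R)), EquivarC B → (∀ i, Commute B (etaC m R i)) →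
      ∀ x, Commute B (Q x * ∑ i ∈ y, A x i * etaC m R i) := fun B h2 h3 x =>
    (commute_aeval (h2 (φ x)) _).mul_right (Commute.sum_right _ _ _ fun i _ =>
      (commute_asAlgebraHom h2 _).mul_right (h3 i))
  refine ⟨fun x => Q x * ∑ i ∈ y, A x i * etaC m R i, fun x g => ?_, fun x x' => ?_, fun x x' => ?_,
    fun x k c hc => ?_, fun x n c hc => ?_, fun x c hc => ?_⟩
  · exact (comm _ (equivarC_rep g) (fun i => (equivarC_etaC i g).symm) x).symm
  · exact (comm _ (equivarC_noneC x') (fun i => (commute_etaC_noneC i x').symm) x).symm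
  · exact (comm _ (equivarC_normC x') (fun i => (commute_etaC_normC i x').symm) x).symm
  · rw [Module.End.mul_apply, LinearMap.sum_apply]
    exact aeval_mem (fun _ h => rep_mem_filC h) _ _ (Submodule.sum_mem _ fun i _ =>
      asAlgebraHom_mem (fun _ _ h => rep_mem_filC h) _ (etaC_mem_filC i hc))
  · rw [Module.End.mul_apply, LinearMap.sum_apply]
    exact aeval_mem (fun _ h => rep_mem_supported_exponent (P := fun v => v.degree + 1 = n) h) _ _
      (Submodule.sum_mem _ fun i _ => asAlgebraHom_mem
        (fun _ _ h => rep_mem_supported_exponent (P := fun v => v.degree + 1 = n) h) _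
        (etaC_mem_predDegC i hc))
  · have h2 : ∀ c, dTot m R (Q x c) = Q x (dTot m R c) := fun c =>
      LinearMap.congr_fun (commute_aeval (equivarC_dTot (R := R) (φ x)) (q x)).eq c
    have h3 : ∀ i c, dTot m R (A x i c) = A x i (dTot m R c) := fun i c =>
      LinearMap.congr_fun (commute_asAlgebraHom (equivarC_dTot (R := R)) (b x i)).eq c
    have h4 : ∑ i ∈ y, A x i (repCell m R (torusSingle m i 1) c - c) =
        repCell m R (φ x) c - c := by
      have h5 := congrArg (fun a => (repCell m R).asAlgebraHom a c) (hb x)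
      simp only [map_sub, map_sum, map_mul, LinearMap.sub_apply, LinearMap.sum_apply,
        Module.End.mul_apply, Representation.asAlgebraHom_of, map_one, Module.End.one_apply] at h5
      rw [repCell_prod_mulSingle (φ x) y hc] at h5
      rw [h5]
      exact Finset.sum_congr rfl fun i _ => map_sub ((repCell m R).asAlgebraHom (b x i)) _ _
    have h5 : frobC φ p x c = Q x (repCell m R (φ x) c - c) := by
      rw [frobC, hq, mul_comm, map_mul, Module.End.mul_apply]
      congr 1
      simp
    rw [h5, ← h4, Module.End.mul_apply, Module.End.mul_apply, h2, ← map_neg, ← map_add,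
      LinearMap.sum_apply, LinearMap.sum_apply, map_sum, ← Finset.sum_neg_distrib,
      ← Finset.sum_add_distrib]
    congr 1
    refine Finset.sum_congr rfl fun i _ => ?_
    rw [Module.End.mul_apply, h3, dTot_etaC, map_add, map_neg, Module.End.mul_apply]

end Homotopies

/-! ### The kernel of the cone -/

section Cone

set_option linter.unusedSectionVars false

variable {ι : Type*} [LinearOrder ι] {m : ι → ℕ} {R : Type*} [CommRing R] [∀ x, NeZero (m x)]
  {φ : ι → Torus m} {p : ι → Polynomial R}

/-- The operators that map the classes of the trivial module to classes with coefficients in the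
universal distribution: the leading term is `thetaL`, and the homotopies `H` correct for the terms
`p (x; Fr_x⁻¹)` of the relations. On chains with positive exponent at `x`, the norm `N_x` is the
anticommutator of `δ` and `θ_x`, and `p (x; Fr_x⁻¹)` is that of `δ` and `H x`; hence `λ_x` is that
of `δ` and `H x - θ_x`, and modulo the relations, these anticommutators vanish. -/
def fL (H : ι → Module.End R (Cell m →₀ R)) : List ι → Module.End R (Cell m →₀ R)
  | [] => 1
  | x :: l => fL H l * thetaC m R x - (-1 : R) ^ l.length • (H x * fL H l)

theorem fL_cons (H : ι → Module.End R (Cell m →₀ R)) (x : ι) (l : List ι) (c : Cell m →₀ R) :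
    fL H (x :: l) c = fL H l (thetaC m R x c) - (-1 : R) ^ l.length • H x (fL H l c) := rfl

theorem commute_fL {H : ι → Module.End R (Cell m →₀ R)} {A : Module.End R (Cell m →₀ R)}
    {l : List ι} (h : ∀ x ∈ l, Commute A (thetaC m R x)) (hH : ∀ x, Commute A (H x)) :
    Commute A (fL H l) := by
  induction l with
  | nil => exact Commute.one_right A
  | cons x l ih =>
    have ih := ih fun y hy => h y (List.mem_cons_of_mem _ hy)
    exact commute_sub_right (ih.mul_right (h x List.mem_cons_self))
      (((hH x).mul_right ih).smul_right _)

theorem noneC_fL {y : Finset ι} {H : ι → Module.End R (Cell m →₀ R)}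
    (hH : IsFrobHomotopy φ p y H) {x : ι} {l : List ι} (hx : x ∉ l) (c : Cell m →₀ R) :
    noneC m R x (fL H l c) = fL H l (noneC m R x c) :=
  LinearMap.congr_fun (commute_fL (fun y hy => (commute_ext_of_ne (by rintro rfl; exact hx hy)
    (homog_sθ _) (homog_snone _)).symm) fun x' => (hH.commute_noneC x' x).symm).eq c

theorem normC_fL {y : Finset ι} {H : ι → Module.End R (Cell m →₀ R)}
    (hH : IsFrobHomotopy φ p y H) {x : ι} {l : List ι} (hx : x ∉ l) (c : Cell m →₀ R) :
    normC m R x (fL H l c) = fL H l (normC m R x c) :=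
  LinearMap.congr_fun (commute_fL (fun y hy => (commute_ext_of_ne (by rintro rfl; exact hx hy)
    (homog_sθ _) (homog_sN _)).symm) fun x' => (hH.commute_normC x' x).symm).eq c

theorem noneC_thetaC {x x' : ι} (h : x ≠ x') (c : Cell m →₀ R) :
    noneC m R x' (thetaC m R x c) = thetaC m R x (noneC m R x' c) := by
  have h1 : Commute (thetaC m R x) (noneC m R x') :=
    commute_ext_of_ne h (homog_sθ _) (homog_snone _)
  exact (LinearMap.congr_fun h1.eq c).symm

theorem posC_thetaC {x x' : ι} (h : x ≠ x') (c : Cell m →₀ R) :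
    posC m R x' (thetaC m R x c) = thetaC m R x (posC m R x' c) := by
  have h1 : Commute (thetaC m R x) (posC m R x') :=
    commute_ext_of_ne h (homog_sθ _) (homog_sq _)
  exact (LinearMap.congr_fun h1.eq c).symm

/-- On suitable chains, the operator `fL H l` is a chain map up to sign, modulo the relations. -/
theorem dTot_fL {y : Finset ι} {H : ι → Module.End R (Cell m →₀ R)} (hH : IsFrobHomotopy φ p y H)
    {l : List ι} (hl : l.Nodup) (hly : ∀ x ∈ l, x ∈ y) {c : Cell m →₀ R}
    (hc : ∀ x ∉ y, noneC m R x c = c) (hcl : ∀ x ∈ l, posC m R x c = c) :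
    dTot m R (fL H l c) - (-1 : R) ^ l.length • fL H l (dTot m R c) ∈ relMod φ p := by
  induction l generalizing c with
  | nil => simp [fL]
  | cons x l ih =>
    rw [List.nodup_cons] at hl
    have hxy : x ∈ y := hly x List.mem_cons_self
    have ih' := fun {c} => ih (c := c) hl.2 fun x' hx' => hly x' (List.mem_cons_of_mem _ hx')
    have h1 := ih' (c := thetaC m R x c)
      (fun x' hx' => by rw [noneC_thetaC (by rintro rfl; exact hx' hxy), hc x' hx'])
      fun x' hx' => by
        rw [posC_thetaC (by rintro rfl; exact hl.1 hx'), hcl x' (List.mem_cons_of_mem _ hx')]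
    have h2 := ih' hc fun x' hx' => hcl x' (List.mem_cons_of_mem _ hx')
    have hpos : posC m R x c = c := hcl x List.mem_cons_self
    have h3 : dTot m R (H x (fL H l c)) = -H x (dTot m R (fL H l c)) + frobC φ p x (fL H l c) :=
      hH.dTot_apply x _ fun x' hx' => by
        rw [noneC_fL hH fun h => hx' (hly x' (List.mem_cons_of_mem _ h)), hc x' hx']
    have h4 : relC φ p x (fL H l c) = frobC φ p x (fL H l c) - normC m R x (fL H l c) := by
      rw [relC, LinearMap.sub_apply, Module.End.mul_apply, noneC_fL hH hl.1,
        noneC_of_posC hpos]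
    have h5 : H x (dTot m R (fL H l c) - (-1 : R) ^ l.length • fL H l (dTot m R c)) ∈
        relMod φ p :=
      relMod_le_comap (fun x' => commute_relC (hH.equivarC x) (hH.commute_noneC x x')
        (hH.commute_normC x x')) h2
    have h6 := Submodule.sub_mem _ (Submodule.add_mem _ h1
      (Submodule.smul_mem _ ((-1 : R) ^ l.length) h5))
      (Submodule.smul_mem _ ((-1 : R) ^ l.length) (relC_mem (φ := φ) (p := p) x (fL H l c)))
    have h7 : ((-1 : R) ^ l.length) * ((-1 : R) ^ l.length) = 1 := by
      rw [← mul_pow]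
      simp
    convert h6 using 1
    rw [fL_cons, fL_cons, map_sub, map_smul, h3, h4, dTot_thetaC, hpos, normC_fL hH hl.1,
      List.length_cons, pow_succ]
    simp only [map_add, map_sub, map_neg, map_smul, smul_sub, smul_add, smul_neg, smul_smul, h7,
      one_smul, mul_neg, mul_one, neg_mul, neg_smul]
    abel

theorem thetaC_mem_filC (x : ι) {k : ℕ} {c : Cell m →₀ R} (hc : c ∈ filC m R k) :
    thetaC m R x c ∈ filC m R (k + 1) := by
  refine ext_mem_supported (fun i hi t ht => ?_) hc
  rw [Set.mem_ofPred_eq, Cell.somes_upd_some (sθ_location _ t ht).2]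
  exact lt_of_le_of_lt (Finset.card_insert_le _ _) (Nat.succ_lt_succ hi)

theorem thetaL_mem_filC (l : List ι) {k : ℕ} {c : Cell m →₀ R} (hc : c ∈ filC m R k) :
    thetaL m R l c ∈ filC m R (k + l.length) := by
  induction l generalizing c k with
  | nil => exact hc
  | cons x l ih =>
    rw [thetaL, Module.End.mul_apply, List.length_cons, add_comm l.length, ← add_assoc]
    exact ih (thetaC_mem_filC x hc)

theorem fL_sub_thetaL_mem_filC {y : Finset ι} {H : ι → Module.End R (Cell m →₀ R)}
    (hH : IsFrobHomotopy φ p y H) (l : List ι) {k : ℕ} {c : Cell m →₀ R}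
    (hc : c ∈ filC m R (k + 1)) : fL H l c - thetaL m R l c ∈ filC m R (k + l.length) := by
  induction l generalizing c k with
  | nil => simp [fL, thetaL]
  | cons x l ih =>
    have h1 := ih (thetaC_mem_filC x hc)
    have h2 : fL H l c ∈ filC m R (k + 1 + l.length) := by
      have := Submodule.add_mem _ (filC_mono (by omega) (ih hc)) (thetaL_mem_filC l hc)
      simpa using this
    have h3 := hH.mem_filC x _ _ h2
    have h4 := Submodule.sub_mem _ h1 (Submodule.smul_mem _ ((-1 : R) ^ l.length) h3)
    rw [List.length_cons, add_comm l.length, ← add_assoc]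
    convert h4 using 1
    rw [fL_cons, thetaL, Module.End.mul_apply]
    abel

theorem cut_somes_thetaL {l : List ι} (hl : l.Nodup) {c : Cell m →₀ R} (hc : c ∈ filC m R 1) :
    thetaL m R l c ∈ Finsupp.supported R R {i : Cell m | i.somes = l.toFinset} := by
  suffices h : ∀ (s : Finset ι) (c : Cell m →₀ R), (∀ x ∈ l, x ∉ s) →
      c ∈ Finsupp.supported R R {i : Cell m | i.somes = s} →
      thetaL m R l c ∈ Finsupp.supported R R {i : Cell m | i.somes = s ∪ l.toFinset} by
    have h1 := h ∅ c (by simp) (Finsupp.supported_mono (fun i hi => ?_) hc)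
    · simpa using h1
    · simpa using hi
  clear hc c
  induction l with
  | nil => intro s c _ hc; simpa [thetaL] using hc
  | cons x l ih =>
    intro s c hs hc
    rw [List.nodup_cons] at hl
    rw [thetaL, Module.End.mul_apply]
    have h1 : thetaC m R x c ∈ Finsupp.supported R R {i : Cell m | i.somes = insert x s} := by
      refine ext_mem_supported (fun i hi t ht => ?_) hc
      have hi' : i.somes = s := hi
      rw [Set.mem_ofPred_eq, Cell.somes_upd_some (sθ_location _ t ht).2, hi']
    have h2 := ih hl.2 (insert x s) _ (fun y hy => ?_) h1
    · rw [List.toFinset_cons, Finset.union_insert, ← Finset.insert_union]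
      exact h2
    · rw [Finset.mem_insert, not_or]
      exact ⟨by rintro rfl; exact hl.1 hy, hs y (List.mem_cons_of_mem _ hy)⟩

/-- The chains of the trivial module whose exponents are positive at the elements of `y`. -/
def adm (m : ι → ℕ) (R : Type*) [CommRing R] [∀ x, NeZero (m x)] (y : Finset ι) :
    Submodule R (Cell m →₀ R) where
  carrier := {e | (∀ x ∈ y, posC m R x e = e) ∧ ∀ x ∉ y, noneC m R x e = e}
  add_mem' ha hb := ⟨fun x hx => by rw [map_add, ha.1 x hx, hb.1 x hx],
    fun x hx => by rw [map_add, ha.2 x hx, hb.2 x hx]⟩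
  zero_mem' := ⟨fun _ _ => map_zero _, fun _ _ => map_zero _⟩
  smul_mem' r _ ha := ⟨fun x hx => by rw [map_smul, ha.1 x hx],
    fun x hx => by rw [map_smul, ha.2 x hx]⟩

theorem adm_noneC {y : Finset ι} {e : Cell m →₀ R} (he : e ∈ adm m R y) (x : ι) :
    noneC m R x e = e := by
  by_cases hx : x ∈ y
  · exact noneC_of_posC (he.1 x hx)
  · exact he.2 x hx

theorem adm_mem_filC {y : Finset ι} {e : Cell m →₀ R} (he : e ∈ adm m R y) : e ∈ filC m R 1 := by
  rw [filC, Finsupp.mem_supported']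
  intro i hi
  have h1 : i.somes.card ≠ 0 := by
    simp only [Set.mem_ofPred_eq] at hi
    omega
  obtain ⟨x, hx⟩ := Finset.card_ne_zero.mp h1
  exact (Finsupp.mem_supported' R e).mp (noneC_eq_self_iff.mp (adm_noneC he x)) i fun h => h hx

theorem posC_mul_piC (x : ι) : posC m R x * piC m R x = piC m R x := by
  rw [posC, piC, ext_mul]
  congr 1
  refine strand_ext' (fun v => ?_) fun v i => ?_
  · rw [Module.End.mul_apply, sπ_nb, map_zero]
  · rw [Module.End.mul_apply, sπ_sb]
    split_ifs <;> rw [map_smul, sq_nb, if_neg (Nat.succ_ne_zero v)]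

theorem posC_piL {x : ι} {l : List ι} (hl : l.Nodup) (hx : x ∈ l) (c : Cell m →₀ R) :
    posC m R x (piL m R l c) = piL m R l c := by
  induction l with
  | nil => simp at hx
  | cons y l ih =>
    rw [List.nodup_cons] at hl
    rw [piL, Module.End.mul_apply]
    by_cases hxl : x ∈ l
    · have hne : y ≠ x := by
        rintro rfl
        exact hl.1 hxl
      have h1 : Commute (posC m R x) (piC m R y) :=
        (commute_ext_of_ne hne (homog_sπ _) (homog_sq _)).symm
      rw [← Module.End.mul_apply, h1.eq, Module.End.mul_apply, ih hl.2 hxl]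
    · obtain rfl : x = y := (List.mem_cons.mp hx).resolve_right hxl
      rw [← Module.End.mul_apply, posC_mul_piC]

theorem posC_mul_hC (x : ι) : posC m R x * hC m R x = hC m R x := by
  rw [posC, hC, ext_mul]
  congr 1
  refine strand_ext' (fun v => ?_) fun v i => ?_
  · rw [Module.End.mul_apply]
    simp only [sh, strandOp_nb]
    split_ifs with h
    · have : v - 1 ≠ 0 := by
        intro h1
        obtain ⟨⟨w, hw⟩, h2⟩ := h
        omega
      rw [sq_nb, if_neg this]
    · rw [map_zero]
  · rw [Module.End.mul_apply]
    simp only [sh, strandOp_sb, map_zero]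

theorem someC_mem_normMod {y : Finset ι} {x : ι} (hx : x ∈ y) (h1 : m x = 1) {c : Cell m →₀ R}
    (hc : c ∈ Finsupp.supported R R {i : Cell m | i.somes = y}) :
    c ∈ normMod m R (y : Set ι) := by
  have h0 : {i : Cell m | i.somes = y} ⊆ {i : Cell m | x ∈ i.somes} := by
    intro i hi
    rw [Set.mem_ofPred_eq] at hi ⊢
    rwa [hi]
  have h2 : someC m R x c = c := someC_eq_self (Finsupp.supported_mono h0 hc)
  rw [← h2, someC, ← sN_mul_sν h1, ← add_zero 0, ← ext_mul]
  exact normC_mem_normMod (Finset.mem_coe.mpr hx) _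

/-- The statement of `cone_acyclic` for the leading terms, that is, for the symbols with set of
primes `y`, modulo norms. If `|G_{z(x)}| = 1` for some `x ∈ y`, then everything is a norm, and `e`
is a boundary since the trivial module has no cohomology in positive exponents of `x`. Otherwise the
homotopy equivalence given by `thetaL` and `piL` is used. -/
theorem exists_leading_term (y : Finset ι) {c e : Cell m →₀ R}
    (hc : c ∈ Finsupp.supported R R {i : Cell m | i.somes = y}) (he : e ∈ adm m R y)
    (hde : dTot m R e = 0)
    (h : dTot m R c - thetaL m R y.toList e ∈ normMod m R (y : Set ι)) :
    ∃ e' ∈ adm m R y, e = (-1 : R) ^ y.card • dTot m R e' ∧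
      ∃ s, c - thetaL m R y.toList e' - dTot m R s ∈ normMod m R (y : Set ι) := by
  have hl := y.nodup_toList
  have hset : {x | x ∈ y.toList} = (y : Set ι) := by
    ext x
    simp
  have hsign : ((-1 : R) ^ y.card) * ((-1 : R) ^ y.card) = 1 := by
    rw [← mul_pow]
    simp
  by_cases h1 : ∃ x ∈ y, m x = 1
  · obtain ⟨x, hx, hmx⟩ := h1
    have h2 : hC m R x e ∈ adm m R y := by
      refine ⟨fun x' hx' => ?_, fun x' hx' => ?_⟩
      · by_cases hxx : x = x'
        · subst hxx
          rw [← Module.End.mul_apply, posC_mul_hC]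
        · rw [← Module.End.mul_apply, posC, hC,
            ← (commute_ext_of_ne hxx (homog_sh _) (homog_sq _)).eq, Module.End.mul_apply]
          exact congrArg _ (he.1 x' hx')
      · have hxx : x ≠ x' := by
          rintro rfl
          exact hx' hx
        rw [← Module.End.mul_apply, noneC, hC,
          ← (commute_ext_of_ne hxx (homog_sh _) (homog_snone _)).eq, Module.End.mul_apply]
        exact congrArg _ (he.2 x' hx')
    refine ⟨(-1 : R) ^ y.card • hC m R x e, Submodule.smul_mem _ _ h2, ?_, 0, ?_⟩
    · rw [map_smul, smul_smul, hsign, one_smul, dTot_hC, hmx, Nat.cast_one, one_smul, hde, map_zero,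
        neg_zero, zero_add, he.1 x hx]
    · rw [map_zero, sub_zero]
      refine Submodule.sub_mem _ (someC_mem_normMod hx hmx hc) (someC_mem_normMod hx hmx ?_)
      have := cut_somes_thetaL hl (adm_mem_filC (Submodule.smul_mem _ ((-1 : R) ^ y.card) h2))
      rwa [Finset.toList_toFinset] at this
  · have h1' : ∀ x ∈ y.toList, 1 < m x := fun x hx => by
      have h2 : m x ≠ 1 := fun h3 => h1 ⟨x, Finset.mem_toList.mp hx, h3⟩
      have h3 : m x ≠ 0 := NeZero.ne _
      omega
    -- The leading term is recovered by `e' = π c`.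
    have hkill : ∀ c ∈ normMod m R (y : Set ι), piL m R y.toList c = 0 := by
      intro c hc
      have : normMod m R (y : Set ι) ≤ LinearMap.ker (piL m R y.toList) := by
        refine iSup_le fun x => iSup_le fun hx => ?_
        rintro _ ⟨c, rfl⟩
        exact piL_normC (Finset.mem_toList.mpr hx) c
      exact this hc
    set e' := piL m R y.toList c with he'
    have h2 : e' ∈ adm m R y := by
      refine ⟨fun x hx => posC_piL hl (Finset.mem_toList.mpr hx) c, fun x hx => ?_⟩
      rw [he', noneC, ext_piL (homog_snone _) (by simpa using hx)]
      have h3 : {i : Cell m | i.somes = y} ⊆ {i : Cell m | x ∉ i.somes} := by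
        intro i hi
        rw [Set.mem_ofPred_eq] at hi ⊢
        rwa [hi]
      exact congrArg _ (noneC_eq_self_iff.mpr (Finsupp.supported_mono h3 hc))
    have h3 : ∀ e ∈ adm m R y, piL m R y.toList (thetaL m R y.toList e) = e := fun e he =>
      piL_thetaL hl h1' fun x hx => he.1 x (Finset.mem_toList.mp hx)
    have h4 : e = (-1 : R) ^ y.card • dTot m R e' := by
      have h5 := hkill _ h
      rw [map_sub, h3 e he, sub_eq_zero] at h5
      rw [he', dTot_piL, Finset.length_toList, smul_smul, hsign, one_smul, h5]
    set c1 := c - thetaL m R y.toList e' with hc1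
    have h5 : ∀ x ∈ y.toList, someC m R x c1 = c1 := by
      intro x hx
      have h6 : thetaL m R y.toList e' ∈ Finsupp.supported R R {i : Cell m | i.somes = y} := by
        have := cut_somes_thetaL hl (adm_mem_filC h2)
        rwa [Finset.toList_toFinset] at this
      have h7 : {i : Cell m | i.somes = y} ⊆ {i : Cell m | x ∈ i.somes} := by
        intro i hi
        rw [Set.mem_ofPred_eq] at hi ⊢
        rw [hi]
        exact Finset.mem_toList.mp hx
      exact someC_eq_self (Finsupp.supported_mono h7 (Submodule.sub_mem _ hc h6))
    have h6 : piL m R y.toList c1 = 0 := by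
      rw [hc1, map_sub, h3 e' h2, sub_self]
    have h7 : dTot m R c1 ∈ normMod m R (y : Set ι) := by
      have h8 := dTot_thetaL hl e'
      rw [hset, Finset.length_toList, ← map_smul, ← h4] at h8
      have h9 := Submodule.sub_mem _ h h8
      rw [hc1, map_sub]
      convert h9 using 1
      abel
    have h8 : sL m R y.toList (dTot m R c1) ∈ normMod m R (y : Set ι) := by
      have h9 : normMod m R (y : Set ι) ≤ (normMod m R (y : Set ι)).comap (sL m R y.toList) := by
        refine normMod_le_comap fun x hx c => ?_
        have := sL_normC hl (Finset.mem_toList.mpr hx) c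
        rwa [hset] at this
      exact h9 h7
    refine ⟨e', h2, h4, sL m R y.toList c1, ?_⟩
    have h9 := sL_homotopy hl h5
    rw [h6, map_zero, add_zero, hset] at h9
    have h10 := Submodule.sub_mem _ h8 h9
    rw [← hc1]
    convert h10 using 1
    abel

theorem cut_dTot (y : Finset ι) (c : Cell m →₀ R) :
    cut R (fun i : Cell m => i.somes = y) (dTot m R c) =
      dTot m R (cut R (fun i : Cell m => i.somes = y) c) := by
  suffices h : cut R (fun i : Cell m => i.somes = y) * dTot m R =
      dTot m R * cut R (fun i : Cell m => i.somes = y) from LinearMap.congr_fun h c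
  refine cell_ext fun i => ?_
  have h1 : ∀ x, cut R (fun i : Cell m => i.somes = y) * ext x 1 (sδ R (m x)) =
      ext x 1 (sδ R (m x)) * cut R (fun i : Cell m => i.somes = y) := fun x =>
    cut_mul_ext fun i t ht => by rw [Cell.somes_upd_of_iff (sδ_location _ t ht)]
  have h2 : ∀ x, cut R (fun i : Cell m => i.somes = y)
      (ext x 1 (sδ R (m x)) (Finsupp.single i 1)) = ext x 1 (sδ R (m x))
        (cut R (fun i : Cell m => i.somes = y) (Finsupp.single i 1)) := fun x =>
    LinearMap.congr_fun (h1 x) _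
  rw [Module.End.mul_apply, Module.End.mul_apply, dTot_single i subset_rfl, map_sum]
  simp only [h2]
  by_cases h : i.somes = y
  · rw [cut_single_of_pos h, dTot_single i subset_rfl]
  · rw [cut_single_of_neg h]
    simp

theorem dTot_mem_filC {k : ℕ} {c : Cell m →₀ R} (hc : c ∈ filC m R k) :
    dTot m R c ∈ filC m R k := by
  rw [filC, Finsupp.mem_supported']
  intro i hi
  have h1 : cut R (fun j : Cell m => j.somes = i.somes) c = 0 := by
    refine cut_eq_zero_of_mem_filC (k := k) (fun j hj => ?_) hc
    rw [hj]
    exact not_lt.mp hi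
  have h2 := congrArg (fun d => d i) (cut_dTot i.somes c)
  rw [h1, map_zero] at h2
  simpa [cut_apply_of_pos] using h2

theorem sub_sum_cut_mem_filC {k : ℕ} {c : Cell m →₀ R} (hc : c ∈ filC m R (k + 1))
    {F : Finset (Finset ι)} (hF : ∀ i ∈ c.support, i.somes.card = k → i.somes ∈ F) :
    c - ∑ y ∈ F, cut R (fun i : Cell m => i.somes = y) c ∈ filC m R k := by
  classical
  rw [filC, Finsupp.mem_supported'] at hc ⊢
  intro i hi
  rw [Finsupp.sub_apply, Finsupp.finsetSum_apply]
  simp only [Set.mem_ofPred_eq, not_lt] at hi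
  by_cases hci : c i = 0
  · have : ∀ y ∈ F, cut R (fun i : Cell m => i.somes = y) c i = 0 := fun y _ => by
      by_cases h : i.somes = y
      · rw [cut_apply_of_pos h, hci]
      · rw [cut_apply_of_neg h]
    rw [Finset.sum_eq_zero this, hci, sub_zero]
  · have hk : i.somes.card = k := by
      have : ¬ k + 1 ≤ i.somes.card := fun h => hci (hc i (not_lt.mpr h))
      omega
    rw [Finset.sum_eq_single_of_mem i.somes (hF i (Finsupp.mem_support_iff.mpr hci) hk),
      cut_apply_of_pos (P := fun j : Cell m => j.somes = i.somes) rfl, sub_self]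
    intro y _ hy
    exact cut_apply_of_neg (fun h => hy h.symm) c

/-- If the sum of the `fL` of cocycles of the trivial module is a boundary modulo the relations,
then these cocycles are boundaries, and every chain whose boundary is such a sum is, modulo
boundaries and relations, itself a sum of this form. This is the acyclicity of the mapping cone of
the sum of the maps `fL`, and it is proved by an induction on the number of primes that divide
the symbols. -/
theorem cone_acyclic {H : Finset ι → ι → Module.End R (Cell m →₀ R)}
    (hH : ∀ y, IsFrobHomotopy φ p y (H y)) (e : Finset ι →₀ (Cell m →₀ R))
    (he : ∀ y, e y ∈ adm m R y) (hde : ∀ y, dTot m R (e y) = 0) (c : Cell m →₀ R)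
    (h : dTot m R c - e.sum (fun y u => fL (H y) y.toList u) ∈ relMod φ p) :
    ∃ e' : Finset ι →₀ (Cell m →₀ R), (∀ y, e' y ∈ adm m R y) ∧
      (∀ y, e y = (-1 : R) ^ y.card • dTot m R (e' y)) ∧
      ∃ c', c - e'.sum (fun y u => fL (H y) y.toList u) - dTot m R c' ∈ relMod φ p := by
  classical
  set f : Finset ι → Module.End R (Cell m →₀ R) := fun y => fL (H y) y.toList with hf
  -- The three properties of `f y = fL` that are used: it is a chain map modulo relations, its
  -- leading term is `thetaL`, and its values involve at most `y.card` primes.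
  have hf1 : ∀ y, ∀ u ∈ adm m R y,
      dTot m R (f y u) - (-1 : R) ^ y.card • f y (dTot m R u) ∈ relMod φ p := by
    intro y u hu
    have := dTot_fL (hH y) y.nodup_toList (fun x hx => Finset.mem_toList.mp hx) hu.2
      (fun x hx => hu.1 x (Finset.mem_toList.mp hx))
    rwa [Finset.length_toList] at this
  have hf2 : ∀ y, ∀ u ∈ adm m R y, f y u - thetaL m R y.toList u ∈ filC m R y.card := by
    intro y u hu
    have := fL_sub_thetaL_mem_filC (hH y) y.toList (k := 0) (adm_mem_filC hu)
    rwa [zero_add, Finset.length_toList] at this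
  have hf3 : ∀ y, ∀ u ∈ adm m R y, f y u ∈ filC m R (y.card + 1) := by
    intro y u hu
    have h1 := thetaL_mem_filC y.toList (adm_mem_filC hu)
    rw [Finset.length_toList, add_comm] at h1
    simpa using Submodule.add_mem _ (filC_mono (Nat.le_succ _) (hf2 y u hu)) h1
  obtain ⟨k, hk, hek⟩ : ∃ k, c ∈ filC m R k ∧ ∀ y, k ≤ y.card → e y = 0 := by
    refine ⟨max (c.support.sup fun i => i.somes.card + 1) (e.support.sup fun y => y.card + 1),
      (Finsupp.mem_supported R c).mpr fun i hi => ?_, fun y hy => ?_⟩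
    · have := Finset.le_sup (f := fun i : Cell m => i.somes.card + 1) hi
      exact lt_of_lt_of_le (Nat.lt_succ_self _) (this.trans (le_max_left _ _))
    · by_contra h0
      have := Finset.le_sup (f := fun y : Finset ι => y.card + 1) (Finsupp.mem_support_iff.mpr h0)
      have h2 := (le_max_right _ _).trans hy
      omega
  induction k generalizing e c with
  | zero =>
    rw [filC_zero, Submodule.mem_bot] at hk
    refine ⟨0, fun y => Submodule.zero_mem _, fun y => ?_, 0, ?_⟩
    · rw [hek y (Nat.zero_le _)]
      simp
    · simp [hk]
  | succ k ih =>
    set L : (Finset ι →₀ (Cell m →₀ R)) →ₗ[R] (Cell m →₀ R) := Finsupp.lsum R f with hL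
    have hLsum : ∀ e : Finset ι →₀ (Cell m →₀ R), e.sum (fun y u => f y u) = L e := fun e => rfl
    have hLF : ∀ (e : Finset ι →₀ (Cell m →₀ R)) (F : Finset (Finset ι)), e.support ⊆ F →
        L e = ∑ y ∈ F, f y (e y) := fun e F hF =>
      Finsupp.sum_of_support_subset e hF _ fun y _ => map_zero _
    set d := dTot m R c - L e with hd
    have hcard : ∀ y ∈ e.support, y.card ≤ k := fun y hy => by
      by_contra h0
      exact Finsupp.mem_support_iff.mp hy (hek y (by omega))
    have h : d ∈ relMod φ p := h
    have hdk : d ∈ filC m R (k + 1) := by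
      refine Submodule.sub_mem _ (dTot_mem_filC hk) (Submodule.sum_mem _ fun y hy => ?_)
      exact filC_mono (Nat.succ_le_succ (hcard y hy)) (hf3 y _ (he y))
    -- The component of `f y' u` at a set `y` with `k` elements is `0` or the leading term.
    have hf4 : ∀ y y' : Finset ι, y.card = k → y'.card ≤ k → ∀ u ∈ adm m R y',
        cut R (fun i : Cell m => i.somes = y) (f y' u) =
          if y' = y then thetaL m R y.toList u else 0 := by
      intro y y' hy hy' u hu
      have hzero : ∀ v ∈ filC m R k, cut R (fun i : Cell m => i.somes = y) v = 0 := fun v hv =>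
        cut_eq_zero_of_mem_filC (fun i hi => by rw [hi, hy]) hv
      have h1 : cut R (fun i : Cell m => i.somes = y) (f y' u) =
          cut R (fun i : Cell m => i.somes = y) (thetaL m R y'.toList u) := by
        rw [← sub_eq_zero, ← map_sub]
        exact hzero _ (filC_mono hy' (hf2 y' u hu))
      have h2 := cut_somes_thetaL y'.nodup_toList (adm_mem_filC hu)
      rw [Finset.toList_toFinset] at h2
      rw [h1]
      split_ifs with hyy
      · subst hyy
        exact cut_eq_self_iff.mpr h2
      · exact cut_eq_zero h2 fun i hi hi' => hyy (hi.symm.trans hi')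
    set F : Finset (Finset ι) :=
      (c.support.image Cell.somes ∪ e.support).filter fun y => y.card = k with hF
    have hFk : ∀ y ∈ F, y.card = k := fun y hy => (Finset.mem_filter.mp hy).2
    -- The component of `d` at `y` is a norm, so the leading terms can be treated for each `y`
    -- separately.
    have hlead : ∀ y, ∃ e1 s : Cell m →₀ R, e1 ∈ adm m R y ∧ (y ∉ F → e1 = 0) ∧
        (y ∈ F → e y = (-1 : R) ^ y.card • dTot m R e1 ∧
          cut R (fun i : Cell m => i.somes = y) c - thetaL m R y.toList e1 -
            dTot m R s ∈ normMod m R (y : Set ι)) := by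
      intro y
      by_cases hy : y ∈ F
      · have h1 : cut R (fun i : Cell m => i.somes = y) d =
            dTot m R (cut R (fun i : Cell m => i.somes = y) c) - thetaL m R y.toList (e y) := by
          rw [hd, map_sub, cut_dTot]
          congr 1
          have h2 : cut R (fun i : Cell m => i.somes = y) (L e) =
              ∑ y' ∈ e.support, if y' = y then thetaL m R y.toList (e y') else 0 := by
            rw [hLF e _ subset_rfl, map_sum]
            exact Finset.sum_congr rfl fun y' hy' => hf4 y y' (hFk y hy) (hcard y' hy') _ (he y')
          rw [h2, Finset.sum_ite_eq']
          split_ifs with h3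
          · rfl
          · rw [Finsupp.notMem_support_iff.mp h3, map_zero]
        have h2 := cut_mem_normMod h (y := y) (by rw [hFk y hy]; exact hdk)
        rw [h1] at h2
        obtain ⟨e1, he1, h3, s, h4⟩ := exists_leading_term y (cut_mem c) (he y) (hde y) h2
        exact ⟨e1, s, he1, fun h => absurd hy h, fun _ => ⟨h3, h4⟩⟩
      · exact ⟨0, 0, Submodule.zero_mem _, fun _ => rfl, fun h => absurd h hy⟩
    choose E S hE hE0 hES using hlead
    set e1 : Finset ι →₀ (Cell m →₀ R) := Finsupp.onFinset F E fun y hy => by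
      by_contra h0
      exact hy (hE0 y h0) with he1
    have hLe1 : L e1 = ∑ y ∈ F, f y (E y) := hLF e1 F Finsupp.support_onFinset_subset
    set s1 := ∑ y ∈ F, cut R (fun i : Cell m => i.somes = y) (S y) with hs1
    -- Modulo relations and symbols with fewer than `k` primes, `c` is a sum of the required form.
    have h1 : c - L e1 - dTot m R s1 ∈ relMod φ p ⊔ filC m R k := by
      have h2 := sub_sum_cut_mem_filC hk (F := F) (fun i hi hik => Finset.mem_filter.mpr
        ⟨Finset.mem_union_left _ (Finset.mem_image_of_mem _ hi), hik⟩)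
      have h3 : ∀ y ∈ F, cut R (fun i : Cell m => i.somes = y) c - f y (E y) -
          dTot m R (cut R (fun i : Cell m => i.somes = y) (S y)) ∈ relMod φ p ⊔ filC m R k := by
        intro y hy
        have h4 := cut_mem_relMod_sup_filC (φ := φ) (p := p) (hES y hy).2
        have h5 := cut_somes_thetaL y.nodup_toList (adm_mem_filC (hE y))
        rw [Finset.toList_toFinset] at h5
        rw [map_sub, map_sub, cut_dTot, cut_eq_self_iff.mpr h5, cut_eq_self_iff.mpr (cut_mem c),
          hFk y hy] at h4
        have h6 := hf2 y _ (hE y)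
        rw [hFk y hy] at h6
        have h7 := Submodule.sub_mem _ h4 (Submodule.mem_sup_right h6)
        convert h7 using 1
        abel
      have h4 := Submodule.add_mem _ (Submodule.mem_sup_right h2) (Submodule.sum_mem _ h3)
      convert h4 using 1
      rw [hLe1, hs1, map_sum, Finset.sum_sub_distrib, Finset.sum_sub_distrib]
      abel
    obtain ⟨r, hr, c3, hc3, hrc⟩ := Submodule.mem_sup.mp h1
    -- The remainder `c3` involves fewer than `k` primes, and the induction hypothesis applies to it
    -- and to the components of `e` at the sets with fewer than `k` elements.
    set e3 := e.filter fun y => y ∉ F with he3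
    have he3F : ∀ y ∈ F, e3 y = 0 := fun y hy => Finsupp.filter_apply_neg _ _ (not_not.mpr hy)
    have he3F' : ∀ y, y ∉ F → e3 y = e y := fun y hy => Finsupp.filter_apply_pos _ _ hy
    have hLe : L e = L e3 + ∑ y ∈ F, f y (e y) := by
      have h2 : e = e3 + e.filter (fun y => ¬ y ∉ F) := (Finsupp.filter_add_filter_not _ _).symm
      have h3 : L (e.filter fun y => ¬ y ∉ F) = ∑ y ∈ F, f y (e y) := by
        rw [hLF _ F fun y hy => ?_]
        · exact Finset.sum_congr rfl fun y hy => by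
            rw [Finsupp.filter_apply_pos (fun y => ¬ y ∉ F) e (not_not.mpr hy)]
        · rw [Finsupp.support_filter, Finset.mem_filter] at hy
          exact not_not.mp hy.2
      conv_lhs => rw [h2, map_add, h3]
    have h3 : dTot m R c3 - L e3 ∈ relMod φ p := by
      have h4 : ∑ y ∈ F, (dTot m R (f y (E y)) - f y (e y)) ∈ relMod φ p := by
        refine Submodule.sum_mem _ fun y hy => ?_
        have := hf1 y (E y) (hE y)
        rwa [← map_smul, ← (hES y hy).1] at this
      have h5 := Submodule.sub_mem _ (Submodule.sub_mem _ h h4) (dTot_mem_relMod hr)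
      convert h5 using 1
      have h6 : c3 = c - L e1 - dTot m R s1 - r := by rw [← hrc]; abel
      rw [h6, hd, hLe, hLe1, Finset.sum_sub_distrib]
      simp only [map_sub, map_sum, dTot_dTot]
      abel
    obtain ⟨e', he', hee', c', hc'⟩ := ih e3
      (fun y => by
        by_cases hy : y ∈ F
        · rw [he3F y hy]
          exact Submodule.zero_mem _
        · rw [he3F' y hy]
          exact he y)
      (fun y => by
        by_cases hy : y ∈ F
        · rw [he3F y hy, map_zero]
        · rw [he3F' y hy]
          exact hde y) c3 h3 hc3
      (fun y hy => by
        by_cases hyF : y ∈ F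
        · exact he3F y hyF
        · rw [he3F' y hyF]
          by_contra h0
          have h4 := Finsupp.mem_support_iff.mpr h0
          exact hyF (Finset.mem_filter.mpr ⟨Finset.mem_union_right _ h4,
            le_antisymm (hcard y h4) hy⟩))
    refine ⟨e1 + e', fun y => Submodule.add_mem _ (hE y) (he' y), fun y => ?_, c' + s1, ?_⟩
    · have h4 : (e1 + e') y = E y + e' y := rfl
      rw [h4, map_add, smul_add, ← hee' y]
      by_cases hy : y ∈ F
      · rw [← (hES y hy).1, he3F y hy, add_zero]
      · rw [hE0 y hy, he3F' y hy, map_zero, smul_zero, zero_add]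
    · rw [hLsum] at hc' ⊢
      have h4 := Submodule.add_mem _ hc' hr
      convert h4 using 1
      have h6 : c = r + c3 + L e1 + dTot m R s1 := by rw [hrc]; abel
      rw [map_add, map_add, h6]
      abel

end Cone

/-! ### The universal distribution in coordinates -/

section Model

set_option linter.unusedSectionVars false

variable {ι : Type*} [LinearOrder ι] {m : ι → ℕ} {R : Type*} [CommRing R] [∀ x, NeZero (m x)]
  (φ : ι → Torus m) (p : ι → Polynomial R)

open Classical in
/-- The operator `λ_{z(x)}` on the free module on the symbols. -/
def relS (x : ι) : Module.End R (Symb m →₀ R) :=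
  Finsupp.linearCombination R fun a => if a.1 x = none then
    Polynomial.aeval (repSymb m R (φ x)) (p x) (Finsupp.single a 1) -
      ∑ j, Finsupp.single (a.upd x (some j)) 1 else 0

theorem relS_of_none {x : ι} {a : Symb m} (h : a.1 x = none) :
    relS φ p x (Finsupp.single a 1) =
      Polynomial.aeval (repSymb m R (φ x)) (p x) (Finsupp.single a 1) -
        ∑ j, Finsupp.single (a.upd x (some j)) 1 := by
  simp [relS, h]

theorem relS_of_ne_none {x : ι} {a : Symb m} (h : a.1 x ≠ none) :
    relS φ p x (Finsupp.single a 1) = 0 := by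
  simp [relS, h]

/-- The submodule of relations in the free module on the symbols. -/
def relModS : Submodule R (Symb m →₀ R) := ⨆ x, LinearMap.range (relS φ p x)

/-- The coefficient of `[v]` of a chain. -/
def slice (v : ι →₀ ℕ) : (Cell m →₀ R) →ₗ[R] (Symb m →₀ R) :=
  Finsupp.linearCombination R fun i => if i.2 = v then Finsupp.single i.1 1 else 0

theorem slice_single (v : ι →₀ ℕ) (i : Cell m) : slice v (Finsupp.single i (1 : R)) =
    if i.2 = v then Finsupp.single i.1 1 else 0 := by
  simp [slice]

/-- The chain `a [v]`. -/
def ins (v : ι →₀ ℕ) : (Symb m →₀ R) →ₗ[R] (Cell m →₀ R) :=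
  Finsupp.lmapDomain R R fun a => (a, v)

theorem ins_single (v : ι →₀ ℕ) (a : Symb m) (r : R) :
    ins v (Finsupp.single a r) = Finsupp.single (a, v) r := by
  simp [ins]

theorem slice_ins (v w : ι →₀ ℕ) (a : Symb m →₀ R) :
    slice v (ins w a) = if w = v then a else 0 := by
  suffices h : slice (R := R) v ∘ₗ ins w = if w = v then (LinearMap.id : (Symb m →₀ R) →ₗ[R] _)
      else 0 by
    have := LinearMap.congr_fun h a
    rw [LinearMap.comp_apply] at this
    rw [this]
    split_ifs <;> rfl
  refine Finsupp.lhom_ext' fun a => LinearMap.ext_ring ?_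
  rw [LinearMap.comp_apply, LinearMap.comp_apply, LinearMap.comp_apply, Finsupp.lsingle_apply,
    ins_single, slice_single]
  split_ifs <;> rfl

theorem ins_slice (v : ι →₀ ℕ) (c : Cell m →₀ R) :
    ins v (slice v c) = cut R (fun i => i.2 = v) c := by
  suffices h : ins v ∘ₗ slice (R := R) (m := m) v = cut R (fun i => i.2 = v) from
    LinearMap.congr_fun h c
  refine cell_ext fun i => ?_
  rw [LinearMap.comp_apply, slice_single]
  split_ifs with h
  · rw [cut_single_of_pos (P := fun i : Cell m => i.2 = v) h, ins_single, ← h]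
  · rw [cut_single_of_neg (P := fun i : Cell m => i.2 = v) h, map_zero]

theorem aeval_intertwine {M N : Type*} [AddCommGroup M] [Module R M] [AddCommGroup N] [Module R N]
    (f : M →ₗ[R] N) {A : Module.End R M} {B : Module.End R N} (h : ∀ c, f (A c) = B (f c))
    (q : Polynomial R) (c : M) :
    f (Polynomial.aeval A q c) = Polynomial.aeval B q (f c) := by
  induction q using Polynomial.induction_on' generalizing c with
  | add q r hq hr => simp only [map_add, LinearMap.add_apply, hq, hr]
  | monomial n t =>
    rw [Polynomial.aeval_monomial, Polynomial.aeval_monomial, Module.End.mul_apply,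
      Module.End.mul_apply, Module.algebraMap_end_apply, Module.algebraMap_end_apply, map_smul]
    congr 1
    induction n generalizing c with
    | zero => simp
    | succ n ih => rw [pow_succ, pow_succ, Module.End.mul_apply, Module.End.mul_apply, ih, h]

theorem slice_repCell (v : ι →₀ ℕ) (g : Torus m) (c : Cell m →₀ R) :
    slice v (repCell m R g c) = repSymb m R g (slice v c) := by
  suffices h : slice v ∘ₗ repCell m R g = repSymb m R g ∘ₗ slice v from LinearMap.congr_fun h c
  refine cell_ext fun i => ?_
  rw [LinearMap.comp_apply, LinearMap.comp_apply, repCell_single, slice_single, slice_single]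
  change (if i.2 = v then _ else _) = _
  split_ifs
  · rw [repSymb_single]
    rfl
  · rw [map_zero]

theorem ins_repSymb (v : ι →₀ ℕ) (g : Torus m) (a : Symb m →₀ R) :
    ins v (repSymb m R g a) = repCell m R g (ins v a) := by
  suffices h : ins v ∘ₗ repSymb m R g = repCell m R g ∘ₗ ins v from LinearMap.congr_fun h a
  refine Finsupp.lhom_ext' fun a => LinearMap.ext_ring ?_
  simp only [LinearMap.comp_apply, Finsupp.lsingle_apply, repSymb_single, ins_single,
    repCell_single]
  rfl

theorem Cell.upd_same_exponent (i : Cell m) (x : ι) (o : Option (ZMod (m x))) :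
    i.upd x (o, i.2 x) = (i.1.upd x o, i.2) := by
  refine Prod.ext rfl (Finsupp.ext fun y => ?_)
  change i.2.update x (i.2 x) y = i.2 y
  rw [Finsupp.update_self]

theorem normC_single_of_none {x : ι} {i : Cell m} (h : i.1.1 x = none) :
    normC m R x (Finsupp.single i 1) = ∑ j, Finsupp.single (i.1.upd x (some j), i.2) 1 := by
  have h1 : Finsupp.single (i.get x) (1 : R) = nb R (m x) (i.2 x) := by
    rw [nb]
    congr 1
    exact Prod.ext h rfl
  rw [normC, ext_single, zero_mul, pow_zero, one_smul, h1, sN_nb, map_sum]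
  refine Finset.sum_congr rfl fun j _ => ?_
  rw [sb, emb_single, Cell.upd_same_exponent]

theorem normC_single_of_ne_none {x : ι} {i : Cell m} (h : i.1.1 x ≠ none) :
    normC m R x (Finsupp.single i 1) = 0 := by
  obtain ⟨j, hj⟩ := Option.ne_none_iff_exists'.mp h
  have h1 : Finsupp.single (i.get x) (1 : R) = sb R (i.2 x) j := by
    rw [sb]
    congr 1
    exact Prod.ext hj rfl
  rw [normC, ext_single, h1, sN_sb, map_zero, smul_zero]

theorem relC_single_of_none {x : ι} {i : Cell m} (h : i.1.1 x = none) :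
    relC φ p x (Finsupp.single i 1) = frobC φ p x (Finsupp.single i 1) -
      ∑ j, Finsupp.single (i.1.upd x (some j), i.2) 1 := by
  rw [relC, LinearMap.sub_apply, Module.End.mul_apply, noneC_eq_cut, cut_single_of_pos,
    normC_single_of_none h]
  rw [Cell.mem_somes, not_not]
  exact h

theorem relC_single_of_ne_none {x : ι} {i : Cell m} (h : i.1.1 x ≠ none) :
    relC φ p x (Finsupp.single i 1) = 0 := by
  rw [relC, LinearMap.sub_apply, Module.End.mul_apply, noneC_eq_cut, cut_single_of_neg,
    normC_single_of_ne_none h, map_zero, sub_zero]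
  rw [not_not, Cell.mem_somes]
  exact h

theorem slice_relC (v : ι →₀ ℕ) (x : ι) (c : Cell m →₀ R) :
    slice v (relC φ p x c) = relS φ p x (slice v c) := by
  suffices h : slice v ∘ₗ relC φ p x = relS φ p x ∘ₗ slice v from LinearMap.congr_fun h c
  refine cell_ext fun i => ?_
  rw [LinearMap.comp_apply, LinearMap.comp_apply]
  by_cases h : i.1.1 x = none
  · rw [relC_single_of_none φ p h, map_sub, frobC,
      aeval_intertwine (slice v) (A := repCell m R (φ x)) (B := repSymb m R (φ x))
        (slice_repCell v (φ x)), map_sum]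
    simp only [slice_single]
    split_ifs
    · rw [relS_of_none φ p h]
    · simp
  · rw [relC_single_of_ne_none φ p h, slice_single, map_zero]
    split_ifs
    · rw [relS_of_ne_none φ p h]
    · rw [map_zero]

theorem ins_relS (v : ι →₀ ℕ) (x : ι) (a : Symb m →₀ R) :
    ins v (relS φ p x a) = relC φ p x (ins v a) := by
  suffices h : ins v ∘ₗ relS φ p x = relC φ p x ∘ₗ ins v from LinearMap.congr_fun h a
  refine Finsupp.lhom_ext' fun a => LinearMap.ext_ring ?_
  simp only [LinearMap.comp_apply, Finsupp.lsingle_apply]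
  by_cases h : a.1 x = none
  · rw [relS_of_none φ p h, map_sub, aeval_intertwine (ins v) (A := repSymb m R (φ x))
      (B := repCell m R (φ x)) (ins_repSymb v (φ x)), ins_single,
      relC_single_of_none φ p (i := (a, v)) h, map_sum]
    simp only [ins_single]
    rfl
  · rw [relS_of_ne_none φ p h, ins_single, relC_single_of_ne_none φ p (i := (a, v)) h, map_zero]

theorem slice_mem_relModS {c : Cell m →₀ R} (hc : c ∈ relMod φ p) (v : ι →₀ ℕ) :
    slice v c ∈ relModS φ p := by
  suffices h : relMod φ p ≤ (relModS φ p).comap (slice v) from h hc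
  refine iSup_le fun x => ?_
  rintro _ ⟨c, rfl⟩
  rw [Submodule.mem_comap, slice_relC]
  exact Submodule.mem_iSup_of_mem x (LinearMap.mem_range_self _ _)

theorem ins_mem_relMod {a : Symb m →₀ R} (ha : a ∈ relModS φ p) (v : ι →₀ ℕ) :
    ins v a ∈ relMod φ p := by
  suffices h : relModS φ p ≤ (relMod φ p).comap (ins v) from h ha
  refine iSup_le fun x => ?_
  rintro _ ⟨c, rfl⟩
  rw [Submodule.mem_comap, ins_relS]
  exact relC_mem x _

theorem eq_sum_ins_slice (c : Cell m →₀ R) :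
    c = ∑ v ∈ c.support.image Prod.snd, ins v (slice v c) := by
  refine Finsupp.ext fun i => ?_
  rw [Finsupp.finsetSum_apply]
  simp only [ins_slice]
  by_cases h : c i = 0
  · rw [h, Finset.sum_eq_zero]
    intro v _
    by_cases hv : i.2 = v
    · rw [cut_apply_of_pos (P := fun i : Cell m => i.2 = v) hv, h]
    · rw [cut_apply_of_neg (P := fun i : Cell m => i.2 = v) hv]
  · rw [Finset.sum_eq_single_of_mem i.2 (Finset.mem_image_of_mem _ (Finsupp.mem_support_iff.mpr h)),
      cut_apply_of_pos (P := fun j : Cell m => j.2 = i.2) rfl]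
    intro v _ hv
    exact cut_apply_of_neg (P := fun j : Cell m => j.2 = v) (fun h => hv h.symm) c

theorem repSymb_relS (g : Torus m) (x : ι) (a : Symb m →₀ R) :
    repSymb m R g (relS φ p x a) = relS φ p x (repSymb m R g a) := by
  have h1 : ∀ a : Symb m →₀ R, slice 0 (ins 0 a) = a := fun a => by rw [slice_ins, if_pos rfl]
  have h2 : Commute (relC φ p x) (repCell m R g) :=
    commute_sub_left ((equivarC_frobC x g).mul_left (equivarC_noneC x g)) (equivarC_normC x g)
  have h3 := LinearMap.congr_fun h2.eq (ins 0 a)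
  have h4 := congrArg (slice 0) h3
  rw [Module.End.mul_apply, Module.End.mul_apply, slice_relC, slice_repCell, slice_repCell,
    slice_relC, h1] at h4
  exact h4.symm

theorem relModS_le_comap (g : Torus m) : relModS φ p ≤ (relModS φ p).comap (repSymb m R g) := by
  refine iSup_le fun x => ?_
  rintro _ ⟨a, rfl⟩
  rw [Submodule.mem_comap, repSymb_relS]
  exact Submodule.mem_iSup_of_mem x (LinearMap.mem_range_self _ _)

/-- The universal distribution, as a quotient of the free module on the symbols. -/
abbrev UModel : Type _ := (Symb m →₀ R) ⧸ relModS φ p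

/-- The group action on the universal distribution. -/
def repU : Representation R (Torus m) (UModel φ p) :=
  (repSymb m R).quotient (relModS φ p) (relModS_le_comap φ p)

theorem repU_mk (g : Torus m) (a : Symb m →₀ R) :
    repU φ p g ((relModS φ p).mkQ a) = (relModS φ p).mkQ (repSymb m R g a) := rfl

theorem isDiscreteRep_repU : IsDiscreteRep (repU φ p) := by
  refine isDiscreteRep_of_agree fun u => ?_
  obtain ⟨a, rfl⟩ := (relModS φ p).mkQ_surjective u
  refine ⟨a.support.biUnion fun s => s.2.toFinset, fun g g' h => ?_⟩
  rw [repU_mk, repU_mk]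
  congr 1
  refine Finsupp.mapDomain_congr fun s hs => Subtype.ext (funext fun x => ?_)
  change (s.1 x).map (· + (g x).toAdd) = (s.1 x).map (· + (g' x).toAdd)
  by_cases hx : s.1 x = none
  · rw [hx]
    rfl
  · rw [h x (Finset.mem_biUnion.mpr ⟨s, hs, by simpa using hx⟩)]

/-- A chain, as a function on the exponents with values in the universal distribution. -/
def toFunU : (Cell m →₀ R) →ₗ[R] ((ι →₀ ℕ) → UModel φ p) :=
  LinearMap.pi fun v => (relModS φ p).mkQ ∘ₗ slice v

theorem toFunU_apply (c : Cell m →₀ R) (v : ι →₀ ℕ) :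
    toFunU φ p c v = (relModS φ p).mkQ (slice v c) := rfl

theorem toFunU_eq_zero_iff (c : Cell m →₀ R) : toFunU φ p c = 0 ↔ c ∈ relMod φ p := by
  constructor
  · intro h
    rw [eq_sum_ins_slice c]
    refine Submodule.sum_mem _ fun v _ => ins_mem_relMod φ p ?_ v
    have := congrFun h v
    rwa [toFunU_apply, Submodule.mkQ_apply, Pi.zero_apply, Submodule.Quotient.mk_eq_zero] at this
  · intro h
    funext v
    rw [toFunU_apply, Submodule.mkQ_apply, Pi.zero_apply, Submodule.Quotient.mk_eq_zero]
    exact slice_mem_relModS φ p h v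

theorem slice_eq_zero {S : Set (ι →₀ ℕ)} {c : Cell m →₀ R}
    (hc : c ∈ Finsupp.supported R R {i : Cell m | i.2 ∈ S}) {v : ι →₀ ℕ} (hv : v ∉ S) :
    slice v c = 0 := by
  have h1 : slice v (ins v (slice v c)) = slice v c := by rw [slice_ins, if_pos rfl]
  rw [← h1, ins_slice, cut_eq_zero hc, map_zero]
  rintro i hi rfl
  exact hv hi

theorem toFunU_mem_perCochains {n : ℕ} {c : Cell m →₀ R} (hc : c ∈ degC m R n) :
    toFunU φ p c ∈ perCochains ι R (UModel φ p) n := by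
  refine ⟨(c.support.image Prod.snd).finite_toSet.subset fun v hv => ?_, fun v hv => ?_⟩
  · by_contra h
    refine hv ?_
    rw [toFunU_apply, slice_eq_zero (S := {w | w ∈ c.support.image Prod.snd}) _ h, map_zero]
    exact (Finsupp.mem_supported R c).mpr fun i hi => Finset.mem_image_of_mem _ hi
  · by_contra h
    refine hv ?_
    rw [toFunU_apply, slice_eq_zero (S := {w | w.degree = n}) hc h, map_zero]

theorem exists_toFunU_eq {n : ℕ} {f : (ι →₀ ℕ) → UModel φ p}
    (hf : f ∈ perCochains ι R (UModel φ p) n) : ∃ c ∈ degC m R n, toFunU φ p c = f := by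
  choose a ha using fun v => (relModS φ p).mkQ_surjective (f v)
  refine ⟨∑ v ∈ hf.1.toFinset, ins v (a v), Submodule.sum_mem _ fun v hv => ?_, ?_⟩
  · have h1 : v.degree = n := hf.2 v (by simpa using hv)
    have h2 : ins v (slice v (ins v (a v))) = cut R (fun i => i.2 = v) (ins v (a v)) :=
      ins_slice v _
    rw [slice_ins, if_pos rfl] at h2
    rw [h2]
    have h3 : {i : Cell m | i.2 = v} ⊆ {i : Cell m | i.2.degree = n} := by
      intro i hi
      rw [Set.mem_ofPred_eq] at hi ⊢
      rw [hi, h1]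
    exact Finsupp.supported_mono h3 (cut_mem _)
  · funext v
    rw [toFunU_apply, map_sum]
    simp only [slice_ins]
    rw [Finset.sum_ite_eq']
    split_ifs with h
    · exact ha v
    · rw [map_zero]
      by_contra h0
      exact h (by simpa using fun h1 => h0 h1.symm)

theorem Symb.act_torusSingle_of_some {a : Symb m} {x : ι} {k : ZMod (m x)} (h : a.1 x = some k)
    (j : ZMod (m x)) : a.act (torusSingle m x j) = a.upd x (some (k + j)) := by
  refine Subtype.ext (funext fun y => ?_)
  by_cases hy : y = x
  · subst hy
    change (a.1 y).map (· + (torusSingle m y j y).toAdd) = Function.update a.1 y _ y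
    rw [Function.update_self, h, torusSingle, Pi.mulSingle_eq_same]
    rfl
  · rw [Symb.act_apply_of_eq_one (Pi.mulSingle_eq_of_ne hy _), Symb.upd_apply,
      Function.update_of_ne hy]

theorem Symb.act_torusSingle_of_none {a : Symb m} {x : ι} (h : a.1 x = none) (j : ZMod (m x)) :
    a.act (torusSingle m x j) = a := by
  refine Subtype.ext (funext fun y => ?_)
  by_cases hy : y = x
  · subst hy
    rw [(Symb.act_eq_none_iff a).mpr h, h]
  · rw [Symb.act_apply_of_eq_one (Pi.mulSingle_eq_of_ne hy _)]

theorem Symb.upd_eq_self {a : Symb m} {x : ι} {o : Option (ZMod (m x))} (h : a.1 x = o) :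
    a.upd x o = a := by
  subst h
  exact Subtype.ext (Function.update_eq_self x a.1)

/-- The differential on a basis element, one prime at a time. -/
theorem slice_ext_sδ (v : ι →₀ ℕ) (x : ι) (i : Cell m) :
    slice v (ext x 1 (sδ R (m x)) (Finsupp.single i 1)) =
      if i.2.update x (i.2 x + 1) = v then
        (-1 : R) ^ signExp x i.2 • stepOp (repSymb m R) x (i.2 x + 1) (Finsupp.single i.1 1)
      else 0 := by
  have hstep : ∀ o : Option (ZMod (m x)), slice v (emb R x i
      (Finsupp.single (o, i.2 x + 1) 1)) = if i.2.update x (i.2 x + 1) = v then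
        Finsupp.single (i.1.upd x o) (1 : R) else 0 := by
    intro o
    rw [emb_single, slice_single]
    rfl
  have hn : slice v (emb R x i (nb R (m x) (i.2 x + 1))) =
      if i.2.update x (i.2 x + 1) = v then Finsupp.single (i.1.upd x none) (1 : R) else 0 :=
    hstep none
  have hs : ∀ j, slice v (emb R x i (sb R (i.2 x + 1) j)) =
      if i.2.update x (i.2 x + 1) = v then Finsupp.single (i.1.upd x (some j)) (1 : R) else 0 :=
    fun j => hstep (some j)
  rw [ext_single, one_mul, map_smul, stepOp, if_neg (Nat.succ_ne_zero _)]
  rcases h : i.1.1 x with _ | k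
  · have h1 : Finsupp.single (i.get x) (1 : R) = nb R (m x) (i.2 x) := by
      rw [nb]
      congr 1
      exact Prod.ext h rfl
    rw [h1, sδ_nb]
    by_cases hodd : Odd (i.2 x)
    · have hodd' : ¬ Odd (i.2 x + 1) := by rwa [odd_succ_iff, Nat.not_even_iff_odd]
      rw [if_pos hodd, if_neg hodd', map_smul, map_smul, hn,
        Symb.upd_eq_self h, normOp, LinearMap.sum_apply]
      simp only [repSymb_single, Symb.act_torusSingle_of_none h]
      rw [Finset.sum_const, Finset.card_univ, ZMod.card, Nat.cast_smul_eq_nsmul]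
      split_ifs <;> simp
    · have hodd' : Odd (i.2 x + 1) := by rwa [odd_succ_iff, ← Nat.not_odd_iff_even]
      rw [if_neg hodd, if_pos hodd', diffOp,
        LinearMap.sub_apply, repSymb_single, Symb.act_torusSingle_of_none h]
      simp
  · have h1 : Finsupp.single (i.get x) (1 : R) = sb R (i.2 x) k := by
      rw [sb]
      congr 1
      exact Prod.ext h rfl
    rw [h1, sδ_sb]
    by_cases hodd : Odd (i.2 x)
    · have hodd' : ¬ Odd (i.2 x + 1) := by rwa [odd_succ_iff, Nat.not_even_iff_odd]
      rw [if_neg (Nat.not_even_iff_odd.mpr hodd), if_neg hodd', map_sum, map_sum, normOp,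
        LinearMap.sum_apply]
      simp only [repSymb_single, Symb.act_torusSingle_of_some h, hs]
      split_ifs
      · congr 1
        exact (Fintype.sum_equiv (Equiv.addLeft k) _ _ fun _ => rfl).symm
      · simp
    · have hodd' : Odd (i.2 x + 1) := by rwa [odd_succ_iff, ← Nat.not_odd_iff_even]
      rw [if_pos (Nat.not_odd_iff_even.mp hodd), if_pos hodd', diffOp, LinearMap.sub_apply,
        repSymb_single, Symb.act_torusSingle_of_some h, map_sub, map_sub, hs, hs,
        Symb.upd_eq_self h]
      split_ifs
      · rfl
      · simp

theorem dPer_slice (c : Cell m →₀ R) (v : ι →₀ ℕ) :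
    dPer (repSymb m R) (fun w => slice w c) v = slice v (dTot m R c) := by
  let S : (Cell m →₀ R) →ₗ[R] ((ι →₀ ℕ) → (Symb m →₀ R)) := LinearMap.pi fun w => slice w
  suffices h : LinearMap.proj v ∘ₗ dPer (repSymb m R) ∘ₗ S = slice v ∘ₗ dTot m R from
    LinearMap.congr_fun h c
  refine cell_ext fun i => ?_
  change dPer (repSymb m R) (fun w => slice w (Finsupp.single i 1)) v =
    slice v (dTot m R (Finsupp.single i 1))
  rw [dPer_eq_sum _ _ v (v.support ∪ i.supp) Finset.subset_union_left,
    dTot_single i (r := v.support ∪ i.supp) Finset.subset_union_right, map_sum]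
  refine Finset.sum_congr rfl fun x _ => ?_
  rw [slice_ext_sδ, shiftOp_apply, slice_single]
  by_cases h : i.2.update x (i.2 x + 1) = v
  · have hv : v x = i.2 x + 1 := by rw [← h, coe_update', if_pos rfl]
    have h2 : i.2 = v.update x (v x - 1) := by
      rw [hv, Nat.add_sub_cancel, ← h, update_update]
      exact (Finsupp.update_self i.2 x).symm
    have h3 : signExp x v = signExp x i.2 := by
      rw [← h, signExp_update_of_not_lt x x (lt_irrefl x)]
    rw [if_pos h, if_pos h2, hv, h3]
  · rw [if_neg h]
    by_cases h0 : v x = 0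
    · simp [h0, stepOp]
    · rw [if_neg, map_zero, smul_zero]
      intro h2
      refine h ?_
      rw [h2, update_update, coe_update', if_pos rfl, Nat.sub_add_cancel
        (Nat.one_le_iff_ne_zero.mpr h0)]
      exact Finsupp.update_self v x

theorem dPer_toFunU (c : Cell m →₀ R) :
    dPer (repU φ p) (toFunU φ p c) = toFunU φ p (dTot m R c) := by
  have h1 := dPer_compLeft (repSymb m R) (repU φ p) (relModS φ p).mkQ (fun g v => rfl)
    (fun w => slice w c)
  refine h1.trans (funext fun v => ?_)
  exact congrArg (relModS φ p).mkQ (dPer_slice c v)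

/-! ### Degrees and blocks -/

theorem cut_relC {P : Cell m → Prop} (hP : ∀ i j : Cell m, i.2 = j.2 → (P i ↔ P j)) (x : ι) :
    Commute (cut R P) (relC φ p x) := by
  have h1 : EquivarC (cut R P) := cut_comm_rep fun g i => hP _ _ rfl
  refine commute_relC h1 ?_ ?_
  · rw [noneC]
    refine cut_mul_ext fun i t ht => ?_
    rw [(snone_location _ t ht).2, Cell.upd_get]
  · refine cell_ext fun i => ?_
    rw [Module.End.mul_apply, Module.End.mul_apply]
    by_cases h : i.1.1 x = none
    · rw [normC_single_of_none h, map_sum]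
      by_cases hi : P i
      · rw [cut_single_of_pos hi, normC_single_of_none h]
        exact Finset.sum_congr rfl fun j _ =>
          cut_single_of_pos ((hP i (i.1.upd x (some j), i.2) rfl).mp hi)
      · rw [cut_single_of_neg hi, map_zero]
        exact Finset.sum_eq_zero fun j _ => cut_single_of_neg fun hj =>
          hi ((hP i (i.1.upd x (some j), i.2) rfl).mpr hj)
    · rw [normC_single_of_ne_none h, map_zero]
      by_cases hi : P i
      · rw [cut_single_of_pos hi, normC_single_of_ne_none h]
      · rw [cut_single_of_neg hi, map_zero]

theorem cut_mem_relMod {P : Cell m → Prop} (hP : ∀ i j : Cell m, i.2 = j.2 → (P i ↔ P j))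
    {c : Cell m →₀ R} (hc : c ∈ relMod φ p) : cut R P c ∈ relMod φ p :=
  relMod_le_comap (fun x => cut_relC φ p hP x) hc

end Model

/-! ### The trivial module inside the periodic complex -/

section Trivial

set_option linter.unusedSectionVars false

variable {ι : Type*} [LinearOrder ι] {m : ι → ℕ} {R : Type*} [CommRing R] [∀ x, NeZero (m x)]
  {φ : ι → Torus m} {p : ι → Polynomial R}

variable (m) in
/-- The symbol `[1]`. -/
def Symb.one : Symb m := ⟨fun _ => none, by simp⟩

theorem Cell.somes_eq_empty_iff {i : Cell m} : i.somes = ∅ ↔ i.1 = Symb.one m := by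
  rw [Finset.eq_empty_iff_forall_notMem]
  simp only [Cell.mem_somes, not_not]
  exact ⟨fun h => Subtype.ext (funext h), fun h x => congrFun (congrArg Subtype.val h) x⟩

theorem posC_eq_cut (x : ι) : posC m R x = cut R fun i => x ∉ i.somes ∧ i.2 x ≠ 0 := by
  refine cell_ext fun i => ?_
  have h0 : posC m R x (Finsupp.single i 1) =
      emb R x i (sq R (m x) (Finsupp.single (i.get x) 1)) := by
    rw [posC, ext_single, zero_mul, pow_zero, one_smul]
  rw [h0]
  rcases h : i.1.1 x with _ | k
  · have h1 : Finsupp.single (i.get x) (1 : R) = nb R (m x) (i.2 x) := by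
      rw [nb]
      congr 1
      exact Prod.ext h rfl
    have hx : x ∉ i.somes := by
      rw [Cell.mem_somes, not_not]
      exact h
    by_cases hv : i.2 x = 0
    · rw [cut_single_of_neg (fun h => h.2 hv), h1, sq_nb, if_pos hv, map_zero]
    · rw [cut_single_of_pos ⟨hx, hv⟩, h1, sq_nb, if_neg hv, ← h1, emb_single, Cell.upd_get]
  · have h1 : Finsupp.single (i.get x) (1 : R) = sb R (i.2 x) k := by
      rw [sb]
      congr 1
      exact Prod.ext h rfl
    have hx : x ∈ i.somes := by
      rw [Cell.mem_somes]
      change i.1.1 x ≠ none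
      rw [h]
      simp
    rw [cut_single_of_neg (fun h => h.1 hx), h1, sq_sb, map_zero]

theorem adm_eq_supported (y : Finset ι) :
    adm m R y = Finsupp.supported R R {i : Cell m | i.1 = Symb.one m ∧ ∀ x ∈ y, i.2 x ≠ 0} := by
  ext e
  constructor
  · intro h
    rw [Finsupp.mem_supported']
    intro i hi
    by_contra h0
    refine hi ⟨Cell.somes_eq_empty_iff.mp ?_, fun x hx => ?_⟩
    · rw [Finset.eq_empty_iff_forall_notMem]
      intro x hx
      exact h0 ((Finsupp.mem_supported' R e).mp (noneC_eq_self_iff.mp (adm_noneC h x)) i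
        fun h => h hx)
    · intro hv
      have h1 := h.1 x hx
      rw [posC_eq_cut, cut_eq_self_iff, Finsupp.mem_supported'] at h1
      exact h0 (h1 i fun h => h.2 hv)
  · intro h
    refine ⟨fun x hx => ?_, fun x _ => ?_⟩
    · have h1 : {i : Cell m | i.1 = Symb.one m ∧ ∀ x ∈ y, i.2 x ≠ 0} ⊆
          {i | x ∉ i.somes ∧ i.2 x ≠ 0} := by
        intro i hi
        refine ⟨?_, hi.2 x hx⟩
        rw [Cell.somes_eq_empty_iff.mpr hi.1]
        simp
      rw [posC_eq_cut, cut_eq_self_iff]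
      exact Finsupp.supported_mono h1 h
    · rw [noneC_eq_self_iff]
      refine Finsupp.supported_mono (fun i hi => ?_) h
      rw [Set.mem_ofPred_eq, Cell.somes_eq_empty_iff.mpr hi.1]
      simp

theorem cut_mem_supported {P : Cell m → Prop} {S : Set (Cell m)} {c : Cell m →₀ R}
    (hc : c ∈ Finsupp.supported R R S) :
    cut R P c ∈ Finsupp.supported R R {i | i ∈ S ∧ P i} := by
  rw [Finsupp.mem_supported'] at hc ⊢
  intro i hi
  by_cases h : P i
  · rw [cut_apply_of_pos h]
    exact hc i fun h' => hi ⟨h', h⟩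
  · exact cut_apply_of_neg h c

theorem cut_mem_adm {P : Cell m → Prop} {y : Finset ι} {c : Cell m →₀ R} (hc : c ∈ adm m R y) :
    cut R P c ∈ adm m R y := by
  rw [adm_eq_supported] at hc ⊢
  exact Finsupp.supported_mono (fun i hi => hi.1) (cut_mem_supported (P := P) hc)

variable (m R) in
/-- The differential raises degrees by one. -/
theorem dTot_mem_degC {n : ℕ} {c : Cell m →₀ R} (hc : c ∈ degC m R n) :
    dTot m R c ∈ degC m R (n + 1) := by
  rw [degC, Finsupp.supported_eq_span_single] at hc
  induction hc using Submodule.span_induction with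
  | mem c hc =>
    obtain ⟨i, hi, rfl⟩ := hc
    rw [dTot_single i subset_rfl]
    refine Submodule.sum_mem _ fun x _ => ?_
    refine ext_mem_supported (S := {i : Cell m | i.2.degree = n}) (fun i hi t ht => ?_)
      (Finsupp.single_mem_supported R 1 hi)
    have h1 : t.2 = i.2 x + 1 := sδ_degree _ t ht
    have h2 : (i.2.update x t.2).degree + i.2 x = i.2.degree + t.2 := degree_update i.2 x t.2
    rw [Set.mem_ofPred_eq] at hi ⊢
    change (i.2.update x t.2).degree = n + 1
    omega
  | zero => rw [map_zero]; exact Submodule.zero_mem _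
  | add a b _ _ ha hb => rw [map_add]; exact Submodule.add_mem _ ha hb
  | smul r a _ ha => rw [map_smul]; exact Submodule.smul_mem _ r ha

variable (R) in
/-- The projection to the component of degree `n`. -/
abbrev cutDeg (n : ℕ) : Module.End R (Cell m →₀ R) := cut R fun i => i.2.degree = n

theorem cutDeg_single_of_ne {n : ℕ} {i : Cell m} (h : i.2.degree ≠ n) :
    cutDeg R n (Finsupp.single i 1) = 0 :=
  cut_single_of_neg (P := fun i : Cell m => i.2.degree = n) h

theorem cutDeg_single {i : Cell m} :
    cutDeg R i.2.degree (Finsupp.single i 1) = Finsupp.single i 1 :=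
  cut_single_of_pos (P := fun j : Cell m => j.2.degree = i.2.degree) rfl

theorem cutDeg_eq_self {n : ℕ} {c : Cell m →₀ R} (hc : c ∈ degC m R n) : cutDeg R n c = c :=
  cut_eq_self_iff.mpr hc

theorem cutDeg_eq_zero {n n' : ℕ} {c : Cell m →₀ R} (hc : c ∈ degC m R n') (h : n' ≠ n) :
    cutDeg R n c = 0 :=
  cut_eq_zero hc fun _ hi hi' => h (hi.symm.trans hi')

theorem single_mem_degC (i : Cell m) : Finsupp.single i (1 : R) ∈ degC m R i.2.degree :=
  Finsupp.single_mem_supported R 1 rfl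

theorem cutDeg_dTot (n : ℕ) (c : Cell m →₀ R) :
    cutDeg R (n + 1) (dTot m R c) = dTot m R (cutDeg R n c) := by
  suffices h : cutDeg R (n + 1) * dTot m R = dTot m R * cutDeg R n from LinearMap.congr_fun h c
  refine cell_ext fun i => ?_
  rw [Module.End.mul_apply, Module.End.mul_apply]
  have h1 := dTot_mem_degC m R (single_mem_degC (R := R) i)
  by_cases h : i.2.degree = n
  · subst h
    rw [cutDeg_eq_self h1, cutDeg_single]
  · rw [cutDeg_single_of_ne h, map_zero, cutDeg_eq_zero h1 fun h' => h (Nat.succ_injective h')]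

theorem cutDeg_zero_dTot (c : Cell m →₀ R) : cutDeg R 0 (dTot m R c) = 0 := by
  suffices h : cutDeg R 0 * dTot m R = 0 from LinearMap.congr_fun h c
  refine cell_ext fun i => ?_
  rw [Module.End.mul_apply, cutDeg_eq_zero (dTot_mem_degC m R (single_mem_degC (R := R) i))
    (Nat.succ_ne_zero _), LinearMap.zero_apply]

theorem predDegC_succ (n : ℕ) : predDegC m R (n + 1) = degC m R n := by
  rw [predDegC, degC]
  congr 1
  ext i
  simp

theorem predDegC_zero : predDegC m R 0 = ⊥ := by
  rw [predDegC, eq_bot_iff]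
  intro c hc
  rw [Finsupp.mem_supported'] at hc
  exact Finsupp.ext fun i => hc i (Nat.succ_ne_zero _)

theorem fL_mem_degC {y : Finset ι} {H : ι → Module.End R (Cell m →₀ R)}
    (hH : IsFrobHomotopy φ p y H) (l : List ι) {n : ℕ} {c : Cell m →₀ R}
    (hc : c ∈ degC m R (n + l.length)) : fL H l c ∈ degC m R n := by
  induction l generalizing n c with
  | nil => exact hc
  | cons x l ih =>
    rw [List.length_cons] at hc
    rw [fL_cons]
    refine Submodule.sub_mem _ (ih ?_) (Submodule.smul_mem _ _ ?_)
    · rw [← predDegC_succ]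
      exact thetaC_mem_predDegC x hc
    · rw [← predDegC_succ]
      refine hH.mem_predDegC x _ _ (ih ?_)
      rwa [show n + 1 + l.length = n + (l.length + 1) by omega]

theorem fL_eq_zero {y : Finset ι} {H : ι → Module.End R (Cell m →₀ R)}
    (hH : IsFrobHomotopy φ p y H) (l : List ι) {n : ℕ} {c : Cell m →₀ R}
    (hc : c ∈ degC m R n) (h : n < l.length) : fL H l c = 0 := by
  induction l generalizing n c with
  | nil => simp at h
  | cons x l ih =>
    rw [List.length_cons] at h
    have h1 : fL H l (thetaC m R x c) = 0 := by
      have h2 := thetaC_mem_predDegC x hc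
      rcases n with _ | n
      · rw [predDegC_zero, Submodule.mem_bot] at h2
        rw [h2, map_zero]
      · rw [predDegC_succ] at h2
        exact ih h2 (by omega)
    have h3 : H x (fL H l c) = 0 := by
      rcases Nat.lt_or_ge n l.length with h4 | h4
      · rw [ih hc h4, map_zero]
      · have h5 : fL H l c ∈ degC m R 0 := fL_mem_degC hH l (by
          rwa [show 0 + l.length = n by omega])
        have h6 := hH.mem_predDegC x _ _ h5
        rwa [predDegC_zero, Submodule.mem_bot] at h6
    rw [fL_cons, h1, h3, smul_zero, sub_zero]

theorem cutDeg_fL {y : Finset ι} {H : ι → Module.End R (Cell m →₀ R)}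
    (hH : IsFrobHomotopy φ p y H) (l : List ι) (n : ℕ) (c : Cell m →₀ R) :
    cutDeg R n (fL H l c) = fL H l (cutDeg R (n + l.length) c) := by
  suffices h : cutDeg R n * fL H l = fL H l * cutDeg R (n + l.length) from
    LinearMap.congr_fun h c
  refine cell_ext fun i => ?_
  rw [Module.End.mul_apply, Module.End.mul_apply]
  by_cases h : i.2.degree = n + l.length
  · rw [← h, cutDeg_single, cutDeg_eq_self]
    refine fL_mem_degC hH l ?_
    rw [← h]
    exact single_mem_degC i
  · rw [cutDeg_single_of_ne h, map_zero]
    rcases Nat.lt_or_ge i.2.degree l.length with h1 | h1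
    · rw [fL_eq_zero hH l (single_mem_degC i) h1, map_zero]
    · obtain ⟨k, hk⟩ := Nat.exists_eq_add_of_le' h1
      have h2 : fL H l (Finsupp.single i (1 : R)) ∈ degC m R k :=
        fL_mem_degC hH l (by rw [← hk]; exact single_mem_degC i)
      refine cutDeg_eq_zero h2 ?_
      rintro rfl
      exact h hk

/-- The differential of a chain of the trivial module. -/
theorem dTot_single_one (v : ι →₀ ℕ) :
    dTot m R (Finsupp.single (Symb.one m, v) 1) = ∑ x ∈ v.support with Odd (v x),
      Finsupp.single (Symb.one m, v + Finsupp.single x 1) ((-1 : R) ^ signExp x v * (m x : R)) := by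
  have h1 : Cell.supp ((Symb.one m, v) : Cell m) ⊆ v.support := by
    intro x hx
    rw [Cell.mem_supp_iff] at hx
    rw [Finsupp.mem_support_iff]
    rintro h
    exact hx (Prod.ext rfl h)
  rw [dTot_single _ h1, Finset.sum_filter]
  refine Finset.sum_congr rfl fun x _ => ?_
  have h2 : Finsupp.single (Cell.get x ((Symb.one m, v) : Cell m)) (1 : R) = nb R (m x) (v x) := rfl
  rw [ext_single, h2, sδ_nb, one_mul]
  split_ifs with h
  · rw [map_smul, nb, emb_single, Finsupp.smul_single, Finsupp.smul_single, smul_eq_mul,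
      smul_eq_mul,
      mul_one]
    congr 1
    refine Prod.ext (Symb.upd_eq_self rfl) ?_
    exact update_succ v x
  · rw [map_zero, smul_zero]

/-- The differential respects the decomposition of the trivial module into blocks. -/
theorem cut_block_dTot (w : ι → ℕ) {c : Cell m →₀ R}
    (hc : c ∈ adm m R ∅) :
    cut R (fun i : Cell m => ∀ x, (i.2 x + 1) / 2 = w x) (dTot m R c) =
      dTot m R (cut R (fun i : Cell m => ∀ x, (i.2 x + 1) / 2 = w x) c) := by
  rw [adm_eq_supported, Finsupp.supported_eq_span_single] at hc
  induction hc using Submodule.span_induction with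
  | mem c hc =>
    obtain ⟨⟨a, v⟩, hi, rfl⟩ := hc
    obtain rfl : a = Symb.one m := hi.1
    have h1 : ∀ x ∈ {x ∈ v.support | Odd (v x)}, ∀ x',
        ((v + Finsupp.single x 1 : ι →₀ ℕ) x' + 1) / 2 =
        (v x' + 1) / 2 := by
      intro x hx x'
      obtain ⟨k, hk⟩ := (Finset.mem_filter.mp hx).2
      by_cases h : x = x'
      · subst h
        simp only [Finsupp.add_apply, Finsupp.single_eq_same]
        omega
      · simp [Finsupp.single_eq_of_ne (Ne.symm h)]
    have hs : ∀ (i : Cell m) (r : R), Finsupp.single i r = r • Finsupp.single i 1 := by simp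
    rw [dTot_single_one, map_sum]
    by_cases h : ∀ x, (v x + 1) / 2 = w x
    · rw [cut_single_of_pos (P := fun i : Cell m => ∀ x, (i.2 x + 1) / 2 = w x) h, dTot_single_one]
      refine Finset.sum_congr rfl fun x hx => ?_
      rw [hs, map_smul, cut_single_of_pos (P := fun i : Cell m => ∀ x, (i.2 x + 1) / 2 = w x)]
      exact fun x' => (h1 x hx x').trans (h x')
    · rw [cut_single_of_neg (P := fun i : Cell m => ∀ x, (i.2 x + 1) / 2 = w x) h, map_zero]
      refine Finset.sum_eq_zero fun x hx => ?_
      rw [hs, map_smul, cut_single_of_neg (P := fun i : Cell m => ∀ x, (i.2 x + 1) / 2 = w x),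
        smul_zero]
      exact fun h' => h fun x' => (h1 x hx x').symm.trans (h' x')
  | zero => simp only [map_zero]
  | add a b _ _ ha hb => simp only [map_add, ha, hb]
  | smul r a _ ha => simp only [map_smul, ha]

end Trivial

/-! ### The decomposition of the cohomology -/

section Decomposition

set_option linter.unusedSectionVars false

variable {X G T : Type*} [LinearOrder X] [Group G] [TopologicalSpace G] [IsTopologicalGroup G]
  [CompactSpace G] [CommRing T] (D : NormData X G) (z : X → ℕ)

/-- The elements of `X` that divide `z`. -/
abbrev Primes (z : X → ℕ) : Type _ := {x : X // z x ≠ 0}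

/-- The orders of the groups `G_{z(x)}`, `x ∣ z`. -/
abbrev NormData.ord (x : Primes z) : ℕ := Nat.card (D.Gfin (Finsupp.single x.1 (z x.1)))

instance (x : Primes z) : NeZero (D.ord z x) := ⟨Nat.card_pos.ne'⟩

/-- The chains `⨁ T [v]`, as chains on the symbol `[1]`. -/
def toCell : ((X →₀ ℕ) →₀ T) →ₗ[T] (Cell (D.ord z) →₀ T) :=
  Finsupp.lmapDomain T T fun v => (Symb.one (D.ord z), v.subtypeDomain fun x => z x ≠ 0)

/-- The inverse of `toCell`. -/
def ofCell : (Cell (D.ord z) →₀ T) →ₗ[T] ((X →₀ ℕ) →₀ T) :=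
  Finsupp.lmapDomain T T fun i => i.2.extendDomain

theorem toCell_single (v : X →₀ ℕ) (r : T) : toCell D z (Finsupp.single v r) =
    Finsupp.single (Symb.one (D.ord z), v.subtypeDomain fun x => z x ≠ 0) r := by
  simp [toCell]

theorem ofCell_single (i : Cell (D.ord z)) (r : T) :
    ofCell D z (Finsupp.single i r) = Finsupp.single i.2.extendDomain r := by
  simp [ofCell]

theorem supported_induction {α : Type*} {S : Set α} {P : (α →₀ T) → Prop} (h0 : P 0)
    (hadd : ∀ a b, P a → P b → P (a + b)) (hsmul : ∀ (r : T) a, P a → P (r • a))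
    (hs : ∀ i ∈ S, P (Finsupp.single i 1)) {c : α →₀ T} (hc : c ∈ Finsupp.supported T T S) :
    P c := by
  rw [Finsupp.supported_eq_span_single] at hc
  induction hc using Submodule.span_induction with
  | mem c hc =>
    obtain ⟨i, hi, rfl⟩ := hc
    exact hs i hi
  | zero => exact h0
  | add a b _ _ ha hb => exact hadd a b ha hb
  | smul r a _ ha => exact hsmul r a ha

/-- The finite formal products of elements that divide `z`. -/
def dvdSet (z : X → ℕ) : Set (X →₀ ℕ) := {v | ∀ x ∈ v.support, z x ≠ 0}

theorem ofCell_toCell {c : (X →₀ ℕ) →₀ T} (hc : c ∈ Finsupp.supported T T (dvdSet z)) :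
    ofCell D z (toCell D z c) = c := by
  refine supported_induction (P := fun c => ofCell D z (toCell D z c) = c) (by simp)
    (fun a b ha hb => by rw [map_add, map_add, ha, hb])
    (fun r a ha => by rw [map_smul, map_smul, ha]) (fun v hv => ?_) hc
  rw [toCell_single, ofCell_single, Finsupp.extendDomain_subtypeDomain v hv]

theorem toCell_ofCell {c : Cell (D.ord z) →₀ T} (hc : c ∈ adm (D.ord z) T ∅) :
    toCell D z (ofCell D z c) = c := by
  rw [adm_eq_supported] at hc
  refine supported_induction (P := fun c => toCell D z (ofCell D z c) = c) (by simp)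
    (fun a b ha hb => by rw [map_add, map_add, ha, hb])
    (fun r a ha => by rw [map_smul, map_smul, ha]) (fun i hi => ?_) hc
  rw [ofCell_single, toCell_single, Finsupp.subtypeDomain_extendDomain, ← hi.1]

theorem subtypeDomain_support {v : X →₀ ℕ} (hv : v ∈ dvdSet z) :
    v.support = (v.subtypeDomain fun x => z x ≠ 0).support.map (Function.Embedding.subtype _) := by
  ext x
  simp only [Finsupp.support_subtypeDomain, Finset.mem_map, Finset.mem_subtype,
    Function.Embedding.subtype_apply, Subtype.exists, exists_and_left, exists_prop]
  constructor
  · intro h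
    exact ⟨x, h, hv x h, rfl⟩
  · rintro ⟨y, h, _, rfl⟩
    exact h

theorem signExp_subtypeDomain {v : X →₀ ℕ} (hv : v ∈ dvdSet z) (x : Primes z) :
    signExp x (v.subtypeDomain fun x => z x ≠ 0) = ∑ x' ∈ v.support with x' < x.1, v x' := by
  rw [signExp, Finset.sum_filter, Finset.sum_filter]
  conv_rhs => rw [subtypeDomain_support z hv, Finset.sum_map]
  rfl

theorem delta_mem_dvdSet {c : (X →₀ ℕ) →₀ T} (hc : c ∈ Finsupp.supported T T (dvdSet z)) :
    D.delta T z c ∈ Finsupp.supported T T (dvdSet z) := by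
  refine supported_induction (P := fun c => D.delta T z c ∈ Finsupp.supported T T (dvdSet z))
    (by simp) (fun a b ha hb => by rw [map_add]; exact Submodule.add_mem _ ha hb)
    (fun r a ha => by rw [map_smul]; exact Submodule.smul_mem _ _ ha) (fun v hv => ?_) hc
  rw [NormData.delta, Finsupp.linearCombination_single, one_smul]
  refine Submodule.sum_mem _ fun x hx => Finsupp.single_mem_supported T _ fun x' hx' => ?_
  rw [Finset.mem_filter] at hx
  by_cases h : x' = x
  · subst h
    exact hv x' hx.1
  · rw [Finsupp.mem_support_iff, Finsupp.add_apply, Finsupp.single_eq_of_ne h, add_zero] at hx'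
    exact hv x' (Finsupp.mem_support_iff.mpr hx')

theorem toCell_delta {c : (X →₀ ℕ) →₀ T} (hc : c ∈ Finsupp.supported T T (dvdSet z)) :
    toCell D z (D.delta T z c) = dTot (D.ord z) T (toCell D z c) := by
  refine supported_induction
    (P := fun c => toCell D z (D.delta T z c) = dTot (D.ord z) T (toCell D z c)) (by simp)
    (fun a b ha hb => by simp only [map_add, ha, hb])
    (fun r a ha => by simp only [map_smul, ha]) (fun v hv => ?_) hc
  rw [NormData.delta, Finsupp.linearCombination_single, one_smul, toCell_single,
    dTot_single_one, map_sum, Finset.sum_filter, Finset.sum_filter]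
  conv_lhs => rw [subtypeDomain_support z hv, Finset.sum_map]
  refine Finset.sum_congr rfl fun x _ => ?_
  simp only [Function.Embedding.subtype_apply]
  have h1 : (v.subtypeDomain fun x => z x ≠ 0) x = v x.1 := rfl
  rw [h1, toCell_single, signExp_subtypeDomain z hv]
  have h2 : (v + Finsupp.single x.1 1).subtypeDomain (fun x => z x ≠ 0) =
      v.subtypeDomain (fun x => z x ≠ 0) + Finsupp.single x 1 := by
    ext y
    simp only [Finsupp.subtypeDomain_apply, Finsupp.add_apply, Finsupp.single_apply,
      Subtype.ext_iff]
  rw [h2, ← subtypeDomain_support z hv]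
  rfl

theorem delta_ofCell {c : Cell (D.ord z) →₀ T} (hc : c ∈ adm (D.ord z) T ∅)
    (hd : ofCell D z c ∈ Finsupp.supported T T (dvdSet z)) :
    D.delta T z (ofCell D z c) = ofCell D z (dTot (D.ord z) T c) := by
  rw [← ofCell_toCell D z (delta_mem_dvdSet D z hd), toCell_delta D z hd, toCell_ofCell D z hc]

theorem mem_blockIndex_iff {w v : X →₀ ℕ} {q : ℕ} :
    v ∈ blockIndex w q ↔ v.degree = q ∧ ∀ x, (v x + 1) / 2 = w x := by
  refine and_congr_right fun _ => ?_
  constructor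
  · rintro ⟨w', hw', h⟩ x
    have h1 := DFunLike.congr_fun h x
    simp only [Finsupp.add_apply, Finsupp.indicator_apply, Finsupp.smul_apply, smul_eq_mul] at h1
    split_ifs at h1 <;> omega
  · intro h
    refine ⟨{x ∈ w.support | Odd (v x)}, Finset.filter_subset _ _, Finsupp.ext fun x => ?_⟩
    have h1 := h x
    simp only [Finsupp.add_apply, Finsupp.indicator_apply, Finsupp.smul_apply, smul_eq_mul,
      Finset.mem_filter, Finsupp.mem_support_iff, dite_eq_ite]
    split_ifs with h2
    · obtain ⟨k, hk⟩ := h2.2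
      omega
    · rcases Nat.even_or_odd (v x) with ⟨k, hk⟩ | ⟨k, hk⟩
      · omega
      · exact absurd ⟨by omega, ⟨k, hk⟩⟩ h2

theorem pos_of_mem_blockIndex {w v : X →₀ ℕ} {q : ℕ} (h : v ∈ blockIndex w q) {x : X}
    (hx : x ∈ w.support) : v x ≠ 0 := by
  have h1 := (mem_blockIndex_iff.mp h).2 x
  have h2 := Finsupp.mem_support_iff.mp hx
  omega

theorem card_le_of_mem_blockIndex {w v : X →₀ ℕ} {q : ℕ} (h : v ∈ blockIndex w q) :
    w.support.card ≤ q := by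
  have h1 : w.support ⊆ v.support := fun x hx =>
    Finsupp.mem_support_iff.mpr (pos_of_mem_blockIndex h hx)
  rw [← h.1, Finsupp.degree_apply]
  calc w.support.card ≤ v.support.card := Finset.card_le_card h1
    _ = ∑ x ∈ v.support, 1 := Finset.card_eq_sum_ones _
    _ ≤ ∑ x ∈ v.support, v x := Finset.sum_le_sum fun x hx =>
      Nat.one_le_iff_ne_zero.mpr (Finsupp.mem_support_iff.mp hx)

/-- The complex `I_T [w²]` vanishes in degrees below `deg w̄`. -/
theorem block_eq_bot {w : X →₀ ℕ} {q : ℕ} (h : q < w.support.card) : block T w q = ⊥ := by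
  rw [block, show blockIndex w q = ∅ from Set.eq_empty_iff_forall_notMem.mpr fun v hv =>
    absurd (card_le_of_mem_blockIndex hv) (not_le.mpr h), Finsupp.supported_empty]

theorem blockIndex_subset_dvdSet {w : X →₀ ℕ} (hw : w ∈ dvdSet z) (q : ℕ) :
    blockIndex w q ⊆ dvdSet z := by
  intro v hv x hx
  have h1 := (mem_blockIndex_iff.mp hv).2 x
  have h2 := Finsupp.mem_support_iff.mp hx
  exact hw x (Finsupp.mem_support_iff.mpr (by omega))

theorem degree_subtypeDomain {v : X →₀ ℕ} (hv : v ∈ dvdSet z) :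
    (v.subtypeDomain fun x => z x ≠ 0).degree = v.degree := by
  rw [Finsupp.degree_apply, Finsupp.degree_apply, subtypeDomain_support z hv, Finset.sum_map]
  rfl

/-- The exponents `u` that belong to the block of `w`, that is, `u x` is `2 w x - 1` or `2 w x`, or
`0` if `w x = 0`. -/
def IsBlock (w : X →₀ ℕ) (i : Cell (D.ord z)) : Prop := ∀ x : Primes z, (i.2 x + 1) / 2 = w x.1

theorem toCell_mem {S : Set (X →₀ ℕ)} {S' : Set (Cell (D.ord z))}
    (h : ∀ v ∈ S, (Symb.one (D.ord z), v.subtypeDomain fun x => z x ≠ 0) ∈ S')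
    {c : (X →₀ ℕ) →₀ T} (hc : c ∈ Finsupp.supported T T S) :
    toCell D z c ∈ Finsupp.supported T T S' := by
  refine supported_induction (P := fun c => toCell D z c ∈ Finsupp.supported T T S')
    (by simp) (fun a b ha hb => by rw [map_add]; exact Submodule.add_mem _ ha hb)
    (fun r a ha => by rw [map_smul]; exact Submodule.smul_mem _ _ ha) (fun v hv => ?_) hc
  rw [toCell_single]
  exact Finsupp.single_mem_supported T _ (h v hv)

theorem ofCell_mem {S : Set (Cell (D.ord z))} {S' : Set (X →₀ ℕ)}
    (h : ∀ i ∈ S, i.2.extendDomain ∈ S') {c : Cell (D.ord z) →₀ T}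
    (hc : c ∈ Finsupp.supported T T S) : ofCell D z c ∈ Finsupp.supported T T S' := by
  refine supported_induction (P := fun c => ofCell D z c ∈ Finsupp.supported T T S')
    (by simp) (fun a b ha hb => by rw [map_add]; exact Submodule.add_mem _ ha hb)
    (fun r a ha => by rw [map_smul]; exact Submodule.smul_mem _ _ ha) (fun v hv => ?_) hc
  rw [ofCell_single]
  exact Finsupp.single_mem_supported T _ (h v hv)

theorem toCell_mem_adm {w : X →₀ ℕ} {q : ℕ} {y : Finset (Primes z)}
    (hy : ∀ x ∈ y, x.1 ∈ w.support) {c : (X →₀ ℕ) →₀ T} (hc : c ∈ block T w q) :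
    toCell D z c ∈ adm (D.ord z) T y := by
  rw [adm_eq_supported]
  refine toCell_mem D z (S := blockIndex w q) (fun v hv => ?_) hc
  exact ⟨rfl, fun x hx => pos_of_mem_blockIndex hv (hy x hx)⟩

theorem toCell_mem_degC {w : X →₀ ℕ} (hw : w ∈ dvdSet z) {q : ℕ} {c : (X →₀ ℕ) →₀ T}
    (hc : c ∈ block T w q) : toCell D z c ∈ degC (D.ord z) T q :=
  toCell_mem D z (S := blockIndex w q) (S' := {i | i.2.degree = q})
    (fun _ hv => (degree_subtypeDomain z (blockIndex_subset_dvdSet z hw q hv)).trans hv.1) hc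

theorem toCell_mem_isBlock {w : X →₀ ℕ} {q : ℕ} {c : (X →₀ ℕ) →₀ T}
    (hc : c ∈ block T w q) : toCell D z c ∈ Finsupp.supported T T {i | IsBlock D z w i} :=
  toCell_mem D z (S := blockIndex w q) (S' := {i | IsBlock D z w i})
    (fun _ hv x => (mem_blockIndex_iff.mp hv).2 x.1) hc

theorem extendDomain_apply_mem (u : Primes z →₀ ℕ) (x : Primes z) : u.extendDomain x.1 = u x :=
  DFunLike.congr_fun (Finsupp.subtypeDomain_extendDomain u) x

theorem extendDomain_mem_dvdSet (u : Primes z →₀ ℕ) : u.extendDomain ∈ dvdSet z := by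
  intro x hx
  exact Finsupp.support_extendDomain_subset u hx

theorem ofCell_mem_block {w : X →₀ ℕ} (hw : w ∈ dvdSet z) {q : ℕ} {c : Cell (D.ord z) →₀ T}
    (hc : c ∈ Finsupp.supported T T {i : Cell (D.ord z) | i.2.degree = q ∧ IsBlock D z w i}) :
    ofCell D z c ∈ block T w q := by
  refine ofCell_mem D z (fun i hi => mem_blockIndex_iff.mpr ⟨?_, fun x => ?_⟩) hc
  · rw [← degree_subtypeDomain z (extendDomain_mem_dvdSet z i.2),
      Finsupp.subtypeDomain_extendDomain, hi.1]
  · by_cases hx : z x = 0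
    · have h1 : i.2.extendDomain x = 0 := by
        by_contra h
        exact extendDomain_mem_dvdSet z i.2 x (Finsupp.mem_support_iff.mpr h) hx
      have h2 : w x = 0 := by
        by_contra h
        exact hw x (Finsupp.mem_support_iff.mpr h) hx
      rw [h1, h2]
    · exact (congrArg (fun k => (k + 1) / 2) (extendDomain_apply_mem z i.2 ⟨x, hx⟩)).trans
        (hi.2 ⟨x, hx⟩)

/-- The subset `y`, as a set of elements that divide `z`. -/
abbrev PairIndex.sub {z : X → ℕ} (j : PairIndex z) : Finset (Primes z) :=
  j.1.1.subtype fun x => z x ≠ 0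

theorem PairIndex.map_sub {z : X → ℕ} (j : PairIndex z) :
    j.sub.map (Function.Embedding.subtype _) = j.1.1 :=
  Finset.subtype_map_of_mem fun x hx => j.2.2 x (j.2.1 hx)

theorem PairIndex.length_sub {z : X → ℕ} (j : PairIndex z) : j.sub.toList.length = j.1.1.card := by
  rw [Finset.length_toList]
  conv_rhs => rw [← j.map_sub]
  rw [Finset.card_map]

theorem PairIndex.mem_support_of_mem_sub {z : X → ℕ} (j : PairIndex z) :
    ∀ x ∈ j.sub, x.1 ∈ j.1.2.support := fun _ hx => j.2.1 (Finset.mem_subtype.mp hx)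

theorem isBlock_unique {w w' : X →₀ ℕ} (hw : w ∈ dvdSet z) (hw' : w' ∈ dvdSet z)
    {i : Cell (D.ord z)} (h : IsBlock D z w i) (h' : IsBlock D z w' i) : w = w' := by
  ext x
  by_cases hx : z x = 0
  · have h1 : ∀ w ∈ dvdSet z, w x = 0 := fun w hw => by
      by_contra h
      exact hw x (Finsupp.mem_support_iff.mpr h) hx
    rw [h1 w hw, h1 w' hw']
  · exact (h ⟨x, hx⟩).symm.trans (h' ⟨x, hx⟩)

/-- The block to which a basis element belongs. -/
def blockOf (i : Cell (D.ord z)) : X →₀ ℕ :=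
  (i.2.mapRange (fun k => (k + 1) / 2) rfl).extendDomain

theorem isBlock_blockOf (i : Cell (D.ord z)) : IsBlock D z (blockOf D z i) i := fun x =>
  (extendDomain_apply_mem z (i.2.mapRange (fun k => (k + 1) / 2) rfl) x).symm

theorem blockOf_mem_dvdSet (i : Cell (D.ord z)) : blockOf D z i ∈ dvdSet z :=
  extendDomain_mem_dvdSet z _

theorem eq_sum_cut_isBlock (c : Cell (D.ord z) →₀ T) :
    c = ∑ w ∈ c.support.image (blockOf D z), cut T (IsBlock D z w) c := by
  refine Finsupp.ext fun i => ?_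
  rw [Finsupp.finsetSum_apply]
  by_cases h : c i = 0
  · rw [h, Finset.sum_eq_zero]
    intro w _
    by_cases hw : IsBlock D z w i
    · rw [cut_apply_of_pos hw, h]
    · rw [cut_apply_of_neg hw]
  · rw [Finset.sum_eq_single_of_mem (blockOf D z i)
      (Finset.mem_image_of_mem _ (Finsupp.mem_support_iff.mpr h)),
      cut_apply_of_pos (isBlock_blockOf D z i)]
    intro w hw hne
    obtain ⟨j, _, rfl⟩ := Finset.mem_image.mp hw
    exact cut_apply_of_neg (fun h => hne (isBlock_unique D z (blockOf_mem_dvdSet D z j)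
      (blockOf_mem_dvdSet D z i) h (isBlock_blockOf D z i))) c

variable {φ : Primes z → Torus (D.ord z)} {p : Primes z → Polynomial T}

/-- The homomorphism that maps the cocycles of the block of `w` to the summand of index `(y, w)`. -/
def summandMap (φ : Primes z → Torus (D.ord z)) (p : Primes z → Polynomial T)
    (H : Finset (Primes z) → Primes z → Module.End T (Cell (D.ord z) →₀ T)) (j : PairIndex z) :
    ((X →₀ ℕ) →₀ T) →ₗ[T] ((Primes z →₀ ℕ) → UModel φ p) :=
  toFunU φ p ∘ₗ fL (H j.sub) j.sub.toList ∘ₗ toCell D z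

theorem adm_mono {ι : Type*} [LinearOrder ι] {m : ι → ℕ} [∀ x, NeZero (m x)] {y y' : Finset ι}
    (h : y ⊆ y') : adm m T y' ≤ adm m T y := by
  rw [adm_eq_supported, adm_eq_supported]
  exact Finsupp.supported_mono fun i hi => ⟨hi.1, fun x hx => hi.2 x (h hx)⟩

variable {H : Finset (Primes z) → Primes z → Module.End T (Cell (D.ord z) →₀ T)}

theorem block_le_dvdSet {w : X →₀ ℕ} (hw : w ∈ dvdSet z) (q : ℕ) :
    block T w q ≤ Finsupp.supported T T (dvdSet z) :=
  Finsupp.supported_mono (blockIndex_subset_dvdSet z hw q)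

theorem toFunU_dTot_fL (hH : ∀ y, IsFrobHomotopy φ p y (H y)) {y : Finset (Primes z)}
    {c : Cell (D.ord z) →₀ T} (hc : c ∈ adm (D.ord z) T y) :
    toFunU φ p (fL (H y) y.toList (dTot (D.ord z) T c)) =
      (-1 : T) ^ y.card • dPer (repU φ p) (toFunU φ p (fL (H y) y.toList c)) := by
  have h1 := dTot_fL (hH y) y.nodup_toList (fun x hx => Finset.mem_toList.mp hx) hc.2
    fun x hx => hc.1 x (Finset.mem_toList.mp hx)
  rw [← toFunU_eq_zero_iff, _root_.map_sub, _root_.map_smul, ← dPer_toFunU, sub_eq_zero,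
    Finset.length_toList] at h1
  rw [h1, smul_smul, ← mul_pow, neg_one_mul, neg_neg, one_pow, one_smul]

theorem summandMap_mem_cocyc (hH : ∀ y, IsFrobHomotopy φ p y (H y)) (n : ℕ) (j : PairIndex z)
    {u : (X →₀ ℕ) →₀ T} (hu : u ∈ D.blockCocycles T z j.1.2 (n + j.1.1.card)) :
    summandMap D z φ p H j u ∈ cocyc (V := fun _ => (Primes z →₀ ℕ) → UModel φ p)
      (perCochains (Primes z) T (UModel φ p)) (fun _ => dPer (repU φ p)) n := by
  have h1 : toCell D z u ∈ adm (D.ord z) T j.sub :=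
    toCell_mem_adm D z j.mem_support_of_mem_sub hu.1
  rw [mem_cocyc]
  constructor
  · refine toFunU_mem_perCochains φ p (fL_mem_degC (hH _) _ ?_)
    rw [j.length_sub]
    exact toCell_mem_degC D z j.2.2 hu.1
  · have h2 := toFunU_dTot_fL D z hH h1
    have h3 : D.delta T z u = 0 := hu.2
    rw [← toCell_delta D z (block_le_dvdSet z j.2.2 _ hu.1), h3, _root_.map_zero, _root_.map_zero,
      _root_.map_zero] at h2
    have h4 := congrArg (fun f => (-1 : T) ^ j.sub.card • f) h2
    simp only [smul_smul, ← mul_pow, neg_one_mul, neg_neg, one_pow, one_smul, smul_zero] at h4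
    exact h4.symm

theorem summandMap_mem_cobd (hH : ∀ y, IsFrobHomotopy φ p y (H y)) (n : ℕ) (j : PairIndex z)
    {u : (X →₀ ℕ) →₀ T} (hu : u ∈ D.blockCoboundaries T z j.1.2 (n + j.1.1.card)) :
    summandMap D z φ p H j u ∈ cobd (V := fun _ => (Primes z →₀ ℕ) → UModel φ p)
      (perCochains (Primes z) T (UModel φ p)) (fun _ => dPer (repU φ p)) n := by
  have hcard : j.1.1.card ≤ j.1.2.support.card := Finset.card_le_card j.2.1
  rcases hq : n + j.1.1.card with _ | q
  · rw [hq] at hu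
    obtain rfl : u = 0 := hu
    rw [_root_.map_zero]
    exact Submodule.zero_mem _
  · rw [hq] at hu
    obtain ⟨u, hu, rfl⟩ := hu
    rcases n with _ | n
    · rw [SetLike.mem_coe, block_eq_bot (by omega), Submodule.mem_bot] at hu
      subst hu
      rw [_root_.map_zero, _root_.map_zero]
      exact Submodule.zero_mem _
    · have hq' : q = n + j.1.1.card := by omega
      have h1 : toCell D z u ∈ adm (D.ord z) T j.sub :=
        toCell_mem_adm D z j.mem_support_of_mem_sub hu
      have h2 : summandMap D z φ p H j (D.delta T z u) =
          dPer (repU φ p) ((-1 : T) ^ j.sub.card • summandMap D z φ p H j u) := by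
        rw [_root_.map_smul]
        refine Eq.trans ?_ (toFunU_dTot_fL D z hH h1)
        rw [← toCell_delta D z (block_le_dvdSet z j.2.2 _ hu)]
        rfl
      rw [h2]
      refine Submodule.mem_map_of_mem (Submodule.smul_mem _ _ (toFunU_mem_perCochains φ p
        (fL_mem_degC (hH _) _ ?_)))
      rw [j.length_sub, ← hq']
      exact toCell_mem_degC D z j.2.2 hu

/-- A cocycle of the trivial module with positive exponents at `y` is a sum of cocycles of
blocks. -/
theorem toFunU_fL_mem_iSup (n : ℕ) (y : Finset (Primes z)) {c : Cell (D.ord z) →₀ T}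
    (hc : c ∈ adm (D.ord z) T y) (hd : dTot (D.ord z) T c = 0)
    (hdeg : c ∈ degC (D.ord z) T (n + y.card)) :
    toFunU φ p (fL (H y) y.toList c) ∈ ⨆ j : PairIndex z,
      (D.blockCocycles T z j.1.2 (n + j.1.1.card)).map (summandMap D z φ p H j) := by
  have hc0 : c ∈ adm (D.ord z) T ∅ := adm_mono (Finset.empty_subset _) hc
  rw [eq_sum_cut_isBlock D z c]
  simp only [_root_.map_sum]
  refine Submodule.sum_mem _ fun w hw => ?_
  obtain ⟨i, hi, rfl⟩ := Finset.mem_image.mp hw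
  set w := blockOf D z i with hwdef
  have hwz : w ∈ dvdSet z := blockOf_mem_dvdSet D z i
  have hyw : ∀ x ∈ y, x.1 ∈ w.support := by
    intro x hx
    rw [adm_eq_supported, Finsupp.mem_supported] at hc
    have h1 : i.2 x ≠ 0 := (hc hi).2 x hx
    have h2 : (i.2 x + 1) / 2 = w x.1 := isBlock_blockOf D z i x
    rw [Finsupp.mem_support_iff]
    omega
  let j : PairIndex z := ⟨(y.map (Function.Embedding.subtype _), w), fun x hx => by
    obtain ⟨x', hx', rfl⟩ := Finset.mem_map.mp hx
    exact hyw x' hx', hwz⟩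
  have hj : j.sub = y := by
    ext x
    simp only [j, PairIndex.sub, Finset.mem_subtype, Finset.mem_map,
      Function.Embedding.subtype_apply]
    exact ⟨fun ⟨x', hx', h⟩ => Subtype.ext h ▸ hx', fun h => ⟨x, h, rfl⟩⟩
  have hjc : j.1.1.card = y.card := Finset.card_map _
  set b := cut T (IsBlock D z w) c with hb
  have hb0 : b ∈ adm (D.ord z) T ∅ := cut_mem_adm hc0
  have hbd : dTot (D.ord z) T b = 0 := by
    have := cut_block_dTot (fun x : Primes z => w x.1) hc0
    rw [hd, _root_.map_zero] at this
    exact this.symm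
  have hbw : ofCell D z b ∈ block T w (n + y.card) :=
    ofCell_mem_block D z hwz (cut_mem_supported (P := IsBlock D z w) hdeg)
  refine Submodule.mem_iSup_of_mem j ⟨ofCell D z b, ⟨?_, ?_⟩, ?_⟩
  · rw [hjc]
    exact hbw
  · rw [SetLike.mem_coe, LinearMap.mem_ker, delta_ofCell D z hb0 (block_le_dvdSet z hwz _ hbw), hbd,
      _root_.map_zero]
  · change toFunU φ p (fL (H j.sub) j.sub.toList (toCell D z (ofCell D z b))) = _
    rw [toCell_ofCell D z hb0, hj]

theorem ofCell_mem_blockCoboundaries {y : Finset (Primes z)} {w : X →₀ ℕ} (hw : w ∈ dvdSet z)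
    {q : ℕ} {e e' : Cell (D.ord z) →₀ T} (he : e ∈ degC (D.ord z) T q)
    (he' : e' ∈ adm (D.ord z) T y) {f : Cell (D.ord z) →₀ T}
    (hf : cut T (IsBlock D z w) f = e) (h : f = (-1 : T) ^ y.card • dTot (D.ord z) T e') :
    ofCell D z e ∈ D.blockCoboundaries T z w q := by
  have h0 : e' ∈ adm (D.ord z) T ∅ := adm_mono (Finset.empty_subset _) he'
  have h1 : e = (-1 : T) ^ y.card • dTot (D.ord z) T (cut T (IsBlock D z w) e') := by
    rw [← hf, h, _root_.map_smul]
    congr 1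
    exact cut_block_dTot (fun x : Primes z => w x.1) h0
  have h2 := cutDeg_eq_self he
  rw [h1, _root_.map_smul] at h2
  rcases q with _ | q
  · rw [cutDeg_zero_dTot, smul_zero, ← h1] at h2
    rw [← h2, _root_.map_zero]
    exact Submodule.zero_mem _
  · rw [cutDeg_dTot, ← h1] at h2
    set b := cutDeg T q (cut T (IsBlock D z w) e')
    have hb : ofCell D z b ∈ block T w q :=
      ofCell_mem_block D z hw (Finsupp.supported_mono (t := {i | i.2.degree = q ∧ IsBlock D z w i})
        (fun _ hi => ⟨hi.2, hi.1⟩) (cut_mem_supported (S := {i | IsBlock D z w i})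
          (P := fun i : Cell (D.ord z) => i.2.degree = q) (cut_mem e')))
    have hb0 : b ∈ adm (D.ord z) T ∅ := cut_mem_adm (cut_mem_adm h0)
    refine ⟨(-1 : T) ^ y.card • ofCell D z b, Submodule.smul_mem _ _ hb, ?_⟩
    rw [_root_.map_smul, delta_ofCell D z hb0 (block_le_dvdSet z hw q hb), ← h2, _root_.map_smul]

/-- The cohomology of the periodic complex with coefficients in the universal distribution: by
`cone_acyclic`, it is the direct sum, over the finite sets `y`, of the cohomology of the trivial
module in the exponents that are positive at `y`, and this decomposes into blocks. -/
theorem nonempty_periodic_equiv (φ : Primes z → Torus (D.ord z)) (p : Primes z → Polynomial T)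
    (hp : ∀ x, (p x).eval 1 = 0) (n : ℕ) :
    Nonempty (Subquotient (cocyc (V := fun _ => (Primes z →₀ ℕ) → UModel φ p)
        (perCochains (Primes z) T (UModel φ p)) (fun _ => dPer (repU φ p)) n)
      (cobd (V := fun _ => (Primes z →₀ ℕ) → UModel φ p)
        (perCochains (Primes z) T (UModel φ p)) (fun _ => dPer (repU φ p)) n) ≃ₗ[T]
      DirectSum (PairIndex z) fun j => D.HT T z j.1.2 (n + j.1.1.card)) := by
  classical
  choose H hH using exists_isFrobHomotopy φ hp
  -- The direct sum of the maps `fL`.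
  let L : (Finset (Primes z) →₀ (Cell (D.ord z) →₀ T)) →ₗ[T] (Cell (D.ord z) →₀ T) :=
    Finsupp.lsum T fun y => fL (H y) y.toList
  have hL : ∀ e, L e = e.sum fun y u => fL (H y) y.toList u := fun e => rfl
  refine Subquotient.nonempty_equiv_directSum (summandMap D z φ p H)
    (fun j u hu => summandMap_mem_cocyc D z hH n j hu)
    (fun j u hu => summandMap_mem_cobd D z hH n j hu) ?_ ?_
  · rintro v ⟨hv, hdv⟩
    obtain ⟨c, hc, rfl⟩ := exists_toFunU_eq φ p hv
    have hdc : dTot (D.ord z) T c ∈ relMod φ p := by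
      rw [← toFunU_eq_zero_iff, ← dPer_toFunU]
      exact hdv
    obtain ⟨e', he', hee', c', hc'⟩ := cone_acyclic hH 0 (fun y => Submodule.zero_mem _)
      (fun y => by simp) c (by simpa using hdc)
    -- The statement of `cone_acyclic` is not graded; its component of degree `n` is needed.
    have h1 : c - ∑ y ∈ e'.support, fL (H y) y.toList (cutDeg T (n + y.card) (e' y)) -
        cutDeg T n (dTot (D.ord z) T c') ∈ relMod φ p := by
      have h2 := cut_mem_relMod φ p (P := fun i => i.2.degree = n)
        (fun i j hij => by rw [hij]) hc'
      rw [_root_.map_sub, _root_.map_sub, cutDeg_eq_self hc, Finsupp.sum, _root_.map_sum] at h2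
      convert h2 using 4 with y
      rw [cutDeg_fL (hH y), Finset.length_toList]
    have h2 : toFunU φ p (cutDeg T n (dTot (D.ord z) T c')) ∈
        cobd (V := fun _ => (Primes z →₀ ℕ) → UModel φ p)
          (perCochains (Primes z) T (UModel φ p)) (fun _ => dPer (repU φ p)) n := by
      rcases n with _ | n
      · rw [cutDeg_zero_dTot, _root_.map_zero]
        exact Submodule.zero_mem _
      · rw [cutDeg_dTot, ← dPer_toFunU]
        exact Submodule.mem_map_of_mem (toFunU_mem_perCochains φ p (cut_mem _))
    have h3 : ∑ y ∈ e'.support, toFunU φ p (fL (H y) y.toList (cutDeg T (n + y.card) (e' y))) ∈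
        ⨆ j : PairIndex z,
          (D.blockCocycles T z j.1.2 (n + j.1.1.card)).map (summandMap D z φ p H j) := by
      refine Submodule.sum_mem _ fun y _ => toFunU_fL_mem_iSup D z n y (cut_mem_adm (he' y)) ?_
        (cut_mem _)
      have h4 : dTot (D.ord z) T (e' y) = 0 := by
        have h5 := congrArg (fun f => (-1 : T) ^ y.card • f) (hee' y)
        simp only [Finsupp.coe_zero, Pi.zero_apply, smul_smul, ← mul_pow, neg_one_mul, neg_neg,
          one_pow, one_smul, smul_zero] at h5
        exact h5.symm
      rw [← cutDeg_dTot, h4, _root_.map_zero]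
    obtain ⟨f, hf, hfs⟩ := (Submodule.mem_iSup_iff_exists_finsupp _ _).mp h3
    choose g hg hgf using hf
    have hg0 : ∀ j, f j = 0 → summandMap D z φ p H j (if f j = 0 then 0 else g j) = f j := by
      intro j hj
      rw [if_pos hj, hj, _root_.map_zero]
    refine ⟨Finsupp.onFinset f.support (fun j => if f j = 0 then 0 else g j) fun j hj => ?_,
      fun j => ?_, ?_⟩
    · rw [Finsupp.mem_support_iff]
      intro h
      exact hj (if_pos h)
    · rw [Finsupp.onFinset_apply]
      split_ifs
      · exact Submodule.zero_mem _
      · exact hg j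
    · have h4 : (Finsupp.onFinset f.support (fun j => if f j = 0 then 0 else g j) (by
          intro j hj
          rw [Finsupp.mem_support_iff]
          intro h
          exact hj (if_pos h))).sum (fun j w => summandMap D z φ p H j w) =
          f.sum fun _ v => v := by
        rw [Finsupp.onFinset_sum _ (fun j => _root_.map_zero _), Finsupp.sum]
        refine Finset.sum_congr rfl fun j hj => ?_
        rw [if_neg (Finsupp.mem_support_iff.mp hj)]
        exact hgf j
      have h5 := (toFunU_eq_zero_iff φ p _).mpr h1
      rw [_root_.map_sub, _root_.map_sub, _root_.map_sum, ← hfs, sub_eq_zero] at h5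
      have h6 := h5.symm ▸ h2
      rw [h4]
      exact h6
  · intro e he hB j
    -- The components of `e` that belong to the same `y` are collected.
    set E : Finset (Primes z) →₀ (Cell (D.ord z) →₀ T) :=
      ∑ j ∈ e.support, Finsupp.single j.sub (toCell D z (e j)) with hE
    have hEy : ∀ y, E y = ∑ j ∈ e.support, if j.sub = y then toCell D z (e j) else 0 := by
      intro y
      rw [hE, Finsupp.finsetSum_apply]
      simp only [Finsupp.single_apply]
    have hLE : toFunU φ p (L E) = e.sum fun j w => summandMap D z φ p H j w := by
      rw [hE, _root_.map_sum, _root_.map_sum, Finsupp.sum]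
      refine Finset.sum_congr rfl fun j _ => ?_
      simp only [L, Finsupp.lsum_single]
      rfl
    have hadm : ∀ y, E y ∈ adm (D.ord z) T y := by
      intro y
      rw [hEy]
      refine Submodule.sum_mem _ fun j _ => ?_
      split_ifs with h
      · rw [← h]
        exact toCell_mem_adm D z j.mem_support_of_mem_sub (he j).1
      · exact Submodule.zero_mem _
    have hdE : ∀ y, dTot (D.ord z) T (E y) = 0 := by
      intro y
      rw [hEy, _root_.map_sum]
      refine Finset.sum_eq_zero fun j _ => ?_
      split_ifs
      · rw [← toCell_delta D z (block_le_dvdSet z j.2.2 _ (he j).1),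
          show D.delta T z (e j) = 0 from (he j).2, _root_.map_zero]
      · rw [_root_.map_zero]
    have hc : ∃ c, dTot (D.ord z) T c - L E ∈ relMod φ p := by
      rw [← hLE] at hB
      rcases n with _ | n
      · refine ⟨0, ?_⟩
        rw [_root_.map_zero, ← toFunU_eq_zero_iff, _root_.map_sub, _root_.map_zero,
          show toFunU φ p (L E) = 0 from hB, sub_zero]
      · obtain ⟨f, hf, hfE⟩ := hB
        obtain ⟨c, _, rfl⟩ := exists_toFunU_eq φ p hf
        refine ⟨c, ?_⟩
        rw [← toFunU_eq_zero_iff, _root_.map_sub, ← dPer_toFunU, sub_eq_zero]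
        exact hfE
    obtain ⟨c, hc⟩ := hc
    obtain ⟨e', he', hee', -⟩ := cone_acyclic hH E hadm hdE c hc
    have hj := ofCell_mem_blockCoboundaries D z (w := j.1.2) j.2.2
      (toCell_mem_degC D z j.2.2 (he j).1) (he' j.sub) (f := E j.sub) ?_ (hee' j.sub)
    · rwa [ofCell_toCell D z (block_le_dvdSet z j.2.2 _ (he j).1)] at hj
    · rw [hEy, _root_.map_sum]
      have h1 : ∀ j' : PairIndex z, cut T (IsBlock D z j.1.2)
          (if j'.sub = j.sub then toCell D z (e j') else 0) =
            if j' = j then toCell D z (e j) else 0 := by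
        intro j'
        by_cases hjj : j' = j
        · subst hjj
          rw [if_pos rfl, if_pos rfl]
          exact cut_eq_self_iff.mpr (toCell_mem_isBlock D z (he j').1)
        · rw [if_neg hjj]
          split_ifs with h
          · refine cut_eq_zero (toCell_mem_isBlock D z (he j').1) fun i hi hi' => hjj ?_
            have h2 := isBlock_unique D z j'.2.2 j.2.2 hi hi'
            have h3 : j'.1.1 = j.1.1 := by rw [← j'.map_sub, ← j.map_sub, h]
            exact Subtype.ext (Prod.ext h3 h2)
          · exact _root_.map_zero _
      rw [Finset.sum_congr rfl fun j' _ => h1 j', Finset.sum_ite_eq']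
      split_ifs with h
      · rfl
      · rw [Finsupp.notMem_support_iff.mp h, _root_.map_zero]

end Decomposition

/-! ### Transport of the cohomology along an isomorphism -/

section Transport

variable {R : Type*} [CommRing R]

theorem Subquotient.nonempty_equiv_of_linearEquiv {V₁ V₂ : Type*} [AddCommGroup V₁] [Module R V₁]
    [AddCommGroup V₂] [Module R V₂] (E : V₁ ≃ₗ[R] V₂) {Z₁ B₁ : Submodule R V₁}
    {Z₂ B₂ : Submodule R V₂} (hZ : ∀ v, v ∈ Z₁ ↔ E v ∈ Z₂) (hB : ∀ v, v ∈ B₁ ↔ E v ∈ B₂) :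
    Nonempty (Subquotient Z₁ B₁ ≃ₗ[R] Subquotient Z₂ B₂) := by
  refine Subquotient.nonempty_equiv Z₁.subtype (E.toLinearMap ∘ₗ Z₁.subtype) (fun v => v.2)
    (fun v => (hZ v).mp v.2) (fun v hv => ⟨⟨v, hv⟩, ?_⟩) (fun v hv => ?_) fun v => hB v
  · rw [Submodule.subtype_apply, sub_self]
    exact Submodule.zero_mem _
  · refine ⟨⟨E.symm v, (hZ _).mpr (by rwa [E.apply_symm_apply])⟩, ?_⟩
    rw [LinearMap.comp_apply, Submodule.subtype_apply, LinearEquiv.coe_coe, E.apply_symm_apply,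
      sub_self]
    exact Submodule.zero_mem _

variable {Γ Γ' V V' : Type*} [Group Γ] [TopologicalSpace Γ] [Group Γ'] [TopologicalSpace Γ']
  [AddCommGroup V] [Module R V] [AddCommGroup V'] [Module R V']

/-- The isomorphism of the spaces of cochains induced by isomorphisms of the group and of the
module. -/
def cochainEquiv (θ : Γ ≃ₜ* Γ') (e : V ≃ₗ[R] V') (n : ℕ) :
    ((Fin n → Γ) → V) ≃ₗ[R] ((Fin n → Γ') → V') where
  toFun f g := e (f fun i => θ.symm (g i))
  invFun f g := e.symm (f fun i => θ (g i))
  left_inv f := by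
    funext g
    simp
  right_inv f := by
    funext g
    simp
  map_add' _ _ := by
    funext g
    simp
  map_smul' _ _ := by
    funext g
    simp

theorem dCochain_cochainEquiv {ρ : Representation R Γ V} {ρ' : Representation R Γ' V'}
    (θ : Γ ≃ₜ* Γ') (e : V ≃ₗ[R] V') (h : ∀ g v, e (ρ g v) = ρ' (θ g) (e v)) (n : ℕ)
    (f : (Fin n → Γ) → V) :
    dCochain ρ' n (cochainEquiv θ e n f) = cochainEquiv θ e (n + 1) (dCochain ρ n f) := by
  funext g
  change _ = e (dCochain ρ n f fun i => θ.symm (g i))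
  rw [dCochain_apply, dCochain_apply, map_add, map_sum, h, θ.apply_symm_apply]
  congr 1
  refine Finset.sum_congr rfl fun j _ => ?_
  rw [map_smul]
  congr 1
  change e (f fun i => θ.symm (Fin.contractNth j (· * ·) g i)) = _
  congr 2
  funext k
  simp only [Fin.contractNth]
  split_ifs
  · rfl
  · exact _root_.map_mul θ.symm _ _
  · rfl

theorem mem_contCochains_iff (θ : Γ ≃ₜ* Γ') (e : V ≃ₗ[R] V') (n : ℕ) (f : (Fin n → Γ) → V) :
    f ∈ contCochains R Γ V n ↔ cochainEquiv θ e n f ∈ contCochains R Γ' V' n := by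
  constructor
  · intro h
    have h1 : IsLocallyConstant f := h
    have h2 : Continuous fun g : Fin n → Γ' => fun i => θ.symm (g i) :=
      continuous_pi fun i => θ.symm.continuous.comp (continuous_apply i)
    exact (h1.comp_continuous h2).comp e
  · intro h
    have h1 : IsLocallyConstant (cochainEquiv θ e n f) := h
    have h2 : Continuous fun g : Fin n → Γ => fun i => θ (g i) :=
      continuous_pi fun i => θ.continuous.comp (continuous_apply i)
    have h3 := (h1.comp_continuous h2).comp e.symm
    have h4 : (e.symm ∘ cochainEquiv θ e n f ∘ fun g : Fin n → Γ => fun i => θ (g i)) = f := by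
      funext g
      simp [cochainEquiv]
    rw [h4] at h3
    exact h3

/-- Isomorphic coefficients over isomorphic groups have isomorphic cohomology. -/
theorem nonempty_groupH_equiv_of_iso {ρ : Representation R Γ V} {ρ' : Representation R Γ' V'}
    (θ : Γ ≃ₜ* Γ') (e : V ≃ₗ[R] V') (h : ∀ g v, e (ρ g v) = ρ' (θ g) (e v)) (n : ℕ) :
    Nonempty (GroupH ρ n ≃ₗ[R] Subquotient (cocyc (contCochains R Γ' V') (dCochain ρ') n)
      (cobd (contCochains R Γ' V') (dCochain ρ') n)) := by
  refine Subquotient.nonempty_equiv_of_linearEquiv (cochainEquiv θ e n) (fun f => ?_) fun f => ?_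
  · refine and_congr (mem_contCochains_iff θ e n f) ?_
    rw [SetLike.mem_coe, SetLike.mem_coe, LinearMap.mem_ker, LinearMap.mem_ker,
      dCochain_cochainEquiv θ e h, LinearEquiv.map_eq_zero_iff]
  · rcases n with _ | n
    · exact (LinearEquiv.map_eq_zero_iff (cochainEquiv θ e 0)).symm
    · constructor
      · rintro ⟨f, hf, rfl⟩
        exact ⟨cochainEquiv θ e n f, (mem_contCochains_iff θ e n f).mp hf,
          dCochain_cochainEquiv θ e h n f⟩
      · rintro ⟨f', hf', h'⟩
        refine ⟨(cochainEquiv θ e n).symm f', ?_, ?_⟩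
        · rw [SetLike.mem_coe, mem_contCochains_iff θ e, LinearEquiv.apply_symm_apply]
          exact hf'
        · refine (cochainEquiv θ e (n + 1)).injective ?_
          rw [← h', ← dCochain_cochainEquiv θ e h, LinearEquiv.apply_symm_apply]

end Transport

/-! ### The structure of the groups `G_z` -/

section Groups

set_option linter.unusedSectionVars false

variable {X G T : Type*} [LinearOrder X] [Group G] [TopologicalSpace G] [IsTopologicalGroup G]
  [CompactSpace G] [CommRing T] (D : NormData X G) {z : X → ℕ}

namespace NormData

theorem H_zero : D.H 0 = ⊤ := by
  rw [eq_top_iff]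
  intro g _
  obtain ⟨a, ha, b, hb, rfl⟩ := D.mul_of_coprime 0 0 (fun x => Or.inl rfl) g
  exact mul_mem ha hb

variable (z) in
/-- The product of the `z(x)` for `x ∈ y`. -/
def stalk (y : Finset (Primes z)) : X →₀ ℕ := ∑ x ∈ y, Finsupp.single x.1 (z x.1)

theorem stalk_apply (y : Finset (Primes z)) (x : Primes z) :
    stalk z y x.1 = if x ∈ y then z x.1 else 0 := by
  rw [stalk, Finsupp.finsetSum_apply]
  have h1 : ∀ x' ∈ y, Finsupp.single x'.1 (z x'.1) x.1 = if x' = x then z x.1 else 0 := by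
    intro x' _
    rw [Finsupp.single_apply]
    by_cases h : x' = x
    · subst h
      simp
    · rw [if_neg h, if_neg fun h' => h (Subtype.ext h')]
  rw [Finset.sum_congr rfl h1, Finset.sum_ite_eq']

theorem stalk_apply_of_eq_zero (y : Finset (Primes z)) {x : X} (hx : z x = 0) :
    stalk z y x = 0 := by
  rw [stalk, Finsupp.finsetSum_apply]
  refine Finset.sum_eq_zero fun x' _ => ?_
  rw [Finsupp.single_apply, if_neg]
  rintro rfl
  exact x'.2 hx

theorem stalk_insert {y : Finset (Primes z)} {x : Primes z} (hx : x ∉ y) :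
    stalk z (insert x y) = stalk z y + Finsupp.single x.1 (z x.1) := by
  rw [stalk, Finset.sum_insert hx, add_comm]
  rfl

theorem stalk_coprime {y : Finset (Primes z)} {x : Primes z} (hx : x ∉ y) (x' : X) :
    stalk z y x' = 0 ∨ Finsupp.single x.1 (z x.1) x' = 0 := by
  by_cases h : x.1 = x'
  · subst h
    left
    rw [stalk_apply, if_neg hx]
  · right
    rw [Finsupp.single_eq_of_ne (Ne.symm h)]

theorem mem_H_stalk (y : Finset (Primes z)) (g : G) :
    g ∈ D.H (stalk z y) ↔ ∀ x ∈ y, g ∈ D.H (Finsupp.single x.1 (z x.1)) := by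
  induction y using Finset.induction_on with
  | empty => simp [stalk, H_zero]
  | insert x y hx ih =>
    rw [stalk_insert hx, D.inf_of_coprime _ _ (stalk_coprime hx), Subgroup.mem_inf, ih,
      Finset.forall_mem_insert, and_comm]

/-- The Chinese remainder theorem for the subgroups `H_{z(x)}`. -/
theorem exists_approx (t : ∀ x : Primes z, D.Gfin (Finsupp.single x.1 (z x.1)))
    (y : Finset (Primes z)) :
    ∃ g : G, ∀ x ∈ y, (g : D.Gfin (Finsupp.single x.1 (z x.1))) = t x := by
  induction y using Finset.induction_on with
  | empty => exact ⟨1, by simp⟩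
  | insert x y hx ih =>
    obtain ⟨g, hg⟩ := ih
    obtain ⟨s, hs⟩ := QuotientGroup.mk_surjective (t x)
    obtain ⟨a, ha, b, hb, hab⟩ := D.mul_of_coprime _ _ (stalk_coprime hx) (s * g⁻¹)
    refine ⟨a * g, fun x' hx' => ?_⟩
    rcases Finset.mem_insert.mp hx' with rfl | hx'
    · have h1 : ((a * b : G) : D.Gfin (Finsupp.single x'.1 (z x'.1))) = (s * g⁻¹ : G) := by
        rw [hab]
      rw [QuotientGroup.mk_mul, (QuotientGroup.eq_one_iff b).mpr hb, mul_one] at h1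
      rw [QuotientGroup.mk_mul, h1, ← QuotientGroup.mk_mul, inv_mul_cancel_right, hs]
    · rw [QuotientGroup.mk_mul, (QuotientGroup.eq_one_iff a).mpr
        ((D.mem_H_stalk y a).mp ha x' hx'), one_mul, hg x' hx']

/-- The set of elements of `X` that divide a stalk. -/
def primesOf (s : FinStalk z) : Finset (Primes z) := s.1.support.subtype fun x => z x ≠ 0

theorem mem_primesOf {s : FinStalk z} {x : Primes z} : x ∈ primesOf s ↔ s.1 x.1 ≠ 0 := by
  rw [primesOf, Finset.mem_subtype, Finsupp.mem_support_iff]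

theorem stalk_primesOf (s : FinStalk z) : stalk z (primesOf s) = s.1 := by
  ext x
  by_cases hx : z x = 0
  · rw [stalk_apply_of_eq_zero _ hx]
    rcases s.2 x with h | h
    · exact h.symm
    · rw [h, hx]
  · refine (stalk_apply (primesOf s) ⟨x, hx⟩).trans ?_
    split_ifs with h
    · exact ((s.2 x).resolve_left (mem_primesOf.mp h)).symm
    · exact (not_not.mp fun h' => h (mem_primesOf.mpr h')).symm

theorem finStalk_ext {s t : FinStalk z} (h : ∀ x : Primes z, s.1 x.1 = 0 ↔ t.1 x.1 = 0) :
    s = t := by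
  refine Subtype.ext ?_
  rw [← stalk_primesOf s, ← stalk_primesOf t]
  congr 1
  ext x
  rw [mem_primesOf, mem_primesOf]
  exact not_congr (h x)

variable (z) in
/-- The product of the `z(x)` for `x ∈ y`, as a stalk of `z`. -/
def stalk' (y : Finset (Primes z)) : FinStalk z := ⟨stalk z y, fun x => by
  by_cases hx : z x = 0
  · exact Or.inl (stalk_apply_of_eq_zero y hx)
  · have := stalk_apply y ⟨x, hx⟩
    split_ifs at this
    · exact Or.inr this
    · exact Or.inl this⟩

theorem stalk'_eq_zero_iff (y : Finset (Primes z)) (x : Primes z) :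
    (stalk' z y).1 x.1 = 0 ↔ x ∉ y := by
  change stalk z y x.1 = 0 ↔ _
  rw [stalk_apply]
  split_ifs with h
  · simp [h, x.2]
  · simp [h]

theorem single_le {s : FinStalk z} {x : Primes z} (h : s.1 x.1 ≠ 0) :
    Finsupp.single x.1 (z x.1) ≤ s.1 := by
  rw [Finsupp.single_le_iff]
  exact ((s.2 x.1).resolve_left h).ge

theorem gfin_eq_iff {s : FinStalk z} {g g' : D.Gfin s.1} :
    g = g' ↔ ∀ (x : Primes z) (h : s.1 x.1 ≠ 0),
      D.proj (single_le h) g = D.proj (single_le h) g' := by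
  refine ⟨fun h x _ => by rw [h], fun h => ?_⟩
  obtain ⟨a, rfl⟩ := QuotientGroup.mk_surjective g
  obtain ⟨b, rfl⟩ := QuotientGroup.mk_surjective g'
  rw [QuotientGroup.eq, ← stalk_primesOf s, mem_H_stalk]
  intro x hx
  exact QuotientGroup.eq.mp (h x (mem_primesOf.mp hx))

theorem exists_gfin (t : ∀ x : Primes z, D.Gfin (Finsupp.single x.1 (z x.1))) (s : FinStalk z) :
    ∃ g : D.Gfin s.1, ∀ (x : Primes z) (h : s.1 x.1 ≠ 0), D.proj (single_le h) g = t x := by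
  obtain ⟨g, hg⟩ := D.exists_approx t (primesOf s)
  exact ⟨(g : G ⧸ D.H s.1), fun x h => hg x (mem_primesOf.mpr h)⟩

theorem proj_proj {a b c : X →₀ ℕ} (h : a ≤ b) (h' : b ≤ c) (g : D.Gfin c) :
    D.proj h (D.proj h' g) = D.proj (h.trans h') g := by
  obtain ⟨g, rfl⟩ := QuotientGroup.mk_surjective g
  rfl

/-- The stalk `z(x)`. -/
def pureStalk (x : Primes z) : FinStalk z := ⟨Finsupp.single x.1 (z x.1), fun x' => by
  by_cases h : x.1 = x'
  · subst h
    right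
    rw [Finsupp.single_eq_same]
  · left
    rw [Finsupp.single_eq_of_ne (Ne.symm h)]⟩

theorem gz_proj (g : D.Gz z) {s : FinStalk z} {x : Primes z} (h : s.1 x.1 ≠ 0) :
    D.proj (single_le h) (g.1 s) = g.1 (pureStalk x) :=
  g.2 (pureStalk x) s (single_le h)

theorem gz_ext {g g' : D.Gz z} (h : ∀ x : Primes z, g.1 (pureStalk x) = g'.1 (pureStalk x)) :
    g = g' := by
  refine Subtype.ext (funext fun s => D.gfin_eq_iff.mpr fun x hx => ?_)
  exact (D.gz_proj g hx).trans ((h x).trans (D.gz_proj g' hx).symm)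

theorem exists_gz (t : ∀ x : Primes z, D.Gfin (Finsupp.single x.1 (z x.1))) :
    ∃ g : D.Gz z, ∀ x : Primes z, g.1 (pureStalk x) = t x := by
  choose g hg using D.exists_gfin t
  refine ⟨⟨g, fun s s' h => D.gfin_eq_iff.mpr fun x hx => ?_⟩, fun x => ?_⟩
  · have hx' : s'.1 x.1 ≠ 0 := fun h0 => hx (Nat.le_zero.mp ((h x.1).trans h0.le))
    rw [hg s x hx, proj_proj]
    exact hg s' x hx'
  · have hx : (pureStalk x).1 x.1 ≠ 0 := by
      change Finsupp.single x.1 (z x.1) x.1 ≠ 0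
      rw [Finsupp.single_eq_same]
      exact x.2
    refine Eq.trans ?_ (hg (pureStalk x) x hx)
    change g (pureStalk x) = _
    obtain ⟨a, ha⟩ := QuotientGroup.mk_surjective (g (pureStalk x))
    rw [← ha]
    rfl

instance (s : X →₀ ℕ) : DiscreteTopology (D.Gfin s) :=
  QuotientGroup.discreteTopology (D.isOpen_H s)

theorem compactSpace_gz : CompactSpace (D.Gz z) := by
  refine isCompact_iff_compactSpace.mp (IsClosed.isCompact ?_)
  have h : ((D.Gz z : Subgroup _) : Set (∀ s : FinStalk z, D.Gfin s.1)) =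
      ⋂ (s : FinStalk z) (t : FinStalk z) (h : s.1 ≤ t.1), {g | D.proj h (g t) = g s} := by
    ext g
    simp only [Set.mem_iInter]
    rfl
  rw [h]
  refine isClosed_iInter fun s => isClosed_iInter fun t => isClosed_iInter fun h => ?_
  exact isClosed_eq (continuous_of_discreteTopology.comp (continuous_apply t)) (continuous_apply s)

variable (hcyc : ∀ x, z x ≠ 0 → IsCyclic (D.Gfin (Finsupp.single x (z x))))

/-- A chosen isomorphism of the cyclic group `G_{z(x)}` with a group of residue classes. -/
def cyc (x : Primes z) :
    Multiplicative (ZMod (D.ord z x)) ≃* D.Gfin (Finsupp.single x.1 (z x.1)) :=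
  zmodCyclicMulEquiv (hcyc x.1 x.2)

/-- The components of an element of `G_z` in the cyclic groups `G_{z(x)}`. -/
def toTorus : D.Gz z →* Torus (D.ord z) where
  toFun g x := (D.cyc hcyc x).symm (g.1 (pureStalk x))
  map_one' := funext fun x => _root_.map_one (D.cyc hcyc x).symm
  map_mul' _ _ := funext fun x => _root_.map_mul (D.cyc hcyc x).symm _ _

theorem toTorus_bijective : Function.Bijective (D.toTorus hcyc) := by
  constructor
  · intro g g' h
    exact D.gz_ext fun x => (D.cyc hcyc x).symm.injective (congrFun h x)
  · intro t
    obtain ⟨g, hg⟩ := D.exists_gz fun x => D.cyc hcyc x (t x)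
    refine ⟨g, funext fun x => ?_⟩
    change (D.cyc hcyc x).symm (g.1 (pureStalk x)) = t x
    rw [hg, MulEquiv.symm_apply_apply]

theorem continuous_toTorus : Continuous (D.toTorus hcyc) :=
  continuous_pi fun x => Continuous.comp (g := (D.cyc hcyc x).symm)
    (f := fun g : D.Gz z => g.1 (pureStalk x)) continuous_of_discreteTopology
    ((continuous_apply (pureStalk x)).comp continuous_subtype_val)

/-- The group `G_z` is the product of the cyclic groups `G_{z(x)}`, as a topological group. -/
def torusEquiv : D.Gz z ≃ₜ* Torus (D.ord z) :=
  haveI := D.compactSpace_gz (z := z)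
  { MulEquiv.ofBijective (D.toTorus hcyc) (D.toTorus_bijective hcyc) with
    continuous_toFun := D.continuous_toTorus hcyc
    continuous_invFun := Continuous.continuous_symm_of_equiv_compact_to_t2
      (f := Equiv.ofBijective _ (D.toTorus_bijective hcyc)) (D.continuous_toTorus hcyc) }

theorem torusEquiv_apply (g : D.Gz z) (x : Primes z) :
    D.torusEquiv hcyc g x = (D.cyc hcyc x).symm (g.1 (pureStalk x)) := rfl

end NormData

end Groups

/-! ### The universal norm distribution in coordinates -/

section Coordinates

theorem Symb.upd_self {ι : Type*} [LinearOrder ι] {m : ι → ℕ} (a : Symb m) (x : ι)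
    (o : Option (ZMod (m x))) : (a.upd x o).1 x = o := by
  simp [Symb.upd_apply]

theorem Symb.upd_of_ne {ι : Type*} [LinearOrder ι] {m : ι → ℕ} {x y : ι} (h : y ≠ x)
    (a : Symb m) (o : Option (ZMod (m x))) : (a.upd x o).1 y = a.1 y := by
  simp [Symb.upd_apply, h]

set_option linter.unusedSectionVars false

variable {X G T : Type*} [LinearOrder X] [Group G] [TopologicalSpace G] [IsTopologicalGroup G]
  [CompactSpace G] [CommRing T] (D : NormData X G) {z : X → ℕ}
  (hcyc : ∀ x, z x ≠ 0 → IsCyclic (D.Gfin (Finsupp.single x (z x))))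

namespace NormData

/-- The symbol `[g z']`, in coordinates. -/
def toSymb (a : D.ASet z) : Symb (D.ord z) :=
  ⟨fun x => if h : a.1.1 x.1 = 0 then none else
      some ((D.cyc hcyc x).symm (D.proj (single_le h) a.2)).toAdd,
    (primesOf a.1).finite_toSet.subset fun x hx => by
      rw [Finset.mem_coe, mem_primesOf]
      intro h
      exact hx (dif_pos h)⟩

theorem toSymb_of_eq_zero {a : D.ASet z} {x : Primes z} (h : a.1.1 x.1 = 0) :
    (D.toSymb hcyc a).1 x = none := dif_pos h

theorem toSymb_of_ne_zero {a : D.ASet z} {x : Primes z} (h : a.1.1 x.1 ≠ 0) :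
    (D.toSymb hcyc a).1 x = some ((D.cyc hcyc x).symm (D.proj (single_le h) a.2)).toAdd :=
  dif_neg h

theorem toSymb_eq_none_iff {a : D.ASet z} {x : Primes z} :
    (D.toSymb hcyc a).1 x = none ↔ a.1.1 x.1 = 0 := by
  refine ⟨fun h => ?_, D.toSymb_of_eq_zero hcyc⟩
  by_contra h0
  rw [D.toSymb_of_ne_zero hcyc h0] at h
  exact Option.some_ne_none _ h

theorem toSymb_bijective : Function.Bijective (D.toSymb hcyc (z := z)) := by
  constructor
  · rintro ⟨s, g⟩ ⟨s', g'⟩ h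
    have hc : ∀ x, (D.toSymb hcyc ⟨s, g⟩).1 x = (D.toSymb hcyc ⟨s', g'⟩).1 x := fun x => by rw [h]
    obtain rfl : s = s' := finStalk_ext fun x => by
      have h1 := D.toSymb_eq_none_iff hcyc (a := ⟨s, g⟩) (x := x)
      have h2 := D.toSymb_eq_none_iff hcyc (a := ⟨s', g'⟩) (x := x)
      rw [hc] at h1
      exact h1.symm.trans h2
    congr 1
    refine D.gfin_eq_iff.mpr fun x hx => ?_
    have h1 := hc x
    rw [D.toSymb_of_ne_zero hcyc (a := ⟨s, g⟩) hx, D.toSymb_of_ne_zero hcyc (a := ⟨s, g'⟩) hx,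
      Option.some_inj] at h1
    exact (D.cyc hcyc x).symm.injective h1
  · intro a
    set s := stalk' z a.2.toFinset
    have hs : ∀ x : Primes z, s.1 x.1 = 0 ↔ a.1 x = none := by
      intro x
      rw [stalk'_eq_zero_iff]
      simp
    obtain ⟨g, hg⟩ := D.exists_gfin
      (fun x => D.cyc hcyc x (Multiplicative.ofAdd ((a.1 x).getD 0))) s
    refine ⟨⟨s, g⟩, Subtype.ext (funext fun x => ?_)⟩
    by_cases h : s.1 x.1 = 0
    · rw [D.toSymb_of_eq_zero hcyc (a := ⟨s, g⟩) h, (hs x).mp h]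
    · rw [D.toSymb_of_ne_zero hcyc (a := ⟨s, g⟩) h, hg x h, MulEquiv.symm_apply_apply]
      obtain ⟨j, hj⟩ := Option.ne_none_iff_exists'.mp fun h' => h ((hs x).mpr h')
      rw [hj]
      rfl

theorem toSymb_act (g : D.Gz z) (a : D.ASet z) :
    D.toSymb hcyc (D.act g a) = (D.toSymb hcyc a).act (D.torusEquiv hcyc g) := by
  refine Subtype.ext (funext fun x => ?_)
  change _ = ((D.toSymb hcyc a).1 x).map _
  by_cases h : a.1.1 x.1 = 0
  · rw [D.toSymb_of_eq_zero hcyc h, D.toSymb_of_eq_zero hcyc (a := D.act g a) h]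
    rfl
  · rw [D.toSymb_of_ne_zero hcyc h, D.toSymb_of_ne_zero hcyc (a := D.act g a) h, Option.map_some,
      Option.some_inj]
    change ((D.cyc hcyc x).symm (D.proj (single_le h) (g.1 a.1 * a.2))).toAdd = _
    rw [_root_.map_mul, _root_.map_mul, D.gz_proj g h, torusEquiv_apply, toAdd_mul, add_comm]

theorem stalkMul_eq_zero_iff (s : FinStalk z) (x : Primes z) (hx : s.1 x.1 = 0) (x' : Primes z) :
    (stalkMul s x.1 hx).1 x'.1 = 0 ↔ x' ≠ x ∧ s.1 x'.1 = 0 := by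
  change s.1 x'.1 + Finsupp.single x.1 (z x.1) x'.1 = 0 ↔ _
  by_cases h : x' = x
  · subst h
    simp [x'.2]
  · rw [Finsupp.single_eq_of_ne fun h' => h (Subtype.ext h')]
    simp [h]

theorem toSymb_stalkMul {s : FinStalk z} {x : Primes z} (hx : s.1 x.1 = 0)
    {g : D.Gfin s.1} {h : D.Gfin (stalkMul s x.1 hx).1}
    (hg : D.proj (le_stalkMul s x.1 hx) h = g) :
    D.toSymb hcyc ⟨stalkMul s x.1 hx, h⟩ = (D.toSymb hcyc ⟨s, g⟩).upd x
      ((D.toSymb hcyc ⟨stalkMul s x.1 hx, h⟩).1 x) := by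
  refine Subtype.ext (funext fun x' => ?_)
  by_cases hxx : x' = x
  · subst hxx
    exact (Symb.upd_self _ _ _).symm
  · refine Eq.trans ?_ (Symb.upd_of_ne hxx _ _).symm
    by_cases h0 : s.1 x'.1 = 0
    · rw [D.toSymb_of_eq_zero hcyc (a := ⟨s, g⟩) h0, D.toSymb_of_eq_zero hcyc]
      exact (stalkMul_eq_zero_iff s x hx x').mpr ⟨hxx, h0⟩
    · have h1 : (stalkMul s x.1 hx).1 x'.1 ≠ 0 := fun h' =>
        h0 ((stalkMul_eq_zero_iff s x hx x').mp h').2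
      rw [D.toSymb_of_ne_zero hcyc (a := ⟨s, g⟩) h0,
        D.toSymb_of_ne_zero hcyc (a := ⟨stalkMul s x.1 hx, h⟩) h1]
      subst hg
      rw [proj_proj]

/-- The norm element, in coordinates. -/
theorem sum_fiber {s : FinStalk z} {x : Primes z} (hx : s.1 x.1 = 0) (g : D.Gfin s.1)
    {M : Type*} [AddCommMonoid M] (F : Symb (D.ord z) → M) :
    ∑ h ∈ (Set.toFinite {h : D.Gfin (stalkMul s x.1 hx).1 |
        D.proj (le_stalkMul s x.1 hx) h = g}).toFinset, F (D.toSymb hcyc ⟨stalkMul s x.1 hx, h⟩) =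
      ∑ j, F ((D.toSymb hcyc ⟨s, g⟩).upd x (some j)) := by
  have hne : (stalkMul s x.1 hx).1 x.1 ≠ 0 := fun h0 =>
    ((stalkMul_eq_zero_iff s x hx x).mp h0).1 rfl
  refine Finset.sum_bij (fun h _ => ((D.cyc hcyc x).symm (D.proj (single_le hne) h)).toAdd)
    (fun _ _ => Finset.mem_univ _) (fun h hh h' hh' heq => ?_) (fun j _ => ?_) fun h hh => ?_
  · rw [Set.Finite.mem_toFinset] at hh hh'
    have h1 := D.toSymb_stalkMul hcyc hx hh
    have h2 := D.toSymb_stalkMul hcyc hx hh'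
    rw [D.toSymb_of_ne_zero hcyc (a := ⟨_, h⟩) hne, heq] at h1
    rw [D.toSymb_of_ne_zero hcyc (a := ⟨_, h'⟩) hne, ← h1] at h2
    exact (eq_of_heq (Sigma.mk.inj ((D.toSymb_bijective hcyc).1 h2)).2).symm
  · obtain ⟨⟨t, h⟩, hb⟩ := (D.toSymb_bijective hcyc).2 ((D.toSymb hcyc ⟨s, g⟩).upd x (some j))
    have hbx : ∀ x', (D.toSymb hcyc ⟨t, h⟩).1 x' =
        Function.update (D.toSymb hcyc ⟨s, g⟩).1 x (some j) x' := fun x' => by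
      rw [hb]
      rfl
    obtain rfl : t = stalkMul s x.1 hx := finStalk_ext fun x' => by
      rw [stalkMul_eq_zero_iff, ← D.toSymb_eq_none_iff hcyc (a := ⟨t, h⟩), hbx]
      by_cases hxx : x' = x
      · subst hxx
        simp
      · rw [Function.update_of_ne hxx, D.toSymb_eq_none_iff]
        simp [hxx]
    refine ⟨h, ?_, ?_⟩
    · rw [Set.Finite.mem_toFinset]
      change D.proj _ h = g
      refine D.gfin_eq_iff.mpr fun x' hx' => ?_
      have hxx : x' ≠ x := by
        rintro rfl
        exact hx' hx
      have h1 := hbx x'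
      have h2 : (stalkMul s x.1 hx).1 x'.1 ≠ 0 := fun h' =>
        hx' ((stalkMul_eq_zero_iff s x hx x').mp h').2
      rw [Function.update_of_ne hxx, D.toSymb_of_ne_zero hcyc (a := ⟨_, h⟩) h2,
        D.toSymb_of_ne_zero hcyc (a := ⟨s, g⟩) hx', Option.some_inj] at h1
      rw [proj_proj]
      exact (D.cyc hcyc x').symm.injective h1
    · have h1 := hbx x
      rw [Function.update_self, D.toSymb_of_ne_zero hcyc (a := ⟨_, h⟩) hne, Option.some_inj] at h1
      exact h1
  · rw [Set.Finite.mem_toFinset] at hh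
    have h1 := D.toSymb_stalkMul hcyc hx hh
    rw [D.toSymb_of_ne_zero hcyc (a := ⟨_, h⟩) hne] at h1
    rw [h1]

variable (T) in
/-- The isomorphism of the free module `𝒜_z` with the free module on the symbols. -/
def symbEquiv : D.AMod T z ≃ₗ[T] (Symb (D.ord z) →₀ T) :=
  Finsupp.domLCongr (Equiv.ofBijective _ (D.toSymb_bijective hcyc))

theorem symbEquiv_single (a : D.ASet z) (r : T) :
    D.symbEquiv T hcyc (Finsupp.single a r) = Finsupp.single (D.toSymb hcyc a) r := by
  rw [symbEquiv, Finsupp.domLCongr_single]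
  rfl

theorem symbEquiv_rhoA (g : D.Gz z) (v : D.AMod T z) :
    D.symbEquiv T hcyc (D.rhoA T z g v) =
      repSymb (D.ord z) T (D.torusEquiv hcyc g) (D.symbEquiv T hcyc v) := by
  suffices h : (D.symbEquiv T hcyc).toLinearMap ∘ₗ D.rhoA T z g =
      repSymb (D.ord z) T (D.torusEquiv hcyc g) ∘ₗ (D.symbEquiv T hcyc).toLinearMap from
    LinearMap.congr_fun h v
  refine Finsupp.lhom_ext' fun a => LinearMap.ext_ring ?_
  simp only [LinearMap.comp_apply, Finsupp.lsingle_apply, LinearEquiv.coe_coe, rhoA_single,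
    symbEquiv_single, repSymb_single, toSymb_act]

variable (p : X → Polynomial T)

variable (z) in
/-- The Frobenius elements, in coordinates. -/
def frob (x : Primes z) : Torus (D.ord z) := D.torusEquiv hcyc (D.toGz z (D.Fr x.1)⁻¹)

theorem symbEquiv_lam (x : Primes z) (v : D.AMod T z) :
    D.symbEquiv T hcyc (D.lam p z x.1 v) =
      relS (D.frob z hcyc) (fun x : Primes z => p x.1) x (D.symbEquiv T hcyc v) := by
  classical
  suffices h : (D.symbEquiv T hcyc).toLinearMap ∘ₗ D.lam p z x.1 =
      relS (D.frob z hcyc) (fun x : Primes z => p x.1) x ∘ₗ (D.symbEquiv T hcyc).toLinearMap from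
    LinearMap.congr_fun h v
  refine Finsupp.lhom_ext' fun a => LinearMap.ext_ring ?_
  rw [LinearMap.comp_apply, LinearMap.comp_apply, LinearMap.comp_apply, LinearMap.comp_apply,
    Finsupp.lsingle_apply, LinearEquiv.coe_coe, symbEquiv_single, lam,
    Finsupp.linearCombination_single, one_smul]
  by_cases h : a.1.1 x.1 = 0
  · rw [dif_pos h, relS_of_none _ _ (D.toSymb_of_eq_zero hcyc h), _root_.map_sub]
    congr 1
    · have h1 := aeval_intertwine (D.symbEquiv T hcyc).toLinearMap
        (A := D.rhoA T z (D.toGz z (D.Fr x.1)⁻¹))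
        (B := repSymb (D.ord z) T (D.frob z hcyc x)) (fun c => D.symbEquiv_rhoA hcyc _ c)
        (p x.1) (Finsupp.single a 1)
      rw [LinearEquiv.coe_coe, symbEquiv_single] at h1
      exact h1
    · rw [normElt, fiberSum, _root_.map_sum]
      simp only [symbEquiv_single]
      exact D.sum_fiber hcyc h a.2 fun b => Finsupp.single b (1 : T)
  · rw [dif_neg h, _root_.map_zero, relS_of_ne_none]
    rwa [Ne, D.toSymb_eq_none_iff]

theorem map_DMod : (D.DMod p z).map (D.symbEquiv T hcyc).toLinearMap =
    relModS (D.frob z hcyc) (fun x : Primes z => p x.1) := by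
  classical
  refine le_antisymm ?_ ?_
  · rw [DMod, Submodule.map_iSup]
    refine iSup_le fun x => ?_
    rw [Submodule.map_iSup]
    refine iSup_le fun hx => ?_
    rintro _ ⟨_, ⟨v, _, rfl⟩, rfl⟩
    refine Submodule.mem_iSup_of_mem (⟨x, hx⟩ : Primes z) ⟨D.symbEquiv T hcyc v, ?_⟩
    exact (D.symbEquiv_lam hcyc p ⟨x, hx⟩ v).symm
  · refine iSup_le fun x => ?_
    rintro _ ⟨u, rfl⟩
    induction u using Finsupp.induction_linear with
    | zero => rw [_root_.map_zero]; exact Submodule.zero_mem _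
    | add u v hu hv => rw [_root_.map_add]; exact Submodule.add_mem _ hu hv
    | single b r =>
      obtain ⟨a, rfl⟩ := (D.toSymb_bijective hcyc).2 b
      rw [← mul_one r, ← smul_eq_mul, ← Finsupp.smul_single, _root_.map_smul]
      refine Submodule.smul_mem _ _ ?_
      by_cases h : a.1.1 x.1 = 0
      · refine ⟨D.lam p z x.1 (Finsupp.single a 1), ?_, ?_⟩
        · exact Submodule.mem_iSup_of_mem x.1 (Submodule.mem_iSup_of_mem x.2
            ⟨_, Finsupp.single_mem_supported T 1 h, rfl⟩)
        · rw [LinearEquiv.coe_coe, symbEquiv_lam, symbEquiv_single]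
      · rw [relS_of_ne_none]
        · exact Submodule.zero_mem _
        · rwa [Ne, D.toSymb_eq_none_iff]

/-- The universal norm distribution, in coordinates. -/
def uEquiv : D.U p z ≃ₗ[T] UModel (D.frob z hcyc) (fun x : Primes z => p x.1) :=
  Submodule.Quotient.equiv _ _ (D.symbEquiv T hcyc) (D.map_DMod hcyc p)

theorem uEquiv_rhoU (g : D.Gz z) (u : D.U p z) :
    D.uEquiv hcyc p (D.rhoU p z g u) =
      repU (D.frob z hcyc) (fun x : Primes z => p x.1) (D.torusEquiv hcyc g)
        (D.uEquiv hcyc p u) := by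
  obtain ⟨v, rfl⟩ := (D.DMod p z).mkQ_surjective u
  change (relModS _ _).mkQ (D.symbEquiv T hcyc (D.rhoA T z g v)) =
    (relModS _ _).mkQ (repSymb (D.ord z) T (D.torusEquiv hcyc g) (D.symbEquiv T hcyc v))
  rw [symbEquiv_rhoA]

include hcyc in
/-- The decomposition of the cohomology of the universal norm distribution. -/
theorem nonempty_groupH_U_equiv (hp : ∀ x, z x ≠ 0 → (p x).eval 1 = 0) (n : ℕ) :
    Nonempty (GroupH (D.rhoU p z) n ≃ₗ[T]
      DirectSum (PairIndex z) fun yw => D.HT T z yw.1.2 (n + yw.1.1.card)) := by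
  obtain ⟨e₁⟩ := nonempty_groupH_equiv_of_iso (D.torusEquiv hcyc) (D.uEquiv hcyc p)
    (D.uEquiv_rhoU hcyc p) n
  obtain ⟨e₂⟩ := nonempty_groupH_equiv n (repU (D.frob z hcyc) fun x : Primes z => p x.1)
    (isDiscreteRep_repU _ _)
  obtain ⟨e₃⟩ := nonempty_periodic_equiv D z (D.frob z hcyc) (fun x : Primes z => p x.1)
    (fun x => hp x.1 x.2) n
  exact ⟨e₁ ≪≫ₗ e₂ ≪≫ₗ e₃⟩

end NormData

end Coordinates

/-! ### The Koszul complexes -/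

section Koszul

set_option linter.unusedSectionVars false

/-- An idempotent integer matrix is the projection to a free direct summand, whose rank is the
trace. -/
theorem exists_factor_of_idempotent {I : Type*} [Fintype I] [DecidableEq I] (M : Matrix I I ℤ)
    (hM : M * M = M) {r : ℕ} (hr : M.trace = r) :
    ∃ (A : Matrix I (Fin r) ℤ) (B : Matrix (Fin r) I ℤ), A * B = M ∧ B * A = 1 := by
  set f := Matrix.toLin' M with hf
  obtain ⟨n, b⟩ := Submodule.basisOfPid (Pi.basisFun ℤ I) (LinearMap.range f)
  have hff : ∀ v, f (f v) = f v := fun v => by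
    rw [hf, ← LinearMap.comp_apply, ← Matrix.toLin'_mul, hM]
  let A' : (Fin n → ℤ) →ₗ[ℤ] (I → ℤ) := (LinearMap.range f).subtype ∘ₗ b.equivFun.symm.toLinearMap
  let B' : (I → ℤ) →ₗ[ℤ] (Fin n → ℤ) := b.equivFun.toLinearMap ∘ₗ f.rangeRestrict
  have h1 : A' ∘ₗ B' = f := by
    refine LinearMap.ext fun v => ?_
    simp [A', B']
  have h2 : B' ∘ₗ A' = LinearMap.id := by
    refine LinearMap.ext fun t => ?_
    obtain ⟨v, hv⟩ := (b.equivFun.symm t).2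
    have h3 : f.rangeRestrict (b.equivFun.symm t : I → ℤ) = b.equivFun.symm t := by
      refine Subtype.ext ?_
      change f _ = _
      rw [← hv, hff]
    simp only [A', B', LinearMap.comp_apply, Submodule.subtype_apply, LinearEquiv.coe_coe,
      LinearMap.id_apply]
    rw [h3, LinearEquiv.apply_symm_apply]
  have h3 : LinearMap.toMatrix' A' * LinearMap.toMatrix' B' = M := by
    rw [← LinearMap.toMatrix'_comp, h1, hf, LinearMap.toMatrix'_toLin']
  have h4 : LinearMap.toMatrix' B' * LinearMap.toMatrix' A' = 1 := by
    rw [← LinearMap.toMatrix'_comp, h2, LinearMap.toMatrix'_id]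
  obtain rfl : n = r := by
    have h5 := congrArg Matrix.trace h4
    rw [Matrix.trace_mul_comm, h3, hr, Matrix.trace_one, Fintype.card_fin] at h5
    exact_mod_cast h5.symm
  exact ⟨_, _, h3, h4⟩

variable {X : Type*} [LinearOrder X] (u : X → ℕ) [∀ x, NeZero (u x)] (R : Type*) [CommRing R]

/-- The differential of the Koszul complexes of a family `u` of natural numbers. -/
def dU : ((X →₀ ℕ) →₀ R) →ₗ[R] ((X →₀ ℕ) →₀ R) :=
  Finsupp.linearCombination R fun v : X →₀ ℕ =>
    ∑ x ∈ v.support with Odd (v x),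
      Finsupp.single (v + Finsupp.single x 1) ((-1 : R) ^ signExp x v * (u x : R))

/-- The homotopy of the Koszul complexes that belongs to `x`. -/
def hU (x : X) : ((X →₀ ℕ) →₀ R) →ₗ[R] ((X →₀ ℕ) →₀ R) :=
  Finsupp.linearCombination R fun v : X →₀ ℕ =>
    if Even (v x) ∧ v x ≠ 0 then Finsupp.single (v - Finsupp.single x 1) ((-1 : R) ^ signExp x v)
    else 0

/-- The chains `⨁ R [v]`, as chains on the symbol `[1]`. -/
def toOne : ((X →₀ ℕ) →₀ R) →ₗ[R] (Cell u →₀ R) :=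
  Finsupp.lmapDomain R R fun v => (Symb.one u, v)

variable {R}

theorem dU_single (v : X →₀ ℕ) : dU u R (Finsupp.single v 1) =
    ∑ x ∈ v.support with Odd (v x),
      Finsupp.single (v + Finsupp.single x 1) ((-1 : R) ^ signExp x v * (u x : R)) := by
  rw [dU, Finsupp.linearCombination_single, one_smul]

theorem hU_single (x : X) (v : X →₀ ℕ) : hU R x (Finsupp.single v 1) =
    if Even (v x) ∧ v x ≠ 0 then Finsupp.single (v - Finsupp.single x 1) ((-1 : R) ^ signExp x v)
    else 0 := by
  rw [hU, Finsupp.linearCombination_single, one_smul]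

theorem toOne_single (v : X →₀ ℕ) (r : R) :
    toOne u R (Finsupp.single v r) = Finsupp.single (Symb.one u, v) r := by
  simp [toOne]

theorem toOne_injective : Function.Injective (toOne u R) :=
  Finsupp.mapDomain_injective fun _ _ h => (Prod.ext_iff.mp h).2

theorem toOne_dU (c : (X →₀ ℕ) →₀ R) : toOne u R (dU u R c) = dTot u R (toOne u R c) := by
  suffices h : toOne u R ∘ₗ dU u R = dTot u R ∘ₗ toOne u R from LinearMap.congr_fun h c
  refine Finsupp.lhom_ext' fun v => LinearMap.ext_ring ?_
  simp only [LinearMap.comp_apply, Finsupp.lsingle_apply]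
  rw [dU_single, toOne_single, dTot_single_one, map_sum]
  exact Finset.sum_congr rfl fun x _ => toOne_single u _ _

theorem toOne_hU (x : X) (c : (X →₀ ℕ) →₀ R) :
    toOne u R (hU R x c) = hC u R x (toOne u R c) := by
  suffices h : toOne u R ∘ₗ hU R x = hC u R x ∘ₗ toOne u R from LinearMap.congr_fun h c
  refine Finsupp.lhom_ext' fun v => LinearMap.ext_ring ?_
  simp only [LinearMap.comp_apply, Finsupp.lsingle_apply]
  have h2 : Finsupp.single (Cell.get x ((Symb.one u, v) : Cell u)) (1 : R) = nb R (u x) (v x) := rfl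
  rw [hU_single, toOne_single, hC, ext_single, h2, one_mul]
  simp only [sh, strandOp_nb]
  split_ifs
  · rw [toOne_single, nb, emb_single, Finsupp.smul_single, smul_eq_mul, mul_one]
    congr 1
    refine Prod.ext (Symb.upd_eq_self rfl).symm ?_
    exact (update_pred v x).symm
  · rw [map_zero, map_zero, smul_zero]

theorem dU_dU (c : (X →₀ ℕ) →₀ R) : dU u R (dU u R c) = 0 := by
  refine toOne_injective u ?_
  rw [toOne_dU, toOne_dU, dTot_dTot, map_zero]

theorem toOne_mem_adm {w : X →₀ ℕ} {q : ℕ} {x : X} (hx : x ∈ w.support) {c : (X →₀ ℕ) →₀ R}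
    (hc : c ∈ block R w q) : toOne u R c ∈ adm u R {x} := by
  rw [adm_eq_supported]
  refine supported_induction (P := fun c => toOne u R c ∈ _) (by simp)
    (fun a b ha hb => by rw [map_add]; exact Submodule.add_mem _ ha hb)
    (fun r a ha => by rw [map_smul]; exact Submodule.smul_mem _ _ ha) (fun v hv => ?_) hc
  rw [toOne_single]
  refine Finsupp.single_mem_supported R 1 ⟨rfl, fun x' hx' => ?_⟩
  obtain rfl := Finset.mem_singleton.mp hx'
  exact pos_of_mem_blockIndex hv hx

theorem dU_hU {w : X →₀ ℕ} {q : ℕ} {x : X} (hx : x ∈ w.support) {c : (X →₀ ℕ) →₀ R}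
    (hc : c ∈ block R w q) : dU u R (hU R x c) + hU R x (dU u R c) = (u x : R) • c := by
  refine toOne_injective u ?_
  rw [map_add, toOne_dU, toOne_hU, toOne_hU, toOne_dU, dTot_hC,
    (toOne_mem_adm u hx hc).1 x (Finset.mem_singleton_self x), map_smul]
  abel

theorem dU_mem_block {w : X →₀ ℕ} {q : ℕ} {c : (X →₀ ℕ) →₀ R} (hc : c ∈ block R w q) :
    dU u R c ∈ block R w (q + 1) := by
  refine supported_induction (P := fun c => dU u R c ∈ block R w (q + 1)) (by simp)
    (fun a b ha hb => by rw [map_add]; exact Submodule.add_mem _ ha hb)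
    (fun r a ha => by rw [map_smul]; exact Submodule.smul_mem _ _ ha) (fun v hv => ?_) hc
  rw [dU_single]
  refine Submodule.sum_mem _ fun x hx => Finsupp.single_mem_supported R _ ?_
  rw [mem_blockIndex_iff] at hv ⊢
  refine ⟨by rw [map_add, Finsupp.degree_single, hv.1], fun x' => ?_⟩
  obtain ⟨k, hk⟩ := (Finset.mem_filter.mp hx).2
  rw [← hv.2 x', Finsupp.add_apply, Finsupp.single_apply]
  split_ifs with h
  · subst h
    omega
  · rfl

theorem hU_mem_block (x : X) {w : X →₀ ℕ} {q : ℕ} {c : (X →₀ ℕ) →₀ R}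
    (hc : c ∈ block R w (q + 1)) : hU R x c ∈ block R w q := by
  refine supported_induction (P := fun c => hU R x c ∈ block R w q) (by simp)
    (fun a b ha hb => by rw [map_add]; exact Submodule.add_mem _ ha hb)
    (fun r a ha => by rw [map_smul]; exact Submodule.smul_mem _ _ ha) (fun v hv => ?_) hc
  rw [hU_single]
  split_ifs with h
  · refine Finsupp.single_mem_supported R _ ?_
    rw [mem_blockIndex_iff] at hv ⊢
    have h1 : v - Finsupp.single x 1 + Finsupp.single x 1 = v :=
      tsub_add_cancel_of_le (Finsupp.single_le_iff.mpr (Nat.one_le_iff_ne_zero.mpr h.2))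
    have h2 := congrArg Finsupp.degree h1
    rw [map_add, Finsupp.degree_single, hv.1] at h2
    refine ⟨by omega, fun x' => ?_⟩
    obtain ⟨k, hk⟩ := h.1
    rw [← hv.2 x', Finsupp.tsub_apply, Finsupp.single_apply]
    split_ifs with h3
    · subst h3
      omega
    · rfl
  · exact Submodule.zero_mem _

variable (R) in
/-- The contraction of the Koszul complexes given by coefficients `ψ x` of a relation
`∑ x, ψ x * u x = 1`. -/
def hSum (S : Finset X) (ψ : X → ℤ) : ((X →₀ ℕ) →₀ R) →ₗ[R] ((X →₀ ℕ) →₀ R) :=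
  ∑ x ∈ S, (ψ x : R) • hU R x

theorem hSum_apply (S : Finset X) (ψ : X → ℤ) (c : (X →₀ ℕ) →₀ R) :
    hSum R S ψ c = ∑ x ∈ S, (ψ x : R) • hU R x c := by
  simp [hSum]

theorem dU_hSum {w : X →₀ ℕ} {ψ : X → ℤ} (hψ : ∑ x ∈ w.support, ψ x * (u x : ℤ) = 1) {q : ℕ}
    {c : (X →₀ ℕ) →₀ R} (hc : c ∈ block R w q) :
    dU u R (hSum R w.support ψ c) + hSum R w.support ψ (dU u R c) = c := by
  have h1 : ∑ x ∈ w.support, (ψ x : R) * (u x : R) = 1 := by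
    have := congrArg (Int.cast : ℤ → R) hψ
    simpa using this
  rw [hSum_apply, hSum_apply, map_sum, ← Finset.sum_add_distrib]
  conv_rhs => rw [← one_smul R c, ← h1, Finset.sum_smul]
  refine Finset.sum_congr rfl fun x hx => ?_
  rw [map_smul, ← smul_add, dU_hU u hx hc, smul_smul]

variable (R) in
/-- Reduction of integral chains. -/
def castChain : ((X →₀ ℕ) →₀ ℤ) →+ ((X →₀ ℕ) →₀ R) :=
  Finsupp.mapRange.addMonoidHom (Int.castAddHom R)

theorem castChain_single (v : X →₀ ℕ) (k : ℤ) :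
    castChain R (Finsupp.single v k) = Finsupp.single v (k : R) := by
  simp [castChain]

theorem castChain_smul (k : ℤ) (c : (X →₀ ℕ) →₀ ℤ) :
    castChain R (k • c) = (k : R) • castChain R c := by
  rw [map_zsmul, Int.cast_smul_eq_zsmul]

theorem single_eq_smul {S α : Type*} [CommRing S] (i : α) (r : S) :
    Finsupp.single i r = r • Finsupp.single i 1 := by
  rw [Finsupp.smul_single, smul_eq_mul, mul_one]

theorem castChain_dU (c : (X →₀ ℕ) →₀ ℤ) :
    castChain R (dU u ℤ c) = dU u R (castChain R c) := by
  induction c using Finsupp.induction_linear with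
  | zero => simp
  | add a b ha hb => simp only [map_add, ha, hb]
  | single v k =>
    rw [single_eq_smul, map_smul, castChain_smul, castChain_smul, castChain_single, map_smul,
      dU_single, Int.cast_one, dU_single, map_sum]
    congr 1
    refine Finset.sum_congr rfl fun x _ => ?_
    rw [castChain_single]
    simp

theorem castChain_hU (x : X) (c : (X →₀ ℕ) →₀ ℤ) :
    castChain R (hU ℤ x c) = hU R x (castChain R c) := by
  induction c using Finsupp.induction_linear with
  | zero => simp
  | add a b ha hb => simp only [map_add, ha, hb]
  | single v k =>
    rw [single_eq_smul, map_smul, castChain_smul, castChain_smul, castChain_single, map_smul,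
      hU_single, Int.cast_one, hU_single]
    congr 1
    split_ifs
    · rw [castChain_single]
      simp
    · rw [map_zero]

theorem castChain_hSum (S : Finset X) (ψ : X → ℤ) (c : (X →₀ ℕ) →₀ ℤ) :
    castChain R (hSum ℤ S ψ c) = hSum R S ψ (castChain R c) := by
  rw [hSum_apply, hSum_apply, map_sum]
  refine Finset.sum_congr rfl fun x _ => ?_
  rw [castChain_smul, castChain_hU, Int.cast_id]

/-- The diagonal coefficients of the projection to the cocycles. -/
theorem dU_hU_single_apply (x : X) (v : X →₀ ℕ) :
    dU u R (hU R x (Finsupp.single v 1)) v = if Even (v x) ∧ v x ≠ 0 then (u x : R) else 0 := by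
  rw [hU_single]
  split_ifs with h
  · have h0 : (v - Finsupp.single x 1 : X →₀ ℕ) x = v x - 1 := by simp
    obtain ⟨k, hk⟩ := h.1
    have hx : x ∈ Finset.filter (fun y => Odd ((v - Finsupp.single x 1 : X →₀ ℕ) y))
        (v - Finsupp.single x 1).support := by
      rw [Finset.mem_filter, Finsupp.mem_support_iff, h0]
      exact ⟨by omega, ⟨k - 1, by omega⟩⟩
    have h1 : v - Finsupp.single x 1 + Finsupp.single x 1 = v :=
      tsub_add_cancel_of_le (Finsupp.single_le_iff.mpr (Nat.one_le_iff_ne_zero.mpr h.2))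
    rw [single_eq_smul, map_smul, dU_single, Finsupp.smul_apply, Finsupp.finsetSum_apply,
      Finset.sum_eq_single_of_mem x hx, h1, Finsupp.single_eq_same, ← update_pred,
      signExp_update_of_not_lt x x (lt_irrefl x), smul_eq_mul, ← mul_assoc, ← mul_pow,
      neg_one_mul, neg_neg, one_pow, one_mul]
    intro y _ hy
    rw [Finsupp.single_apply, if_neg]
    intro h2
    have h3 := DFunLike.congr_fun h2 x
    rw [Finsupp.add_apply, h0, Finsupp.single_eq_of_ne (Ne.symm hy)] at h3
    omega
  · simp

/-- The exponent of the basis element `w² / A`. -/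
def enc (w : X →₀ ℕ) (A : Finset X) : X →₀ ℕ := 2 • w - Finsupp.indicator A fun _ _ => 1

theorem enc_apply (w : X →₀ ℕ) (A : Finset X) (x : X) :
    enc w A x = 2 * w x - if x ∈ A then 1 else 0 := by
  rw [enc, Finsupp.tsub_apply, Finsupp.indicator_apply, Finsupp.smul_apply, smul_eq_mul,
    dite_eq_ite]

theorem enc_add {w : X →₀ ℕ} {A : Finset X} (hA : A ⊆ w.support) :
    enc w A + Finsupp.indicator A (fun _ _ => 1) = 2 • w := by
  ext x
  rw [Finsupp.add_apply, enc_apply, Finsupp.indicator_apply, Finsupp.smul_apply, smul_eq_mul,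
    dite_eq_ite]
  split_ifs with h
  · have := Finsupp.mem_support_iff.mp (hA h)
    omega
  · rfl

theorem degree_indicator (A : Finset X) :
    (Finsupp.indicator A (fun _ _ => 1) : X →₀ ℕ).degree = A.card := by
  have h : (Finsupp.indicator A (fun _ _ => 1) : X →₀ ℕ).support = A := by
    ext x
    simp [Finsupp.indicator_apply]
  rw [Finsupp.degree_apply, h, Finset.card_eq_sum_ones]
  exact Finset.sum_congr rfl fun x hx => by rw [Finsupp.indicator_apply, dif_pos hx]

theorem degree_enc {w : X →₀ ℕ} {A : Finset X} (hA : A ⊆ w.support) :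
    (enc w A).degree + A.card = 2 * w.degree := by
  have h := congrArg Finsupp.degree (enc_add hA)
  rwa [map_add, degree_indicator, two_nsmul, map_add, ← two_mul] at h

theorem even_enc_iff {w : X →₀ ℕ} (A : Finset X) {x : X} (hx : x ∈ w.support) :
    (Even (enc w A x) ∧ enc w A x ≠ 0) ↔ x ∉ A := by
  have h := Finsupp.mem_support_iff.mp hx
  rw [enc_apply]
  split_ifs with hxA
  · simp only [hxA, not_true_eq_false, iff_false, not_and]
    rintro ⟨k, hk⟩
    omega
  · simp only [hxA, not_false_eq_true, iff_true, tsub_zero]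
    exact ⟨⟨w x, by omega⟩, by omega⟩

theorem enc_injOn {w : X →₀ ℕ} {A A' : Finset X} (hA : A ⊆ w.support) (hA' : A' ⊆ w.support)
    (h : enc w A = enc w A') : A = A' := by
  ext x
  by_cases hx : x ∈ w.support
  · rw [← not_iff_not, ← even_enc_iff A hx, ← even_enc_iff A' hx, h]
  · exact ⟨fun h => absurd (hA h) hx, fun h => absurd (hA' h) hx⟩

/-- The index set of the basis of the component of degree `2 deg w - j` of the complex
`I_T [w²]`. -/
abbrev KIdx (w : X →₀ ℕ) (j : ℕ) : Type _ := ↥(w.support.powersetCard j)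

theorem KIdx.subset {w : X →₀ ℕ} {j : ℕ} (A : KIdx w j) : A.1 ⊆ w.support :=
  (Finset.mem_powersetCard.mp A.2).1

theorem enc_mem {w : X →₀ ℕ} {j q : ℕ} (hq : q + j = 2 * w.degree) (A : KIdx w j) :
    enc w A.1 ∈ blockIndex w q := by
  refine ⟨?_, A.1, A.subset, enc_add A.subset⟩
  have h := degree_enc A.subset
  rw [(Finset.mem_powersetCard.mp A.2).2] at h
  omega

theorem exists_enc {w : X →₀ ℕ} {j q : ℕ} (hq : q + j = 2 * w.degree) {v : X →₀ ℕ}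
    (hv : v ∈ blockIndex w q) : ∃ A : KIdx w j, enc w A.1 = v := by
  obtain ⟨hdeg, A, hA, h⟩ := hv
  have h1 : enc w A = v := by
    rw [enc, ← h, add_tsub_cancel_right]
  refine ⟨⟨A, Finset.mem_powersetCard.mpr ⟨hA, ?_⟩⟩, h1⟩
  have h2 := degree_enc hA
  rw [h1] at h2
  omega

variable (R) in
/-- The coordinates of the component of degree `2 deg w - j` of the complex `I_T [w²]`. -/
def fromCoord (w : X →₀ ℕ) (j : ℕ) : (KIdx w j → R) →ₗ[R] ((X →₀ ℕ) →₀ R) :=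
  ∑ A : KIdx w j, Finsupp.lsingle (enc w A.1) ∘ₗ LinearMap.proj A

theorem fromCoord_apply (w : X →₀ ℕ) (j : ℕ) (t : KIdx w j → R) :
    fromCoord R w j t = ∑ A : KIdx w j, t A • Finsupp.single (enc w A.1) 1 := by
  simp [fromCoord]

theorem fromCoord_apply_enc {w : X →₀ ℕ} {j : ℕ} (t : KIdx w j → R) (A : KIdx w j) :
    fromCoord R w j t (enc w A.1) = t A := by
  rw [fromCoord_apply, Finsupp.finsetSum_apply, Finset.sum_eq_single_of_mem A (Finset.mem_univ _)]
  · simp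
  · intro A' _ h
    rw [Finsupp.smul_apply, Finsupp.single_apply, if_neg, smul_zero]
    exact fun h' => h (Subtype.ext (enc_injOn A'.subset A.subset h'))

theorem fromCoord_injective (w : X →₀ ℕ) (j : ℕ) : Function.Injective (fromCoord R w j) :=
  fun t t' h => funext fun A => by rw [← fromCoord_apply_enc t, h, fromCoord_apply_enc]

theorem fromCoord_mem {w : X →₀ ℕ} {j q : ℕ} (hq : q + j = 2 * w.degree) (t : KIdx w j → R) :
    fromCoord R w j t ∈ block R w q := by
  rw [fromCoord_apply]
  exact Submodule.sum_mem _ fun A _ =>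
    Submodule.smul_mem _ _ (Finsupp.single_mem_supported R 1 (enc_mem hq A))

theorem fromCoord_coord {w : X →₀ ℕ} {j q : ℕ} (hq : q + j = 2 * w.degree)
    {c : (X →₀ ℕ) →₀ R} (hc : c ∈ block R w q) :
    fromCoord R w j (fun A => c (enc w A.1)) = c := by
  refine Finsupp.ext fun v => ?_
  by_cases hv : v ∈ blockIndex w q
  · obtain ⟨A, rfl⟩ := exists_enc hq hv
    rw [fromCoord_apply_enc]
  · rw [(Finsupp.mem_supported' R _).mp (fromCoord_mem hq _) v hv,
      (Finsupp.mem_supported' R _).mp hc v hv]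

/-- The matrix of the projection to the cocycles. -/
def projMatrix (w : X →₀ ℕ) (j : ℕ) (ψ : X → ℤ) : Matrix (KIdx w j) (KIdx w j) ℤ :=
  Matrix.of fun A' A => dU u ℤ (hSum ℤ w.support ψ (Finsupp.single (enc w A.1) 1)) (enc w A'.1)

theorem hSum_mem_block (S : Finset X) (ψ : X → ℤ) {w : X →₀ ℕ} {q : ℕ} {c : (X →₀ ℕ) →₀ R}
    (hc : c ∈ block R w (q + 1)) : hSum R S ψ c ∈ block R w q := by
  rw [hSum_apply]
  exact Submodule.sum_mem _ fun x _ => Submodule.smul_mem _ _ (hU_mem_block x hc)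

theorem block_zero_eq_bot {w : X →₀ ℕ} (hw : w ≠ 0) : block R w 0 = ⊥ :=
  block_eq_bot (Finset.card_pos.mpr (Finsupp.support_nonempty_iff.mpr hw))

theorem proj_mem_block {w : X →₀ ℕ} (hw : w ≠ 0) (ψ : X → ℤ) {q : ℕ} {c : (X →₀ ℕ) →₀ R}
    (hc : c ∈ block R w q) : dU u R (hSum R w.support ψ c) ∈ block R w q := by
  rcases q with _ | q
  · rw [block_zero_eq_bot hw, Submodule.mem_bot] at hc
    rw [hc, map_zero, map_zero]
    exact Submodule.zero_mem _
  · exact dU_mem_block u (hSum_mem_block _ ψ hc)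

theorem proj_fromCoord {w : X →₀ ℕ} (hw : w ≠ 0) {j q : ℕ} (hq : q + j = 2 * w.degree)
    (ψ : X → ℤ) (t : KIdx w j → R) :
    dU u R (hSum R w.support ψ (fromCoord R w j t)) =
      fromCoord R w j (((projMatrix u w j ψ).map (Int.cast : ℤ → R)).mulVec t) := by
  rw [← fromCoord_coord hq (proj_mem_block u hw ψ (fromCoord_mem hq t))]
  congr 1
  funext A'
  rw [fromCoord_apply, map_sum, map_sum, Finsupp.finsetSum_apply, Matrix.mulVec, dotProduct]
  refine Finset.sum_congr rfl fun A _ => ?_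
  have h1 : castChain R (Finsupp.single (enc w A.1) 1) = Finsupp.single (enc w A.1) (1 : R) := by
    rw [castChain_single, Int.cast_one]
  rw [map_smul, map_smul, ← h1, ← castChain_hSum, ← castChain_dU, Finsupp.smul_apply, smul_eq_mul,
    mul_comm]
  rfl

theorem proj_proj_apply {w : X →₀ ℕ} (hw : w ≠ 0) {ψ : X → ℤ}
    (hψ : ∑ x ∈ w.support, ψ x * (u x : ℤ) = 1) {q : ℕ} {c : (X →₀ ℕ) →₀ R}
    (hc : c ∈ block R w q) :
    dU u R (hSum R w.support ψ (dU u R (hSum R w.support ψ c))) =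
      dU u R (hSum R w.support ψ c) := by
  have h := dU_hSum u hψ (proj_mem_block u hw ψ hc)
  rwa [dU_dU, map_zero, add_zero] at h

theorem projMatrix_mul_self {w : X →₀ ℕ} (hw : w ≠ 0) {ψ : X → ℤ}
    (hψ : ∑ x ∈ w.support, ψ x * (u x : ℤ) = 1) {j q : ℕ} (hq : q + j = 2 * w.degree) :
    projMatrix u w j ψ * projMatrix u w j ψ = projMatrix u w j ψ := by
  have hmap : (projMatrix u w j ψ).map (Int.cast : ℤ → ℤ) = projMatrix u w j ψ := by
    ext
    simp
  refine Matrix.ext_of_mulVec_single fun A => ?_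
  refine fromCoord_injective w j ?_
  have h1 := fun t => proj_fromCoord (R := ℤ) u hw hq ψ t
  rw [hmap] at h1
  rw [← Matrix.mulVec_mulVec, ← h1, ← h1]
  exact proj_proj_apply u hw hψ (fromCoord_mem hq _)

theorem card_filter_notMem (S : Finset X) {x : X} (hx : x ∈ S) (j : ℕ) :
    ((S.powersetCard j).filter fun A => x ∉ A).card = (S.card - 1).choose j := by
  have h : (S.powersetCard j).filter (fun A => x ∉ A) = (S.erase x).powersetCard j := by
    ext A
    rw [Finset.mem_filter, Finset.mem_powersetCard, Finset.mem_powersetCard, Finset.subset_erase]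
    tauto
  rw [h, Finset.card_powersetCard, Finset.card_erase_of_mem hx]

theorem trace_projMatrix {w : X →₀ ℕ} {ψ : X → ℤ}
    (hψ : ∑ x ∈ w.support, ψ x * (u x : ℤ) = 1) (j : ℕ) :
    (projMatrix u w j ψ).trace = ((w.support.card - 1).choose j : ℕ) := by
  have h1 : ∀ A : KIdx w j, (projMatrix u w j ψ) A A =
      ∑ x ∈ w.support, if x ∉ A.1 then ψ x * (u x : ℤ) else 0 := by
    intro A
    rw [projMatrix, Matrix.of_apply, hSum_apply, map_sum, Finsupp.finsetSum_apply]
    refine Finset.sum_congr rfl fun x hx => ?_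
    rw [map_smul, Finsupp.smul_apply, dU_hU_single_apply, Int.cast_id, smul_eq_mul]
    by_cases h : x ∉ A.1
    · rw [if_pos h, if_pos ((even_enc_iff A.1 hx).mpr h)]
    · rw [if_neg h, if_neg fun h' => h ((even_enc_iff A.1 hx).mp h'), mul_zero]
  rw [Matrix.trace]
  simp only [Matrix.diag_apply, h1]
  rw [Finset.sum_comm]
  have h2 : ∀ x ∈ w.support, (∑ A : KIdx w j, if x ∉ A.1 then ψ x * (u x : ℤ) else 0) =
      ((w.support.card - 1).choose j : ℕ) * (ψ x * (u x : ℤ)) := by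
    intro x hx
    rw [Finset.sum_coe_sort (w.support.powersetCard j)
      (fun A => if x ∉ A then ψ x * (u x : ℤ) else 0), ← Finset.sum_filter, Finset.sum_const,
      card_filter_notMem _ hx, nsmul_eq_mul]
  rw [Finset.sum_congr rfl h2, ← Finset.mul_sum, hψ, mul_one]

end Koszul

/-! ### The cohomology of the complexes `I_T [w²]` -/

section BlockCohomology

set_option linter.unusedSectionVars false

variable {X G T : Type*} [LinearOrder X] [Group G] [TopologicalSpace G] [IsTopologicalGroup G]
  [CompactSpace G] [CommRing T] (D : NormData X G) {z : X → ℕ}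

namespace NormData

theorem subsingleton_HT_of_lt {w : X →₀ ℕ} {q : ℕ} (h : q < w.support.card) :
    Subsingleton (D.HT T z w q) := by
  refine Subquotient.subsingleton_of_le fun c hc => ?_
  have h1 : c ∈ block T w q := hc.1
  rw [block_eq_bot h, Submodule.mem_bot] at h1
  rw [h1]
  exact Submodule.zero_mem _

theorem mem_blockIndex_zero_iff {v : X →₀ ℕ} {q : ℕ} : v ∈ blockIndex 0 q ↔ v = 0 ∧ q = 0 := by
  rw [mem_blockIndex_iff]
  constructor
  · rintro ⟨h1, h2⟩
    obtain rfl : v = 0 := Finsupp.ext fun x => by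
      have := h2 x
      rw [Finsupp.zero_apply] at this ⊢
      omega
    exact ⟨rfl, by rw [← h1, map_zero]⟩
  · rintro ⟨rfl, rfl⟩
    exact ⟨map_zero _, fun x => by simp⟩

theorem subsingleton_HT_zero {q : ℕ} (hq : q ≠ 0) : Subsingleton (D.HT T z 0 q) := by
  refine Subquotient.subsingleton_of_le fun c hc => ?_
  have h1 : c ∈ Finsupp.supported T T (blockIndex (0 : X →₀ ℕ) q) := hc.1
  have h2 : blockIndex (0 : X →₀ ℕ) q = ∅ :=
    Set.eq_empty_iff_forall_notMem.mpr fun v hv => hq (mem_blockIndex_zero_iff.mp hv).2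
  rw [h2, Finsupp.supported_empty, Submodule.mem_bot] at h1
  rw [h1]
  exact Submodule.zero_mem _

theorem nonempty_HT_zero : Nonempty (D.HT T z 0 0 ≃ₗ[T] T) := by
  have hmem : ∀ t : T, Finsupp.single (0 : X →₀ ℕ) t ∈ D.blockCocycles T z 0 0 := fun t => by
    refine ⟨Finsupp.single_mem_supported T t (mem_blockIndex_zero_iff.mpr ⟨rfl, rfl⟩), ?_⟩
    rw [SetLike.mem_coe, LinearMap.mem_ker, delta, Finsupp.linearCombination_single]
    simp
  have h := nonempty_equiv_of_surjective (LinearMap.id : T →ₗ[T] T)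
    (Subquotient.mk (D.blockCocycles T z 0 0) (D.blockCoboundaries T z 0 0) ∘ₗ
      (Finsupp.lsingle (0 : X →₀ ℕ)).codRestrict (D.blockCocycles T z 0 0) hmem)
    Function.surjective_id (fun c => ?_) fun t => ?_
  · exact h.map LinearEquiv.symm
  · obtain ⟨⟨c, hc⟩, rfl⟩ := Subquotient.mk_surjective _ _ c
    refine ⟨c 0, ?_⟩
    rw [LinearMap.comp_apply]
    congr 1
    refine Subtype.ext (Finsupp.ext fun v => ?_)
    change Finsupp.single 0 (c 0) v = c v
    by_cases hv : v = 0
    · rw [hv, Finsupp.single_eq_same]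
    · rw [Finsupp.single_eq_of_ne hv, (Finsupp.mem_supported' T c).mp hc.1 v
        fun h => hv (mem_blockIndex_zero_iff.mp h).1]
  · rw [LinearMap.comp_apply, Subquotient.mk_eq_zero]
    change t = 0 ↔ Finsupp.single (0 : X →₀ ℕ) t = 0
    rw [Finsupp.single_eq_zero]

/-- The order of `G_{z(x)}`, for `x ∣ w`, divided by `m_w`. For the other `x`, the value `1` is
chosen, which does not matter for the complex `I_T [w²]`. -/
def redOrd (z : X → ℕ) (w : X →₀ ℕ) (x : X) : ℕ :=
  if x ∈ w.support then Nat.card (D.Gfin (Finsupp.single x (z x))) / D.m z w else 1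

theorem m_mul_redOrd {w : X →₀ ℕ} {x : X} (hx : x ∈ w.support) :
    D.m z w * D.redOrd z w x = Nat.card (D.Gfin (Finsupp.single x (z x))) := by
  rw [redOrd, if_pos hx]
  exact Nat.mul_div_cancel' (Finset.gcd_dvd hx)

instance (w : X →₀ ℕ) (x : X) : NeZero (D.redOrd z w x) := ⟨by
  by_cases hx : x ∈ w.support
  · intro h
    have h1 := D.m_mul_redOrd (z := z) hx
    rw [h, mul_zero] at h1
    exact Nat.card_pos.ne h1
  · rw [redOrd, if_neg hx]
    exact one_ne_zero⟩

theorem exists_bezout {w : X →₀ ℕ} (hw : w ≠ 0) :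
    ∃ ψ : X → ℤ, ∑ x ∈ w.support, ψ x * (D.redOrd z w x : ℤ) = 1 := by
  obtain ⟨x₀, hx₀⟩ := Finsupp.support_nonempty_iff.mpr hw
  have hm0 : D.m z w ≠ 0 := fun h => by
    have h1 := D.m_mul_redOrd (z := z) hx₀
    rw [h, zero_mul] at h1
    exact Nat.card_pos.ne h1
  obtain ⟨ψ, hψ⟩ := Finset.gcd_eq_sum_mul w.support fun x => (D.redOrd z w x : ℤ)
  set g := w.support.gcd fun x => (D.redOrd z w x : ℤ) with hg
  have h1 : (D.m z w * g.natAbs) ∣ D.m z w := by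
    refine Finset.dvd_gcd fun x hx => ?_
    rw [← D.m_mul_redOrd hx]
    refine mul_dvd_mul_left _ ?_
    rw [← Int.natCast_dvd_natCast, Int.natCast_natAbs, abs_dvd]
    exact Finset.gcd_dvd hx
  have h2 : g.natAbs = 1 := by
    have h3 := Nat.le_of_dvd (Nat.pos_of_ne_zero hm0) h1
    have h4 : g.natAbs ≠ 0 := fun h => by
      rw [h, mul_zero, zero_dvd_iff] at h1
      exact hm0 h1
    have h5 : g.natAbs ≤ 1 := by
      by_contra h6
      have h7 : D.m z w * 2 ≤ D.m z w * g.natAbs := Nat.mul_le_mul_left _ (by omega)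
      omega
    omega
  refine ⟨fun x => g.sign * ψ x, ?_⟩
  calc ∑ x ∈ w.support, g.sign * ψ x * (D.redOrd z w x : ℤ)
      = g.sign * ∑ x ∈ w.support, (D.redOrd z w x : ℤ) * ψ x := by
        rw [Finset.mul_sum]
        exact Finset.sum_congr rfl fun x _ => by ring
    _ = 1 := by
        rw [← hψ, mul_comm, Int.mul_sign_self, h2, Nat.cast_one]

theorem delta_eq_smul_dU {w : X →₀ ℕ} {q : ℕ} {c : (X →₀ ℕ) →₀ T} (hc : c ∈ block T w q) :
    D.delta T z c = (D.m z w : T) • dU (D.redOrd z w) T c := by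
  refine supported_induction
    (P := fun c => D.delta T z c = (D.m z w : T) • dU (D.redOrd z w) T c) (by simp)
    (fun a b ha hb => by rw [_root_.map_add, _root_.map_add, smul_add, ha, hb])
    (fun r a ha => by rw [_root_.map_smul, _root_.map_smul, ha, smul_comm]) (fun v hv => ?_) hc
  rw [delta, Finsupp.linearCombination_single, one_smul, dU_single, Finset.smul_sum]
  refine Finset.sum_congr rfl fun x hx => ?_
  have hxw : x ∈ w.support := by
    have h1 := (mem_blockIndex_iff.mp hv).2 x
    have h2 := Finsupp.mem_support_iff.mp (Finset.mem_filter.mp hx).1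
    rw [Finsupp.mem_support_iff]
    omega
  rw [Finsupp.smul_single, smul_eq_mul, ← D.m_mul_redOrd hxw, Nat.cast_mul, signExp]
  congr 1
  ring

/-- The cohomology of `I_T [w²]`. The differential is `m_w` times the differential of a
contractible complex, whose cocycles are free, being the image of an idempotent integer matrix. -/
theorem nonempty_HT_equiv {w : X →₀ ℕ} (hw : w ≠ 0)
    (hm : ∀ t : T, (D.m z w : T) * t = 0 → t = 0) {j q : ℕ} (hq : q + j = 2 * w.degree) :
    Nonempty (D.HT T z w q ≃ₗ[T]
      (Fin ((w.support.card - 1).choose j) → T ⧸ Ideal.span {(D.m z w : T)})) := by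
  obtain ⟨ψ, hψ⟩ := D.exists_bezout (z := z) hw
  set u := D.redOrd z w with hu
  obtain ⟨A, B, hAB, hBA⟩ := exists_factor_of_idempotent (projMatrix u w j ψ)
    (projMatrix_mul_self u hw hψ hq) (trace_projMatrix u hψ j)
  generalize (w.support.card - 1).choose j = r at A B hAB hBA ⊢
  set AT : Matrix (KIdx w j) (Fin r) T := A.map (Int.cast : ℤ → T) with hAT
  set BT : Matrix (Fin r) (KIdx w j) T := B.map (Int.cast : ℤ → T) with hBT
  have hABT : AT * BT = (projMatrix u w j ψ).map (Int.cast : ℤ → T) := by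
    rw [hAT, hBT, ← hAB]
    exact (Matrix.map_mul (L := A) (M := B) (f := Int.castRingHom T)).symm
  have hBAT : BT * AT = 1 := by
    rw [hAT, hBT]
    refine (Matrix.map_mul (L := B) (M := A) (f := Int.castRingHom T)).symm.trans ?_
    rw [hBA]
    exact Matrix.map_one _ (_root_.map_zero _) (_root_.map_one _)
  -- `f` parametrizes the cocycles of the contractible complex, by the factorization `A * B` of the
  -- projection `dU * hSum`.
  let f : (Fin r → T) →ₗ[T] ((X →₀ ℕ) →₀ T) := fromCoord T w j ∘ₗ Matrix.mulVecLin AT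
  have hf : ∀ t, f t = fromCoord T w j (AT.mulVec t) := fun t => rfl
  have hfinj : Function.Injective f := by
    intro t t' h
    have h1 := congrArg BT.mulVec (fromCoord_injective w j h)
    simpa only [Matrix.mulVecLin_apply, Matrix.mulVec_mulVec, hBAT, Matrix.one_mulVec] using h1
  have hfmem : ∀ t, f t ∈ block T w q := fun t => fromCoord_mem hq _
  have hsmul : ∀ c : (X →₀ ℕ) →₀ T, (D.m z w : T) • c = 0 → c = 0 := fun c h =>
    Finsupp.ext fun v => hm _ (by simpa using DFunLike.congr_fun h v)
  have hproj : ∀ t, dU u T (hSum T w.support ψ (f t)) = f t := by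
    intro t
    rw [hf, proj_fromCoord u hw hq ψ, ← hABT, Matrix.mulVec_mulVec, Matrix.mul_assoc, hBAT,
      Matrix.mul_one]
  have hdf : ∀ t, dU u T (f t) = 0 := fun t => by rw [← hproj, dU_dU]
  have hrange : ∀ c ∈ block T w q, dU u T c = 0 → ∃ t, f t = c := by
    intro c hc hd
    have h1 := dU_hSum u hψ hc
    rw [hd, _root_.map_zero, add_zero] at h1
    refine ⟨BT.mulVec fun A => c (enc w A.1), ?_⟩
    rw [hf, Matrix.mulVec_mulVec, hABT, ← proj_fromCoord u hw hq ψ, fromCoord_coord hq hc, h1]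
  have hZ : ∀ t, f t ∈ D.blockCocycles T z w q := fun t => ⟨hfmem t, by
    rw [SetLike.mem_coe, LinearMap.mem_ker, D.delta_eq_smul_dU (hfmem t), hdf, smul_zero]⟩
  have hB : ∀ c ∈ block T w q, dU u T c = 0 →
      (c ∈ D.blockCoboundaries T z w q ↔
        ∃ c' ∈ block T w q, dU u T c' = 0 ∧ (D.m z w : T) • c' = c) := by
    intro c _ _
    rcases q with _ | q
    · constructor
      · intro h
        exact ⟨0, Submodule.zero_mem _, _root_.map_zero _, by
          rw [smul_zero]
          exact (show c = 0 from h).symm⟩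
      · rintro ⟨c', hc', -, rfl⟩
        rw [block_zero_eq_bot hw, Submodule.mem_bot] at hc'
        rw [hc', smul_zero]
        exact Submodule.zero_mem _
    · constructor
      · rintro ⟨b, hb, rfl⟩
        exact ⟨dU u T b, dU_mem_block u hb, dU_dU u b, (D.delta_eq_smul_dU hb).symm⟩
      · rintro ⟨c', hc', hd', rfl⟩
        have h1 := dU_hSum u hψ hc'
        rw [hd', _root_.map_zero, add_zero] at h1
        refine ⟨hSum T w.support ψ c', hSum_mem_block _ ψ hc', ?_⟩
        rw [D.delta_eq_smul_dU (hSum_mem_block _ ψ hc'), h1]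
  let mk : (Fin r → T) →ₗ[T] (Fin r → T ⧸ Ideal.span {(D.m z w : T)}) :=
    (Ideal.span {(D.m z w : T)}).mkQ.compLeft (Fin r)
  refine nonempty_equiv_of_surjective (Subquotient.mk _ _ ∘ₗ f.codRestrict _ hZ) mk
    (fun c => ?_) (fun s => ?_) fun t => ?_
  · obtain ⟨⟨c, hc⟩, rfl⟩ := Subquotient.mk_surjective _ _ c
    have hd : dU u T c = 0 := hsmul _ (by
      rw [← D.delta_eq_smul_dU hc.1]
      exact hc.2)
    obtain ⟨t, ht⟩ := hrange c hc.1 hd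
    exact ⟨t, congrArg _ (Subtype.ext ht)⟩
  · choose t ht using fun i => (Ideal.span {(D.m z w : T)}).mkQ_surjective (s i)
    exact ⟨t, funext ht⟩
  · rw [LinearMap.comp_apply, Subquotient.mk_eq_zero]
    change f t ∈ _ ↔ _
    rw [hB _ (hfmem t) (hdf t)]
    constructor
    · rintro ⟨c', hc', hd', h⟩
      obtain ⟨t', rfl⟩ := hrange c' hc' hd'
      rw [← _root_.map_smul] at h
      rw [← hfinj h]
      funext i
      change (Ideal.span {(D.m z w : T)}).mkQ _ = 0
      rw [Submodule.mkQ_apply, Submodule.Quotient.mk_eq_zero]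
      exact Ideal.mem_span_singleton.mpr ⟨t' i, rfl⟩
    · intro h
      have h1 : ∀ i, ∃ s, t i = (D.m z w : T) * s := fun i => by
        have h2 : (Ideal.span {(D.m z w : T)}).mkQ (t i) = 0 := congrFun h i
        rw [Submodule.mkQ_apply, Submodule.Quotient.mk_eq_zero] at h2
        exact Ideal.mem_span_singleton.mp h2
      choose s hs using h1
      refine ⟨f s, hfmem s, hdf s, ?_⟩
      rw [← _root_.map_smul]
      exact congrArg f (funext fun i => (hs i).symm)

end NormData

end BlockCohomology

end NormDist

end

theorem mainTheorem2 {X G O T : Type*} [LinearOrder X]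
    [Group G] [TopologicalSpace G] [IsTopologicalGroup G] [CompactSpace G]
    [TotallyDisconnectedSpace G]
    [CommRing O] [IsDomain O] [CommRing T] [Algebra O T] [Module.Finite O T]
    [Module.IsTorsionFree O T]
    (D : NormDist.NormData X G) (p : X → Polynomial T) (z : X → ℕ)
    (hcyc : ∀ x, z x ≠ 0 → IsCyclic (D.Gfin (Finsupp.single x (z x))))
    (hp : ∀ x, z x ≠ 0 → (p x).eval 1 = 0) :
    -- the decomposition of the cohomology of `𝒰_z`: in degree `n`, it is the direct sum of the
    -- components `H_{T,w}^q [y]` with `q - deg y = n`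
    (∀ n : ℕ, Nonempty (NormDist.GroupH (D.rhoU p z) n ≃ₗ[T]
      DirectSum (NormDist.PairIndex z) fun yw => D.HT T z yw.1.2 (n + yw.1.1.card))) ∧
    -- there is nothing in negative degrees
    (∀ (yw : NormDist.PairIndex z) (q : ℕ), q < yw.1.1.card →
      Subsingleton (D.HT T z yw.1.2 q)) ∧
    -- `H_{T,1}` is `T` in degree `0`
    (Nonempty (D.HT T z 0 0 ≃ₗ[T] T) ∧ ∀ q : ℕ, q ≠ 0 → Subsingleton (D.HT T z 0 q)) ∧
    -- `H_{T,w}` is a free graded `T / m_w T`-module of the given ranks for `w ≠ 1`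
    (∀ w : X →₀ ℕ, w ≠ 0 → (∀ x ∈ w.support, z x ≠ 0) → ((D.m z w : ℕ) : O) ≠ 0 →
      (∀ i q : ℕ, 1 ≤ i → i ≤ w.support.card → q + w.support.card = 2 * w.degree + i →
        Nonempty (D.HT T z w q ≃ₗ[T]
          (Fin ((w.support.card - 1).choose (i - 1)) → T ⧸ Ideal.span {((D.m z w : ℕ) : T)}))) ∧
      (∀ q : ℕ, (∀ i : ℕ, 1 ≤ i → i ≤ w.support.card →
          q + w.support.card ≠ 2 * w.degree + i) → Subsingleton (D.HT T z w q))) := by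
  refine ⟨fun n => D.nonempty_groupH_U_equiv hcyc p hp n, fun yw q hq =>
    D.subsingleton_HT_of_lt (hq.trans_le (Finset.card_le_card yw.2.1)),
    ⟨D.nonempty_HT_zero, fun q hq => D.subsingleton_HT_zero hq⟩, fun w hw _ hm => ?_⟩
  have hmT : ∀ t : T, ((D.m z w : ℕ) : T) * t = 0 → t = 0 := by
    intro t ht
    have h1 : ((D.m z w : ℕ) : O) • t = 0 := by
      rw [Algebra.smul_def, map_natCast, ht]
    exact (smul_eq_zero.mp h1).resolve_left hm
  have hcard : w.support.card ≠ 0 := by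
    rwa [Ne, Finset.card_eq_zero, Finsupp.support_eq_empty]
  refine ⟨fun i q hi hik hq => ?_, fun q hq => ?_⟩
  · have h1 : q + (w.support.card - i) = 2 * w.degree := by omega
    obtain ⟨e⟩ := D.nonempty_HT_equiv hw hmT h1
    rw [← Nat.choose_symm (by omega : w.support.card - i ≤ w.support.card - 1),
      show w.support.card - 1 - (w.support.card - i) = i - 1 by omega] at e
    exact ⟨e⟩
  · -- the remaining degrees are those of the last term of the complex, and those outside of it
    by_cases h : q ≤ 2 * w.degree
    · obtain ⟨j, hj⟩ := Nat.exists_eq_add_of_le h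
      have hj' : w.support.card ≤ j := by
        by_contra h'
        exact hq (w.support.card - j) (by omega) (by omega) (by omega)
      obtain ⟨e⟩ := D.nonempty_HT_equiv hw hmT hj.symm
      rw [Nat.choose_eq_zero_of_lt (by omega : w.support.card - 1 < j)] at e
      exact e.toEquiv.subsingleton
    · refine NormDist.Subquotient.subsingleton_of_le fun c hc => ?_
      have h1 : c = 0 := Finsupp.ext fun v => (Finsupp.mem_supported' T c).mp hc.1 v fun hv => by
        obtain ⟨w', -, hv'⟩ := hv.2
        have h2 := congrArg Finsupp.degree hv'
        rw [map_add, two_nsmul, map_add, hv.1] at h2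
        omega
      rw [h1]
      exact Submodule.zero_mem _
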